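/- Let $(M,g)$ be a connected, oriented, smooth four-dimensional spacetime of signature $(-+++)$ with volume element $\epsilon$, and for a 2-form $F$ put ${}^*F_{\mu\nu}=\tfrac12F^{\lambda\gamma}\epsilon_{\lambda\gamma\mu\nu}$. Suppose that $(M,g)$ is axially symmetric, i.e. the circle group $SO(2)$ acts smoothly and effectively on $M$ by isometries. Let $\bar\eta=\eta^\mu$ be the generating Killing field (with period $2\pi$), assumed spacelike wherever it does not vanish; let $\boldsymbol\eta=\eta_\mu dx^\mu$ be the dual 1-form, $\eta=\eta^\mu\eta_\mu$, and $\hat{\boldsymbol\eta}=\boldsymbol\eta/\eta$ (defined off the axis $\{\bar\eta=0\}$). Let $F$ be a smooth 2-form with $\pounds_{\bar\eta}F=0$ such that the source-free Einstein--Maxwell equations hold: $$G_{\mu\nu}=8\pi T_{\mu\nu},\quad T_{\mu\nu}=\tfrac1{4\pi}\bigl(F_{\mu\lambda}F_\nu{}^\lambda-\tfrac14g_{\mu\nu}F_{\lambda\gamma}F^{\lambda\gamma}\bigr),\quad dF=0,\quad d\,{}^*F=0 .$$ Let $S$ be a compact, orientable, smoothly embedded three-surface with boundary, tangent to $\eta^\mu$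 (i.e. $\eta^\mu\in T_pS$ at each $p\in S$), whose boundary $\mathcal S$ (possibly disconnected) carries the orientation of Stokes' theorem. Let $\chi,\psi$ be smooth functions on a neighbourhood of $S$ with $d\chi=F(\bar\eta)=F_{\mu\nu}\eta^\mu dx^\nu$ and $d\psi={}^*F(\bar\eta)$, and put $\gamma=\tfrac12(\chi\,d\psi-\psi\,d\chi)$. Then $\gamma\wedge\hat{\boldsymbol\eta}$ is integrable over $\mathcal S$, and the Komar angular momentum of $\mathcal S$ is $$J(\mathcal S):=\frac1{16\pi}\int_{\mathcal S}{}^*d\boldsymbol\eta=-\frac1{4\pi}\int_{\mathcal S}\gamma\wedge\hat{\boldsymbol\eta}.$$ Consequently the total angular momentum $$J_T(\mathcal S):=\frac1{16\pi}\int_{\mathcal S}\bigl({}^*d\boldsymbol\eta+4\,\gamma\wedge\hat{\boldsymbol\eta}\bigr)$$ is conserved: $J_T(\mathcal S)=0$ for such a boundary, and if $\mathcal S$ is the disjoint union of two closed surfaces $\mathcal S_1$ and $-\mathcal S_2$ (the latter being $\mathcal S_2$ with the opposite orientation), then $J_T(\mathcal S_1)=J_T(\mathcal S_2)$. -/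

import Mathlib

open Set Filter Topology MeasureTheory
open scoped Manifold ContDiff Matrix

noncomputable section

namespace AngMom

/-! ### Differential forms on manifolds -/

section Forms

variable {E : Type*} [NormedAddCommGroup E] [NormedSpace ℝ E]
  {H : Type*} [TopologicalSpace H] (I : ModelWithCorners ℝ E H)
  {X : Type*} [TopologicalSpace X] [ChartedSpace H X]

/-- A (not necessarily smooth) differential `k`-form on the manifold `X`. -/
abbrev Form (X : Type*) [TopologicalSpace X] [ChartedSpace H X] (k : ℕ) : Type _ :=
  ∀ x : X, TangentSpace I x [⋀^Fin k]→L[ℝ] ℝ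

/-- A (not necessarily continuous) vector field on `X`. -/
abbrev VField (X : Type*) [TopologicalSpace X] [ChartedSpace H X] : Type _ :=
  ∀ x : X, TangentSpace I x

/-- The derivative of the inverse of the chart `c`: it sends the coordinate vector `e_i` at `y` to
the coordinate vector field `∂_i` at the point with coordinates `y`. -/
def chartFrame (c : OpenPartialHomeomorph X H) (y : E) :
    E →L[ℝ] TangentSpace I ((c.extend I).symm y) :=
  mfderivWithin 𝓘(ℝ, E) I (c.extend I).symm (range I) y

/-- The expression of a form in the chart `c`, i.e. its pullback under the inverse of `c`. -/
def Form.inChart {k : ℕ} (θ : Form I X k) (c : OpenPartialHomeomorph X H) (y : E) :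
    E [⋀^Fin k]→L[ℝ] ℝ :=
  (θ ((c.extend I).symm y)).compContinuousLinearMap (chartFrame I c y)

/-- A form is smooth if its expressions in all charts of the atlas are smooth. -/
def Form.IsSmooth {k : ℕ} (θ : Form I X k) : Prop :=
  ∀ c ∈ atlas H X, ContDiffOn ℝ ∞ (Form.inChart I θ c) (c.extend I).target

/-- The exterior derivative, computed at `x` in the preferred chart at `x`. -/
def Form.d {k : ℕ} (θ : Form I X k) : Form I X (k + 1) := fun x =>
  (extDerivWithin (Form.inChart I θ (chartAt H x)) (range I)
    (extChartAt I x x)).compContinuousLinearMap (mfderiv I 𝓘(ℝ, E) (extChartAt I x) x)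

/-- The differential of a function, as a field of covectors. -/
def differential (f : X → ℝ) (x : X) : TangentSpace I x →L[ℝ] ℝ := mfderiv I 𝓘(ℝ, ℝ) f x

/-- An orientation of `X`, given by a continuous nowhere vanishing form of top degree (a frame is
positively oriented if the form is positive on it). -/
def IsOrientationForm {n : ℕ} (ν : Form I X n) : Prop :=
  (∀ c ∈ atlas H X, ContinuousOn (Form.inChart I ν c) (c.extend I).target) ∧ ∀ x, ν x ≠ 0

/-- Pullback of a form under a map. -/
def Form.pullback {E' : Type*} [NormedAddCommGroup E'] [NormedSpace ℝ E']
    {H' : Type*} [TopologicalSpace H'] (I' : ModelWithCorners ℝ E' H')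
    {Y : Type*} [TopologicalSpace Y] [ChartedSpace H' Y] {k : ℕ}
    (θ : Form I X k) (f : Y → X) : Form I' Y k := fun y =>
  (θ (f y)).compContinuousLinearMap (mfderiv I' I f y)

end Forms

/-- The wedge product `a ∧ b = a ⊗ b - b ⊗ a` of two covectors. -/
def wedge {V : Type*} [NormedAddCommGroup V] [NormedSpace ℝ V] (a b : V →L[ℝ] ℝ) :
    V [⋀^Fin 2]→L[ℝ] ℝ :=
  ContinuousAlternatingMap.alternatizeUncurryFin
    (a.smulRight (ContinuousAlternatingMap.ofSubsingleton ℝ V ℝ (0 : Fin 1) b))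

theorem wedge_apply {V : Type*} [NormedAddCommGroup V] [NormedSpace ℝ V] (a b : V →L[ℝ] ℝ)
    (v w : V) : wedge a b ![v, w] = a v * b w - a w * b v := by
  simp [wedge, ContinuousAlternatingMap.alternatizeUncurryFin_apply, Fin.sum_univ_two,
    Fin.removeNth, sub_eq_add_neg]

/-! ### Integration over closed oriented manifolds -/

section Integration

variable {n : ℕ} {X : Type*} [TopologicalSpace X] [ChartedSpace (EuclideanSpace ℝ (Fin n)) X]

/-- The standard basis of `ℝⁿ`. -/
def stdFrame (n : ℕ) : Fin n → EuclideanSpace ℝ (Fin n) := fun i => EuclideanSpace.single i 1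

/-- The coefficient of the top-degree form `θ` in the chart `c`, with the sign that makes the
chart positively oriented with respect to the orientation form `ν`. -/
def chartDensity (ν θ : Form (𝓡 n) X n)
    (c : OpenPartialHomeomorph X (EuclideanSpace ℝ (Fin n))) (y : EuclideanSpace ℝ (Fin n)) : ℝ :=
  Real.sign (Form.inChart (𝓡 n) ν c y (stdFrame n)) * Form.inChart (𝓡 n) θ c y (stdFrame n)

/-- Local integrability of a form of top degree: its coefficients in all charts are locally
Lebesgue integrable. -/
def FormIntegrable (θ : Form (𝓡 n) X n) : Prop :=
  ∀ c ∈ atlas (EuclideanSpace ℝ (Fin n)) X,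
    LocallyIntegrableOn (fun y => Form.inChart (𝓡 n) θ c y (stdFrame n)) c.target

/-- A smooth partition of unity subordinate to the preferred charts. -/
def chartPartition (n : ℕ) (X : Type*) [TopologicalSpace X]
    [ChartedSpace (EuclideanSpace ℝ (Fin n)) X] [IsManifold (𝓡 n) ∞ X] [T2Space X]
    [CompactSpace X] : SmoothPartitionOfUnity X (𝓡 n) X univ :=
  Classical.choose (SmoothPartitionOfUnity.exists_isSubordinate_chartAt_source (𝓡 n) X)

/-- The integral of the `n`-form `θ` over the part `A` of the closed `n`-manifold `X` that is
oriented by `ν`. -/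
def formIntegral [IsManifold (𝓡 n) ∞ X] [T2Space X] [CompactSpace X]
    (ν θ : Form (𝓡 n) X n) (A : Set X) : ℝ :=
  ∑ᶠ p : X, ∫ y in (chartAt (EuclideanSpace ℝ (Fin n)) p).target ∩
      (chartAt (EuclideanSpace ℝ (Fin n)) p).symm ⁻¹' A,
    chartPartition n X p ((chartAt (EuclideanSpace ℝ (Fin n)) p).symm y) *
      chartDensity ν θ (chartAt (EuclideanSpace ℝ (Fin n)) p) y

end Integration

/-! ### Four-dimensional Lorentzian geometry -/

/-- The model space `ℝ⁴`. -/
abbrev E4 : Type := EuclideanSpace ℝ (Fin 4)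

section Curvature

/-- Christoffel symbols `Γ^k_{ij}` of the metric with components `G` on a domain of `ℝ⁴`. -/
def christoffel (G : E4 → Matrix (Fin 4) (Fin 4) ℝ) (k i j : Fin 4) (y : E4) : ℝ :=
  (1 / 2) * ∑ l, (G y)⁻¹ k l *
    (fderiv ℝ (fun z => G z j l) y (stdFrame 4 i) + fderiv ℝ (fun z => G z i l) y (stdFrame 4 j)
      - fderiv ℝ (fun z => G z i j) y (stdFrame 4 l))

/-- Components of the Ricci tensor (positive on round spheres). -/
def ricci (G : E4 → Matrix (Fin 4) (Fin 4) ℝ) (i j : Fin 4) (y : E4) : ℝ :=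
  ∑ k, fderiv ℝ (christoffel G k i j) y (stdFrame 4 k)
    - ∑ k, fderiv ℝ (christoffel G k i k) y (stdFrame 4 j)
    + ∑ k, ∑ l, christoffel G k k l y * christoffel G l i j y
    - ∑ k, ∑ l, christoffel G k j l y * christoffel G l i k y

/-- Components of the Einstein tensor `R_{ij} - ½ R g_{ij}`. -/
def einstein (G : E4 → Matrix (Fin 4) (Fin 4) ℝ) (i j : Fin 4) (y : E4) : ℝ :=
  ricci G i j y - (1 / 2) * (∑ a, ∑ b, (G y)⁻¹ a b * ricci G a b y) * G y i j

/-- Components of the energy-momentum tensor of the electromagnetic field `F`: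
`T_{ij} = (1/4π) (F_{ia} F_j{}^a - ¼ g_{ij} F_{ab} F^{ab})`. -/
def maxwellStress (G F : Matrix (Fin 4) (Fin 4) ℝ) (i j : Fin 4) : ℝ :=
  1 / (4 * Real.pi) * ((∑ a, ∑ b, G⁻¹ a b * F i a * F j b)
    - (1 / 4) * G i j * ∑ a, ∑ b, ∑ c, ∑ d, G⁻¹ a c * G⁻¹ b d * F a b * F c d)

end Curvature

section Lorentz

variable (M : Type*) [TopologicalSpace M] [ChartedSpace E4 M]

/-- A field of bilinear forms on the tangent spaces. -/
abbrev BilinField : Type _ := ∀ x : M, TangentSpace (𝓡 4) x →L[ℝ] TangentSpace (𝓡 4) x →L[ℝ] ℝ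

variable {M}

/-- Components `g_{ij}` of a bilinear form in the chart `c`. -/
def gram (g : BilinField M) (c : OpenPartialHomeomorph M E4) (y : E4) :
    Matrix (Fin 4) (Fin 4) ℝ := fun i j =>
  g _ (chartFrame (𝓡 4) c y (stdFrame 4 i)) (chartFrame (𝓡 4) c y (stdFrame 4 j))

/-- Components `F_{ij}` of a 2-form in the chart `c`. -/
def comps (F : Form (𝓡 4) M 2) (c : OpenPartialHomeomorph M E4) (y : E4) :
    Matrix (Fin 4) (Fin 4) ℝ := fun i j =>
  Form.inChart (𝓡 4) F c y ![stdFrame 4 i, stdFrame 4 j]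

/-- `g`-orthonormal frames at `x`, the first vector being the timelike one. -/
def IsOrthonormalFrame (g : BilinField M) (x : M) (e : Fin 4 → TangentSpace (𝓡 4) x) : Prop :=
  ∀ i j, g x (e i) (e j) = if i = j then (if i = 0 then -1 else 1) else 0

/-- Smooth Lorentzian metrics of signature `(-+++)`. -/
structure IsLorentzMetric (g : BilinField M) : Prop where
  symm : ∀ x v w, g x v w = g x w v
  signature : ∀ x, ∃ e, IsOrthonormalFrame g x e
  smooth : ∀ c ∈ atlas E4 M, ∀ i j, ContDiffOn ℝ ∞ (fun y => gram g c y i j) c.target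

/-- `ε` is a volume element of `g`: a smooth 4-form with value `±1` on orthonormal frames. -/
structure IsVolumeElement (g : BilinField M) (ε : Form (𝓡 4) M 4) : Prop where
  smooth : Form.IsSmooth (𝓡 4) ε
  unit : ∀ x e, IsOrthonormalFrame g x e → ε x e = 1 ∨ ε x e = -1

/-- The standard basis of the tangent space at `x` (the coordinate vectors of the preferred
chart). -/
def tangentFrame (x : M) (i : Fin 4) : TangentSpace (𝓡 4) x := stdFrame 4 i

/-- The inverse metric `g^{ij}` at `x` in the standard basis. -/
def invMetric (g : BilinField M) (x : M) : Matrix (Fin 4) (Fin 4) ℝ :=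
  (Matrix.of fun i j => g x (tangentFrame x i) (tangentFrame x j))⁻¹

/-- The Hodge dual of a 2-form, `(*F)_{ij} = ½ F^{ab} ε_{abij}`. -/
def hodge (g : BilinField M) (ε : Form (𝓡 4) M 4) (F : Form (𝓡 4) M 2) : Form (𝓡 4) M 2 :=
  fun x => ∑ a, ∑ b, ∑ c, ∑ d,
    ((1 / 2) * invMetric g x a c * invMetric g x b d * F x ![tangentFrame x c, tangentFrame x d]) •
      ContinuousAlternatingMap.curryLeft (E := E4)
        (ContinuousAlternatingMap.curryLeft (E := E4) (ε x) (tangentFrame x a)) (tangentFrame x b)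

/-- The Einstein equations `G_{ij} = 8π T_{ij}` with the energy-momentum tensor of `F`, and the
source-free Maxwell equations `dF = 0`, `d*F = 0`. -/
structure IsEinsteinMaxwell (g : BilinField M) (ε : Form (𝓡 4) M 4) (F : Form (𝓡 4) M 2) :
    Prop where
  smooth : Form.IsSmooth (𝓡 4) F
  einstein_eq : ∀ c ∈ atlas E4 M, ∀ y ∈ c.target, ∀ i j,
    einstein (gram g c) i j y = 8 * Real.pi * maxwellStress (gram g c y) (comps F c y) i j
  dF : ∀ x, Form.d (𝓡 4) F x = 0
  dStarF : ∀ x, Form.d (𝓡 4) (hodge g ε F) x = 0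

/-! ### Axial symmetry -/

/-- A smooth effective action of the circle group `SO(2)` on `M` by isometries of `g`. -/
structure IsAxialSymmetry [MulAction Circle M] (g : BilinField M) : Prop where
  smooth : ContMDiff ((𝓡 1).prod (𝓡 4)) (𝓡 4) ∞ (fun p : Circle × M => p.1 • p.2)
  effective : FaithfulSMul Circle M
  isometry : ∀ (z : Circle) (x : M) (v w : TangentSpace (𝓡 4) x),
    g (z • x) (mfderiv (𝓡 4) (𝓡 4) (fun p : M => z • p) x v)
      (mfderiv (𝓡 4) (𝓡 4) (fun p : M => z • p) x w) = g x v w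

/-- The Killing field `η` that generates the circle action, normalised so that its flow has
period `2π`. -/
def axialField (M : Type*) [TopologicalSpace M] [ChartedSpace E4 M] [MulAction Circle M] :
    VField (𝓡 4) M := fun x =>
  (show TangentSpace (𝓡 4) (Circle.exp 0 • x) →L[ℝ] TangentSpace (𝓡 4) x from
    ContinuousLinearMap.id ℝ E4)
    (mfderiv 𝓘(ℝ, ℝ) (𝓡 4) (fun t : ℝ => Circle.exp t • x) 0 (1 : ℝ))

/-- The Lie derivative of the 2-form `F` along the axial Killing field vanishes:
`d/dt Φ_t^* F = 0` at `t = 0`, with `Φ_t` the flow. -/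
def LieDerivVanishes [MulAction Circle M] (F : Form (𝓡 4) M 2) : Prop :=
  ∀ (x : M) (v w : TangentSpace (𝓡 4) x),
    HasDerivAt (fun t : ℝ => F (Circle.exp t • x)
      ![mfderiv (𝓡 4) (𝓡 4) (fun p : M => Circle.exp t • p) x v,
        mfderiv (𝓡 4) (𝓡 4) (fun p : M => Circle.exp t • p) x w]) 0 0

/-! ### The forms entering the angular momentum -/

variable (g : BilinField M) (ξ : VField (𝓡 4) M)

/-- The 1-form `η_μ` metrically dual to the vector field, as a field of covectors. -/
def lower (x : M) : TangentSpace (𝓡 4) x →L[ℝ] ℝ := g x (ξ x)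

/-- The 1-form `η_μ` metrically dual to the vector field. -/
def lowerForm : Form (𝓡 4) M 1 := fun x =>
  ContinuousAlternatingMap.ofSubsingleton ℝ (TangentSpace (𝓡 4) x) ℝ (0 : Fin 1) (lower g ξ x)

/-- `η̂ = η / |η|²`; at the zeros of the field, where this is not defined, the value is `0`. -/
def hatForm (x : M) : TangentSpace (𝓡 4) x →L[ℝ] ℝ := (g x (ξ x) (ξ x))⁻¹ • lower g ξ x

/-- `χ` is a potential on the set `U` of the 1-form `F(η) = F_{μν} η^μ`. -/
def IsPotential (F : Form (𝓡 4) M 2) (χ : M → ℝ) (U : Set M) : Prop :=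
  ContMDiffOn (𝓡 4) 𝓘(ℝ, ℝ) ∞ χ U ∧
    ∀ x ∈ U, ∀ v : TangentSpace (𝓡 4) x, differential (𝓡 4) χ x v = F x ![ξ x, v]

/-- `γ = ½ (χ dψ - ψ dχ)`. -/
def gammaForm (χ ψ : M → ℝ) (x : M) : TangentSpace (𝓡 4) x →L[ℝ] ℝ :=
  (1 / 2 : ℝ) • (χ x • differential (𝓡 4) ψ x - ψ x • differential (𝓡 4) χ x)

/-- The 2-form `γ ∧ η̂`. -/
def gammaWedgeHat (χ ψ : M → ℝ) : Form (𝓡 4) M 2 := fun x =>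
  wedge (V := E4) (gammaForm χ ψ x) (hatForm g ξ x)

/-- The Komar 2-form `*dη`. -/
def komarForm (ε : Form (𝓡 4) M 4) : Form (𝓡 4) M 2 :=
  hodge g ε (Form.d (𝓡 4) (lowerForm g ξ))

variable {B : Type*} [TopologicalSpace B] [ChartedSpace (EuclideanSpace ℝ (Fin 2)) B]
  [IsManifold (𝓡 2) ∞ B] [T2Space B] [CompactSpace B]

/-- The Komar integral `(1/16π) ∫ *dη` over the part `A` of the closed surface `f : B → M`
oriented by `ν`. -/
def komar (ε : Form (𝓡 4) M 4) (ν : Form (𝓡 2) B 2) (f : B → M) (A : Set B) : ℝ :=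
  1 / (16 * Real.pi) *
    formIntegral ν (Form.pullback (𝓡 4) (𝓡 2) (komarForm g ξ ε) f) A

/-- The total angular momentum `(1/16π) ∫ (*dη + 4 γ ∧ η̂)` over the part `A` of the closed
surface `f : B → M` oriented by `ν`. -/
def totalAngularMomentum (ε : Form (𝓡 4) M 4) (χ ψ : M → ℝ) (ν : Form (𝓡 2) B 2) (f : B → M)
    (A : Set B) : ℝ :=
  1 / (16 * Real.pi) *
    formIntegral ν (Form.pullback (𝓡 4) (𝓡 2)
      (fun x => komarForm g ξ ε x + (4 : ℝ) • gammaWedgeHat g ξ χ ψ x) f) A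

end Lorentz

/-! ### Three-surfaces with boundary -/

section Hypersurface

variable {N : Type*} [TopologicalSpace N] [ChartedSpace (EuclideanHalfSpace 3) N]

/-- `ι` embeds the (compact) 3-manifold with boundary `N` into `M` as a three-surface tangent to
the vector field `ξ`. -/
structure IsTangentHypersurface {M : Type*} [TopologicalSpace M] [ChartedSpace E4 M]
    (ξ : VField (𝓡 4) M) (ι : N → M) : Prop where
  smooth : ContMDiff (𝓡∂ 3) (𝓡 4) ∞ ι
  injective : Function.Injective ι
  immersion : ∀ p, Function.Injective (mfderiv (𝓡∂ 3) (𝓡 4) ι p)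
  tangent : ∀ p, ∃ v : TangentSpace (𝓡∂ 3) p, mfderiv (𝓡∂ 3) (𝓡 4) ι p v = ξ (ι p)

/-- A tangent vector at a boundary point that points out of the manifold. In half-space charts
the manifold is `{y | 0 ≤ y 0}`. -/
def IsOutward (p : N) (v : TangentSpace (𝓡∂ 3) p) : Prop :=
  (show EuclideanSpace ℝ (Fin 3) from
    mfderiv (𝓡∂ 3) 𝓘(ℝ, EuclideanSpace ℝ (Fin 3)) (extChartAt (𝓡∂ 3) p) p v) 0 < 0

/-- `j` identifies the closed surface `B`, oriented by `νB`, with the boundary of the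
3-manifold `N`, oriented by `νN`, with the orientation of Stokes' theorem (outward vector
first). -/
structure IsOrientedBoundary {B : Type*} [TopologicalSpace B]
    [ChartedSpace (EuclideanSpace ℝ (Fin 2)) B]
    (νN : Form (𝓡∂ 3) N 3) (νB : Form (𝓡 2) B 2) (j : B → N) : Prop where
  smooth : ContMDiff (𝓡 2) (𝓡∂ 3) ∞ j
  injective : Function.Injective j
  immersion : ∀ b, Function.Injective (mfderiv (𝓡 2) (𝓡∂ 3) j b)
  range_eq : range j = (𝓡∂ 3).boundary N
  orient : ∀ (b : B) (n : TangentSpace (𝓡∂ 3) (j b)), IsOutward (j b) n →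
    ∀ v w : TangentSpace (𝓡 2) b, 0 < νB b ![v, w] →
      0 < νN (j b) ![n, mfderiv (𝓡 2) (𝓡∂ 3) j b v, mfderiv (𝓡 2) (𝓡∂ 3) j b w]

end Hypersurface

end AngMom

end

set_option linter.unusedSectionVars false

noncomputable section

namespace AngMom

/-! ### Smoothness of maps with values in alternating forms -/

section Alternating

variable {D : Type*} [NormedAddCommGroup D] [NormedSpace ℝ D]
  {E : Type*} [NormedAddCommGroup E] [NormedSpace ℝ E] [FiniteDimensional ℝ E]
  {G : Type*} [NormedAddCommGroup G] [NormedSpace ℝ G]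

theorem contDiffWithinAt_clm_of_apply {n : WithTop ℕ∞} {f : D → E →L[ℝ] G} {s : Set D} {y : D}
    (h : ∀ v, ContDiffWithinAt ℝ n (fun z => f z v) s y) : ContDiffWithinAt ℝ n f s y := by
  let b := Module.finBasis ℝ E
  have hf : f = fun z => ∑ i, ContinuousLinearMap.smulRightL ℝ E G
      (LinearMap.toContinuousLinearMap (b.coord i)) (f z (b i)) := by
    funext z
    ext v
    conv_lhs => rw [← b.sum_repr v, map_sum]
    simp
  rw [hf]
  exact ContDiffWithinAt.sum fun i _ =>
    (ContinuousLinearMap.contDiff _).comp_contDiffWithinAt (h (b i))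

theorem contDiffWithinAt_alternating_of_apply {n : WithTop ℕ∞} {k : ℕ} {f : D → E [⋀^Fin k]→L[ℝ] ℝ}
    {s : Set D} {y : D} (h : ∀ v, ContDiffWithinAt ℝ n (fun z => f z v) s y) :
    ContDiffWithinAt ℝ n f s y := by
  induction k with
  | zero =>
    have hf : f = fun z => ContinuousAlternatingMap.constOfIsEmptyLIE ℝ E ℝ (Fin 0) (f z 0) := by
      funext z
      ext v
      simp [Subsingleton.elim v 0]
    rw [hf]
    exact (LinearIsometryEquiv.contDiff _).comp_contDiffWithinAt (h 0)
  | succ k ih =>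
    have hc : ContDiffWithinAt ℝ n (fun z => (f z).curryLeft) s y :=
      contDiffWithinAt_clm_of_apply fun v => ih fun w => by
        simpa using h (Matrix.vecCons v w)
    have hf : f = fun z => ((k : ℝ) + 1)⁻¹ •
        ContinuousAlternatingMap.alternatizeUncurryFinCLM ℝ E ℝ (f z).curryLeft := by
      funext z
      have hk : ((k : ℝ) + 1) ≠ 0 := by positivity
      have := ContinuousAlternatingMap.alternatizeUncurryFin_curryLeft (f z)
      rw [ContinuousAlternatingMap.alternatizeUncurryFinCLM_apply, this, eq_inv_smul_iff₀ hk]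
      ext v; simp
    rw [hf]
    exact ((ContinuousLinearMap.contDiff _).comp_contDiffWithinAt hc).const_smul _

theorem alternating_apply_eq_sum {k : ℕ} (θ : E [⋀^Fin k]→L[ℝ] ℝ) {m : ℕ}
    (b : Module.Basis (Fin m) ℝ E) (v : Fin k → E) :
    θ v = ∑ r : Fin k → Fin m, (∏ i, b.repr (v i) (r i)) • θ (fun i => b (r i)) := by
  conv_lhs => rw [show v = fun i => ∑ j, b.repr (v i) j • b j from
    funext fun i => (b.sum_repr (v i)).symm]
  have := (θ.toMultilinearMap).map_sum (fun i j => b.repr (v i) j • b j)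
  refine this.trans ?_
  refine Finset.sum_congr rfl fun r _ => ?_
  exact θ.toMultilinearMap.map_smul_univ (fun i => b.repr (v i) (r i)) (fun i => b (r i))

theorem ContDiffWithinAt.alternating_apply {n : WithTop ℕ∞} {k : ℕ} {f : D → E [⋀^Fin k]→L[ℝ] ℝ}
    {v : D → Fin k → E} {s : Set D} {y : D} (hf : ContDiffWithinAt ℝ n f s y)
    (hv : ∀ i, ContDiffWithinAt ℝ n (fun z => v z i) s y) :
    ContDiffWithinAt ℝ n (fun z => f z (v z)) s y := by
  let b := Module.finBasis ℝ E
  have hfv : (fun z => f z (v z)) = fun z => ∑ r : Fin k → Fin (Module.finrank ℝ E),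
      (∏ i, b.repr (v z i) (r i)) • f z (fun i => b (r i)) :=
    funext fun z => alternating_apply_eq_sum (f z) b (v z)
  rw [hfv]
  refine ContDiffWithinAt.sum fun r _ => ContDiffWithinAt.fun_smul ?_ ?_
  · refine contDiffWithinAt_prod fun i _ => ?_
    exact (LinearMap.toContinuousLinearMap (b.coord (r i))).contDiff.comp_contDiffWithinAt (hv i)
  · exact (ContinuousAlternatingMap.apply ℝ E ℝ
      (fun i => b (r i))).contDiff.comp_contDiffWithinAt hf

theorem ContDiffWithinAt.compContinuousLinearMap_alternating {E' : Type*} [NormedAddCommGroup E']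
    [NormedSpace ℝ E'] [FiniteDimensional ℝ E'] {n : WithTop ℕ∞} {k : ℕ}
    {f : D → E [⋀^Fin k]→L[ℝ] ℝ}
    {L : D → E' →L[ℝ] E} {s : Set D} {y : D} (hf : ContDiffWithinAt ℝ n f s y)
    (hL : ContDiffWithinAt ℝ n L s y) :
    ContDiffWithinAt ℝ n (fun z => (f z).compContinuousLinearMap (L z)) s y :=
  contDiffWithinAt_alternating_of_apply fun v => by
    simp only [ContinuousAlternatingMap.compContinuousLinearMap_apply]
    exact ContDiffWithinAt.alternating_apply hf fun i => hL.clm_apply contDiffWithinAt_const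

end Alternating

/-! ### Forms in charts -/

section Charts

variable {E : Type*} [NormedAddCommGroup E] [NormedSpace ℝ E]
  {H : Type*} [TopologicalSpace H] (I : ModelWithCorners ℝ E H)
  {X : Type*} [TopologicalSpace X] [ChartedSpace H X] [IsManifold I ∞ X]
  {c : OpenPartialHomeomorph X H}

theorem extend_target_subset_range (c : OpenPartialHomeomorph X H) :
    (c.extend I).target ⊆ range I := by
  rw [c.extend_target]; exact inter_subset_right

theorem extend_target_mem_nhdsWithin' {y : E} (hy : y ∈ (c.extend I).target) :
    (c.extend I).target ∈ 𝓝[range I] y := by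
  have h1 : (c.extend I).symm y ∈ c.source := by
    have := (c.extend I).map_target hy
    rwa [c.extend_source] at this
  have := c.extend_target_mem_nhdsWithin (I := I) h1
  rwa [(c.extend I).right_inv hy] at this

theorem extend_symm_mem_source {y : E} (hy : y ∈ (c.extend I).target) :
    (c.extend I).symm y ∈ c.source := by
  have := (c.extend I).map_target hy
  rwa [c.extend_source] at this

theorem extend_mem_target {x : X} (hx : x ∈ c.source) : c.extend I x ∈ (c.extend I).target :=
  (c.extend I).map_source (by rwa [c.extend_source])

theorem extend_left_inv' {x : X} (hx : x ∈ c.source) : (c.extend I).symm (c.extend I x) = x :=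
  (c.extend I).left_inv (by rwa [c.extend_source])

theorem contMDiffAt_extend_of_mem_atlas (hc : c ∈ atlas H X) {x : X} (hx : x ∈ c.source) :
    ContMDiffAt I 𝓘(ℝ, E) ∞ (c.extend I) x :=
  c.contMDiffAt_extend (IsManifold.subset_maximalAtlas hc) hx

theorem contMDiffWithinAt_extend_symm (hc : c ∈ atlas H X) {y : E}
    (hy : y ∈ (c.extend I).target) :
    ContMDiffWithinAt 𝓘(ℝ, E) I ∞ (c.extend I).symm (range I) y := by
  have h := contMDiffOn_extend_symm (I := I) (n := ∞)
    (IsManifold.subset_maximalAtlas (I := I) (n := ∞) hc)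
  have he : (c.extend I).target = I '' c.target := by
    rw [c.extend_target, I.image_eq]
  rw [← he] at h
  exact (h y hy).mono_of_mem_nhdsWithin (extend_target_mem_nhdsWithin' I hy)

/-- The derivative of the chart `c`, inverse to `chartFrame`. -/
def coframe (c : OpenPartialHomeomorph X H) (x : X) : TangentSpace I x →L[ℝ] E :=
  mfderiv I 𝓘(ℝ, E) (c.extend I) x

theorem hasMFDerivAt_extend (hc : c ∈ atlas H X) {x : X} (hx : x ∈ c.source) :
    HasMFDerivAt I 𝓘(ℝ, E) (c.extend I) x (coframe I c x) :=
  ((contMDiffAt_extend_of_mem_atlas I hc hx).mdifferentiableAt (by simp)).hasMFDerivAt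

theorem hasMFDerivWithinAt_extend_symm (hc : c ∈ atlas H X) {y : E}
    (hy : y ∈ (c.extend I).target) :
    HasMFDerivWithinAt 𝓘(ℝ, E) I (c.extend I).symm (range I) y (chartFrame I c y) :=
  ((contMDiffWithinAt_extend_symm I hc hy).mdifferentiableWithinAt
    (by simp)).hasMFDerivWithinAt

/-- The coordinate expression of a map, differentiated. -/
theorem hasFDerivWithinAt_coord {E' : Type*} [NormedAddCommGroup E'] [NormedSpace ℝ E']
    {H' : Type*} [TopologicalSpace H'] (I' : ModelWithCorners ℝ E' H')
    {Y : Type*} [TopologicalSpace Y] [ChartedSpace H' Y] [IsManifold I' ∞ Y]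
    {c' : OpenPartialHomeomorph Y H'} (hc : c ∈ atlas H X) (hc' : c' ∈ atlas H' Y)
    {f : X → Y} {y : E} (hy : y ∈ (c.extend I).target)
    (hf : MDifferentiableAt I I' f ((c.extend I).symm y))
    (hfy : f ((c.extend I).symm y) ∈ c'.source) :
    HasFDerivWithinAt (fun z => c'.extend I' (f ((c.extend I).symm z)))
      ((coframe I' c' (f ((c.extend I).symm y))).comp
        ((mfderiv I I' f ((c.extend I).symm y)).comp (chartFrame I c y))) (range I) y := by
  have h1 := hasMFDerivWithinAt_extend_symm I hc hy
  have h2 := hasMFDerivAt_extend I' hc' hfy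
  exact (h2.comp_hasMFDerivWithinAt y (hf.hasMFDerivAt.comp_hasMFDerivWithinAt y h1)).hasFDerivWithinAt

theorem coframe_comp_frame (hc : c ∈ atlas H X) {y : E} (hy : y ∈ (c.extend I).target) :
    (coframe I c ((c.extend I).symm y)).comp (chartFrame I c y) =
      ContinuousLinearMap.id ℝ E := by
  have h1 := hasMFDerivWithinAt_extend_symm I hc hy
  have h2 := hasMFDerivAt_extend I hc (extend_symm_mem_source I hy)
  have h3 : HasFDerivWithinAt (c.extend I ∘ (c.extend I).symm)
      ((coframe I c ((c.extend I).symm y)).comp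
        (chartFrame I c y)) (range I) y := (h2.comp_hasMFDerivWithinAt y h1).hasFDerivWithinAt
  have h4 : HasFDerivWithinAt (c.extend I ∘ (c.extend I).symm) (ContinuousLinearMap.id ℝ E)
      (range I) y :=
    (hasFDerivWithinAt_id y _).congr_of_eventuallyEq
      (by filter_upwards [extend_target_mem_nhdsWithin' I hy] with z hz
          exact (c.extend I).right_inv hz) ((c.extend I).right_inv hy)
  exact (I.uniqueDiffOn y (extend_target_subset_range I c hy)).eq h3 h4

theorem frame_comp_coframe (hc : c ∈ atlas H X) {y : E} (hy : y ∈ (c.extend I).target) :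
    (chartFrame I c y).comp (coframe I c ((c.extend I).symm y)) =
      ContinuousLinearMap.id ℝ (TangentSpace I ((c.extend I).symm y)) := by
  have h1 := hasMFDerivWithinAt_extend_symm I hc hy
  have hs := extend_symm_mem_source I hy
  have h2 := hasMFDerivAt_extend I hc hs
  have h1' : HasMFDerivWithinAt 𝓘(ℝ, E) I (c.extend I).symm (range I)
      (c.extend I ((c.extend I).symm y)) (chartFrame I c y) := by
    rwa [(c.extend I).right_inv hy]
  have h3 := HasMFDerivWithinAt.comp (I := I) (I' := 𝓘(ℝ, E)) (I'' := I) (s := univ) _ h1'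
    h2.hasMFDerivWithinAt (fun z _ => by simp)
  rw [hasMFDerivWithinAt_univ] at h3
  have h4 : HasMFDerivAt I I ((c.extend I).symm ∘ c.extend I) ((c.extend I).symm y)
      (ContinuousLinearMap.id ℝ (TangentSpace I ((c.extend I).symm y))) :=
    (hasMFDerivAt_id _).congr_of_eventuallyEq (by
      filter_upwards [c.open_source.mem_nhds hs] with z hz
      exact extend_left_inv' I hz)
  exact hasMFDerivAt_unique h3 h4

variable {k : ℕ}

theorem form_eq_inChart_comp (hc : c ∈ atlas H X) (θ : Form I X k) {x : X} (hx : x ∈ c.source) :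
    θ x = (Form.inChart I θ c (c.extend I x)).compContinuousLinearMap
      (coframe I c x) := by
  obtain ⟨y, hy, rfl⟩ : ∃ y, y ∈ (c.extend I).target ∧ (c.extend I).symm y = x :=
    ⟨_, extend_mem_target I hx, extend_left_inv' I hx⟩
  rw [(c.extend I).right_inv hy]
  ext v
  refine congrArg (θ _) (funext fun i => ?_)
  exact (DFunLike.congr_fun (frame_comp_coframe I hc hy) (v i)).symm

section Pullback

variable {E' : Type*} [NormedAddCommGroup E'] [NormedSpace ℝ E']
    {H' : Type*} [TopologicalSpace H'] (I' : ModelWithCorners ℝ E' H')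
    {Y : Type*} [TopologicalSpace Y] [ChartedSpace H' Y] [IsManifold I' ∞ Y]
    {c' : OpenPartialHomeomorph Y H'}

theorem inChart_pullback (hc : c ∈ atlas H X) (hc' : c' ∈ atlas H' Y)
    {f : X → Y} {y : E} (hy : y ∈ (c.extend I).target)
    (hf : MDifferentiableAt I I' f ((c.extend I).symm y))
    (hfy : f ((c.extend I).symm y) ∈ c'.source) (θ : Form I' Y k) :
    Form.inChart I (Form.pullback I' I θ f) c y =
      (Form.inChart I' θ c' (c'.extend I' (f ((c.extend I).symm y)))).compContinuousLinearMap
        (fderivWithin ℝ (fun z => c'.extend I' (f ((c.extend I).symm z))) (range I) y) := by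
  rw [(hasFDerivWithinAt_coord I I' hc hc' hy hf hfy).fderivWithin
    (I.uniqueDiffOn y (extend_target_subset_range I c hy))]
  rw [Form.inChart, Form.pullback, form_eq_inChart_comp I' hc' θ hfy]
  rfl

theorem contDiffWithinAt_coord (hc : c ∈ atlas H X) (hc' : c' ∈ atlas H' Y)
    {f : X → Y} {y : E} (hy : y ∈ (c.extend I).target)
    (hf : ContMDiffAt I I' ∞ f ((c.extend I).symm y))
    (hfy : f ((c.extend I).symm y) ∈ c'.source) :
    ContDiffWithinAt ℝ ∞ (fun z => c'.extend I' (f ((c.extend I).symm z))) (range I) y :=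
  ((contMDiffAt_extend_of_mem_atlas I' hc' hfy).comp_contMDiffWithinAt y
    (hf.comp_contMDiffWithinAt y (contMDiffWithinAt_extend_symm I hc hy))).contDiffWithinAt

theorem eventually_coord {f : X → Y} {y : E} (hy : y ∈ (c.extend I).target)
    (hf : ContinuousAt f ((c.extend I).symm y))
    (hfy : f ((c.extend I).symm y) ∈ c'.source) :
    ∀ᶠ z in 𝓝[range I] y, z ∈ (c.extend I).target ∧ f ((c.extend I).symm z) ∈ c'.source := by
  have h1 := extend_target_mem_nhdsWithin' I hy
  refine Filter.inter_mem h1 ?_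
  have h2 : ContinuousWithinAt (c.extend I).symm (range I) y :=
    ((c.continuousOn_extend_symm (I := I)) y hy).mono_of_mem_nhdsWithin h1
  exact (hf.comp_continuousWithinAt h2) (c'.open_source.mem_nhds hfy)

/-- A form is smooth at a point if its expressions in all charts are. -/
def Form.SmoothAt (θ : Form I X k) (x : X) : Prop :=
  ∀ c ∈ atlas H X, x ∈ c.source →
    ContDiffWithinAt ℝ ∞ (Form.inChart I θ c) (range I) (c.extend I x)

variable [FiniteDimensional ℝ E] [FiniteDimensional ℝ E']

theorem contDiffWithinAt_inChart_pullback (hc : c ∈ atlas H X) (hc' : c' ∈ atlas H' Y)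
    {f : X → Y} {y : E} (hy : y ∈ (c.extend I).target)
    (hf : ∀ᶠ x in 𝓝 ((c.extend I).symm y), ContMDiffAt I I' ∞ f x)
    (hfy : f ((c.extend I).symm y) ∈ c'.source) {θ : Form I' Y k}
    (hθ : ContDiffWithinAt ℝ ∞ (Form.inChart I' θ c') (range I')
      (c'.extend I' (f ((c.extend I).symm y)))) :
    ContDiffWithinAt ℝ ∞ (Form.inChart I (Form.pullback I' I θ f) c) (range I) y := by
  have hf0 := hf.self_of_nhds
  have hco := contDiffWithinAt_coord I I' hc hc' hy hf0 hfy
  have hsymm : ContinuousWithinAt (c.extend I).symm (range I) y :=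
    ((c.continuousOn_extend_symm (I := I)) y hy).mono_of_mem_nhdsWithin
      (extend_target_mem_nhdsWithin' I hy)
  have hev : Form.inChart I (Form.pullback I' I θ f) c =ᶠ[𝓝[range I] y] fun z =>
      (Form.inChart I' θ c' (c'.extend I' (f ((c.extend I).symm z)))).compContinuousLinearMap
        (fderivWithin ℝ (fun z => c'.extend I' (f ((c.extend I).symm z))) (range I) z) := by
    filter_upwards [eventually_coord I hy hf0.continuousAt hfy, hsymm hf] with z hz hfz
    exact inChart_pullback I I' hc hc' hz.1 (hfz.mdifferentiableAt (by simp)) hz.2 θ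
  refine ContDiffWithinAt.congr_of_eventuallyEq_of_mem ?_ hev (extend_target_subset_range I c hy)
  refine ContDiffWithinAt.compContinuousLinearMap_alternating ?_ ?_
  · exact hθ.comp y hco fun z _ => by simp
  · exact hco.fderivWithin_right I.uniqueDiffOn (by simp) (extend_target_subset_range I c hy)

theorem pullback_id (θ : Form I X k) : Form.pullback I I θ id = θ := by
  funext x
  simp only [Form.pullback, mfderiv_id]
  ext v; rfl

theorem Form.IsSmooth.smoothAt {θ : Form I X k} (h : Form.IsSmooth I θ) (x : X) :
    Form.SmoothAt I θ x := fun c hc hx =>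
  (h c hc _ (extend_mem_target I hx)).mono_of_mem_nhdsWithin
    (extend_target_mem_nhdsWithin' I (extend_mem_target I hx))

theorem Form.SmoothAt.pullback {θ : Form I' Y k} {f : X → Y} {x : X}
    (hf : ∀ᶠ x' in 𝓝 x, ContMDiffAt I I' ∞ f x') (h : Form.SmoothAt I' θ (f x)) :
    Form.SmoothAt I (Form.pullback I' I θ f) x := by
  intro c hc hx
  have hl := extend_left_inv' I hx
  refine contDiffWithinAt_inChart_pullback I I' hc (chart_mem_atlas H' (f x))
    (extend_mem_target I hx) (by rwa [hl]) ?_ ?_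
  · rw [hl]; exact mem_chart_source H' _
  · rw [hl]; exact h _ (chart_mem_atlas H' (f x)) (mem_chart_source H' _)

theorem extDerivWithin_inChart_pullback (hc : c ∈ atlas H X) (hc' : c' ∈ atlas H' Y)
    {f : X → Y} {y : E} (hy : y ∈ (c.extend I).target)
    (hf : ∀ᶠ x in 𝓝 ((c.extend I).symm y), ContMDiffAt I I' ∞ f x)
    (hfy : f ((c.extend I).symm y) ∈ c'.source) {θ : Form I' Y k}
    (hθ : ContDiffWithinAt ℝ ∞ (Form.inChart I' θ c') (range I')
      (c'.extend I' (f ((c.extend I).symm y)))) :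
    extDerivWithin (Form.inChart I (Form.pullback I' I θ f) c) (range I) y =
      (extDerivWithin (Form.inChart I' θ c') (range I')
        (c'.extend I' (f ((c.extend I).symm y)))).compContinuousLinearMap
        (fderivWithin ℝ (fun z => c'.extend I' (f ((c.extend I).symm z))) (range I) y) := by
  have hf0 := hf.self_of_nhds
  have hco := contDiffWithinAt_coord I I' hc hc' hy hf0 hfy
  have hsymm : ContinuousWithinAt (c.extend I).symm (range I) y :=
    ((c.continuousOn_extend_symm (I := I)) y hy).mono_of_mem_nhdsWithin
      (extend_target_mem_nhdsWithin' I hy)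
  have hyr := extend_target_subset_range I c hy
  have hev : Form.inChart I (Form.pullback I' I θ f) c =ᶠ[𝓝[range I] y] fun z =>
      (Form.inChart I' θ c' (c'.extend I' (f ((c.extend I).symm z)))).compContinuousLinearMap
        (fderivWithin ℝ (fun z => c'.extend I' (f ((c.extend I).symm z))) (range I) z) := by
    filter_upwards [eventually_coord I hy hf0.continuousAt hfy, hsymm hf] with z hz hfz
    exact inChart_pullback I I' hc hc' hz.1 (hfz.mdifferentiableAt (by simp)) hz.2 θ
  rw [hev.extDerivWithin_eq_of_mem hyr]
  exact extDerivWithin_pullback (f := fun z => c'.extend I' (f ((c.extend I).symm z)))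
    (hθ.differentiableWithinAt (by simp)) hco
    (by simpa using WithTop.coe_le_coe.2 (le_top : (2 : ℕ∞) ≤ ⊤))
    I.uniqueDiffOn (I.range_subset_closure_interior hyr) hyr (fun z _ => by simp)

/-- The exterior derivative may be computed in any chart. -/
theorem inChart_d (hc : c ∈ atlas H X) {θ : Form I X k} {y : E} (hy : y ∈ (c.extend I).target)
    (hθ : Form.SmoothAt I θ ((c.extend I).symm y)) :
    Form.inChart I (Form.d I θ) c y = extDerivWithin (Form.inChart I θ c) (range I) y := by
  set x := (c.extend I).symm y with hx
  have h0 := chart_mem_atlas H x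
  have hx0 := mem_chart_source H x
  have h1 := extDerivWithin_inChart_pullback I I hc h0 (f := id) hy
    (Eventually.of_forall fun _ => contMDiffAt_id) hx0 (θ := θ) (hθ _ h0 hx0)
  rw [pullback_id] at h1
  rw [h1, (hasFDerivWithinAt_coord I I hc h0 (f := id) hy mdifferentiableAt_id hx0).fderivWithin
    (I.uniqueDiffOn y (extend_target_subset_range I c hy)), mfderiv_id]
  rfl

theorem Form.SmoothAt.d {θ : Form I X k} {x : X} (h : ∀ᶠ x' in 𝓝 x, Form.SmoothAt I θ x') :
    Form.SmoothAt I (Form.d I θ) x := by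
  intro c hc hx
  have hy := extend_mem_target I hx
  have hl := extend_left_inv' I hx
  have hyr := extend_target_subset_range I c hy
  have hsymm : ContinuousWithinAt (c.extend I).symm (range I) (c.extend I x) :=
    ((c.continuousOn_extend_symm (I := I)) _ hy).mono_of_mem_nhdsWithin
      (extend_target_mem_nhdsWithin' I hy)
  have hev : Form.inChart I (Form.d I θ) c =ᶠ[𝓝[range I] (c.extend I x)]
      extDerivWithin (Form.inChart I θ c) (range I) := by
    filter_upwards [extend_target_mem_nhdsWithin' I hy, hsymm (by rw [hl]; exact h)] with z hz hs
    exact inChart_d I hc hz hs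
  refine ContDiffWithinAt.congr_of_eventuallyEq_of_mem ?_ hev hyr
  have := ((h.self_of_nhds c hc hx).fderivWithin_right I.uniqueDiffOn (m := ∞) (by simp) hyr)
  exact (ContinuousAlternatingMap.alternatizeUncurryFinCLM ℝ E ℝ).contDiff.comp_contDiffWithinAt
    this

/-- The exterior derivative commutes with pullbacks. -/
theorem d_pullback {θ : Form I' Y k} {f : X → Y} {x : X}
    (hf : ∀ᶠ x' in 𝓝 x, ContMDiffAt I I' ∞ f x') (h : Form.SmoothAt I' θ (f x)) :
    Form.d I (Form.pullback I' I θ f) x = Form.pullback I' I (Form.d I' θ) f x := by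
  have h0 := chart_mem_atlas H x
  have hx0 := mem_chart_source H x
  have hl := extend_left_inv' I hx0
  have h0' := chart_mem_atlas H' (f x)
  have hx0' := mem_chart_source H' (f x)
  have hy := extend_mem_target I hx0
  rw [form_eq_inChart_comp I h0 (Form.d I (Form.pullback I' I θ f)) hx0,
    form_eq_inChart_comp I h0 (Form.pullback I' I (Form.d I' θ) f) hx0,
    inChart_d I h0 hy (by rw [hl]; exact h.pullback I I' hf),
    extDerivWithin_inChart_pullback I I' h0 h0' hy (by rwa [hl]) (by rw [hl]; exact hx0')
      (by rw [hl]; exact h _ h0' hx0'),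
    inChart_pullback I I' h0 h0' hy (by rw [hl]; exact hf.self_of_nhds.mdifferentiableAt (by simp))
      (by rw [hl]; exact hx0'), hl,
    inChart_d I' h0' (extend_mem_target I' hx0')
      (by rw [extend_left_inv' I' hx0']; exact h)]

end Pullback

end Charts

/-! ### Change of variables for integrals of forms -/

section ChangeOfVariables

/-- The standard basis of `ℝⁿ`, as a basis. -/
def stdBasis (n : ℕ) : Module.Basis (Fin n) ℝ (EuclideanSpace ℝ (Fin n)) :=
  (EuclideanSpace.basisFun (Fin n) ℝ).toBasis

theorem stdBasis_eq (n : ℕ) : (stdBasis n : Fin n → EuclideanSpace ℝ (Fin n)) = stdFrame n := by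
  funext i
  simp [stdBasis, stdFrame]

theorem stdBasis_repr {n : ℕ} (v : EuclideanSpace ℝ (Fin n)) (i : Fin n) :
    (stdBasis n).repr v i = v i := by
  simp [stdBasis]

theorem stdBasis_det_comp_stdFrame {n : ℕ}
    (L : EuclideanSpace ℝ (Fin n) →L[ℝ] EuclideanSpace ℝ (Fin n)) :
    (stdBasis n).det (fun i => L (stdFrame n i)) = L.det := by
  have := (stdBasis n).det_comp (L : EuclideanSpace ℝ (Fin n) →ₗ[ℝ] EuclideanSpace ℝ (Fin n))
    (stdFrame n)
  rw [← stdBasis_eq, Module.Basis.det_self, mul_one, stdBasis_eq] at this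
  exact this

variable {n : ℕ} {H : Type*} [TopologicalSpace H]
  (I : ModelWithCorners ℝ (EuclideanSpace ℝ (Fin n)) H)
  {X : Type*} [TopologicalSpace X] [ChartedSpace H X] [IsManifold I ∞ X]

/-- The coefficient of the form `θ` in the chart `c`, with the sign that makes the
chart positively oriented with respect to the orientation form `ν`. -/
def orientedCoef (ν θ : Form I X n) (c : OpenPartialHomeomorph X H)
    (y : EuclideanSpace ℝ (Fin n)) : ℝ :=
  Real.sign (Form.inChart I ν c y (stdFrame n)) * Form.inChart I θ c y (stdFrame n)

/-- The integral of a form of top degree, computed with the partition of unity `P`. -/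
def partitionIntegral (P : SmoothPartitionOfUnity X I X univ) (ν θ : Form I X n) : ℝ :=
  ∑ᶠ p : X, ∫ y in ((chartAt H p).extend I).target,
    P p (((chartAt H p).extend I).symm y) * orientedCoef I ν θ (chartAt H p) y

theorem measurableSet_extend_target_inter (c : OpenPartialHomeomorph X H) {U : Set X}
    (hU : IsOpen U) : MeasurableSet ((c.extend I).target ∩ (c.extend I).symm ⁻¹' U) := by
  have : (c.extend I).target ∩ (c.extend I).symm ⁻¹' U =
      range I ∩ I.symm ⁻¹' (c.target ∩ c.symm ⁻¹' U) := by
    rw [c.extend_target]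
    ext y
    simp only [mem_inter_iff, mem_preimage]
    change (_ ∧ _) ∧ (c.symm (I.symm y) ∈ U) ↔ _
    tauto
  rw [this]
  exact I.isClosed_range.measurableSet.inter
    ((c.isOpen_inter_preimage_symm hU).preimage I.continuous_symm).measurableSet

theorem finite_support_partition [CompactSpace X] (P : SmoothPartitionOfUnity X I X univ) :
    {p : X | ∃ x, P p x ≠ 0}.Finite := by
  refine (P.locallyFinite.finite_nonempty_of_compact).subset ?_
  rintro p ⟨x, hx⟩
  exact ⟨x, hx⟩

theorem partitionIntegral_eq_sum [CompactSpace X] (P : SmoothPartitionOfUnity X I X univ)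
    (ν θ : Form I X n) {T : Finset X} (hT : ∀ p, (∃ x, P p x ≠ 0) → p ∈ T) :
    partitionIntegral I P ν θ = ∑ p ∈ T, ∫ y in ((chartAt H p).extend I).target,
      P p (((chartAt H p).extend I).symm y) * orientedCoef I ν θ (chartAt H p) y := by
  refine finsum_eq_sum_of_support_subset _ fun p hp => ?_
  by_contra hcon
  refine hp ?_
  have : ∀ x, P p x = 0 := by
    by_contra! hx
    exact hcon (hT p hx)
  simp [this]

variable [CompactSpace X]

/-- Change of variables: the integral of a form that vanishes off an open set `U`, computed with a
differentiable injective map `κ` on `U`. -/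
theorem partitionIntegral_eq_integral_image (P : SmoothPartitionOfUnity X I X univ)
    (hP : P.IsSubordinate fun p => (chartAt H p).source) {ν θ : Form I X n} {U : Set X}
    (hU : IsOpen U) {κ : X → EuclideanSpace ℝ (Fin n)}
    (hκ : ∀ x ∈ U, MDifferentiableAt I 𝓘(ℝ, EuclideanSpace ℝ (Fin n)) κ x) (hinj : InjOn κ U)
    {h : EuclideanSpace ℝ (Fin n) → ℝ} (hh : IntegrableOn h (κ '' U))
    (hθ : ∀ x ∈ U, ∀ e : Fin n → TangentSpace I x, Real.sign (ν x e) * θ x e =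
      |(stdBasis n).det fun i => mfderiv I 𝓘(ℝ, EuclideanSpace ℝ (Fin n)) κ x (e i)| * h (κ x))
    (hθ0 : ∀ x ∉ U, θ x = 0) :
    partitionIntegral I P ν θ = ∫ z in κ '' U, h z := by
  set T : Finset X := (finite_support_partition I P).toFinset with hTdef
  have hT : ∀ p, (∃ x, P p x ≠ 0) → p ∈ T := fun p hp => by simpa [hTdef] using hp
  rw [partitionIntegral_eq_sum I P ν θ hT]
  let s : X → Set (EuclideanSpace ℝ (Fin n)) := fun p =>
    ((chartAt H p).extend I).target ∩ ((chartAt H p).extend I).symm ⁻¹' U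
  let τ : X → EuclideanSpace ℝ (Fin n) → EuclideanSpace ℝ (Fin n) := fun p y =>
    κ (((chartAt H p).extend I).symm y)
  let L : X → EuclideanSpace ℝ (Fin n) → EuclideanSpace ℝ (Fin n) →L[ℝ] EuclideanSpace ℝ (Fin n) :=
    fun p y => (mfderiv I 𝓘(ℝ, EuclideanSpace ℝ (Fin n)) κ
      (((chartAt H p).extend I).symm y)).comp (chartFrame I (chartAt H p) y)
  have hs : ∀ p, MeasurableSet (s p) := fun p => measurableSet_extend_target_inter I _ hU
  have hL : ∀ p, ∀ y ∈ s p, HasFDerivWithinAt (τ p) (L p y) (s p) y := by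
    intro p y hy
    have h1 := hasMFDerivWithinAt_extend_symm I (chart_mem_atlas H p) hy.1
    have h2 := (hκ _ hy.2).hasMFDerivAt
    exact (h2.comp_hasMFDerivWithinAt y h1).hasFDerivWithinAt.mono
      (inter_subset_left.trans (extend_target_subset_range I _))
  have hτ : ∀ p, InjOn (τ p) (s p) := by
    intro p y hy y' hy' he
    exact ((chartAt H p).extend I).symm.injOn (by simpa using hy.1) (by simpa using hy'.1)
      (hinj hy.2 hy'.2 he)
  have himg : ∀ p, τ p '' s p = κ '' (U ∩ (chartAt H p).source) := by
    intro p
    ext z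
    constructor
    · rintro ⟨y, hy, rfl⟩
      exact ⟨_, ⟨hy.2, extend_symm_mem_source I hy.1⟩, rfl⟩
    · rintro ⟨x, hx, rfl⟩
      have hl := extend_left_inv' I hx.2
      exact ⟨_, ⟨extend_mem_target I hx.2, by rw [mem_preimage, hl]; exact hx.1⟩, by simp only [τ, hl]⟩
  let r : X → EuclideanSpace ℝ (Fin n) → ℝ := fun p =>
    Function.extend (fun x : U => κ x) (fun x : U => P p x) 0
  have hr : ∀ p, ∀ x ∈ U, r p (κ x) = P p x := fun p x hx =>
    (injOn_iff_injective.1 hinj).extend_apply (fun x : U => P p x) 0 ⟨x, hx⟩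
  have hcoef : ∀ p, ∀ y ∈ s p, orientedCoef I ν θ (chartAt H p) y = |(L p y).det| * h (τ p y) := by
    intro p y hy
    have := hθ _ hy.2 (fun i => chartFrame I (chartAt H p) y (stdFrame n i))
    rw [← stdBasis_det_comp_stdFrame]
    exact this
  have hzero : ∀ p, ∀ x ∈ U, x ∉ (chartAt H p).source → P p x = 0 := by
    intro p x _ hx
    by_contra hne
    exact hx (hP p (subset_tsupport _ hne))
  have hmeas : ∀ p, MeasurableSet (τ p '' s p) := fun p =>
    measurable_image_of_fderivWithin (hs p) (hL p) (hτ p)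
  have hcover : κ '' U = ⋃ p ∈ T, τ p '' s p := by
    simp only [himg]
    ext z
    simp only [mem_image, mem_iUnion, mem_inter_iff, exists_prop]
    constructor
    · rintro ⟨x, hx, rfl⟩
      obtain ⟨p, hp⟩ : ∃ p, P p x ≠ 0 := by
        by_contra! hall
        have := P.sum_eq_one (mem_univ x)
        simp [hall] at this
      refine ⟨p, hT p ⟨x, hp⟩, x, ⟨hx, ?_⟩, rfl⟩
      by_contra hcon
      exact hp (hzero p x hx hcon)
    · rintro ⟨p, _, x, hx, rfl⟩
      exact ⟨x, hx.1, rfl⟩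
  have hmeasU : MeasurableSet (κ '' U) := by
    rw [hcover]
    exact T.measurableSet_biUnion fun p _ => hmeas p
  have hsub : ∀ p, τ p '' s p ⊆ κ '' U := fun p => by
    rw [himg]; exact image_mono inter_subset_left
  have hrout : ∀ p, ∀ z ∈ κ '' U \ τ p '' s p, r p z * h z = 0 := by
    rintro p z ⟨⟨x, hx, rfl⟩, hz⟩
    rw [himg] at hz
    rw [hr p x hx, hzero p x hx fun hxs => hz ⟨x, ⟨hx, hxs⟩, rfl⟩, zero_mul]
  have hτr : ∀ p, ∀ y ∈ s p, r p (τ p y) = P p (((chartAt H p).extend I).symm y) :=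
    fun p y hy => hr p _ hy.2
  have hint : ∀ p, IntegrableOn (fun z => r p z * h z) (κ '' U) := by
    intro p
    refine IntegrableOn.of_forall_sdiff_eq_zero (s := τ p '' s p) ?_ hmeasU (hrout p)
    rw [integrableOn_image_iff_integrableOn_abs_det_fderiv_smul volume (hs p) (hL p) (hτ p)]
    have h1 := (integrableOn_image_iff_integrableOn_abs_det_fderiv_smul volume (hs p) (hL p)
      (hτ p) h).1 (hh.mono_set (hsub p))
    have hcont : ContinuousOn (fun y => P p (((chartAt H p).extend I).symm y)) (s p) :=
      (P p).contMDiff.continuous.comp_continuousOn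
        (((chartAt H p).continuousOn_extend_symm (I := I)).mono inter_subset_left)
    have h2 := Integrable.bdd_mul (c := 1) h1 (hcont.aestronglyMeasurable (hs p))
      (Eventually.of_forall fun y => by
        rw [Real.norm_of_nonneg (P.nonneg p _)]; exact P.le_one p _)
    refine (integrableOn_congr_fun (fun y hy => ?_) (hs p)).1 h2
    simp only [hτr p y hy, smul_eq_mul]
    ring
  have hterm : ∀ p, ∫ y in ((chartAt H p).extend I).target,
      P p (((chartAt H p).extend I).symm y) * orientedCoef I ν θ (chartAt H p) y =
      ∫ z in κ '' U, r p z * h z := by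
    intro p
    have htm : MeasurableSet ((chartAt H p).extend I).target := by
      simpa using measurableSet_extend_target_inter I (chartAt H p) isOpen_univ
    rw [setIntegral_eq_of_subset_of_forall_sdiff_eq_zero hmeasU (hsub p) (hrout p),
      integral_image_eq_integral_abs_det_fderiv_smul volume (hs p) (hL p) (hτ p),
      setIntegral_eq_of_subset_of_forall_sdiff_eq_zero htm
        (inter_subset_left : s p ⊆ ((chartAt H p).extend I).target) ?_]
    · refine setIntegral_congr_fun (hs p) fun y hy => ?_
      simp only [hτr p y hy, hcoef p y hy, smul_eq_mul]
      ring
    · rintro y ⟨hy, hys⟩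
      have : ((chartAt H p).extend I).symm y ∉ U := fun hyU => hys ⟨hy, hyU⟩
      have h0 : Form.inChart I θ (chartAt H p) y (stdFrame n) = 0 := by
        rw [Form.inChart, hθ0 _ this]; rfl
      rw [orientedCoef, h0, mul_zero, mul_zero]
  rw [Finset.sum_congr rfl fun p _ => hterm p, ← integral_finsetSum T fun p _ => hint p]
  refine setIntegral_congr_fun hmeasU ?_
  rintro _ ⟨x, hx, rfl⟩
  simp only [hr _ x hx]
  rw [← Finset.sum_mul]
  have hsum : ∑ p ∈ T, P p x = 1 := by
    have h1 := P.sum_eq_one (mem_univ x)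
    rwa [finsum_eq_sum_of_support_subset _ fun p hp => hT p ⟨x, hp⟩] at h1
  rw [hsum, one_mul]

end ChangeOfVariables

/-! ### Stokes' theorem on a half-space -/

section HalfSpace

/-- The divergence theorem for compactly supported fields on the half-space `{x | 0 ≤ x 0}`. -/
theorem integral_divergence_halfSpace (f : Fin 3 → (Fin 3 → ℝ) → ℝ)
    (f' : Fin 3 → (Fin 3 → ℝ) → (Fin 3 → ℝ) →L[ℝ] ℝ) {R : ℝ} (hR : 0 < R)
    (hc : ∀ i, ContinuousOn (f i) {x | 0 ≤ x 0})
    (hd : ∀ i x, 0 < x 0 → HasFDerivAt (f i) (f' i x) x)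
    (hi : IntegrableOn (fun x => ∑ i, f' i x (Pi.single i 1)) {x | 0 ≤ x 0})
    (hz : ∀ i x, 0 ≤ x 0 → (∃ k, R ≤ |x k|) → f i x = 0)
    (hz' : ∀ x : Fin 3 → ℝ, 0 ≤ x 0 → (∃ k, R ≤ |x k|) → ∑ i, f' i x (Pi.single i 1) = 0) :
    ∫ x in {x : Fin 3 → ℝ | 0 ≤ x 0}, ∑ i, f' i x (Pi.single i 1) =
      -∫ z : Fin 2 → ℝ, f 0 (Fin.insertNth 0 0 z) := by
  let a : Fin 3 → ℝ := ![0, -R, -R]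
  let b : Fin 3 → ℝ := ![R, R, R]
  have hle : a ≤ b := by
    intro i; fin_cases i <;> simp [a, b] <;> linarith
  have hsub : Icc a b ⊆ {x : Fin 3 → ℝ | 0 ≤ x 0} := fun x hx => by simpa [a] using hx.1 0
  have hmeas : MeasurableSet {x : Fin 3 → ℝ | 0 ≤ x 0} :=
    measurableSet_le measurable_const (measurable_pi_apply 0)
  have key := integral_divergence_of_hasFDerivAt_off_countable' a b hle f f' ∅ countable_empty
    (fun i => (hc i).mono hsub)
    (fun x hx i => hd i x (by simpa [a] using (hx.1 0 (mem_univ _)).1)) (hi.mono_set hsub)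
  rw [← setIntegral_eq_of_subset_of_forall_sdiff_eq_zero hmeas hsub] at key
  · rw [key, Fin.sum_univ_three]
    have h1 : ∀ i, ∀ z : Fin 2 → ℝ, (0 ≤ (i.insertNth (b i) z : Fin 3 → ℝ) 0) →
        f i (i.insertNth (b i) z) = 0 := fun i z h => by
      refine hz i _ h ⟨i, ?_⟩
      rw [Fin.insertNth_apply_same]
      fin_cases i <;> simp [b, le_abs_self]
    have h2 : ∀ i, i ≠ 0 → ∀ z : Fin 2 → ℝ, (0 ≤ (i.insertNth (a i) z : Fin 3 → ℝ) 0) →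
        f i (i.insertNth (a i) z) = 0 := fun i hi z h => by
      refine hz i _ h ⟨i, ?_⟩
      rw [Fin.insertNth_apply_same]
      fin_cases i
      · exact absurd rfl hi
      all_goals simp [a, le_abs_self]
    have hf : ∀ i : Fin 3, i ≠ 0 → ∀ t : ℝ, ∀ z ∈ Icc (a ∘ i.succAbove) (b ∘ i.succAbove),
        0 ≤ (i.insertNth t z : Fin 3 → ℝ) 0 := by
      intro i hi t z hz
      have h0 := hz.1 0
      have : i.succAbove 0 = 0 := Fin.succAbove_ne_zero_zero hi
      rw [show (i.insertNth t z : Fin 3 → ℝ) 0 = (i.insertNth t z : Fin 3 → ℝ) (i.succAbove 0) by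
        rw [this], Fin.insertNth_apply_succAbove]
      simpa [Function.comp, this, a] using h0
    have e0 : ∫ z in Icc (a ∘ (0 : Fin 3).succAbove) (b ∘ (0 : Fin 3).succAbove),
        f 0 ((0 : Fin 3).insertNth (b 0) z) = 0 := by
      refine setIntegral_eq_zero_of_forall_eq_zero fun z _ => h1 0 z ?_
      rw [Fin.insertNth_apply_same]; simpa [b] using hR.le
    have e1 : ∀ i : Fin 3, i ≠ 0 → ∫ z in Icc (a ∘ i.succAbove) (b ∘ i.succAbove),
        f i (i.insertNth (b i) z) = 0 := fun i hi =>
      setIntegral_eq_zero_of_forall_eq_zero fun z hz => h1 i z (hf i hi _ z hz)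
    have e2 : ∀ i : Fin 3, i ≠ 0 → ∫ z in Icc (a ∘ i.succAbove) (b ∘ i.succAbove),
        f i (i.insertNth (a i) z) = 0 := fun i hi =>
      setIntegral_eq_zero_of_forall_eq_zero fun z hz => h2 i hi z (hf i hi _ z hz)
    rw [e0, e1 1 (by decide), e1 2 (by decide), e2 1 (by decide), e2 2 (by decide)]
    have e3 : ∫ z in Icc (a ∘ (0 : Fin 3).succAbove) (b ∘ (0 : Fin 3).succAbove),
        f 0 ((0 : Fin 3).insertNth (a 0) z) = ∫ z : Fin 2 → ℝ, f 0 (Fin.insertNth 0 0 z) := by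
      refine setIntegral_eq_integral_of_forall_compl_eq_zero fun z hz0 => ?_
      refine hz 0 _ (by rw [Fin.insertNth_apply_same]; simp [a]) ?_
      by_contra! hcon
      refine hz0 ⟨fun k => ?_, fun k => ?_⟩
      · have := (abs_lt.1 (hcon ((0 : Fin 3).succAbove k))).1
        rw [Fin.insertNth_apply_succAbove] at this
        fin_cases k <;> exact this.le
      · have := (abs_lt.1 (hcon ((0 : Fin 3).succAbove k))).2
        rw [Fin.insertNth_apply_succAbove] at this
        fin_cases k <;> exact this.le
    rw [e3]; ring
  · rintro x ⟨hx, hxs⟩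
    refine hz' x hx ?_
    by_contra! hcon
    refine hxs ⟨fun i => ?_, fun i => ?_⟩
    · have := (abs_lt.1 (hcon i)).1
      fin_cases i
      · exact hx
      · exact this.le
      · exact this.le
    · have := (abs_lt.1 (hcon i)).2
      fin_cases i <;> exact this.le

/-- The inclusion of the boundary of the half-space. -/
def boundaryIncl (z : EuclideanSpace ℝ (Fin 2)) : EuclideanSpace ℝ (Fin 3) :=
  WithLp.toLp 2 (Fin.insertNth (0 : Fin 3) (0 : ℝ) z.ofLp)

theorem mem_range_halfSpace {y : EuclideanSpace ℝ (Fin 3)} : y ∈ range (𝓡∂ 3) ↔ 0 ≤ y 0 := by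
  rw [range_modelWithCornersEuclideanHalfSpace]; rfl

theorem extDerivWithin_eq_zero_of_lt_norm {k : ℕ} {S : Set (EuclideanSpace ℝ (Fin 3))}
    {g : EuclideanSpace ℝ (Fin 3) → EuclideanSpace ℝ (Fin 3) [⋀^Fin k]→L[ℝ] ℝ} {R : ℝ}
    (hR : ∀ y ∈ S, R < ‖y‖ → g y = 0) : ∀ y ∈ S, R < ‖y‖ → extDerivWithin g S y = 0 := by
  intro y hy hyR
  have : g =ᶠ[𝓝[S] y] fun _ => 0 := by
    filter_upwards [self_mem_nhdsWithin, mem_nhdsWithin_of_mem_nhds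
      ((isOpen_lt continuous_const continuous_norm).mem_nhds hyR)] with z hz hzR
    exact hR z hz hzR
  rw [this.extDerivWithin_eq_of_mem hy, extDerivWithin, fderivWithin_fun_const]
  exact (ContinuousAlternatingMap.alternatizeUncurryFinCLM ℝ _ ℝ).map_zero

theorem integrableOn_extDerivWithin_halfSpace
    {g : EuclideanSpace ℝ (Fin 3) → EuclideanSpace ℝ (Fin 3) [⋀^Fin 2]→L[ℝ] ℝ}
    (hg : ContDiffOn ℝ 1 g (range (𝓡∂ 3))) {R : ℝ}
    (hR : ∀ y ∈ range (𝓡∂ 3), R < ‖y‖ → g y = 0) :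
    IntegrableOn (fun y => extDerivWithin g (range (𝓡∂ 3)) y (stdFrame 3)) (range (𝓡∂ 3)) := by
  set S : Set (EuclideanSpace ℝ (Fin 3)) := range (𝓡∂ 3) with hS
  have hSu : UniqueDiffOn ℝ S := (𝓡∂ 3).uniqueDiffOn
  have hnear := extDerivWithin_eq_zero_of_lt_norm hR
  have hcd : ContinuousOn (fderivWithin ℝ g S) S := hg.continuousOn_fderivWithin hSu le_rfl
  have hdivc : ContinuousOn (fun y => extDerivWithin g S y (stdFrame 3)) S := by
    have h1 : ContinuousOn (fun y => extDerivWithin g S y) S :=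
      (ContinuousAlternatingMap.alternatizeUncurryFinCLM ℝ _ ℝ).continuous.comp_continuousOn hcd
    exact (ContinuousAlternatingMap.apply ℝ (EuclideanSpace ℝ (Fin 3)) ℝ
      (stdFrame 3)).continuous.comp_continuousOn h1
  have hSm : MeasurableSet S := (𝓡∂ 3).isClosed_range.measurableSet
  · have hK : IsCompact (S ∩ Metric.closedBall 0 R) :=
      (isCompact_closedBall _ _).inter_left (𝓡∂ 3).isClosed_range
    refine IntegrableOn.of_forall_sdiff_eq_zero
      ((hdivc.mono inter_subset_left).integrableOn_compact hK) hSm ?_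
    rintro y ⟨hy, hyK⟩
    have : R < ‖y‖ := by
      by_contra! hcon
      exact hyK ⟨hy, by simpa using hcon⟩
    rw [hnear y hy this]; rfl

/-- Stokes' theorem for compactly supported 2-forms on the half-space. -/
theorem integral_extDerivWithin_halfSpace
    {g : EuclideanSpace ℝ (Fin 3) → EuclideanSpace ℝ (Fin 3) [⋀^Fin 2]→L[ℝ] ℝ}
    (hg : ContDiffOn ℝ 1 g (range (𝓡∂ 3))) {R : ℝ}
    (hR : ∀ y ∈ range (𝓡∂ 3), R < ‖y‖ → g y = 0) :
    ∫ y in range (𝓡∂ 3), extDerivWithin g (range (𝓡∂ 3)) y (stdFrame 3) =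
      -∫ z, g (boundaryIncl z) ![stdFrame 3 1, stdFrame 3 2] := by
  set S : Set (EuclideanSpace ℝ (Fin 3)) := range (𝓡∂ 3) with hS
  have hSu : UniqueDiffOn ℝ S := (𝓡∂ 3).uniqueDiffOn
  let ℓ : (Fin 3 → ℝ) ≃L[ℝ] EuclideanSpace ℝ (Fin 3) := (EuclideanSpace.equiv (Fin 3) ℝ).symm
  have hℓ : ∀ x, ℓ x = WithLp.toLp 2 x := fun x => rfl
  have hmem : ∀ x : Fin 3 → ℝ, ℓ x ∈ S ↔ 0 ≤ x 0 := fun x => mem_range_halfSpace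
  have hSpre : (WithLp.toLp 2) ⁻¹' S = {x : Fin 3 → ℝ | 0 ≤ x 0} := by
    ext x; exact hmem x
  have hint : ∀ y ∈ S, 0 < y 0 → S ∈ 𝓝 y := by
    intro y _ hy0
    have : y ∈ interior S := by
      rw [hS, interior_range_modelWithCornersEuclideanHalfSpace]; exact hy0
    exact mem_interior_iff_mem_nhds.1 this
  let e : Fin 3 → (EuclideanSpace ℝ (Fin 3) [⋀^Fin 2]→L[ℝ] ℝ) →L[ℝ] ℝ := fun i =>
    ((-1 : ℝ) ^ (i : ℕ)) • ContinuousAlternatingMap.apply ℝ (EuclideanSpace ℝ (Fin 3)) ℝ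
      (i.removeNth (stdFrame 3))
  let f : Fin 3 → (Fin 3 → ℝ) → ℝ := fun i x => e i (g (ℓ x))
  let f' : Fin 3 → (Fin 3 → ℝ) → (Fin 3 → ℝ) →L[ℝ] ℝ := fun i x =>
    (e i).comp ((fderivWithin ℝ g S (ℓ x)).comp (ℓ : (Fin 3 → ℝ) →L[ℝ] _))
  have hdiv : ∀ x, 0 ≤ x 0 → ∑ i, f' i x (Pi.single i 1) =
      extDerivWithin g S (ℓ x) (stdFrame 3) := by
    intro x hx
    have hxS := (hmem x).2 hx
    rw [extDerivWithin_apply ((hg _ hxS).differentiableWithinAt one_ne_zero) (hSu _ hxS)]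
    refine Finset.sum_congr rfl fun i _ => ?_
    rw [fderivWithin_continuousAlternatingMap_apply_const_apply (hSu _ hxS)
      ((hg _ hxS).differentiableWithinAt one_ne_zero)]
    have hsingle : ℓ (Pi.single i 1) = stdFrame 3 i := by
      ext k; simp [hℓ, stdFrame]
    change (-1 : ℝ) ^ (i : ℕ) • fderivWithin ℝ g S (ℓ x) (ℓ (Pi.single i 1)) _ = _
    rw [hsingle, zsmul_eq_mul, smul_eq_mul]
    push_cast
    rfl
  have hnear := extDerivWithin_eq_zero_of_lt_norm hR
  have hnorm : ∀ x : Fin 3 → ℝ, (∃ k, max R 0 + 1 ≤ |x k|) → R < ‖ℓ x‖ := by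
    rintro x ⟨k, hk⟩
    have := PiLp.norm_apply_le (ℓ x) k
    rw [Real.norm_eq_abs] at this
    have h2 := le_max_left R 0
    change |x k| ≤ _ at this
    linarith
  have hdivi := integrableOn_extDerivWithin_halfSpace hg hR
  have hvp := PiLp.volume_preserving_toLp (Fin 3)
  have hemb : MeasurableEmbedding (WithLp.toLp 2 : (Fin 3 → ℝ) → EuclideanSpace ℝ (Fin 3)) :=
    (MeasurableEquiv.toLp 2 (Fin 3 → ℝ)).measurableEmbedding
  have hhm : MeasurableSet {x : Fin 3 → ℝ | 0 ≤ x 0} :=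
    measurableSet_le measurable_const (measurable_pi_apply 0)
  have hmain := integral_divergence_halfSpace f f' (R := max R 0 + 1) (by positivity)
    (fun i => by
      refine (e i).continuous.comp_continuousOn (hg.continuousOn.comp ℓ.continuous.continuousOn ?_)
      intro x hx; exact (hmem x).2 hx)
    (fun i x hx => by
      have hxS := (hmem x).2 hx.le
      have h1 : HasFDerivAt g (fderivWithin ℝ g S (ℓ x)) (ℓ x) :=
        ((hg _ hxS).differentiableWithinAt one_ne_zero).hasFDerivWithinAt.hasFDerivAt
          (hint _ hxS hx)
      exact (e i).hasFDerivAt.comp x (h1.comp x ℓ.hasFDerivAt))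
    (by
      refine IntegrableOn.congr_fun (f := fun x => extDerivWithin g S (ℓ x) (stdFrame 3)) ?_
        (fun x hx => (hdiv x hx).symm) hhm
      rw [← hSpre]
      exact (hvp.integrableOn_comp_preimage hemb).2 hdivi)
    (fun i x hx hk => by
      simp only [f]
      rw [hR _ ((hmem x).2 hx) (hnorm x hk), map_zero])
    (fun x hx hk => by
      rw [hdiv x hx, hnear _ ((hmem x).2 hx) (hnorm x hk)]; rfl)
  rw [setIntegral_congr_fun hhm fun x hx => hdiv x hx] at hmain
  rw [← hvp.setIntegral_preimage_emb hemb, hSpre]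
  refine hmain.trans ?_
  rw [neg_inj, ← (PiLp.volume_preserving_toLp (Fin 2)).integral_comp
    (MeasurableEquiv.toLp 2 (Fin 2 → ℝ)).measurableEmbedding]
  refine integral_congr_ae (Eventually.of_forall fun z => ?_)
  have hr : (0 : Fin 3).removeNth (stdFrame 3) = ![stdFrame 3 1, stdFrame 3 2] := by
    funext i; fin_cases i <;> rfl
  simp only [f, e, hr]
  simp [boundaryIncl, hℓ]

end HalfSpace

section Determinants

theorem stdBasis_det_eq {n : ℕ} (v : Fin n → EuclideanSpace ℝ (Fin n)) :
    (stdBasis n).det v = Matrix.det (Matrix.of fun i j => v j i) := by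
  rw [Module.Basis.det_apply]
  congr 1

theorem alternating_eq_mul_det {n : ℕ} (α : EuclideanSpace ℝ (Fin n) [⋀^Fin n]→L[ℝ] ℝ)
    (v : Fin n → EuclideanSpace ℝ (Fin n)) : α v = α (stdFrame n) * (stdBasis n).det v := by
  have := α.toAlternatingMap.eq_smul_basis_det (stdBasis n)
  have h := DFunLike.congr_fun this v
  simpa [stdBasis_eq] using h

theorem sign_mul_self_eq_abs (a : ℝ) : Real.sign a * a = |a| := by
  rcases lt_trichotomy a 0 with h | h | h
  · rw [Real.sign_of_neg h, abs_of_neg h]; ring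
  · simp [h]
  · rw [Real.sign_of_pos h, abs_of_pos h]; ring

theorem sign_mul_eq (a b : ℝ) : Real.sign (a * b) = Real.sign a * Real.sign b := by
  rcases lt_trichotomy a 0 with h | h | h <;> rcases lt_trichotomy b 0 with h' | h' | h'
  · rw [Real.sign_of_neg h, Real.sign_of_neg h', Real.sign_of_pos (mul_pos_of_neg_of_neg h h')]
    norm_num
  · simp [h']
  · rw [Real.sign_of_neg h, Real.sign_of_pos h', Real.sign_of_neg (mul_neg_of_neg_of_pos h h')]
    norm_num
  · simp [h]
  · simp [h]
  · simp [h]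
  · rw [Real.sign_of_pos h, Real.sign_of_neg h', Real.sign_of_neg (mul_neg_of_pos_of_neg h h')]
    norm_num
  · simp [h']
  · rw [Real.sign_of_pos h, Real.sign_of_pos h', Real.sign_of_pos (mul_pos h h')]; norm_num

theorem eventually_sign_eq {α : Type*} [TopologicalSpace α] {s : Set α} {f : α → ℝ} {y : α}
    (hf : ContinuousWithinAt f s y) (hy : f y ≠ 0) :
    ∀ᶠ z in 𝓝[s] y, Real.sign (f z) = Real.sign (f y) := by
  rcases lt_or_gt_of_ne hy with h | h
  · filter_upwards [hf (isOpen_Iio.mem_nhds h)] with z hz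
    rw [Real.sign_of_neg h, Real.sign_of_neg hz]
  · filter_upwards [hf (isOpen_Ioi.mem_nhds h)] with z hz
    rw [Real.sign_of_pos h, Real.sign_of_pos hz]

/-- The density identity in the change of variables formula need only be checked on one frame. -/
theorem density_of_stdFrame {n : ℕ} {α β : EuclideanSpace ℝ (Fin n) [⋀^Fin n]→L[ℝ] ℝ}
    {L : EuclideanSpace ℝ (Fin n) →L[ℝ] EuclideanSpace ℝ (Fin n)} {t : ℝ}
    (h : Real.sign (α (stdFrame n)) * β (stdFrame n) =
      |(stdBasis n).det fun i => L (stdFrame n i)| * t) (e : Fin n → EuclideanSpace ℝ (Fin n)) :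
    Real.sign (α e) * β e = |(stdBasis n).det fun i => L (e i)| * t := by
  have h1 : (stdBasis n).det (fun i => L (e i)) =
      ((stdBasis n).det fun i => L (stdFrame n i)) * (stdBasis n).det e := by
    rw [stdBasis_det_comp_stdFrame]
    exact (stdBasis n).det_comp (L : EuclideanSpace ℝ (Fin n) →ₗ[ℝ] EuclideanSpace ℝ (Fin n)) e
  rw [alternating_eq_mul_det α e, alternating_eq_mul_det β e, h1, sign_mul_eq, abs_mul]
  rw [← sign_mul_self_eq_abs ((stdBasis n).det e)]
  linear_combination (Real.sign ((stdBasis n).det e) * (stdBasis n).det e) * h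

end Determinants

section ChartLemmas

variable {E : Type*} [NormedAddCommGroup E] [NormedSpace ℝ E]
  {H : Type*} [TopologicalSpace H] (I : ModelWithCorners ℝ E H)
  {X : Type*} [TopologicalSpace X] [ChartedSpace H X] [IsManifold I ∞ X]
  {c c₁ c₂ : OpenPartialHomeomorph X H}

theorem exists_coframe_eq (hc : c ∈ atlas H X) {x : X} (hx : x ∈ c.source) (w : E) :
    ∃ v : TangentSpace I x, coframe I c x v = w := by
  obtain ⟨y, hy, rfl⟩ : ∃ y, y ∈ (c.extend I).target ∧ (c.extend I).symm y = x :=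
    ⟨_, extend_mem_target I hx, extend_left_inv' I hx⟩
  exact ⟨chartFrame I c y w, DFunLike.congr_fun (coframe_comp_frame I hc hy) w⟩

theorem coframe_injective (hc : c ∈ atlas H X) {x : X} (hx : x ∈ c.source) :
    Function.Injective (coframe I c x) := by
  obtain ⟨y, hy, rfl⟩ : ∃ y, y ∈ (c.extend I).target ∧ (c.extend I).symm y = x :=
    ⟨_, extend_mem_target I hx, extend_left_inv' I hx⟩
  refine Function.LeftInverse.injective (g := chartFrame I c y) fun v => ?_
  exact DFunLike.congr_fun (frame_comp_coframe I hc hy) v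

/-- The transition map between two charts, differentiated. -/
theorem exists_hasFDerivWithinAt_transition (h₁ : c₁ ∈ atlas H X) (h₂ : c₂ ∈ atlas H X) {x : X}
    (hx₁ : x ∈ c₁.source) (hx₂ : x ∈ c₂.source) :
    ∃ T : E →L[ℝ] E, HasFDerivWithinAt (fun z => c₂.extend I ((c₁.extend I).symm z)) T (range I)
      (c₁.extend I x) ∧ ∀ v : TangentSpace I x, T (coframe I c₁ x v) = coframe I c₂ x v := by
  obtain ⟨y, hy, rfl⟩ : ∃ y, y ∈ (c₁.extend I).target ∧ (c₁.extend I).symm y = x :=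
    ⟨_, extend_mem_target I hx₁, extend_left_inv' I hx₁⟩
  have h := hasFDerivWithinAt_coord I I h₁ h₂ (f := id) hy mdifferentiableAt_id hx₂
  rw [(c₁.extend I).right_inv hy]
  refine ⟨_, h, fun v => ?_⟩
  rw [mfderiv_id]
  exact congrArg (coframe I c₂ ((c₁.extend I).symm y))
    (DFunLike.congr_fun (frame_comp_coframe I h₁ hy) v)

end ChartLemmas

section Boundary

variable {N : Type*} [TopologicalSpace N] [ChartedSpace (EuclideanHalfSpace 3) N]
  [IsManifold (𝓡∂ 3) ∞ N] {c c₁ c₂ : OpenPartialHomeomorph N (EuclideanHalfSpace 3)}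

theorem extend_apply_zero_nonneg (c : OpenPartialHomeomorph N (EuclideanHalfSpace 3)) (x : N) :
    0 ≤ c.extend (𝓡∂ 3) x 0 := mem_range_halfSpace.1 (by simp)

theorem isBoundaryPoint_iff_apply_zero (hc : c ∈ atlas (EuclideanHalfSpace 3) N) {x : N}
    (hx : x ∈ c.source) : (𝓡∂ 3).IsBoundaryPoint x ↔ c.extend (𝓡∂ 3) x 0 = 0 := by
  rw [← not_iff_not, ← ModelWithCorners.isInteriorPoint_iff_not_isBoundaryPoint,
    ModelWithCorners.isInteriorPoint_iff_of_mem_atlas (n := ∞) (by simp) hc hx]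
  have h0 := extend_apply_zero_nonneg c x
  constructor
  · intro h
    have h1 := interior_mono (extend_target_subset_range (𝓡∂ 3) c) h
    rw [interior_range_modelWithCornersEuclideanHalfSpace] at h1
    exact (ne_of_gt h1)
  · intro h
    refine c.mem_interior_extend_target (c.map_source hx) ?_
    have h1 : 0 < c.extend (𝓡∂ 3) x 0 := lt_of_le_of_ne h0 (Ne.symm h)
    have h2 : c.extend (𝓡∂ 3) x ∈ interior (range (𝓡∂ 3)) := by
      rw [interior_range_modelWithCornersEuclideanHalfSpace]; exact h1
    exact h2

/-- Being outward-pointing does not depend on the chart. -/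
theorem coframe_apply_zero_neg (h₁ : c₁ ∈ atlas (EuclideanHalfSpace 3) N)
    (h₂ : c₂ ∈ atlas (EuclideanHalfSpace 3) N) {x : N} (hx₁ : x ∈ c₁.source) (hx₂ : x ∈ c₂.source)
    (h0 : (𝓡∂ 3).IsBoundaryPoint x) {v : TangentSpace (𝓡∂ 3) x}
    (hv : coframe (𝓡∂ 3) c₁ x v 0 < 0) : coframe (𝓡∂ 3) c₂ x v 0 < 0 := by
  obtain ⟨T, hT, hTc⟩ := exists_hasFDerivWithinAt_transition (𝓡∂ 3) h₁ h₂ hx₁ hx₂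
  have e₁ := (isBoundaryPoint_iff_apply_zero h₁ hx₁).1 h0
  have e₂ := (isBoundaryPoint_iff_apply_zero h₂ hx₂).1 h0
  let π : EuclideanSpace ℝ (Fin 3) →L[ℝ] ℝ := EuclideanSpace.proj 0
  have hπT := π.hasFDerivAt.comp_hasFDerivWithinAt _ hT
  have hmin : IsLocalMinOn (π ∘ fun z => c₂.extend (𝓡∂ 3) ((c₁.extend (𝓡∂ 3)).symm z))
      (range (𝓡∂ 3)) (c₁.extend (𝓡∂ 3) x) := by
    refine Filter.Eventually.of_forall fun z => ?_
    simp only [Function.comp_apply, extend_left_inv' (𝓡∂ 3) hx₁]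
    change c₂.extend (𝓡∂ 3) x 0 ≤ c₂.extend (𝓡∂ 3) _ 0
    rw [e₂]; exact extend_apply_zero_nonneg _ _
  have hnn : ∀ w : EuclideanSpace ℝ (Fin 3), 0 ≤ w 0 → 0 ≤ T w 0 := by
    intro w hw
    refine hmin.hasFDerivWithinAt_nonneg hπT (mem_posTangentConeAt_of_segment_subset ?_)
    rw [segment_eq_image']
    rintro _ ⟨t, ht, rfl⟩
    rw [mem_range_halfSpace]
    simp only [add_sub_cancel_left, PiLp.add_apply, PiLp.smul_apply, smul_eq_mul, e₁, zero_add]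
    exact mul_nonneg ht.1 hw
  have hzero : ∀ w : EuclideanSpace ℝ (Fin 3), w 0 = 0 → T w 0 = 0 := by
    intro w hw
    refine le_antisymm ?_ (hnn w hw.ge)
    have := hnn (-w) (by simp [hw])
    simpa using this
  set w := coframe (𝓡∂ 3) c₁ x v with hw
  rw [← hTc v, ← hw]
  have h1 : T w 0 ≤ 0 := by
    have := hnn (-w) (by simpa using hv.le)
    simpa using this
  refine lt_of_le_of_ne h1 fun hcon => ?_
  obtain ⟨u, hu⟩ := exists_coframe_eq (𝓡∂ 3) h₂ hx₂ (EuclideanSpace.single 0 1)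
  have h3 : T (coframe (𝓡∂ 3) c₁ x u) 0 = 0 := by
    set q := coframe (𝓡∂ 3) c₁ x u
    have h4 := hzero (q - (q 0 / w 0) • w) (by
      simp only [PiLp.sub_apply, PiLp.smul_apply, smul_eq_mul]
      field_simp [hv.ne]
      ring)
    simp only [map_sub, map_smul, PiLp.sub_apply, PiLp.smul_apply, hcon, smul_zero, sub_zero] at h4
    exact h4
  rw [hTc, hu] at h3
  simp at h3

end Boundary

/-! ### Stokes' theorem on a compact three-manifold with boundary -/

section Stokes

theorem formIntegral_eq_partitionIntegral {n : ℕ} {X : Type*} [TopologicalSpace X]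
    [ChartedSpace (EuclideanSpace ℝ (Fin n)) X] [IsManifold (𝓡 n) ∞ X] [T2Space X]
    [CompactSpace X] (ν θ : Form (𝓡 n) X n) :
    formIntegral ν θ univ = partitionIntegral (𝓡 n) (chartPartition n X) ν θ := by
  unfold formIntegral partitionIntegral
  refine finsum_congr fun p => ?_
  rw [preimage_univ, inter_univ]
  simp only [OpenPartialHomeomorph.extend, modelWithCornersSelf_partialEquiv,
    PartialEquiv.trans_refl]
  rfl

theorem chartPartition_isSubordinate {n : ℕ} {X : Type*} [TopologicalSpace X]
    [ChartedSpace (EuclideanSpace ℝ (Fin n)) X] [IsManifold (𝓡 n) ∞ X] [T2Space X]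
    [CompactSpace X] : (chartPartition n X).IsSubordinate
      fun p => (chartAt (EuclideanSpace ℝ (Fin n)) p).source :=
  Classical.choose_spec (SmoothPartitionOfUnity.exists_isSubordinate_chartAt_source (𝓡 n) X)

/-- The linear inclusion of the boundary of the half-space. -/
def boundaryInclL : EuclideanSpace ℝ (Fin 2) →L[ℝ] EuclideanSpace ℝ (Fin 3) :=
  LinearMap.toContinuousLinearMap
    { toFun := boundaryIncl
      map_add' := fun x y => by
        ext i; refine Fin.cases ?_ (fun k => ?_) i <;> simp [boundaryIncl]
      map_smul' := fun t x => by
        ext i; refine Fin.cases ?_ (fun k => ?_) i <;> simp [boundaryIncl] }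

theorem boundaryInclL_apply (z : EuclideanSpace ℝ (Fin 2)) :
    boundaryInclL z = boundaryIncl z := rfl

/-- The projection of the half-space onto its boundary. -/
def boundaryProj : EuclideanSpace ℝ (Fin 3) →L[ℝ] EuclideanSpace ℝ (Fin 2) :=
  LinearMap.toContinuousLinearMap
    { toFun := fun y => WithLp.toLp 2 fun i => y i.succ
      map_add' := fun x y => by ext i; simp
      map_smul' := fun t x => by ext i; simp }

theorem boundaryProj_apply (y : EuclideanSpace ℝ (Fin 3)) (i : Fin 2) :
    boundaryProj y i = y i.succ := rfl

theorem boundaryIncl_zero' (z : EuclideanSpace ℝ (Fin 2)) : boundaryIncl z 0 = 0 := by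
  simp [boundaryIncl]

theorem boundaryProj_boundaryIncl (z : EuclideanSpace ℝ (Fin 2)) :
    boundaryProj (boundaryIncl z) = z := by
  ext i; simp [boundaryIncl, boundaryProj_apply]

theorem boundaryIncl_boundaryProj {y : EuclideanSpace ℝ (Fin 3)} (hy : y 0 = 0) :
    boundaryIncl (boundaryProj y) = y := by
  ext i
  refine Fin.cases ?_ (fun k => ?_) i
  · rw [boundaryIncl_zero', hy]
  · simp [boundaryIncl, boundaryProj_apply]

theorem boundaryIncl_stdFrame (i : Fin 2) : boundaryInclL (stdFrame 2 i) = stdFrame 3 i.succ := by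
  ext k
  refine Fin.cases ?_ (fun k => ?_) k
  · simp [boundaryInclL_apply, boundaryIncl, stdFrame]
  · simp [boundaryInclL_apply, boundaryIncl, stdFrame, Pi.single_apply]

theorem norm_le_norm_boundaryIncl (z : EuclideanSpace ℝ (Fin 2)) : ‖z‖ ≤ ‖boundaryIncl z‖ := by
  rw [EuclideanSpace.norm_eq, EuclideanSpace.norm_eq, Fin.sum_univ_succ (n := 2)]
  refine Real.sqrt_le_sqrt ?_
  simp [boundaryIncl]

/-- The value of a 2-form on vectors tangent to the boundary of the half-space. -/
theorem alternating_boundary_apply (α : EuclideanSpace ℝ (Fin 3) [⋀^Fin 2]→L[ℝ] ℝ)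
    {u : Fin 2 → EuclideanSpace ℝ (Fin 3)} (hu : ∀ i, u i 0 = 0) :
    α u = α ![stdFrame 3 1, stdFrame 3 2] * (stdBasis 2).det fun i => boundaryProj (u i) := by
  have h := alternating_eq_mul_det (α.compContinuousLinearMap boundaryInclL)
    fun i => boundaryProj (u i)
  rw [ContinuousAlternatingMap.compContinuousLinearMap_apply,
    ContinuousAlternatingMap.compContinuousLinearMap_apply] at h
  convert h using 2
  · funext i
    exact (boundaryIncl_boundaryProj (hu i)).symm
  · congr 1
    funext i
    refine (?_ : _ = boundaryInclL (stdFrame 2 i))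
    rw [boundaryIncl_stdFrame]
    fin_cases i <;> rfl

theorem det_cons_boundary (n : EuclideanSpace ℝ (Fin 3)) {u : Fin 2 → EuclideanSpace ℝ (Fin 3)}
    (hu : ∀ i, u i 0 = 0) : (stdBasis 3).det ![n, u 0, u 1] =
      n 0 * (stdBasis 2).det fun i => boundaryProj (u i) := by
  rw [stdBasis_det_eq, stdBasis_det_eq, Matrix.det_fin_three, Matrix.det_fin_two]
  simp only [Matrix.of_apply, Matrix.cons_val, hu, boundaryProj_apply]
  have e0 : (Fin.succ 0 : Fin 3) = 1 := rfl
  have e1 : (Fin.succ 1 : Fin 3) = 2 := rfl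
  rw [e0, e1]
  ring

variable {N : Type*} [TopologicalSpace N] [T2Space N] [CompactSpace N]
  [ChartedSpace (EuclideanHalfSpace 3) N] [IsManifold (𝓡∂ 3) ∞ N]
  {B : Type*} [TopologicalSpace B] [T2Space B] [CompactSpace B]
  [ChartedSpace (EuclideanSpace ℝ (Fin 2)) B] [IsManifold (𝓡 2) ∞ B]

theorem inChart_orientation_ne_zero {n : ℕ} {H : Type*} [TopologicalSpace H]
    (I : ModelWithCorners ℝ (EuclideanSpace ℝ (Fin n)) H)
    {X : Type*} [TopologicalSpace X] [ChartedSpace H X] [IsManifold I ∞ X]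
    {ν : Form I X n} (hν : IsOrientationForm I ν) {c : OpenPartialHomeomorph X H}
    (hc : c ∈ atlas H X) {y : EuclideanSpace ℝ (Fin n)} (hy : y ∈ (c.extend I).target) :
    Form.inChart I ν c y (stdFrame n) ≠ 0 := by
  intro h0
  refine hν.2 ((c.extend I).symm y) ?_
  rw [form_eq_inChart_comp I hc ν (extend_symm_mem_source I hy), (c.extend I).right_inv hy]
  ext v
  rw [ContinuousAlternatingMap.compContinuousLinearMap_apply, alternating_eq_mul_det, h0, zero_mul]
  rfl

/-- The form `θ` in the half-space chart `c`, extended by zero and multiplied with the sign of the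
orientation. -/
def chartExtension (ν : Form (𝓡∂ 3) N 3) (c : OpenPartialHomeomorph N (EuclideanHalfSpace 3))
    {k : ℕ} (θ : Form (𝓡∂ 3) N k) (y : EuclideanSpace ℝ (Fin 3)) :
    EuclideanSpace ℝ (Fin 3) [⋀^Fin k]→L[ℝ] ℝ := by
  classical
  exact if y ∈ (c.extend (𝓡∂ 3)).target then
    Real.sign (Form.inChart (𝓡∂ 3) ν c y (stdFrame 3)) • Form.inChart (𝓡∂ 3) θ c y else 0

section SingleChart

/-- A smooth form with compact support in the domain of a chart of an oriented three-manifold. -/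
structure IsSupportedInChart (ν : Form (𝓡∂ 3) N 3)
    (c : OpenPartialHomeomorph N (EuclideanHalfSpace 3)) (α : Form (𝓡∂ 3) N 2) (K : Set N) :
    Prop where
  orientation : IsOrientationForm (𝓡∂ 3) ν
  mem_atlas : c ∈ atlas (EuclideanHalfSpace 3) N
  smoothAt : ∀ x, Form.SmoothAt (𝓡∂ 3) α x
  isCompact : IsCompact K
  subset_source : K ⊆ c.source
  eq_zero : ∀ x ∉ K, α x = 0

variable {ν : Form (𝓡∂ 3) N 3} {c : OpenPartialHomeomorph N (EuclideanHalfSpace 3)}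
  {α : Form (𝓡∂ 3) N 2} {K : Set N}

theorem chartExtension_eventuallyEq (h : IsSupportedInChart ν c α K) {y : EuclideanSpace ℝ (Fin 3)}
    (hy : y ∈ (c.extend (𝓡∂ 3)).target) :
    chartExtension ν c α =ᶠ[𝓝[range (𝓡∂ 3)] y] fun z =>
      Real.sign (Form.inChart (𝓡∂ 3) ν c y (stdFrame 3)) • Form.inChart (𝓡∂ 3) α c z := by
  have h1 := extend_target_mem_nhdsWithin' (𝓡∂ 3) hy
  have hcont : ContinuousWithinAt (fun z => Form.inChart (𝓡∂ 3) ν c z (stdFrame 3))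
      (range (𝓡∂ 3)) y :=
    (ContinuousAlternatingMap.apply ℝ (EuclideanSpace ℝ (Fin 3)) ℝ
      (stdFrame 3)).continuous.continuousAt.comp_continuousWithinAt
      ((h.orientation.1 c h.mem_atlas y hy).mono_of_mem_nhdsWithin h1)
  filter_upwards [h1, eventually_sign_eq hcont (inChart_orientation_ne_zero (𝓡∂ 3) h.orientation h.mem_atlas hy)]
    with z hz hs
  rw [chartExtension, if_pos hz, hs]

theorem chartExtension_eq_zero (h : IsSupportedInChart ν c α K) {y : EuclideanSpace ℝ (Fin 3)}
    (hy : y ∉ c.extend (𝓡∂ 3) '' K) : chartExtension ν c α y = 0 := by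
  unfold chartExtension
  split_ifs with hy'
  · have : (c.extend (𝓡∂ 3)).symm y ∉ K := fun hcon =>
      hy ⟨_, hcon, (c.extend (𝓡∂ 3)).right_inv hy'⟩
    have h0 : Form.inChart (𝓡∂ 3) α c y = 0 := by
      rw [Form.inChart, h.eq_zero _ this]; rfl
    rw [h0, smul_zero]
  · rfl

theorem isCompact_extend_image (h : IsSupportedInChart ν c α K) : IsCompact (c.extend (𝓡∂ 3) '' K) :=
  h.isCompact.image_of_continuousOn ((c.continuousOn_extend (I := 𝓡∂ 3)).mono
    (by rw [c.extend_source]; exact h.subset_source))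

theorem chartExtension_eventuallyEq_zero (h : IsSupportedInChart ν c α K) {y : EuclideanSpace ℝ (Fin 3)}
    (hy : y ∉ (c.extend (𝓡∂ 3)).target) : chartExtension ν c α =ᶠ[𝓝 y] fun _ => 0 := by
  have hcl := (isCompact_extend_image h).isClosed
  have : y ∈ (c.extend (𝓡∂ 3) '' K)ᶜ := by
    rintro ⟨x, hx, rfl⟩
    exact hy (extend_mem_target (𝓡∂ 3) (h.subset_source hx))
  filter_upwards [hcl.isOpen_compl.mem_nhds this] with z hz
  exact chartExtension_eq_zero h hz

theorem contDiffOn_chartExtension (h : IsSupportedInChart ν c α K) : ContDiffOn ℝ 1 (chartExtension ν c α) (range (𝓡∂ 3)) := by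
  intro y hy
  by_cases hyt : y ∈ (c.extend (𝓡∂ 3)).target
  · refine ContDiffWithinAt.congr_of_eventuallyEq_of_mem ?_
      (chartExtension_eventuallyEq h hyt) hy
    have := h.smoothAt _ c h.mem_atlas (extend_symm_mem_source (𝓡∂ 3) hyt)
    rw [(c.extend (𝓡∂ 3)).right_inv hyt] at this
    exact (this.of_le (mod_cast le_top)).const_smul _
  · refine ContDiffWithinAt.congr_of_eventuallyEq_of_mem contDiffWithinAt_const
      ((chartExtension_eventuallyEq_zero h hyt).filter_mono
        nhdsWithin_le_nhds) hy

theorem extDerivWithin_chartExtension (h : IsSupportedInChart ν c α K) {y : EuclideanSpace ℝ (Fin 3)} (hy : y ∈ range (𝓡∂ 3)) :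
    extDerivWithin (chartExtension ν c α) (range (𝓡∂ 3)) y =
      chartExtension ν c (Form.d (𝓡∂ 3) α) y := by
  by_cases hyt : y ∈ (c.extend (𝓡∂ 3)).target
  · rw [(chartExtension_eventuallyEq h hyt).extDerivWithin_eq_of_mem hy,
      extDerivWithin_fun_smul _ _ ((𝓡∂ 3).uniqueDiffOn y hy), chartExtension, if_pos hyt,
      inChart_d (𝓡∂ 3) h.mem_atlas hyt (h.smoothAt _)]
  · rw [((chartExtension_eventuallyEq_zero h hyt).filter_mono
        nhdsWithin_le_nhds).extDerivWithin_eq_of_mem hy, extDerivWithin, fderivWithin_fun_const,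
        chartExtension, if_neg hyt]
    exact (ContinuousAlternatingMap.alternatizeUncurryFinCLM ℝ _ ℝ).map_zero

theorem d_eq_zero_of_notMem (h : IsSupportedInChart ν c α K) {x : N} (hx : x ∉ K) : Form.d (𝓡∂ 3) α x = 0 := by
  have h0 := chart_mem_atlas (EuclideanHalfSpace 3) x
  have hx0 := mem_chart_source (EuclideanHalfSpace 3) x
  have hy := extend_mem_target (𝓡∂ 3) hx0
  have hsymm : ContinuousWithinAt ((chartAt (EuclideanHalfSpace 3) x).extend (𝓡∂ 3)).symm
      (range (𝓡∂ 3)) ((chartAt (EuclideanHalfSpace 3) x).extend (𝓡∂ 3) x) :=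
    (((chartAt (EuclideanHalfSpace 3) x).continuousOn_extend_symm (I := 𝓡∂ 3)) _
      hy).mono_of_mem_nhdsWithin (extend_target_mem_nhdsWithin' (𝓡∂ 3) hy)
  have hev : Form.inChart (𝓡∂ 3) α (chartAt (EuclideanHalfSpace 3) x) =ᶠ[𝓝[range (𝓡∂ 3)]
      ((chartAt (EuclideanHalfSpace 3) x).extend (𝓡∂ 3) x)] fun _ => 0 := by
    have := hsymm (h.isCompact.isClosed.isOpen_compl.mem_nhds
      (by rw [extend_left_inv' (𝓡∂ 3) hx0]; exact hx))
    filter_upwards [this] with z hz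
    rw [Form.inChart, h.eq_zero _ hz]
    rfl
  have hz : extDerivWithin (Form.inChart (𝓡∂ 3) α (chartAt (EuclideanHalfSpace 3) x))
      (range (𝓡∂ 3)) ((chartAt (EuclideanHalfSpace 3) x).extend (𝓡∂ 3) x) = 0 := by
    rw [hev.extDerivWithin_eq_of_mem (extend_target_subset_range _ _ hy), extDerivWithin,
      fderivWithin_fun_const]
    exact (ContinuousAlternatingMap.alternatizeUncurryFinCLM ℝ _ ℝ).map_zero
  rw [form_eq_inChart_comp (𝓡∂ 3) h0 (Form.d (𝓡∂ 3) α) hx0, inChart_d (𝓡∂ 3) h0 hy (h.smoothAt _), hz]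
  rfl

/-- Stokes' theorem in a chart: the interior integral. -/
theorem partitionIntegral_d_eq (h : IsSupportedInChart ν c α K)
    (P : SmoothPartitionOfUnity N (𝓡∂ 3) N univ)
    (hP : P.IsSubordinate fun p => (chartAt (EuclideanHalfSpace 3) p).source) :
    partitionIntegral (𝓡∂ 3) P ν (Form.d (𝓡∂ 3) α) =
      -∫ z, chartExtension ν c α (boundaryIncl z) ![stdFrame 3 1, stdFrame 3 2] := by
  obtain ⟨R, hR⟩ := (isCompact_extend_image h).isBounded.exists_norm_le
  have hR' : ∀ y ∈ range (𝓡∂ 3), R < ‖y‖ → chartExtension ν c α y = 0 := fun y _ hy =>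
    chartExtension_eq_zero h fun hcon => absurd (hR y hcon) (not_le.2 hy)
  have hcd := contDiffOn_chartExtension h
  have himg : c.extend (𝓡∂ 3) '' c.source = (c.extend (𝓡∂ 3)).target := by
    rw [← c.extend_source (I := 𝓡∂ 3)]; exact (c.extend (𝓡∂ 3)).image_source_eq_target
  have hval : ∀ y ∈ (c.extend (𝓡∂ 3)).target,
      extDerivWithin (chartExtension ν c α) (range (𝓡∂ 3)) y (stdFrame 3) =
        orientedCoef (𝓡∂ 3) ν (Form.d (𝓡∂ 3) α) c y := fun y hy => by
    rw [extDerivWithin_chartExtension h (extend_target_subset_range _ _ hy), chartExtension,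
      if_pos hy]
    rfl
  have htm : MeasurableSet (c.extend (𝓡∂ 3)).target := by
    simpa using measurableSet_extend_target_inter (𝓡∂ 3) c isOpen_univ
  have hint := integrableOn_extDerivWithin_halfSpace hcd hR'
  rw [← integral_extDerivWithin_halfSpace hcd hR', partitionIntegral_eq_integral_image (𝓡∂ 3) P hP
    c.open_source (κ := c.extend (𝓡∂ 3)) (h := orientedCoef (𝓡∂ 3) ν (Form.d (𝓡∂ 3) α) c)
    (fun x hx => (hasMFDerivAt_extend (𝓡∂ 3) h.mem_atlas hx).mdifferentiableAt)
    (by rw [← c.extend_source (I := 𝓡∂ 3)]; exact (c.extend (𝓡∂ 3)).injOn)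
    (by
      rw [himg]
      exact (hint.mono_set (extend_target_subset_range _ _)).congr_fun hval htm)
    ?_ (fun x hx => d_eq_zero_of_notMem h fun hxK => hx (h.subset_source hxK)), himg,
    ← setIntegral_congr_fun htm hval,
    setIntegral_eq_of_subset_of_forall_sdiff_eq_zero (𝓡∂ 3).isClosed_range.measurableSet
      (extend_target_subset_range _ c)]
  · rintro y ⟨hy, hyt⟩
    rw [extDerivWithin_chartExtension h hy, chartExtension, if_neg hyt]
    rfl
  · intro x hx e
    have e1 := form_eq_inChart_comp (𝓡∂ 3) h.mem_atlas ν hx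
    have e2 := form_eq_inChart_comp (𝓡∂ 3) h.mem_atlas (Form.d (𝓡∂ 3) α) hx
    rw [e1, e2, ContinuousAlternatingMap.compContinuousLinearMap_apply,
      ContinuousAlternatingMap.compContinuousLinearMap_apply, alternating_eq_mul_det,
      alternating_eq_mul_det (Form.inChart (𝓡∂ 3) (Form.d (𝓡∂ 3) α) c _), sign_mul_eq]
    change _ = |(stdBasis 3).det (coframe (𝓡∂ 3) c x ∘ e)| * (_ * _)
    rw [← sign_mul_self_eq_abs]
    ring

/-- Stokes' theorem in a chart: the boundary integral. -/
theorem formIntegral_boundary_eq (h : IsSupportedInChart ν c α K) {νB : Form (𝓡 2) B 2}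
    (hνB : IsOrientationForm (𝓡 2) νB) {j : B → N} (hj : IsOrientedBoundary ν νB j) :
    formIntegral νB (Form.pullback (𝓡∂ 3) (𝓡 2) α j) univ =
      -∫ z, chartExtension ν c α (boundaryIncl z) ![stdFrame 3 1, stdFrame 3 2] := by
  obtain ⟨R, hR⟩ := (isCompact_extend_image h).isBounded.exists_norm_le
  have hcd := contDiffOn_chartExtension h
  have hinclr : ∀ z, boundaryIncl z ∈ range (𝓡∂ 3) := fun z => by
    rw [mem_range_halfSpace, boundaryIncl_zero']
  let f : EuclideanSpace ℝ (Fin 2) → ℝ := fun z =>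
    -chartExtension ν c α (boundaryIncl z) ![stdFrame 3 1, stdFrame 3 2]
  have hfc : Continuous f := by
    refine Continuous.neg ?_
    refine (ContinuousAlternatingMap.apply ℝ (EuclideanSpace ℝ (Fin 3)) ℝ
      ![stdFrame 3 1, stdFrame 3 2]).continuous.comp ?_
    exact hcd.continuousOn.comp_continuous boundaryInclL.continuous hinclr
  have hfi : Integrable f := by
    refine hfc.integrable_of_hasCompactSupport
      (HasCompactSupport.intro (isCompact_closedBall (0 : EuclideanSpace ℝ (Fin 2)) R) fun z hz => ?_)
    have h1 : chartExtension ν c α (boundaryIncl z) = 0 :=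
      chartExtension_eq_zero h fun hcon => hz (by
        simpa using (norm_le_norm_boundaryIncl z).trans (hR _ hcon))
    simp only [f, h1]
    simp
  have hbd : ∀ b, (𝓡∂ 3).IsBoundaryPoint (j b) := fun b => by
    have : j b ∈ (𝓡∂ 3).boundary N := by rw [← hj.range_eq]; exact ⟨b, rfl⟩
    exact this
  have hU : IsOpen (j ⁻¹' c.source) := c.open_source.preimage hj.smooth.continuous
  have hzero : ∀ b, j b ∈ c.source → c.extend (𝓡∂ 3) (j b) 0 = 0 := fun b hb =>
    (isBoundaryPoint_iff_apply_zero h.mem_atlas hb).1 (hbd b)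
  let κ : B → EuclideanSpace ℝ (Fin 2) := fun b => boundaryProj (c.extend (𝓡∂ 3) (j b))
  have hincl : ∀ b, j b ∈ c.source → boundaryIncl (κ b) = c.extend (𝓡∂ 3) (j b) := fun b hb =>
    boundaryIncl_boundaryProj (hzero b hb)
  have hD : ∀ b, j b ∈ c.source → HasMFDerivAt (𝓡 2) 𝓘(ℝ, EuclideanSpace ℝ (Fin 3))
      (fun b => c.extend (𝓡∂ 3) (j b)) b
      ((coframe (𝓡∂ 3) c (j b)).comp (mfderiv (𝓡 2) (𝓡∂ 3) j b)) := fun b hb =>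
    (hasMFDerivAt_extend (𝓡∂ 3) h.mem_atlas hb).comp b
      ((hj.smooth b).mdifferentiableAt (by simp)).hasMFDerivAt
  have hκ : ∀ b, j b ∈ c.source → HasMFDerivAt (𝓡 2) 𝓘(ℝ, EuclideanSpace ℝ (Fin 2)) κ b
      (boundaryProj.comp ((coframe (𝓡∂ 3) c (j b)).comp (mfderiv (𝓡 2) (𝓡∂ 3) j b))) := fun b hb =>
    (boundaryProj.hasMFDerivAt).comp b (hD b hb)
  have htan : ∀ b, j b ∈ c.source → ∀ v,
      coframe (𝓡∂ 3) c (j b) (mfderiv (𝓡 2) (𝓡∂ 3) j b v) 0 = 0 := by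
    intro b hb v
    let π : EuclideanSpace ℝ (Fin 3) →L[ℝ] ℝ := EuclideanSpace.proj 0
    have h1 := (π.hasMFDerivAt (x := c.extend (𝓡∂ 3) (j b))).comp b (hD b hb)
    have h2 : HasMFDerivAt (𝓡 2) 𝓘(ℝ, ℝ) (π ∘
        (fun b => c.extend (𝓡∂ 3) (j b))) b 0 := by
      refine (hasMFDerivAt_const (0 : ℝ) b).congr_of_eventuallyEq ?_
      filter_upwards [hU.mem_nhds hb] with b' hb'
      exact hzero b' hb'
    exact DFunLike.congr_fun (hasMFDerivAt_unique h1 h2) v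
  rw [formIntegral_eq_partitionIntegral, partitionIntegral_eq_integral_image (𝓡 2) _
    chartPartition_isSubordinate hU (κ := κ) (h := f)
    (fun b hb => (hκ b hb).mdifferentiableAt) ?_ hfi.integrableOn ?_ ?_, ← integral_neg]
  · refine setIntegral_eq_integral_of_forall_compl_eq_zero fun z hz => ?_
    have h1 : chartExtension ν c α (boundaryIncl z) = 0 := by
      unfold chartExtension
      refine if_neg fun hzt => hz ?_
      have hs := extend_symm_mem_source (𝓡∂ 3) hzt
      have hr := (c.extend (𝓡∂ 3)).right_inv hzt
      have hb : (𝓡∂ 3).IsBoundaryPoint ((c.extend (𝓡∂ 3)).symm (boundaryIncl z)) := by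
        rw [isBoundaryPoint_iff_apply_zero h.mem_atlas hs, hr, boundaryIncl_zero']
      have hb' : (c.extend (𝓡∂ 3)).symm (boundaryIncl z) ∈ range j := by rw [hj.range_eq]; exact hb
      obtain ⟨b, hb⟩ := hb'
      refine ⟨b, by rw [mem_preimage, hb]; exact hs, ?_⟩
      simp only [κ]
      rw [hb, hr, boundaryProj_boundaryIncl]
    simp only [f, h1]
    simp
  · intro b hb b' hb' he
    have h1 : c.extend (𝓡∂ 3) (j b) = c.extend (𝓡∂ 3) (j b') := by
      rw [← hincl b hb, ← hincl b' hb', he]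
    refine hj.injective ((c.extend (𝓡∂ 3)).injOn ?_ ?_ h1)
    · rw [c.extend_source]; exact hb
    · rw [c.extend_source]; exact hb'
  · intro b hb
    refine density_of_stdFrame (α := νB b) (β := Form.pullback (𝓡∂ 3) (𝓡 2) α j b)
      (L := mfderiv (𝓡 2) 𝓘(ℝ, EuclideanSpace ℝ (Fin 2)) κ b) ?_
    rw [(hκ b hb).mfderiv]
    set u : Fin 2 → EuclideanSpace ℝ (Fin 3) := fun i =>
      coframe (𝓡∂ 3) c (j b) (mfderiv (𝓡 2) (𝓡∂ 3) j b (stdFrame 2 i)) with hu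
    have hu0 : ∀ i, u i 0 = 0 := fun i => htan b hb _
    set D : ℝ := (stdBasis 2).det fun i => boundaryProj (u i) with hDdef
    set y := c.extend (𝓡∂ 3) (j b) with hy
    have hyt : y ∈ (c.extend (𝓡∂ 3)).target := extend_mem_target _ hb
    set t := Form.inChart (𝓡∂ 3) α c y ![stdFrame 3 1, stdFrame 3 2] with ht
    set s := Form.inChart (𝓡∂ 3) ν c y (stdFrame 3) with hs
    have e1 : Form.pullback (𝓡∂ 3) (𝓡 2) α j b (stdFrame 2) = t * D := by
      have h1 := form_eq_inChart_comp (𝓡∂ 3) h.mem_atlas α hb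
      rw [Form.pullback, h1]
      exact alternating_boundary_apply (Form.inChart (𝓡∂ 3) α c y) hu0
    have e2 : f (κ b) = -(Real.sign s * t) := by
      simp only [f, hincl b hb]
      rw [chartExtension, if_pos hyt]
      rfl
    have hνb : νB b (stdFrame 2) ≠ 0 := by
      intro h0
      refine hνB.2 b ?_
      ext v
      exact (alternating_eq_mul_det (νB b) v).trans ((congrArg (· * _) h0).trans (zero_mul _))
    obtain ⟨n, hn⟩ := exists_coframe_eq (𝓡∂ 3) (chart_mem_atlas (EuclideanHalfSpace 3) (j b))
      (mem_chart_source (EuclideanHalfSpace 3) (j b)) (-EuclideanSpace.single (0 : Fin 3) (1 : ℝ))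
    have hn0 : coframe (𝓡∂ 3) (chartAt (EuclideanHalfSpace 3) (j b)) (j b) n 0 < 0 := by
      rw [hn]; simp
    have hnc := coframe_apply_zero_neg (chart_mem_atlas (EuclideanHalfSpace 3) (j b)) h.mem_atlas
      (mem_chart_source (EuclideanHalfSpace 3) (j b)) hb (hbd b) hn0
    have hor := hj.orient b n hn0
    have hval : ∀ v w : TangentSpace (𝓡 2) b, ν (j b) ![n, mfderiv (𝓡 2) (𝓡∂ 3) j b v,
        mfderiv (𝓡 2) (𝓡∂ 3) j b w] = s * (coframe (𝓡∂ 3) c (j b) n 0 * (stdBasis 2).det fun i =>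
          boundaryProj (coframe (𝓡∂ 3) c (j b) (mfderiv (𝓡 2) (𝓡∂ 3) j b (![v, w] i)))) := by
      intro v w
      have h1 := form_eq_inChart_comp (𝓡∂ 3) h.mem_atlas ν hb
      rw [h1, ContinuousAlternatingMap.compContinuousLinearMap_apply, alternating_eq_mul_det,
        ← det_cons_boundary _ fun i => htan b hb _]
      congr 2
      funext i
      fin_cases i <;> rfl
    have key : Real.sign (νB b (stdFrame 2)) * D = -Real.sign s * |D| := by
      have hstd : (stdFrame 2 : Fin 2 → TangentSpace (𝓡 2) b) =
          ![stdFrame 2 0, stdFrame 2 1] := by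
        funext i; fin_cases i <;> rfl
      rcases lt_or_gt_of_ne hνb with hneg | hpos
      · have hsw : νB b ![stdFrame 2 1, stdFrame 2 0] = -νB b (stdFrame 2) := by
          have h1 := alternating_eq_mul_det (νB b) ![stdFrame 2 1, stdFrame 2 0]
          have h2 : (stdBasis 2).det ![stdFrame 2 1, stdFrame 2 0] = -1 := by
            rw [stdBasis_det_eq, Matrix.det_fin_two]; simp [stdFrame]
          rw [h2] at h1
          exact h1.trans (mul_neg_one _)
        have h3 := lt_of_lt_of_eq (hor (stdFrame 2 1) (stdFrame 2 0)
          (lt_of_lt_of_eq (neg_pos.2 hneg) hsw.symm)) (hval (stdFrame 2 1) (stdFrame 2 0))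
        have h4 : (stdBasis 2).det (fun i => boundaryProj (coframe (𝓡∂ 3) c (j b)
            (mfderiv (𝓡 2) (𝓡∂ 3) j b (![stdFrame 2 1, stdFrame 2 0] i)))) = -D := by
          rw [hDdef, stdBasis_det_eq, stdBasis_det_eq, Matrix.det_fin_two, Matrix.det_fin_two]
          simp only [Matrix.of_apply, Matrix.cons_val, hu]
          ring
        replace h3 := lt_of_lt_of_eq h3 (congrArg (fun t => s * (coframe (𝓡∂ 3) c (j b) n 0 * t)) h4)
        have h5 : 0 < s * D := by
          by_contra! hcon
          nlinarith
        rw [Real.sign_of_neg hneg, ← sign_mul_self_eq_abs D]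
        rcases pos_and_pos_or_neg_and_neg_of_mul_pos h5 with ⟨ha, hb⟩ | ⟨ha, hb⟩
        · rw [Real.sign_of_pos ha, Real.sign_of_pos hb]; ring
        · rw [Real.sign_of_neg ha, Real.sign_of_neg hb]; ring
      · have h3 := lt_of_lt_of_eq (hor (stdFrame 2 0) (stdFrame 2 1)
          (lt_of_lt_of_eq hpos (congrArg (νB b) hstd))) (hval (stdFrame 2 0) (stdFrame 2 1))
        have h4 : (stdBasis 2).det (fun i => boundaryProj (coframe (𝓡∂ 3) c (j b)
            (mfderiv (𝓡 2) (𝓡∂ 3) j b (![stdFrame 2 0, stdFrame 2 1] i)))) = D := by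
          rw [hDdef, stdBasis_det_eq, stdBasis_det_eq, Matrix.det_fin_two, Matrix.det_fin_two]
          simp only [Matrix.of_apply, Matrix.cons_val, hu]
        replace h3 := lt_of_lt_of_eq h3 (congrArg (fun t => s * (coframe (𝓡∂ 3) c (j b) n 0 * t)) h4)
        have h5 : s * D < 0 := by
          by_contra! hcon
          nlinarith
        rw [Real.sign_of_pos hpos, ← sign_mul_self_eq_abs D]
        rcases mul_neg_iff.1 h5 with ⟨ha, hb⟩ | ⟨ha, hb⟩
        · rw [Real.sign_of_pos ha, Real.sign_of_neg hb]; ring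
        · rw [Real.sign_of_neg ha, Real.sign_of_pos hb]; ring
    have e3 : Real.sign (νB b (stdFrame 2)) * (t * D) = |D| * -(Real.sign s * t) := by
      linear_combination t * key
    exact (congrArg (Real.sign (νB b (stdFrame 2)) * ·) e1).trans
      (e3.trans (congrArg (|D| * ·) e2.symm))
  · intro b hb
    have : α (j b) = 0 := h.eq_zero _ fun hcon => hb (h.subset_source hcon)
    rw [Form.pullback, this]
    rfl

end SingleChart

end Stokes

/-! ### Linear operations on forms -/

section Linear

variable {E : Type*} [NormedAddCommGroup E] [NormedSpace ℝ E] [FiniteDimensional ℝ E]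
  {H : Type*} [TopologicalSpace H] (I : ModelWithCorners ℝ E H)
  {X : Type*} [TopologicalSpace X] [ChartedSpace H X] [IsManifold I ∞ X] {k : ℕ}

theorem contDiffWithinAt_comp_extend_symm {F : Type*} [NormedAddCommGroup F] [NormedSpace ℝ F]
    {f : X → F} {x : X} (hf : ContMDiffAt I 𝓘(ℝ, F) ∞ f x) {c : OpenPartialHomeomorph X H}
    (hc : c ∈ atlas H X) (hx : x ∈ c.source) :
    ContDiffWithinAt ℝ ∞ (fun y => f ((c.extend I).symm y)) (range I) (c.extend I x) := by
  have hl := extend_left_inv' I hx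
  rw [← contMDiffWithinAt_iff_contDiffWithinAt]
  rw [← hl] at hf
  exact hf.comp_contMDiffWithinAt _ (contMDiffWithinAt_extend_symm I hc (extend_mem_target I hx))

theorem Form.SmoothAt.smul {θ : Form I X k} {f : X → ℝ} {x : X}
    (hf : ContMDiffAt I 𝓘(ℝ, ℝ) ∞ f x) (h : Form.SmoothAt I θ x) :
    Form.SmoothAt I (fun x => f x • θ x) x := fun c hc hx =>
  (contDiffWithinAt_comp_extend_symm I hf hc hx).smul (h c hc hx)

theorem Form.SmoothAt.const_smul {θ : Form I X k} (t : ℝ) {x : X} (h : Form.SmoothAt I θ x) :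
    Form.SmoothAt I (fun x => t • θ x) x := fun c hc hx => (h c hc hx).const_smul t

theorem Form.SmoothAt.add {θ θ' : Form I X k} {x : X} (h : Form.SmoothAt I θ x)
    (h' : Form.SmoothAt I θ' x) : Form.SmoothAt I (fun x => θ x + θ' x) x := fun c hc hx =>
  (h c hc hx).add (h' c hc hx)

theorem Form.smoothAt_zero (x : X) : Form.SmoothAt I (fun x => 0 : Form I X k) x := fun c hc hx =>
  (contDiffWithinAt_const (c := (0 : E [⋀^Fin k]→L[ℝ] ℝ)))

theorem Form.SmoothAt.sum {ι : Type*} {T : Finset ι} {θ : ι → Form I X k} {x : X}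
    (h : ∀ i ∈ T, Form.SmoothAt I (θ i) x) : Form.SmoothAt I (fun x => ∑ i ∈ T, θ i x) x := by
  classical
  induction T using Finset.induction_on with
  | empty => simpa using Form.smoothAt_zero I x
  | insert a T ha ih =>
    simp only [Finset.sum_insert ha]
    exact (h a (Finset.mem_insert_self a T)).add I
      (ih fun i hi => h i (Finset.mem_insert_of_mem hi))

theorem d_add {θ θ' : Form I X k} {x : X} (h : Form.SmoothAt I θ x)
    (h' : Form.SmoothAt I θ' x) :
    Form.d I (fun x => θ x + θ' x) x = Form.d I θ x + Form.d I θ' x := by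
  have hx := mem_chart_source H x
  have hc := chart_mem_atlas H x
  have hy := extend_target_subset_range I _ (extend_mem_target I hx)
  have h1 := extDerivWithin_add (I.uniqueDiffOn _ hy) ((h _ hc hx).differentiableWithinAt (by simp))
    ((h' _ hc hx).differentiableWithinAt (by simp))
  unfold Form.d
  change ContinuousAlternatingMap.compContinuousLinearMap (extDerivWithin
    (Form.inChart I θ (chartAt H x) + Form.inChart I θ' (chartAt H x)) (range I)
    ((chartAt H x).extend I x)) _ = _
  rw [h1]
  rfl

theorem d_zero (x : X) : Form.d I (fun x => 0 : Form I X k) x = 0 := by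
  have h0 : Form.inChart I (fun x => 0 : Form I X k) (chartAt H x) = fun _ => 0 := rfl
  unfold Form.d
  rw [h0, extDerivWithin, fderivWithin_fun_const]
  have : ContinuousAlternatingMap.alternatizeUncurryFin
    ((fun _ => 0 : E → E →L[ℝ] E [⋀^Fin k]→L[ℝ] ℝ) (extChartAt I x x)) = 0 :=
    (ContinuousAlternatingMap.alternatizeUncurryFinCLM ℝ _ ℝ).map_zero
  exact congrArg (fun t => ContinuousAlternatingMap.compContinuousLinearMap t _) this

theorem d_sum {ι : Type*} {T : Finset ι} {θ : ι → Form I X k} {x : X}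
    (h : ∀ i ∈ T, Form.SmoothAt I (θ i) x) :
    Form.d I (fun x => ∑ i ∈ T, θ i x) x = ∑ i ∈ T, Form.d I (θ i) x := by
  classical
  induction T using Finset.induction_on with
  | empty => simpa using d_zero I x
  | insert a T ha ih =>
    simp only [Finset.sum_insert ha]
    rw [d_add I (h a (Finset.mem_insert_self a T))
      (Form.SmoothAt.sum I fun i hi => h i (Finset.mem_insert_of_mem hi)),
      ih fun i hi => h i (Finset.mem_insert_of_mem hi)]

end Linear

/-! ### Linearity and continuity of the integral -/

section Integral

variable {n : ℕ} {H : Type*} [TopologicalSpace H]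
  (I : ModelWithCorners ℝ (EuclideanSpace ℝ (Fin n)) H)
  {X : Type*} [TopologicalSpace X] [ChartedSpace H X] [IsManifold I ∞ X] [T2Space X]
  [CompactSpace X]

/-- The coefficients of `θ` in the preferred charts are locally integrable. -/
def IsLocallyIntegrableForm (θ : Form I X n) : Prop :=
  ∀ p : X, LocallyIntegrableOn (fun y => Form.inChart I θ (chartAt H p) y (stdFrame n))
    ((chartAt H p).extend I).target

variable {P : SmoothPartitionOfUnity X I X univ} {ν θ : Form I X n}

theorem isCompact_tsupport_partition (p : X) : IsCompact (tsupport (P p)) :=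
  (isClosed_tsupport _).isCompact

theorem measurableSet_extend_target (c : OpenPartialHomeomorph X H) :
    MeasurableSet (c.extend I).target := by
  simpa using measurableSet_extend_target_inter I c isOpen_univ

theorem continuousOn_sign (hν : IsOrientationForm I ν) (c : OpenPartialHomeomorph X H)
    (hc : c ∈ atlas H X) : ContinuousOn
      (fun y => Real.sign (Form.inChart I ν c y (stdFrame n))) (c.extend I).target := by
  intro y hy
  have hcont : ContinuousWithinAt (fun z => Form.inChart I ν c z (stdFrame n))
      (c.extend I).target y :=
    (ContinuousAlternatingMap.apply ℝ (EuclideanSpace ℝ (Fin n)) ℝ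
      (stdFrame n)).continuous.continuousAt.comp_continuousWithinAt (hν.1 c hc y hy)
  refine (continuousWithinAt_const (b := Real.sign (Form.inChart I ν c y (stdFrame n)))).congr_of_eventuallyEq
    (eventually_sign_eq hcont (inChart_orientation_ne_zero I hν hc hy)) rfl

theorem abs_sign_le_one (t : ℝ) : |Real.sign t| ≤ 1 := by
  rcases Real.sign_apply_eq t with h | h | h <;> simp [h]

theorem integrableOn_partition_mul (hP : P.IsSubordinate fun p => (chartAt H p).source)
    {f : EuclideanSpace ℝ (Fin n) → ℝ} (p : X)
    (hf : LocallyIntegrableOn f ((chartAt H p).extend I).target) :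
    IntegrableOn (fun y => P p (((chartAt H p).extend I).symm y) * f y)
      ((chartAt H p).extend I).target := by
  set c := (chartAt H p).extend I with hc
  have hsub : c '' tsupport (P p) ⊆ c.target := by
    rintro _ ⟨x, hx, rfl⟩
    exact extend_mem_target I (hP p hx)
  have hK : IsCompact (c '' tsupport (P p)) := (isCompact_tsupport_partition I p).image_of_continuousOn
    (((chartAt H p).continuousOn_extend (I := I)).mono
      (by rw [(chartAt H p).extend_source]; exact hP p))
  have h1 := hf.integrableOn_compact_subset hsub hK
  refine IntegrableOn.of_forall_sdiff_eq_zero (s := c '' tsupport (P p)) ?_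
    (measurableSet_extend_target I _) ?_
  · refine Integrable.bdd_mul (c := 1) h1 ?_ (Eventually.of_forall fun y => ?_)
    · refine ContinuousOn.aestronglyMeasurable ?_ hK.isClosed.measurableSet
      exact (P p).contMDiff.continuous.comp_continuousOn
        (((chartAt H p).continuousOn_extend_symm (I := I)).mono hsub)
    · rw [Real.norm_of_nonneg (P.nonneg p _)]; exact P.le_one p _
  · rintro y ⟨hy, hyK⟩
    have : P p (c.symm y) = 0 := by
      by_contra hne
      exact hyK ⟨_, subset_tsupport _ hne, c.right_inv hy⟩
    rw [this, zero_mul]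

theorem locallyIntegrableOn_orientedCoef (hν : IsOrientationForm I ν)
    (hθ : IsLocallyIntegrableForm I θ) (p : X) :
    LocallyIntegrableOn (orientedCoef I ν θ (chartAt H p)) ((chartAt H p).extend I).target := by
  intro y hy
  obtain ⟨s, hs, hs'⟩ := hθ p y hy
  refine ⟨s ∩ ((chartAt H p).extend I).target, Filter.inter_mem hs self_mem_nhdsWithin, ?_⟩
  refine Integrable.bdd_mul (c := 1) (hs'.mono_set inter_subset_left) ?_
    (Eventually.of_forall fun y => abs_sign_le_one _)
  exact ((continuousOn_sign I hν _ (chart_mem_atlas H p)).aestronglyMeasurable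
    (measurableSet_extend_target I _)).mono_measure (Measure.restrict_mono inter_subset_right le_rfl)

theorem integrableOn_partition_orientedCoef (hP : P.IsSubordinate fun p => (chartAt H p).source)
    (hν : IsOrientationForm I ν) (hθ : IsLocallyIntegrableForm I θ) (p : X) :
    IntegrableOn (fun y => P p (((chartAt H p).extend I).symm y) *
      orientedCoef I ν θ (chartAt H p) y) ((chartAt H p).extend I).target :=
  integrableOn_partition_mul I hP p (locallyIntegrableOn_orientedCoef I hν hθ p)

theorem partitionIntegral_sum {ι : Type*} (hP : P.IsSubordinate fun p => (chartAt H p).source)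
    (hν : IsOrientationForm I ν) {S : Finset ι} {θ : ι → Form I X n}
    (hθ : ∀ i ∈ S, IsLocallyIntegrableForm I (θ i)) :
    partitionIntegral I P ν (fun x => ∑ i ∈ S, θ i x) = ∑ i ∈ S, partitionIntegral I P ν (θ i) := by
  set T : Finset X := (finite_support_partition I P).toFinset with hTdef
  have hT : ∀ p, (∃ x, P p x ≠ 0) → p ∈ T := fun p hp => by simpa [hTdef] using hp
  simp only [partitionIntegral_eq_sum I P ν _ hT]
  rw [Finset.sum_comm]
  refine Finset.sum_congr rfl fun p _ => ?_
  rw [← integral_finsetSum S fun i hi => integrableOn_partition_orientedCoef I hP hν (hθ i hi) p]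
  refine integral_congr_ae (Eventually.of_forall fun y => ?_)
  have h : Form.inChart I (fun x => ∑ i ∈ S, θ i x) (chartAt H p) y (stdFrame n) =
      ∑ i ∈ S, Form.inChart I (θ i) (chartAt H p) y (stdFrame n) := by
    simp only [Form.inChart, ContinuousAlternatingMap.compContinuousLinearMap_apply,
      ContinuousAlternatingMap.sum_apply]
  simp only [orientedCoef, h, Finset.mul_sum]

theorem partitionIntegral_const_smul (t : ℝ) : partitionIntegral I P ν (fun x => t • θ x) =
    t * partitionIntegral I P ν θ := by
  unfold partitionIntegral
  rw [← smul_eq_mul, smul_finsum]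
  refine finsum_congr fun p => ?_
  rw [smul_eq_mul, ← integral_const_mul]
  refine integral_congr_ae (Eventually.of_forall fun y => ?_)
  have h : Form.inChart I (fun x => t • θ x) (chartAt H p) y (stdFrame n) =
      t * Form.inChart I θ (chartAt H p) y (stdFrame n) := rfl
  simp only [orientedCoef, h]
  ring

theorem partitionIntegral_add (hP : P.IsSubordinate fun p => (chartAt H p).source)
    (hν : IsOrientationForm I ν) {θ θ' : Form I X n} (hθ : IsLocallyIntegrableForm I θ)
    (hθ' : IsLocallyIntegrableForm I θ') :
    partitionIntegral I P ν (fun x => θ x + θ' x) =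
      partitionIntegral I P ν θ + partitionIntegral I P ν θ' := by
  have h := partitionIntegral_sum I hP hν (S := Finset.univ) (θ := ![θ, θ'])
    (fun i _ => by fin_cases i <;> assumption)
  simpa [Fin.sum_univ_two] using h

/-- Dominated convergence for integrals of forms; the domination is only required locally. -/
theorem tendsto_partitionIntegral (hP : P.IsSubordinate fun p => (chartAt H p).source)
    (hν : IsOrientationForm I ν) {θ : ℕ → Form I X n} {θ₀ : Form I X n}
    (hθ : ∀ k, IsLocallyIntegrableForm I (θ k))
    (hb : ∀ p, ∀ y₀ ∈ ((chartAt H p).extend I).target, ∃ t ∈ 𝓝 y₀,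
      ∃ b : EuclideanSpace ℝ (Fin n) → ℝ, Integrable b ∧ ∀ k, ∀ y ∈ t,
        y ∈ ((chartAt H p).extend I).target →
          |Form.inChart I (θ k) (chartAt H p) y (stdFrame n)| ≤ b y)
    (hlim : ∀ p, ∀ y ∈ ((chartAt H p).extend I).target,
      Tendsto (fun k => Form.inChart I (θ k) (chartAt H p) y (stdFrame n)) atTop
        (𝓝 (Form.inChart I θ₀ (chartAt H p) y (stdFrame n)))) :
    Tendsto (fun k => partitionIntegral I P ν (θ k)) atTop (𝓝 (partitionIntegral I P ν θ₀)) := by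
  set T : Finset X := (finite_support_partition I P).toFinset with hTdef
  have hT : ∀ p, (∃ x, P p x ≠ 0) → p ∈ T := fun p hp => by simpa [hTdef] using hp
  simp only [partitionIntegral_eq_sum I P ν _ hT]
  refine tendsto_finsetSum _ fun p _ => ?_
  have hsub : (chartAt H p).extend I '' tsupport (P p) ⊆ ((chartAt H p).extend I).target := by
    rintro _ ⟨x, hx, rfl⟩
    exact extend_mem_target I (hP p hx)
  have hK : IsCompact ((chartAt H p).extend I '' tsupport (P p)) :=
    (isCompact_tsupport_partition I p).image_of_continuousOn
      (((chartAt H p).continuousOn_extend (I := I)).mono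
        (by rw [(chartAt H p).extend_source]; exact hP p))
  obtain ⟨b, hbi, hb0, hb⟩ : ∃ b : EuclideanSpace ℝ (Fin n) → ℝ, Integrable b ∧ (∀ y, 0 ≤ b y) ∧
      ∀ k, ∀ y ∈ (chartAt H p).extend I '' tsupport (P p),
        |Form.inChart I (θ k) (chartAt H p) y (stdFrame n)| ≤ b y := by
    refine hK.induction_on (p := fun s => ∃ b : EuclideanSpace ℝ (Fin n) → ℝ, Integrable b ∧
      (∀ y, 0 ≤ b y) ∧ ∀ k, ∀ y ∈ s,
        |Form.inChart I (θ k) (chartAt H p) y (stdFrame n)| ≤ b y) ?_ ?_ ?_ ?_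
    · exact ⟨fun _ => 0, integrable_zero _ _ _, fun _ => le_rfl, fun k y hy => hy.elim⟩
    · rintro s t hst ⟨b, h1, h2, h3⟩
      exact ⟨b, h1, h2, fun k y hy => h3 k y (hst hy)⟩
    · rintro s t ⟨b, h1, h2, h3⟩ ⟨b', h1', h2', h3'⟩
      refine ⟨fun y => b y + b' y, h1.add h1', fun y => add_nonneg (h2 y) (h2' y), ?_⟩
      rintro k y (hy | hy)
      · exact (h3 k y hy).trans (le_add_of_nonneg_right (h2' y))
      · exact (h3' k y hy).trans (le_add_of_nonneg_left (h2 y))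
    · intro y hy
      obtain ⟨t, ht, b, hbi, hb⟩ := hb p y (hsub hy)
      exact ⟨_, Filter.inter_mem (mem_nhdsWithin_of_mem_nhds ht) self_mem_nhdsWithin,
        fun y => |b y|, hbi.abs, fun y => abs_nonneg _,
        fun k z hz => (hb k z hz.1 (hsub hz.2)).trans (le_abs_self _)⟩
  refine tendsto_integral_of_dominated_convergence b
    (fun k => (integrableOn_partition_orientedCoef I hP hν (hθ k) p).aestronglyMeasurable)
    hbi.integrableOn (fun k => ?_) ?_
  · refine (ae_restrict_mem (measurableSet_extend_target I _)).mono fun y hy => ?_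
    rw [norm_mul, Real.norm_of_nonneg (P.nonneg p _)]
    by_cases h0 : P p (((chartAt H p).extend I).symm y) = 0
    · rw [h0, zero_mul]; exact hb0 y
    rw [orientedCoef, norm_mul]
    have h1 := hb k y ⟨_, subset_tsupport _ h0, ((chartAt H p).extend I).right_inv hy⟩
    have h2 := mul_le_mul (abs_sign_le_one (Form.inChart I ν (chartAt H p) y (stdFrame n))) h1
      (abs_nonneg _) zero_le_one
    have h3 := mul_le_mul (P.le_one p (((chartAt H p).extend I).symm y)) h2
      (mul_nonneg (abs_nonneg _) (abs_nonneg _)) zero_le_one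
    rw [one_mul, one_mul] at h3
    exact h3
  · refine (ae_restrict_mem (measurableSet_extend_target I _)).mono fun y hy => ?_
    exact ((hlim p y hy).const_mul _).const_mul _

theorem continuousOn_inChart {k : ℕ} {θ : Form I X k} (h : ∀ x, Form.SmoothAt I θ x)
    {c : OpenPartialHomeomorph X H} (hc : c ∈ atlas H X) (v : Fin k → EuclideanSpace ℝ (Fin n)) :
    ContinuousOn (fun y => Form.inChart I θ c y v) (c.extend I).target := by
  intro y hy
  have h1 := h _ c hc (extend_symm_mem_source I hy)
  rw [(c.extend I).right_inv hy] at h1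
  exact (ContinuousAlternatingMap.apply ℝ (EuclideanSpace ℝ (Fin n)) ℝ
    v).continuous.continuousAt.comp_continuousWithinAt
      (h1.continuousWithinAt.mono (extend_target_subset_range I c))

theorem isLocallyIntegrableForm_of_smoothAt (h : ∀ x, Form.SmoothAt I θ x) :
    IsLocallyIntegrableForm I θ := fun p =>
  (continuousOn_inChart I h (chart_mem_atlas H p) _).locallyIntegrableOn
    (measurableSet_extend_target I _)

end Integral

section GlobalStokes

variable {N : Type*} [TopologicalSpace N] [T2Space N] [CompactSpace N]
  [ChartedSpace (EuclideanHalfSpace 3) N] [IsManifold (𝓡∂ 3) ∞ N]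
  {B : Type*} [TopologicalSpace B] [T2Space B] [CompactSpace B]
  [ChartedSpace (EuclideanSpace ℝ (Fin 2)) B] [IsManifold (𝓡 2) ∞ B]

/-- Stokes' theorem for a compact oriented three-manifold with boundary. -/
theorem stokes {P : SmoothPartitionOfUnity N (𝓡∂ 3) N univ}
    (hP : P.IsSubordinate fun p => (chartAt (EuclideanHalfSpace 3) p).source)
    {ν : Form (𝓡∂ 3) N 3} (hν : IsOrientationForm (𝓡∂ 3) ν) {νB : Form (𝓡 2) B 2}
    (hνB : IsOrientationForm (𝓡 2) νB) {j : B → N} (hj : IsOrientedBoundary ν νB j)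
    {α : Form (𝓡∂ 3) N 2} (hα : ∀ x, Form.SmoothAt (𝓡∂ 3) α x) :
    formIntegral νB (Form.pullback (𝓡∂ 3) (𝓡 2) α j) univ =
      partitionIntegral (𝓡∂ 3) P ν (Form.d (𝓡∂ 3) α) := by
  set T : Finset N := (finite_support_partition (𝓡∂ 3) P).toFinset with hTdef
  have hT : ∀ p, (∃ x, P p x ≠ 0) → p ∈ T := fun p hp => by simpa [hTdef] using hp
  let β : N → Form (𝓡∂ 3) N 2 := fun p x => P p x • α x
  have hβ : ∀ p x, Form.SmoothAt (𝓡∂ 3) (β p) x := fun p x =>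
    (hα x).smul (𝓡∂ 3) (P p).contMDiff.contMDiffAt
  have hsum : α = fun x => ∑ p ∈ T, β p x := by
    funext x
    simp only [β]
    rw [← Finset.sum_smul]
    have h1 := P.sum_eq_one (mem_univ x)
    rw [finsum_eq_sum_of_support_subset _ fun p hp => hT p ⟨x, hp⟩] at h1
    rw [h1, one_smul]
  have hloc : ∀ p, IsSupportedInChart ν (chartAt (EuclideanHalfSpace 3) p) (β p)
      (tsupport (P p)) := fun p =>
    { orientation := hν
      mem_atlas := chart_mem_atlas _ p
      smoothAt := hβ p
      isCompact := isCompact_tsupport_partition (𝓡∂ 3) p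
      subset_source := hP p
      eq_zero := fun x hx => by simp only [β]; rw [image_eq_zero_of_notMem_tsupport hx, zero_smul] }
  have hd : Form.d (𝓡∂ 3) α = fun x => ∑ p ∈ T, Form.d (𝓡∂ 3) (β p) x := by
    conv_lhs => rw [hsum]
    funext x
    exact d_sum (𝓡∂ 3) fun p _ => hβ p x
  have hpb : Form.pullback (𝓡∂ 3) (𝓡 2) α j =
      fun b => ∑ p ∈ T, Form.pullback (𝓡∂ 3) (𝓡 2) (β p) j b := by
    conv_lhs => rw [hsum]
    funext b
    ext v
    simp only [Form.pullback, ContinuousAlternatingMap.compContinuousLinearMap_apply,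
      ContinuousAlternatingMap.sum_apply]
  rw [formIntegral_eq_partitionIntegral, hd, hpb,
    partitionIntegral_sum (𝓡∂ 3) hP hν fun p _ => isLocallyIntegrableForm_of_smoothAt (𝓡∂ 3)
      fun x => Form.SmoothAt.d (𝓡∂ 3) (Eventually.of_forall fun x' => hβ p x'),
    partitionIntegral_sum (𝓡 2) chartPartition_isSubordinate hνB
      fun p _ => isLocallyIntegrableForm_of_smoothAt (𝓡 2)
        fun b => (hβ p (j b)).pullback (𝓡 2) (𝓡∂ 3) (Eventually.of_forall fun b' => hj.smooth b')]
  refine Finset.sum_congr rfl fun p _ => ?_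
  rw [partitionIntegral_d_eq (hloc p) P hP, ← formIntegral_boundary_eq (hloc p) hνB hj,
    formIntegral_eq_partitionIntegral]

end GlobalStokes

/-! ### Killing fields in coordinates -/

section Coordinates

/-- The partial derivative `∂_i f`. -/
def pd (i : Fin 4) (f : E4 → ℝ) (y : E4) : ℝ := fderiv ℝ f y (stdFrame 4 i)

section pd

variable {i : Fin 4} {f h : E4 → ℝ} {y : E4}

theorem pd_add (hf : DifferentiableAt ℝ f y) (hh : DifferentiableAt ℝ h y) :
    pd i (fun z => f z + h z) y = pd i f y + pd i h y := by
  simp [pd, fderiv_fun_add hf hh]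

theorem pd_neg : pd i (fun z => -f z) y = -pd i f y := by
  simp [pd, fderiv_fun_neg]

theorem pd_mul (hf : DifferentiableAt ℝ f y) (hh : DifferentiableAt ℝ h y) :
    pd i (fun z => f z * h z) y = pd i f y * h y + f y * pd i h y := by
  simp [pd, fderiv_fun_mul hf hh]; ring

theorem pd_const_mul (t : ℝ) (hf : DifferentiableAt ℝ f y) :
    pd i (fun z => t * f z) y = t * pd i f y := by
  simp [pd, fderiv_const_mul hf]

theorem pd_sum {ι : Type*} {T : Finset ι} {F : ι → E4 → ℝ}
    (hF : ∀ a ∈ T, DifferentiableAt ℝ (F a) y) :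
    pd i (fun z => ∑ a ∈ T, F a z) y = ∑ a ∈ T, pd i (F a) y := by
  simp [pd, fderiv_fun_sum hF]

theorem pd_congr (hfh : f =ᶠ[𝓝 y] h) : pd i f y = pd i h y := by
  rw [pd, pd, hfh.fderiv_eq]

theorem fderiv_apply_eq_sum_pd (f : E4 → ℝ) (y u : E4) :
    fderiv ℝ f y u = ∑ i, u i * pd i f y := by
  conv_lhs => rw [← (stdBasis 4).sum_repr u]
  simp [pd, stdBasis_repr, stdBasis_eq]

theorem pd_comm (hf : ContDiffAt ℝ ∞ f y) (i j : Fin 4) :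
    pd i (pd j f) y = pd j (pd i f) y := by
  have hs : IsSymmSndFDerivAt ℝ f y :=
    (hf.of_le (ENat.LEInfty.out : (2 : WithTop ℕ∞) ≤ ∞)).isSymmSndFDerivAt (by simp)
  have hd : DifferentiableAt ℝ (fderiv ℝ f) y :=
    (hf.fderiv_right (m := 1) (ENat.LEInfty.out : (2 : WithTop ℕ∞) ≤ ∞)).differentiableAt (by simp)
  have h1 : ∀ a b : Fin 4, pd a (pd b f) y =
      fderiv ℝ (fderiv ℝ f) y (stdFrame 4 a) (stdFrame 4 b) := by
    intro a b
    change fderiv ℝ (fun z => fderiv ℝ f z (stdFrame 4 b)) y (stdFrame 4 a) = _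
    rw [fderiv_clm_apply hd (differentiableAt_const _)]
    simp
  rw [h1, h1, hs.eq]

theorem ContDiffAt.pd (hf : ContDiffAt ℝ ∞ f y) (i : Fin 4) : ContDiffAt ℝ ∞ (AngMom.pd i f) y :=
  (hf.fderiv_right (m := ∞) (by simp)).clm_apply contDiffAt_const

end pd

theorem christoffel_eq (G : E4 → Matrix (Fin 4) (Fin 4) ℝ) (k i j : Fin 4) (y : E4) :
    christoffel G k i j y = (1 / 2) * ∑ l, (G y)⁻¹ k l *
      (pd i (fun z => G z j l) y + pd j (fun z => G z i l) y - pd l (fun z => G z i j) y) := rfl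

theorem ricci_eq (G : E4 → Matrix (Fin 4) (Fin 4) ℝ) (i j : Fin 4) (y : E4) :
    ricci G i j y = ∑ k, pd k (christoffel G k i j) y - ∑ k, pd j (christoffel G k i k) y
    + ∑ k, ∑ l, christoffel G k k l y * christoffel G l i j y
    - ∑ k, ∑ l, christoffel G k j l y * christoffel G l i k y := rfl

/-- Smoothness of the determinant of a matrix with smooth entries. -/
theorem contDiffAt_det {G : E4 → Matrix (Fin 4) (Fin 4) ℝ} {y : E4}
    (hG : ∀ i j, ContDiffAt ℝ ∞ (fun z => G z i j) y) : ContDiffAt ℝ ∞ (fun z => (G z).det) y := by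
  simp only [Matrix.det_apply]
  exact ContDiffAt.sum fun σ _ => (contDiffAt_prod fun i _ => hG _ _).const_smul _

theorem contDiffAt_inv_apply {G : E4 → Matrix (Fin 4) (Fin 4) ℝ} {y : E4}
    (hG : ∀ i j, ContDiffAt ℝ ∞ (fun z => G z i j) y) (h0 : (G y).det ≠ 0) (i j : Fin 4) :
    ContDiffAt ℝ ∞ (fun z => (G z)⁻¹ i j) y := by
  simp only [Matrix.inv_def, Matrix.smul_apply, Ring.inverse_eq_inv', smul_eq_mul,
    Matrix.adjugate_apply]
  refine ((contDiffAt_det hG).inv h0).mul (contDiffAt_det fun a b => ?_)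
  by_cases h : a = j
  · subst h
    simpa using contDiffAt_const
  · simpa [Matrix.updateRow_ne h] using hG a b

/-- Jacobi's formula. -/
theorem pd_det {G : E4 → Matrix (Fin 4) (Fin 4) ℝ} {y : E4}
    (hG : ∀ i j, DifferentiableAt ℝ (fun z => G z i j) y) (h0 : (G y).det ≠ 0) (k : Fin 4) :
    pd k (fun z => (G z).det) y =
      (G y).det * ∑ i, ∑ j, (G y)⁻¹ j i * pd k (fun z => G z i j) y := by
  let D : ContinuousMultilinearMap ℝ (fun _ : Fin 4 => Fin 4 → ℝ) ℝ :=
    ⟨(Matrix.detRowAlternating (R := ℝ) (n := Fin 4)).toMultilinearMap,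
      Continuous.matrix_det (A := fun a : Fin 4 → Fin 4 → ℝ => Matrix.of a) continuous_id⟩
  let Γ : E4 → Fin 4 → Fin 4 → ℝ := fun z i j => G z i j
  have hΓ : DifferentiableAt ℝ Γ y :=
    differentiableAt_pi.2 fun i => differentiableAt_pi.2 fun j => hG i j
  have h1 : HasFDerivAt (fun z => (G z).det) ((D.linearDeriv (Γ y)).comp (fderiv ℝ Γ y)) y :=
    (D.hasFDerivAt (Γ y)).comp y hΓ.hasFDerivAt
  rw [pd, h1.fderiv, ContinuousLinearMap.comp_apply, ContinuousMultilinearMap.linearDeriv_apply,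
    Finset.mul_sum]
  refine Finset.sum_congr rfl fun i _ => ?_
  have h2 : ∀ b : Fin 4 → ℝ, D (Function.update (Γ y) i b) =
      (G y).det * ∑ j, (G y)⁻¹ j i * b j := by
    intro b
    change (Matrix.updateRow (G y) i b).det = _
    rw [← Matrix.cramer_transpose_apply, Matrix.cramer_eq_adjugate_mulVec, Matrix.mulVec,
      dotProduct, ← Matrix.adjugate_transpose, Finset.mul_sum]
    refine Finset.sum_congr rfl fun j _ => ?_
    rw [Matrix.inv_def, Matrix.smul_apply, Ring.inverse_eq_inv', smul_eq_mul, Matrix.transpose_apply]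
    field_simp
  rw [h2]
  congr 1
  refine Finset.sum_congr rfl fun j _ => ?_
  congr 1
  have h3 : HasFDerivAt (fun z => G z i j) _ y :=
    hasFDerivAt_pi'.1 (hasFDerivAt_pi'.1 hΓ.hasFDerivAt i) j
  rw [pd, h3.fderiv]
  rfl

/-- A nondegenerate smooth symmetric matrix `G` on the open set `W` of `ℝ⁴` with a Killing
field `X`. -/
structure IsKillingOn (W : Set E4) (G : E4 → Matrix (Fin 4) (Fin 4) ℝ) (X : E4 → E4) : Prop where
  isOpen : IsOpen W
  metric : ∀ y ∈ W, ∀ i j, ContDiffAt ℝ ∞ (fun z => G z i j) y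
  symm : ∀ y ∈ W, ∀ i j, G y i j = G y j i
  det_ne_zero : ∀ y ∈ W, (G y).det ≠ 0
  field : ∀ y ∈ W, ContDiffAt ℝ ∞ X y
  killing : ∀ y ∈ W, ∀ i j, ∑ k, X y k * pd k (fun z => G z i j) y +
    ∑ k, G y k j * pd i (fun z => X z k) y + ∑ k, G y i k * pd j (fun z => X z k) y = 0

/-- The covariant derivative `∇_j X^i`. -/
def covDeriv (G : E4 → Matrix (Fin 4) (Fin 4) ℝ) (X : E4 → E4) (i j : Fin 4) (y : E4) : ℝ :=
  pd j (fun z => X z i) y + ∑ k, christoffel G i j k y * X y k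

/-- The bivector `∇^j X^i`. -/
def covBivector (G : E4 → Matrix (Fin 4) (Fin 4) ℝ) (X : E4 → E4) (i j : Fin 4) (y : E4) : ℝ :=
  ∑ k, covDeriv G X i k y * (G y)⁻¹ k j

variable {W : Set E4} {G : E4 → Matrix (Fin 4) (Fin 4) ℝ} {X : E4 → E4} {y : E4}

namespace IsKillingOn

theorem field_apply (h : IsKillingOn W G X) (hy : y ∈ W) (i : Fin 4) :
    ContDiffAt ℝ ∞ (fun z => X z i) y :=
  (EuclideanSpace.proj (𝕜 := ℝ) i : E4 →L[ℝ] ℝ).contDiff.contDiffAt.comp y (h.field y hy)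

theorem contDiffAt_inv (h : IsKillingOn W G X) (hy : y ∈ W) (i j : Fin 4) :
    ContDiffAt ℝ ∞ (fun z => (G z)⁻¹ i j) y :=
  contDiffAt_inv_apply (h.metric y hy) (h.det_ne_zero y hy) i j

theorem contDiffAt_christoffel (h : IsKillingOn W G X) (hy : y ∈ W) (k i j : Fin 4) :
    ContDiffAt ℝ ∞ (christoffel G k i j) y := by
  refine contDiffAt_const.mul (ContDiffAt.sum fun l _ => (h.contDiffAt_inv hy k l).mul ?_)
  exact ((ContDiffAt.pd (h.metric y hy j l) i).add (ContDiffAt.pd (h.metric y hy i l) j)).sub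
    (ContDiffAt.pd (h.metric y hy i j) l)

theorem contDiffAt_covDeriv (h : IsKillingOn W G X) (hy : y ∈ W) (i j : Fin 4) :
    ContDiffAt ℝ ∞ (covDeriv G X i j) y :=
  (ContDiffAt.pd (h.field_apply hy i) j).add (ContDiffAt.sum fun k _ =>
    (h.contDiffAt_christoffel hy i j k).mul (h.field_apply hy k))

theorem contDiffAt_covBivector (h : IsKillingOn W G X) (hy : y ∈ W) (i j : Fin 4) :
    ContDiffAt ℝ ∞ (covBivector G X i j) y :=
  ContDiffAt.sum fun k _ => (h.contDiffAt_covDeriv hy i k).mul (h.contDiffAt_inv hy k j)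

theorem eventually_mem (h : IsKillingOn W G X) (hy : y ∈ W) : ∀ᶠ z in 𝓝 y, z ∈ W :=
  h.isOpen.mem_nhds hy

theorem pd_symm (h : IsKillingOn W G X) (hy : y ∈ W) (k i j : Fin 4) :
    pd k (fun z => G z i j) y = pd k (fun z => G z j i) y :=
  pd_congr ((h.eventually_mem hy).mono fun z hz => h.symm z hz i j)

theorem inv_symm (h : IsKillingOn W G X) (hy : y ∈ W) (i j : Fin 4) :
    (G y)⁻¹ i j = (G y)⁻¹ j i := by
  have ht : (G y)ᵀ = G y := by ext a b; exact h.symm y hy b a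
  have := congrFun (congrFun (Matrix.transpose_nonsing_inv (G y)) j) i
  rw [ht] at this
  exact this

theorem christoffel_symm (h : IsKillingOn W G X) (hy : y ∈ W) (k i j : Fin 4) :
    christoffel G k i j y = christoffel G k j i y := by
  rw [christoffel_eq, christoffel_eq]
  congr 1
  refine Finset.sum_congr rfl fun l _ => ?_
  rw [h.pd_symm hy l i j]
  ring

theorem mul_inv (h : IsKillingOn W G X) (hy : y ∈ W) (i j : Fin 4) :
    ∑ k, G y i k * (G y)⁻¹ k j = if i = j then 1 else 0 := by
  have := Matrix.mul_nonsing_inv (G y) (isUnit_iff_ne_zero.2 (h.det_ne_zero y hy))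
  rw [← Matrix.mul_apply, this, Matrix.one_apply]

theorem inv_mul (h : IsKillingOn W G X) (hy : y ∈ W) (i j : Fin 4) :
    ∑ k, (G y)⁻¹ i k * G y k j = if i = j then 1 else 0 := by
  have := Matrix.nonsing_inv_mul (G y) (isUnit_iff_ne_zero.2 (h.det_ne_zero y hy))
  rw [← Matrix.mul_apply, this, Matrix.one_apply]

theorem lower_christoffel (h : IsKillingOn W G X) (hy : y ∈ W) (m i j : Fin 4) :
    ∑ k, G y m k * christoffel G k i j y = (1 / 2) *
      (pd i (fun z => G z j m) y + pd j (fun z => G z i m) y - pd m (fun z => G z i j) y) := by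
  simp only [christoffel_eq, Finset.mul_sum]
  rw [Finset.sum_comm]
  have : ∀ l, ∑ k, G y m k * (1 / 2 * ((G y)⁻¹ k l * (pd i (fun z => G z j l) y +
      pd j (fun z => G z i l) y - pd l (fun z => G z i j) y))) =
      (∑ k, G y m k * (G y)⁻¹ k l) * (1 / 2 * (pd i (fun z => G z j l) y +
      pd j (fun z => G z i l) y - pd l (fun z => G z i j) y)) := fun l => by
    rw [Finset.sum_mul]
    exact Finset.sum_congr rfl fun k _ => by ring
  simp only [this, h.mul_inv hy, ite_mul, one_mul, zero_mul]
  simp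

theorem christoffel_trace (h : IsKillingOn W G X) (hy : y ∈ W) (j : Fin 4) :
    ∑ l, christoffel G l l j y =
      (1 / 2) * ∑ i, ∑ l, (G y)⁻¹ l i * pd j (fun z => G z i l) y := by
  simp only [christoffel_eq]
  rw [← Finset.mul_sum]
  congr 1
  have h1 : ∑ l, ∑ m, (G y)⁻¹ l m * pd l (fun z => G z j m) y =
      ∑ l, ∑ m, (G y)⁻¹ l m * pd m (fun z => G z l j) y := by
    rw [Finset.sum_comm]
    refine Finset.sum_congr rfl fun l _ => Finset.sum_congr rfl fun m _ => ?_
    rw [h.inv_symm hy m l, h.pd_symm hy m j l]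
  have h2 : ∀ l, ∑ m, (G y)⁻¹ l m * (pd l (fun z => G z j m) y + pd j (fun z => G z l m) y -
      pd m (fun z => G z l j) y) = ∑ m, (G y)⁻¹ l m * pd l (fun z => G z j m) y +
      ∑ m, (G y)⁻¹ l m * pd j (fun z => G z l m) y -
      ∑ m, (G y)⁻¹ l m * pd m (fun z => G z l j) y := fun l => by
    rw [← Finset.sum_add_distrib, ← Finset.sum_sub_distrib]
    exact Finset.sum_congr rfl fun m _ => by ring
  simp only [h2, Finset.sum_sub_distrib, Finset.sum_add_distrib, h1]
  have h3 : ∑ i, ∑ l, (G y)⁻¹ l i * pd j (fun z => G z i l) y =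
      ∑ i, ∑ l, (G y)⁻¹ i l * pd j (fun z => G z i l) y :=
    Finset.sum_congr rfl fun l _ => Finset.sum_congr rfl fun m _ => by rw [h.inv_symm hy m l]
  rw [h3]
  ring

/-- `∇_i X_j` is antisymmetric. -/
theorem lower_covDeriv (h : IsKillingOn W G X) (hy : y ∈ W) (i j : Fin 4) :
    ∑ m, G y i m * covDeriv G X m j y = -∑ m, G y j m * covDeriv G X m i y := by
  have h1 : ∀ a b, ∑ m, G y a m * covDeriv G X m b y = ∑ m, G y a m * pd b (fun z => X z m) y +
      ∑ k, X y k * ((1 / 2) * (pd b (fun z => G z k a) y + pd k (fun z => G z b a) y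
        - pd a (fun z => G z b k) y)) := by
    intro a b
    simp only [covDeriv, mul_add, Finset.sum_add_distrib, Finset.mul_sum]
    congr 1
    rw [Finset.sum_comm]
    refine Finset.sum_congr rfl fun k _ => ?_
    have := h.lower_christoffel hy a b k
    rw [← this, Finset.mul_sum]
    exact Finset.sum_congr rfl fun m _ => by ring
  rw [h1, h1, eq_neg_iff_add_eq_zero, ← h.killing y hy i j]
  have h2 : ∑ k, G y k j * pd i (fun z => X z k) y = ∑ m, G y j m * pd i (fun z => X z m) y :=
    Finset.sum_congr rfl fun k _ => by rw [h.symm y hy k j]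
  have h3 : ∑ k, X y k * ((1 / 2) * (pd j (fun z => G z k i) y + pd k (fun z => G z j i) y
        - pd i (fun z => G z j k) y)) + ∑ k, X y k * ((1 / 2) * (pd i (fun z => G z k j) y +
        pd k (fun z => G z i j) y - pd j (fun z => G z i k) y)) =
      ∑ k, X y k * pd k (fun z => G z i j) y := by
    rw [← Finset.sum_add_distrib]
    refine Finset.sum_congr rfl fun k _ => ?_
    rw [h.pd_symm hy j k i, h.pd_symm hy k j i, h.pd_symm hy i k j]
    ring
  rw [h2]
  linear_combination h3

/-- `∇^j X^i` is antisymmetric. -/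
theorem covBivector_antisymm (h : IsKillingOn W G X) (hy : y ∈ W) (i j : Fin 4) :
    covBivector G X i j y = -covBivector G X j i y := by
  let Bm : Matrix (Fin 4) (Fin 4) ℝ := fun a b => covDeriv G X a b y
  let A : Matrix (Fin 4) (Fin 4) ℝ := fun a b => covBivector G X a b y
  have hu := isUnit_iff_ne_zero.2 (h.det_ne_zero y hy)
  have hA : A = Bm * (G y)⁻¹ := by ext a b; rw [Matrix.mul_apply]; rfl
  have hC : (G y * Bm)ᵀ = -(G y * Bm) := by
    ext a b
    rw [Matrix.transpose_apply, Matrix.neg_apply, Matrix.mul_apply, Matrix.mul_apply]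
    exact h.lower_covDeriv hy b a
  have hHt : ((G y)⁻¹)ᵀ = (G y)⁻¹ := by ext a b; exact h.inv_symm hy b a
  have hA' : A = (G y)⁻¹ * (G y * Bm) * (G y)⁻¹ := by
    rw [← Matrix.mul_assoc, Matrix.nonsing_inv_mul _ hu, Matrix.one_mul, hA]
  have : Aᵀ = -A := by
    rw [hA', Matrix.transpose_mul, Matrix.transpose_mul, hC, hHt]
    simp [Matrix.mul_assoc]
  have := congrFun (congrFun this j) i
  exact this

theorem covDeriv_eq (h : IsKillingOn W G X) (hy : y ∈ W) (i j : Fin 4) :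
    covDeriv G X i j y = ∑ m, covBivector G X i m y * G y m j := by
  simp only [covBivector, Finset.sum_mul]
  rw [Finset.sum_comm]
  have : ∀ k, ∑ m, covDeriv G X i k y * (G y)⁻¹ k m * G y m j =
      covDeriv G X i k y * ∑ m, (G y)⁻¹ k m * G y m j := fun k => by
    rw [Finset.mul_sum]
    exact Finset.sum_congr rfl fun m _ => by ring
  simp only [this, h.inv_mul hy]
  simp

theorem covDeriv_trace (h : IsKillingOn W G X) (hy : y ∈ W) : ∑ i, covDeriv G X i i y = 0 := by
  have h1 : ∑ i, covDeriv G X i i y = ∑ i, ∑ m, covBivector G X i m y * G y m i :=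
    Finset.sum_congr rfl fun i _ => h.covDeriv_eq hy i i
  have h2 : ∑ i, ∑ m, covBivector G X i m y * G y m i =
      -∑ i, ∑ m, covBivector G X i m y * G y m i := by
    conv_lhs => rw [Finset.sum_comm]
    rw [← Finset.sum_neg_distrib]
    refine Finset.sum_congr rfl fun i _ => ?_
    rw [← Finset.sum_neg_distrib]
    refine Finset.sum_congr rfl fun m _ => ?_
    rw [h.covBivector_antisymm hy m i, h.symm y hy i m]
    ring
  linarith

/-- The contracted Ricci identity. -/
theorem ricci_covDeriv (h : IsKillingOn W G X) (hy : y ∈ W) (j : Fin 4) :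
    ∑ i, pd i (covDeriv G X i j) y + ∑ i, ∑ l, christoffel G i i l y * covDeriv G X l j y
      - ∑ i, ∑ l, christoffel G i j l y * covDeriv G X l i y = ∑ l, ricci G l j y * X y l := by
  have hX : ∀ i, DifferentiableAt ℝ (fun z => X z i) y := fun i =>
    (h.field_apply hy i).differentiableAt (by simp)
  have hΓ : ∀ k i j, DifferentiableAt ℝ (christoffel G k i j) y := fun k i j =>
    (h.contDiffAt_christoffel hy k i j).differentiableAt (by simp)
  have hpd : ∀ i j, DifferentiableAt ℝ (pd j (fun z => X z i)) y := fun i j =>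
    (ContDiffAt.pd (h.field_apply hy i) j).differentiableAt (by simp)
  have h1 : ∀ k i j, pd k (covDeriv G X i j) y = pd k (pd j (fun z => X z i)) y +
      ∑ l, (pd k (christoffel G i j l) y * X y l + christoffel G i j l y * pd k (fun z => X z l) y) := by
    intro k i j
    unfold covDeriv
    rw [pd_add (hpd i j) (DifferentiableAt.fun_sum fun l _ => (hΓ i j l).fun_mul (hX l)),
      pd_sum fun l _ => (hΓ i j l).fun_mul (hX l)]
    congr 1
    exact Finset.sum_congr rfl fun l _ => pd_mul (hΓ i j l) (hX l)
  have htr : ∑ i, pd j (covDeriv G X i i) y = 0 := by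
    rw [← pd_sum fun i _ => (h.contDiffAt_covDeriv hy i i).differentiableAt (by simp),
      pd_congr (h := fun _ => 0) ((h.eventually_mem hy).mono fun z hz => h.covDeriv_trace hz)]
    simp [pd]
  have hcomm : ∀ i, pd i (pd j (fun z => X z i)) y = pd j (pd i (fun z => X z i)) y := fun i =>
    pd_comm (h.field_apply hy i) i j
  have hΓ' : ∀ k a b, pd j (christoffel G k a b) y = pd j (christoffel G k b a) y := fun k a b =>
    pd_congr ((h.eventually_mem hy).mono fun z hz => h.christoffel_symm hz k a b)
  have hΓ'' : ∀ i k a b, pd i (christoffel G k a b) y = pd i (christoffel G k b a) y := fun i k a b =>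
    pd_congr ((h.eventually_mem hy).mono fun z hz => h.christoffel_symm hz k a b)
  have e1 : ∑ i, pd i (covDeriv G X i j) y = ∑ i, (pd i (covDeriv G X i j) y -
      pd j (covDeriv G X i i) y) := by
    rw [Finset.sum_sub_distrib, htr, sub_zero]
  have e2 : ∀ i, pd i (covDeriv G X i j) y - pd j (covDeriv G X i i) y =
      ∑ l, (pd i (christoffel G i l j) y * X y l - pd j (christoffel G i l i) y * X y l
        + christoffel G i j l y * pd i (fun z => X z l) y
        - christoffel G i i l y * pd j (fun z => X z l) y) := by
    intro i
    rw [h1, h1, hcomm, add_sub_add_left_eq_sub, ← Finset.sum_sub_distrib]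
    refine Finset.sum_congr rfl fun l _ => ?_
    rw [hΓ'' i i j l, hΓ' i i l]
    ring
  have e3 : ∀ i l, christoffel G i i l y * covDeriv G X l j y =
      christoffel G i i l y * pd j (fun z => X z l) y +
        ∑ k, christoffel G i i l y * christoffel G l k j y * X y k := by
    intro i l
    rw [covDeriv, mul_add, Finset.mul_sum]
    congr 1
    exact Finset.sum_congr rfl fun k _ => by rw [h.christoffel_symm hy l j k]; ring
  have e4 : ∀ i l, christoffel G i j l y * covDeriv G X l i y =
      christoffel G i j l y * pd i (fun z => X z l) y +
        ∑ k, christoffel G i j l y * christoffel G l k i y * X y k := by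
    intro i l
    rw [covDeriv, mul_add, Finset.mul_sum]
    congr 1
    exact Finset.sum_congr rfl fun k _ => by rw [h.christoffel_symm hy l i k]; ring
  rw [e1]
  simp only [e2, e3, e4, ricci_eq, Finset.sum_add_distrib, Finset.sum_sub_distrib, add_mul,
    sub_mul, Finset.sum_mul]
  rw [Finset.sum_comm (f := fun l k => pd k (christoffel G k l j) y * X y l),
    Finset.sum_comm (f := fun l k => pd j (christoffel G k l k) y * X y l)]
  have e5 : ∀ T : Fin 4 → Fin 4 → Fin 4 → ℝ, ∑ k, ∑ i, ∑ l, T i l k = ∑ i, ∑ l, ∑ k, T i l k := by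
    intro T
    rw [Finset.sum_comm]
    exact Finset.sum_congr rfl fun i _ => Finset.sum_comm
  rw [e5 fun i l k => christoffel G i i l y * christoffel G l k j y * X y k,
    e5 fun i l k => christoffel G i j l y * christoffel G l k i y * X y k]
  ring

/-- The divergence of `∇^j X^i` is the Ricci tensor applied to `X`. -/
theorem divergence_covBivector (h : IsKillingOn W G X) (hy : y ∈ W) (j : Fin 4) :
    ∑ m, (∑ i, (pd i (covBivector G X i m) y +
      (∑ l, christoffel G l l i y) * covBivector G X i m y)) * G y m j =
      ∑ l, ricci G l j y * X y l := by
  rw [← h.ricci_covDeriv hy j]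
  have hA : ∀ i j, DifferentiableAt ℝ (covBivector G X i j) y := fun i j =>
    (h.contDiffAt_covBivector hy i j).differentiableAt (by simp)
  have hG : ∀ i j, DifferentiableAt ℝ (fun z => G z i j) y := fun i j =>
    (h.metric y hy i j).differentiableAt (by simp)
  have h1 : ∀ i, pd i (covDeriv G X i j) y = ∑ m, (pd i (covBivector G X i m) y * G y m j +
      covBivector G X i m y * pd i (fun z => G z m j) y) := by
    intro i
    rw [pd_congr ((h.eventually_mem hy).mono fun z hz => h.covDeriv_eq hz i j),
      pd_sum fun m _ => (hA i m).fun_mul (hG m j)]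
    exact Finset.sum_congr rfl fun m _ => pd_mul (hA i m) (hG m j)
  have h2 : ∑ i, ∑ l, christoffel G i i l y * covDeriv G X l j y =
      ∑ i, ∑ m, (∑ l, christoffel G l l i y) * covBivector G X i m y * G y m j := by
    rw [Finset.sum_comm]
    refine Finset.sum_congr rfl fun l _ => ?_
    rw [← Finset.sum_mul, h.covDeriv_eq hy, Finset.mul_sum]
    exact Finset.sum_congr rfl fun m _ => by ring
  have h3 : ∑ i, ∑ l, christoffel G i j l y * covDeriv G X l i y =
      ∑ l, ∑ m, covBivector G X l m y * ((1 / 2) * (pd j (fun z => G z l m) y +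
        pd l (fun z => G z j m) y - pd m (fun z => G z j l) y)) := by
    rw [Finset.sum_comm]
    refine Finset.sum_congr rfl fun l _ => ?_
    have : ∀ i, christoffel G i j l y * covDeriv G X l i y =
        ∑ m, covBivector G X l m y * (G y m i * christoffel G i j l y) := fun i => by
      rw [h.covDeriv_eq hy, Finset.mul_sum]
      exact Finset.sum_congr rfl fun m _ => by ring
    simp only [this]
    rw [Finset.sum_comm]
    refine Finset.sum_congr rfl fun m _ => ?_
    rw [← Finset.mul_sum, h.lower_christoffel hy m j l]
  have hanti : ∀ T : Fin 4 → Fin 4 → ℝ, (∀ l m, T l m = T m l) →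
      ∑ l, ∑ m, covBivector G X l m y * T l m = 0 := by
    intro T hT
    have : ∑ l, ∑ m, covBivector G X l m y * T l m =
        -∑ l, ∑ m, covBivector G X l m y * T l m := by
      conv_lhs => rw [Finset.sum_comm]
      rw [← Finset.sum_neg_distrib]
      refine Finset.sum_congr rfl fun i _ => ?_
      rw [← Finset.sum_neg_distrib]
      refine Finset.sum_congr rfl fun m _ => ?_
      rw [h.covBivector_antisymm hy m i, hT m i]
      ring
    linarith
  have h4 := hanti (fun l m => (1 / 2) * (pd j (fun z => G z l m) y + pd l (fun z => G z j m) y +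
    pd m (fun z => G z j l) y)) (fun l m => by rw [h.pd_symm hy j l m]; ring)
  have h5 : ∑ l, ∑ m, covBivector G X l m y * pd l (fun z => G z m j) y =
      ∑ l, ∑ m, covBivector G X l m y * ((1 / 2) * (pd j (fun z => G z l m) y +
        pd l (fun z => G z j m) y - pd m (fun z => G z j l) y)) := by
    have h6 : ∑ l, ∑ m, covBivector G X l m y * ((1 / 2) * (pd j (fun z => G z l m) y +
        pd l (fun z => G z j m) y - pd m (fun z => G z j l) y)) =
        ∑ l, ∑ m, covBivector G X l m y * pd l (fun z => G z m j) y +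
        ∑ l, ∑ m, covBivector G X l m y * ((1 / 2) * (pd j (fun z => G z l m) y -
          (pd l (fun z => G z j m) y + pd m (fun z => G z j l) y))) := by
      rw [← Finset.sum_add_distrib]
      refine Finset.sum_congr rfl fun l _ => ?_
      rw [← Finset.sum_add_distrib]
      refine Finset.sum_congr rfl fun m _ => ?_
      rw [h.pd_symm hy l m j]
      ring
    rw [h6, hanti (fun l m => (1 / 2) * (pd j (fun z => G z l m) y -
          (pd l (fun z => G z j m) y + pd m (fun z => G z j l) y)))
          (fun l m => by rw [h.pd_symm hy j l m]; ring), add_zero]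
  rw [h2, h3, ← h5]
  simp only [h1, Finset.sum_add_distrib, Finset.sum_mul, add_mul]
  rw [Finset.sum_comm (f := fun m i => pd i (covBivector G X i m) y * G y m j)]
  rw [Finset.sum_comm (f := fun m i => ∑ l, christoffel G l l i y * covBivector G X i m y * G y m j)]
  ring

/-- The derivative of a density `e` with `e² = -det G`. -/
theorem pd_density (h : IsKillingOn W G X) (hy : y ∈ W) {e : E4 → ℝ} (he : DifferentiableAt ℝ e y)
    (hee : ∀ᶠ z in 𝓝 y, e z ^ 2 = -(G z).det) (j : Fin 4) :
    pd j e y = e y * ∑ l, christoffel G l l j y := by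
  have h0 := h.det_ne_zero y hy
  have hG : ∀ i j, DifferentiableAt ℝ (fun z => G z i j) y := fun i j =>
    (h.metric y hy i j).differentiableAt (by simp)
  have h1 := pd_det hG h0 j
  have h2 : pd j (fun z => e z * e z) y = pd j (fun z => -(G z).det) y :=
    pd_congr (hee.mono fun z hz => (sq (e z)).symm.trans hz)
  rw [pd_mul he he, pd_neg, h1] at h2
  have h3 := hee.self_of_nhds
  have he0 : e y ≠ 0 := by
    intro hcon
    rw [hcon] at h3
    apply h0
    linarith
  rw [h.christoffel_trace hy]
  refine mul_left_cancel₀ he0 ?_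
  linear_combination (1 / 2) * h2 + (1 / 2) *
    (∑ i, ∑ l, (G y)⁻¹ l i * pd j (fun z => G z i l) y) * (-h3)

end IsKillingOn

end Coordinates

/-! ### Hodge duality in arbitrary frames -/

section Frames

/-- The Gram matrix of a bilinear form in a frame. -/
def gramOf (b : E4 →L[ℝ] E4 →L[ℝ] ℝ) (f : Fin 4 → E4) : Matrix (Fin 4) (Fin 4) ℝ :=
  Matrix.of fun i j => b (f i) (f j)

/-- The matrix whose columns are the coordinates of the vectors of a frame. -/
def frameMatrix (f : Fin 4 → E4) : Matrix (Fin 4) (Fin 4) ℝ := Matrix.of fun i j => f j i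

theorem frame_eq_sum (f : Fin 4 → E4) (i : Fin 4) :
    f i = ∑ k, frameMatrix f k i • stdFrame 4 k := by
  conv_lhs => rw [← (stdBasis 4).sum_repr (f i)]
  simp [stdBasis_repr, stdBasis_eq, frameMatrix]

theorem bilinear_frame (β : E4 →ₗ[ℝ] E4 →ₗ[ℝ] ℝ) (f : Fin 4 → E4) :
    (Matrix.of fun i j => β (f i) (f j)) =
      (frameMatrix f)ᵀ * (Matrix.of fun i j => β (stdFrame 4 i) (stdFrame 4 j)) * frameMatrix f := by
  ext i j
  rw [Matrix.mul_apply, Matrix.of_apply, frame_eq_sum f i, frame_eq_sum f j]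
  simp only [map_sum, map_smul, LinearMap.sum_apply, LinearMap.smul_apply, smul_eq_mul,
    Matrix.mul_apply, Matrix.transpose_apply, Matrix.of_apply, Finset.mul_sum, Finset.sum_mul]
  exact Finset.sum_congr rfl fun k _ => Finset.sum_congr rfl fun l _ => by ring

/-- A 2-form as a bilinear map. -/
def bilinOfForm (θ : E4 [⋀^Fin 2]→L[ℝ] ℝ) : E4 →ₗ[ℝ] E4 →ₗ[ℝ] ℝ :=
  LinearMap.mk₂ ℝ (fun u v => (ContinuousAlternatingMap.curryLeft
    (ContinuousAlternatingMap.curryLeft θ u) v) ![])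
    (by intros; simp [map_add]) (by intros; simp) (by intros; simp) (by intros; simp)

theorem bilinOfForm_apply (θ : E4 [⋀^Fin 2]→L[ℝ] ℝ) (u v : E4) :
    bilinOfForm θ u v = θ ![u, v] := rfl

/-- A 4-form with the last two arguments fixed as a bilinear map. -/
def bilinOfVolume (θ : E4 [⋀^Fin 4]→L[ℝ] ℝ) (w : Fin 2 → E4) : E4 →ₗ[ℝ] E4 →ₗ[ℝ] ℝ :=
  LinearMap.mk₂ ℝ (fun u v => (ContinuousAlternatingMap.curryLeft
    (ContinuousAlternatingMap.curryLeft θ u) v) w)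
    (by intros; simp [map_add]) (by intros; simp) (by intros; simp) (by intros; simp)

theorem bilinOfVolume_apply (θ : E4 [⋀^Fin 4]→L[ℝ] ℝ) (w : Fin 2 → E4) (u v : E4) :
    bilinOfVolume θ w u v = θ ![u, v, w 0, w 1] := by
  change θ (Matrix.vecCons u (Matrix.vecCons v w)) = _
  congr 1
  funext i
  fin_cases i <;> rfl

/-- A continuous bilinear form as a bilinear map. -/
def bilinOfCLM (b : E4 →L[ℝ] E4 →L[ℝ] ℝ) : E4 →ₗ[ℝ] E4 →ₗ[ℝ] ℝ :=
  LinearMap.mk₂ ℝ (fun u v => b u v) (by intros; simp) (by intros; simp) (by intros; simp)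
    (by intros; simp)

theorem gramOf_frame (b : E4 →L[ℝ] E4 →L[ℝ] ℝ) (f : Fin 4 → E4) :
    gramOf b f = (frameMatrix f)ᵀ * gramOf b (stdFrame 4) * frameMatrix f :=
  bilinear_frame (bilinOfCLM b) f

/-- The double contraction `Tr (G⁻¹ F G⁻ᵀ Eᵀ)`. -/
theorem contraction_eq_trace (H F E : Matrix (Fin 4) (Fin 4) ℝ) :
    ∑ a, ∑ b, ∑ c, ∑ d, H a c * H b d * F c d * E a b = (H * F * Hᵀ * Eᵀ).trace := by
  simp only [Matrix.trace, Matrix.diag, Matrix.mul_apply, Matrix.transpose_apply, Finset.sum_mul]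
  refine Finset.sum_congr rfl fun a _ => Finset.sum_congr rfl fun b _ => ?_
  rw [Finset.sum_comm]
  exact Finset.sum_congr rfl fun c _ => Finset.sum_congr rfl fun d _ => by ring

theorem inv_congruence {S G : Matrix (Fin 4) (Fin 4) ℝ} (hS : S.det ≠ 0) :
    S * (Sᵀ * G * S)⁻¹ * Sᵀ = G⁻¹ := by
  have hu := isUnit_iff_ne_zero.2 hS
  have hut : IsUnit Sᵀ.det := by rwa [Matrix.det_transpose]
  rw [Matrix.mul_inv_rev, Matrix.mul_inv_rev, ← Matrix.mul_assoc, ← Matrix.mul_assoc,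
    Matrix.mul_nonsing_inv _ hu, Matrix.one_mul, Matrix.mul_assoc, Matrix.nonsing_inv_mul _ hut,
    Matrix.mul_one]

theorem trace_congruence {S G : Matrix (Fin 4) (Fin 4) ℝ} (hS : S.det ≠ 0)
    (F E : Matrix (Fin 4) (Fin 4) ℝ) :
    ((Sᵀ * G * S)⁻¹ * (Sᵀ * F * S) * ((Sᵀ * G * S)⁻¹)ᵀ * (Sᵀ * E * S)ᵀ).trace =
      (G⁻¹ * F * (G⁻¹)ᵀ * Eᵀ).trace := by
  rw [← inv_congruence (G := G) hS]
  set K := (Sᵀ * G * S)⁻¹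
  simp only [Matrix.transpose_mul, Matrix.transpose_transpose, Matrix.mul_assoc]
  conv_rhs => rw [Matrix.trace_mul_comm]
  simp only [Matrix.mul_assoc]

theorem trace_congruence' {S G : Matrix (Fin 4) (Fin 4) ℝ} (hS : S.det ≠ 0)
    (E : Matrix (Fin 4) (Fin 4) ℝ) :
    ((Sᵀ * G * S)⁻¹ * (Sᵀ * E * S)ᵀ).trace = (G⁻¹ * Eᵀ).trace := by
  rw [← inv_congruence (G := G) hS]
  set K := (Sᵀ * G * S)⁻¹
  simp only [Matrix.transpose_mul, Matrix.transpose_transpose, Matrix.mul_assoc]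
  conv_rhs => rw [Matrix.trace_mul_comm]
  simp only [Matrix.mul_assoc]

/-- The Hodge dual in a frame. -/
def hodgeSum (b : E4 →L[ℝ] E4 →L[ℝ] ℝ) (ε : E4 [⋀^Fin 4]→L[ℝ] ℝ) (F : E4 [⋀^Fin 2]→L[ℝ] ℝ)
    (f : Fin 4 → E4) (w : Fin 2 → E4) : ℝ :=
  (1 / 2) * ∑ i, ∑ j, ∑ k, ∑ l, (gramOf b f)⁻¹ i k * (gramOf b f)⁻¹ j l * F ![f k, f l] *
    ε ![f i, f j, w 0, w 1]

theorem hodgeSum_eq_trace (b : E4 →L[ℝ] E4 →L[ℝ] ℝ) (ε : E4 [⋀^Fin 4]→L[ℝ] ℝ)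
    (F : E4 [⋀^Fin 2]→L[ℝ] ℝ) (f : Fin 4 → E4) (w : Fin 2 → E4) : hodgeSum b ε F f w =
      (1 / 2) * ((gramOf b f)⁻¹ * (Matrix.of fun i j => bilinOfForm F (f i) (f j)) *
        ((gramOf b f)⁻¹)ᵀ * (Matrix.of fun i j => bilinOfVolume ε w (f i) (f j))ᵀ).trace := by
  rw [← contraction_eq_trace]
  simp only [Matrix.of_apply, bilinOfVolume_apply, bilinOfForm_apply]
  rfl

theorem hodgeSum_frame (b : E4 →L[ℝ] E4 →L[ℝ] ℝ) (ε : E4 [⋀^Fin 4]→L[ℝ] ℝ)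
    (F : E4 [⋀^Fin 2]→L[ℝ] ℝ) {f : Fin 4 → E4} (hf : (frameMatrix f).det ≠ 0) (w : Fin 2 → E4) :
    hodgeSum b ε F f w = hodgeSum b ε F (stdFrame 4) w := by
  rw [hodgeSum_eq_trace, hodgeSum_eq_trace, gramOf_frame, bilinear_frame (bilinOfForm F),
    bilinear_frame (bilinOfVolume ε w), trace_congruence hf]

variable {M : Type*} [TopologicalSpace M] [ChartedSpace E4 M]

theorem hodge_eq_hodgeSum (g : BilinField M) (ε : Form (𝓡 4) M 4) (F : Form (𝓡 4) M 2) (x : M)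
    (w : Fin 2 → TangentSpace (𝓡 4) x) : hodge g ε F x w =
      hodgeSum (g x) (ε x) (F x) (stdFrame 4) w := by
  have h : hodge g ε F x w = ∑ a, ∑ b, ∑ c, ∑ d,
      ((1 / 2) * invMetric g x a c * invMetric g x b d *
        F x ![tangentFrame x c, tangentFrame x d]) *
      (ContinuousAlternatingMap.curryLeft (E := E4) (ContinuousAlternatingMap.curryLeft (E := E4)
        (ε x) (tangentFrame x a)) (tangentFrame x b)) w := by
    simp only [hodge, ContinuousAlternatingMap.sum_apply]
    refine Finset.sum_congr rfl fun i _ => Finset.sum_congr rfl fun j _ =>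
      Finset.sum_congr rfl fun k _ => ?_
    exact ContinuousAlternatingMap.sum_apply _ _
  refine h.trans ?_
  unfold hodgeSum
  simp only [Finset.mul_sum]
  refine Finset.sum_congr rfl fun i _ => Finset.sum_congr rfl fun j _ =>
    Finset.sum_congr rfl fun k _ => Finset.sum_congr rfl fun l _ => ?_
  exact (by intros; ring : ∀ p q r t : ℝ, 1 / 2 * p * q * r * t = 1 / 2 * (p * q * r * t)) _ _ _ _
    |>.trans (congrArg (fun t => 1 / 2 * (_ * t)) (bilinOfVolume_apply (ε x) w _ _))

/-- The Hodge dual can be computed in any frame. -/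
theorem hodge_eq_frame (g : BilinField M) (ε : Form (𝓡 4) M 4) (F : Form (𝓡 4) M 2) (x : M)
    {f : Fin 4 → E4} (hf : (frameMatrix f).det ≠ 0) (w : Fin 2 → TangentSpace (𝓡 4) x) :
    hodge g ε F x w = hodgeSum (g x) (ε x) (F x) f w := by
  rw [hodge_eq_hodgeSum]
  exact (hodgeSum_frame (g x) (ε x) (F x) hf w).symm

/-- The diagonal matrix `diag(-1, 1, 1, 1)`. -/
def minkowski : Matrix (Fin 4) (Fin 4) ℝ :=
  Matrix.of fun i j => if i = j then (if i = 0 then -1 else 1) else 0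

theorem minkowski_mul_self : minkowski * minkowski = 1 := by
  ext i j
  fin_cases i <;> fin_cases j <;> simp [minkowski, Matrix.mul_apply]

theorem minkowski_inv : minkowski⁻¹ = minkowski :=
  Matrix.inv_eq_left_inv minkowski_mul_self

theorem minkowski_det : minkowski.det = -1 := by
  have : minkowski = Matrix.diagonal fun i => if i = 0 then -1 else 1 := by
    ext i j
    simp [minkowski, Matrix.diagonal_apply]
  rw [this, Matrix.det_diagonal]
  simp

/-- Orthonormal frames of a bilinear form on `ℝ⁴`. -/
theorem det_frameMatrix_sq {b : E4 →L[ℝ] E4 →L[ℝ] ℝ} {f : Fin 4 → E4}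
    (hf : gramOf b f = minkowski) :
    (frameMatrix f).det ^ 2 * (gramOf b (stdFrame 4)).det = -1 := by
  have := congrArg Matrix.det hf
  rw [gramOf_frame, Matrix.det_mul, Matrix.det_mul, Matrix.det_transpose, minkowski_det] at this
  linarith

theorem det_frameMatrix_ne_zero {b : E4 →L[ℝ] E4 →L[ℝ] ℝ} {f : Fin 4 → E4}
    (hf : gramOf b f = minkowski) : (frameMatrix f).det ≠ 0 := by
  intro h0
  have := det_frameMatrix_sq hf
  rw [h0] at this
  norm_num at this

/-- The linear map that sends the standard basis to the frame `f`. -/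
def frameMap (f : Fin 4 → E4) : E4 →L[ℝ] E4 :=
  LinearMap.toContinuousLinearMap (Matrix.toEuclideanLin (frameMatrix f))

theorem frameMap_apply (f : Fin 4 → E4) (u : E4) : frameMap f u = ∑ k, u k • f k := by
  ext i
  change Matrix.toEuclideanLin (frameMatrix f) u i = _
  rw [Matrix.toLpLin_apply]
  simp [Matrix.mulVec, dotProduct, frameMatrix, mul_comm]

theorem frameMap_stdFrame (f : Fin 4 → E4) (i : Fin 4) : frameMap f (stdFrame 4 i) = f i := by
  rw [frameMap_apply]
  simp [stdFrame]

theorem frameMap_surjective {f : Fin 4 → E4} (hf : (frameMatrix f).det ≠ 0) (u : E4) :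
    ∃ a : E4, frameMap f a = u := by
  refine ⟨WithLp.toLp 2 ((frameMatrix f)⁻¹ *ᵥ u.ofLp), ?_⟩
  change Matrix.toEuclideanLin (frameMatrix f) _ = _
  rw [Matrix.toLpLin_apply]
  simp [Matrix.mulVec_mulVec, Matrix.mul_nonsing_inv _ (isUnit_iff_ne_zero.2 hf)]

theorem volume_frame (ε : E4 [⋀^Fin 4]→L[ℝ] ℝ) (f u : Fin 4 → E4) :
    ε (fun i => frameMap f (u i)) = ε f * (Matrix.of fun i j => u i j).det := by
  have h := alternating_eq_mul_det (ε.compContinuousLinearMap (frameMap f)) u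
  rw [ContinuousAlternatingMap.compContinuousLinearMap_apply,
    ContinuousAlternatingMap.compContinuousLinearMap_apply] at h
  have h1 : (frameMap f ∘ stdFrame 4) = f := funext fun i => frameMap_stdFrame f i
  have h2 : (stdBasis 4).det u = (Matrix.of fun i j => u i j).det := by
    rw [stdBasis_det_eq, ← Matrix.det_transpose]
    rfl
  rw [h1, h2] at h
  exact h

theorem bilinear_frameMap (β : E4 →ₗ[ℝ] E4 →ₗ[ℝ] ℝ) (f : Fin 4 → E4) (u v : E4) :
    β (frameMap f u) (frameMap f v) = ∑ i, ∑ j, u i * v j * β (f i) (f j) := by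
  rw [frameMap_apply, frameMap_apply]
  simp only [map_sum, map_smul, LinearMap.sum_apply, LinearMap.smul_apply, smul_eq_mul,
    Finset.mul_sum]
  rw [Finset.sum_comm]
  refine Finset.sum_congr rfl fun i _ => Finset.sum_congr rfl fun j _ => by ring

/-- Laplace expansion of a determinant along the first two rows. -/
theorem det_laplace (r₀ r₁ r₂ r₃ : E4) :
    (Matrix.of fun m n => (![r₀, r₁, r₂, r₃] m : E4) n).det =
      (r₀ 0 * r₁ 1 - r₀ 1 * r₁ 0) * (r₂ 2 * r₃ 3 - r₂ 3 * r₃ 2)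
      - (r₀ 0 * r₁ 2 - r₀ 2 * r₁ 0) * (r₂ 1 * r₃ 3 - r₂ 3 * r₃ 1)
      + (r₀ 0 * r₁ 3 - r₀ 3 * r₁ 0) * (r₂ 1 * r₃ 2 - r₂ 2 * r₃ 1)
      + (r₀ 1 * r₁ 2 - r₀ 2 * r₁ 1) * (r₂ 0 * r₃ 3 - r₂ 3 * r₃ 0)
      - (r₀ 1 * r₁ 3 - r₀ 3 * r₁ 1) * (r₂ 0 * r₃ 2 - r₂ 2 * r₃ 0)
      + (r₀ 2 * r₁ 3 - r₀ 3 * r₁ 2) * (r₂ 0 * r₃ 1 - r₂ 1 * r₃ 0) := by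
  rw [Matrix.det_succ_row_zero]
  simp only [Fin.sum_univ_four, Matrix.det_fin_three, Matrix.submatrix_apply, Matrix.of_apply,
    Fin.succAbove, Fin.succ_zero_eq_one, Fin.succ_one_eq_two]
  simp [Matrix.cons_val]
  ring

theorem sum_minkowski (T : Fin 4 → ℝ) (i : Fin 4) :
    ∑ k, minkowski i k * T k = minkowski i i * T i := by
  simp [minkowski]

/-- The algebraic identity behind the conservation law, in components. -/
theorem poynting_components (s Q : ℝ) (F : Fin 4 → Fin 4 → ℝ) (hF : ∀ i j, F i j = -F j i)
    (a b p q : E4) (star : E4 → E4 → ℝ)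
    (hstar : ∀ u v, star u v = (1 / 2) * ∑ i, ∑ j, ∑ k, ∑ l, minkowski i k * minkowski j l *
      F k l * (s * (Matrix.of fun m n => (![stdFrame 4 i, stdFrame 4 j, u, v] m : E4) n).det))
    (hb : ∀ m, minkowski m m * b m = 4 * (∑ i, ∑ j, minkowski i j * (∑ k, a k * F k i) * F m j) -
      Q * (minkowski m m * a m)) :
    s * (Matrix.of fun m n => (![b, a, p, q] m : E4) n).det =
      -4 * ((∑ i, ∑ j, a i * p j * F i j) * star a q - (∑ i, ∑ j, a i * q j * F i j) * star a p) := by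
  have d : ∀ i, F i i = 0 := fun i => by linarith [hF i i]
  have h10 := hF 1 0
  have h20 := hF 2 0
  have h30 := hF 3 0
  have h21 := hF 2 1
  have h31 := hF 3 1
  have h32 := hF 3 2
  have m0 : minkowski 0 0 = -1 := by simp [minkowski]
  have m1 : minkowski 1 1 = 1 := by simp [minkowski]
  have m2 : minkowski 2 2 = 1 := by simp [minkowski]
  have m3 : minkowski 3 3 = 1 := by simp [minkowski]
  have hb' : ∀ m, minkowski m m * b m = 4 * (∑ i, minkowski i i * ((∑ k, a k * F k i) * F m i)) -
      Q * (minkowski m m * a m) := fun m => by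
    rw [hb]
    congr 2
    refine Finset.sum_congr rfl fun i _ => ?_
    simp only [mul_assoc]
    rw [sum_minkowski (fun j => (∑ k, a k * F k i) * F m j)]
  have hb0 := hb' 0
  have hb1 := hb' 1
  have hb2 := hb' 2
  have hb3 := hb' 3
  simp only [Fin.sum_univ_four, m0, m1, m2, m3, d, h10, h20, h30, h21, h31, h32] at hb0 hb1 hb2 hb3
  have star_eq : ∀ u v, star u v = s * (
      -F 0 1 * (u 2 * v 3 - u 3 * v 2) + F 0 2 * (u 1 * v 3 - u 3 * v 1)
      - F 0 3 * (u 1 * v 2 - u 2 * v 1) + F 1 2 * (u 0 * v 3 - u 3 * v 0)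
      - F 1 3 * (u 0 * v 2 - u 2 * v 0) + F 2 3 * (u 0 * v 1 - u 1 * v 0)) := by
    intro u v
    have e1 : star u v = (1 / 2) * ∑ i, ∑ j, minkowski i i * (minkowski j j * (F i j *
        (s * (Matrix.of fun m n => (![stdFrame 4 i, stdFrame 4 j, u, v] m : E4) n).det))) := by
      rw [hstar]
      congr 1
      refine Finset.sum_congr rfl fun i _ => Finset.sum_congr rfl fun j _ => ?_
      simp only [mul_assoc, ← Finset.mul_sum]
      rw [sum_minkowski (fun k => ∑ l, minkowski j l * (F k l * (s * (Matrix.of fun m n =>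
        (![stdFrame 4 i, stdFrame 4 j, u, v] m : E4) n).det))), sum_minkowski]
    rw [e1]
    simp only [det_laplace, Fin.sum_univ_four, m0, m1, m2, m3, d, h10, h20, h30, h21, h31, h32]
    simp [stdFrame]
    ring
  rw [star_eq, star_eq, det_laplace]
  have hb0' : b 0 = -(4 * (-1 * ((a 0 * 0 + a 1 * -F 0 1 + a 2 * -F 0 2 + a 3 * -F 0 3) * 0) +
    1 * ((a 0 * F 0 1 + a 1 * 0 + a 2 * -F 1 2 + a 3 * -F 1 3) * F 0 1) +
    1 * ((a 0 * F 0 2 + a 1 * F 1 2 + a 2 * 0 + a 3 * -F 2 3) * F 0 2) +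
    1 * ((a 0 * F 0 3 + a 1 * F 1 3 + a 2 * F 2 3 + a 3 * 0) * F 0 3)) - Q * (-1 * a 0)) := by
    linarith
  rw [one_mul] at hb1 hb2 hb3
  simp only [Fin.sum_univ_four, d, h10, h20, h30, h21, h31, h32]
  rw [hb0', hb1, hb2, hb3]
  ring

end Frames

/-! ### The exterior derivative of the Komar form -/

section Komar

theorem extDeriv_one_apply {θ : E4 → E4 [⋀^Fin 1]→L[ℝ] ℝ} {y : E4} (h : DifferentiableAt ℝ θ y)
    (u v : E4) : extDeriv θ y ![u, v] =
      fderiv ℝ (fun z => θ z ![v]) y u - fderiv ℝ (fun z => θ z ![u]) y v := by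
  have h1 : ∀ (k : E4) (w : Fin 1 → E4), fderiv ℝ (fun z => θ z w) y k = (fderiv ℝ θ y k) w := by
    intro k w
    have := ((ContinuousAlternatingMap.apply ℝ E4 ℝ w).hasFDerivAt.comp y h.hasFDerivAt).fderiv
    exact congrArg (fun L => L k) this
  rw [h1, h1, extDeriv, ContinuousAlternatingMap.alternatizeUncurryFin_apply, Fin.sum_univ_two]
  have e0 : Fin.removeNth (0 : Fin 2) ![u, v] = ![v] := by funext i; fin_cases i; rfl
  have e1 : Fin.removeNth (1 : Fin 2) ![u, v] = ![u] := by funext i; fin_cases i; rfl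
  rw [e0, e1]
  simp [sub_eq_add_neg]

theorem extDeriv_two_apply {θ : E4 → E4 [⋀^Fin 2]→L[ℝ] ℝ} {y : E4} (h : DifferentiableAt ℝ θ y)
    (u v w : E4) : extDeriv θ y ![u, v, w] =
      fderiv ℝ (fun z => θ z ![v, w]) y u - fderiv ℝ (fun z => θ z ![u, w]) y v
        + fderiv ℝ (fun z => θ z ![u, v]) y w := by
  have h1 : ∀ (k : E4) (w : Fin 2 → E4), fderiv ℝ (fun z => θ z w) y k = (fderiv ℝ θ y k) w := by
    intro k w
    have := ((ContinuousAlternatingMap.apply ℝ E4 ℝ w).hasFDerivAt.comp y h.hasFDerivAt).fderiv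
    exact congrArg (fun L => L k) this
  rw [h1, h1, h1, extDeriv, ContinuousAlternatingMap.alternatizeUncurryFin_apply, Fin.sum_univ_three]
  have e0 : Fin.removeNth (0 : Fin 3) ![u, v, w] = ![v, w] := by funext i; fin_cases i <;> rfl
  have e1 : Fin.removeNth (1 : Fin 3) ![u, v, w] = ![u, w] := by funext i; fin_cases i <;> rfl
  have e2 : Fin.removeNth (2 : Fin 3) ![u, v, w] = ![u, v] := by funext i; fin_cases i <;> rfl
  rw [e0, e1, e2]
  simp [sub_eq_add_neg]

theorem divergence_det (p : Fin 4 → Fin 4 → Fin 4 → ℝ) (hp : ∀ k i j, p k i j = -p k j i)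
    (u v w : E4) :
    (∑ k, u k * ∑ i, ∑ j, p k i j * (Matrix.of fun m n => (![stdFrame 4 i, stdFrame 4 j, v, w] m : E4) n).det)
    - (∑ k, v k * ∑ i, ∑ j, p k i j * (Matrix.of fun m n => (![stdFrame 4 i, stdFrame 4 j, u, w] m : E4) n).det)
    + (∑ k, w k * ∑ i, ∑ j, p k i j * (Matrix.of fun m n => (![stdFrame 4 i, stdFrame 4 j, u, v] m : E4) n).det)
    = -2 * (Matrix.of fun m n => (![WithLp.toLp 2 (fun m => ∑ i, p i i m), u, v, w] m : E4) n).det := by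
  have d : ∀ k i, p k i i = 0 := fun k i => by linarith [hp k i i]
  simp only [det_laplace, Fin.sum_univ_four, d, hp _ 1 0, hp _ 2 0, hp _ 3 0, hp _ 2 1, hp _ 3 1, hp _ 3 2]
  simp [stdFrame]
  ring

namespace IsKillingOn

variable {W : Set E4} {G : E4 → Matrix (Fin 4) (Fin 4) ℝ} {X : E4 → E4} {y : E4}

theorem pd_lower (h : IsKillingOn W G X) (hy : y ∈ W) (k l : Fin 4) :
    pd k (fun z => ∑ m, G z l m * X z m) y - pd l (fun z => ∑ m, G z k m * X z m) y =
      2 * ∑ m, G y l m * covDeriv G X m k y := by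
  have hX : ∀ i, DifferentiableAt ℝ (fun z => X z i) y := fun i =>
    (h.field_apply hy i).differentiableAt (by simp)
  have hG : ∀ i j, DifferentiableAt ℝ (fun z => G z i j) y := fun i j =>
    (h.metric y hy i j).differentiableAt (by simp)
  have h1 : ∀ a b, pd a (fun z => ∑ m, G z b m * X z m) y =
      ∑ m, G y b m * pd a (fun z => X z m) y + ∑ m, X y m * pd a (fun z => G z b m) y := by
    intro a b
    rw [pd_sum fun m _ => (hG b m).fun_mul (hX m), ← Finset.sum_add_distrib]
    exact Finset.sum_congr rfl fun m _ => by rw [pd_mul (hG b m) (hX m)]; ring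
  have h2 : ∀ a b, ∑ m, G y a m * covDeriv G X m b y = ∑ m, G y a m * pd b (fun z => X z m) y +
      ∑ k, X y k * ((1 / 2) * (pd b (fun z => G z k a) y + pd k (fun z => G z b a) y
        - pd a (fun z => G z b k) y)) := by
    intro a b
    simp only [covDeriv, mul_add, Finset.sum_add_distrib, Finset.mul_sum]
    congr 1
    rw [Finset.sum_comm]
    refine Finset.sum_congr rfl fun k _ => ?_
    rw [← h.lower_christoffel hy a b k, Finset.mul_sum]
    exact Finset.sum_congr rfl fun m _ => by ring
  have h3 := h.lower_covDeriv hy l k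
  have h4 : ∑ k', X y k' * ((1 / 2) * (pd k (fun z => G z k' l) y + pd k' (fun z => G z k l) y
        - pd l (fun z => G z k k') y)) - ∑ k', X y k' * ((1 / 2) * (pd l (fun z => G z k' k) y
        + pd k' (fun z => G z l k) y - pd k (fun z => G z l k') y)) =
      ∑ m, X y m * pd k (fun z => G z l m) y - ∑ m, X y m * pd l (fun z => G z k m) y := by
    rw [← Finset.sum_sub_distrib, ← Finset.sum_sub_distrib]
    refine Finset.sum_congr rfl fun m _ => ?_
    rw [h.pd_symm hy k m l, h.pd_symm hy m k l, h.pd_symm hy l m k]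
    ring
  have h5 : 2 * ∑ m, G y l m * covDeriv G X m k y = ∑ m, G y l m * covDeriv G X m k y -
      ∑ m, G y k m * covDeriv G X m l y := by linarith
  rw [h5, h1, h1, h2, h2]
  linear_combination -h4

theorem raise_pd_lower (h : IsKillingOn W G X) (hy : y ∈ W) (i j : Fin 4) :
    ∑ k, ∑ l, (G y)⁻¹ i k * (G y)⁻¹ j l * (pd k (fun z => ∑ m, G z l m * X z m) y -
      pd l (fun z => ∑ m, G z k m * X z m) y) = -2 * covBivector G X i j y := by
  have h1 : ∀ k, ∑ l, (G y)⁻¹ i k * (G y)⁻¹ j l * (pd k (fun z => ∑ m, G z l m * X z m) y -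
      pd l (fun z => ∑ m, G z k m * X z m) y) = 2 * (covDeriv G X j k y * (G y)⁻¹ k i) := by
    intro k
    have h2 : ∑ l, (G y)⁻¹ j l * ∑ m, G y l m * covDeriv G X m k y = covDeriv G X j k y := by
      simp only [Finset.mul_sum]
      rw [Finset.sum_comm]
      have : ∀ m, ∑ l, (G y)⁻¹ j l * (G y l m * covDeriv G X m k y) =
          (∑ l, (G y)⁻¹ j l * G y l m) * covDeriv G X m k y := fun m => by
        rw [Finset.sum_mul]
        exact Finset.sum_congr rfl fun l _ => by ring
      simp only [this, h.inv_mul hy]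
      simp
    rw [← h2, h.inv_symm hy k i, Finset.sum_mul, Finset.mul_sum]
    refine Finset.sum_congr rfl fun l _ => ?_
    rw [h.pd_lower hy]
    ring
  rw [Finset.sum_congr rfl fun k _ => h1 k, ← Finset.mul_sum]
  change 2 * covBivector G X j i y = _
  rw [h.covBivector_antisymm hy j i]
  ring

end IsKillingOn

variable {M : Type*} [TopologicalSpace M] [ChartedSpace E4 M] [IsManifold (𝓡 4) ∞ M]

theorem extend_target_model (c : OpenPartialHomeomorph M E4) :
    (c.extend (𝓡 4)).target = c.target := by
  rw [c.extend_target]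
  simp

theorem range_model : range (𝓡 4) = univ := by simp

/-- The components of a vector field in the chart `c`. -/
def coordField (ξ : VField (𝓡 4) M) (c : OpenPartialHomeomorph M E4) (y : E4) : E4 :=
  coframe (𝓡 4) c ((c.extend (𝓡 4)).symm y) (ξ ((c.extend (𝓡 4)).symm y))

/-- Killing fields of `g`: the components in all charts are smooth and satisfy Killing's
equation. -/
def IsKillingField (g : BilinField M) (ξ : VField (𝓡 4) M) : Prop :=
  ∀ c ∈ atlas E4 M, IsKillingOn c.target (gram g c) (coordField ξ c)

variable {g : BilinField M} {ξ : VField (𝓡 4) M} {c : OpenPartialHomeomorph M E4} {y : E4}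

theorem chartFrame_coordField (hc : c ∈ atlas E4 M) (hy : y ∈ c.target) :
    chartFrame (𝓡 4) c y (coordField ξ c y) = ξ ((c.extend (𝓡 4)).symm y) :=
  DFunLike.congr_fun (frame_comp_coframe (𝓡 4) hc (by rwa [extend_target_model])) _

/-- The coordinate frame as a frame of vectors in `ℝ⁴`. -/
def coordFrame (c : OpenPartialHomeomorph M E4) (y : E4) (i : Fin 4) : E4 :=
  chartFrame (𝓡 4) c y (stdFrame 4 i)

theorem frameMap_coordFrame (c : OpenPartialHomeomorph M E4) (y u : E4) :
    frameMap (coordFrame c y) u = chartFrame (𝓡 4) c y u := by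
  rw [frameMap_apply]
  conv_rhs => rw [← (stdBasis 4).sum_repr u]
  simp only [stdBasis_repr, stdBasis_eq, map_sum, map_smul]
  rfl

theorem det_coordFrame_ne_zero (hc : c ∈ atlas E4 M) (hy : y ∈ c.target) :
    (frameMatrix (coordFrame c y)).det ≠ 0 := by
  rw [← extend_target_model] at hy
  have h := frame_comp_coframe (𝓡 4) hc hy
  have hsurj : ∀ u : E4, ∃ a : E4, frameMap (coordFrame c y) a = u := fun u =>
    ⟨coframe (𝓡 4) c ((c.extend (𝓡 4)).symm y) u, by
      rw [frameMap_coordFrame]; exact DFunLike.congr_fun h u⟩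
  intro h0
  obtain ⟨v, hv, hv0⟩ := Matrix.exists_mulVec_eq_zero_iff.2 h0
  have hinj : Function.Injective (frameMap (coordFrame c y)).toLinearMap :=
    LinearMap.injective_iff_surjective.2 hsurj
  apply hv
  have h1 : frameMap (coordFrame c y) (WithLp.toLp 2 v) = 0 := by
    change Matrix.toEuclideanLin (frameMatrix (coordFrame c y)) _ = _
    rw [Matrix.toLpLin_apply]
    simp [hv0]
  have h2 : (WithLp.toLp 2 v : E4) = 0 := hinj (h1.trans (map_zero _).symm)
  simpa using h2

theorem gramOf_coordFrame (g : BilinField M) (c : OpenPartialHomeomorph M E4) (y : E4) :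
    gramOf (g ((c.extend (𝓡 4)).symm y)) (coordFrame c y) = gram g c y := rfl

theorem exists_minkowski_frame (hg : IsLorentzMetric g) (x : M) :
    ∃ f : Fin 4 → E4, gramOf (g x) f = minkowski ∧ IsOrthonormalFrame g x f := by
  obtain ⟨f, hf⟩ := hg.signature x
  exact ⟨f, by ext i j; exact hf i j, hf⟩

theorem inChart_volume_sq (hg : IsLorentzMetric g) {ε : Form (𝓡 4) M 4}
    (hε : IsVolumeElement g ε) (c : OpenPartialHomeomorph M E4) (y : E4) :
    Form.inChart (𝓡 4) ε c y (stdFrame 4) ^ 2 = -(gram g c y).det := by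
  obtain ⟨f, hf, hf'⟩ := exists_minkowski_frame hg ((c.extend (𝓡 4)).symm y)
  have hd := det_frameMatrix_ne_zero hf
  choose u hu using fun i => frameMap_surjective hd (coordFrame c y i)
  have h1 : Form.inChart (𝓡 4) ε c y (stdFrame 4) =
      ε ((c.extend (𝓡 4)).symm y) f * (Matrix.of fun i j => u i j).det := by
    refine Eq.trans ?_ (volume_frame (ε ((c.extend (𝓡 4)).symm y)) f u)
    exact congrArg (ε ((c.extend (𝓡 4)).symm y)) (funext fun i => (hu i).symm)
  have h2 : gram g c y = (Matrix.of fun i j => u i j) * minkowski *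
      (Matrix.of fun i j => u i j)ᵀ := by
    rw [← gramOf_coordFrame, ← hf]
    ext i j
    have h3 := bilinear_frameMap (bilinOfCLM (g ((c.extend (𝓡 4)).symm y))) f (u i) (u j)
    rw [hu, hu] at h3
    refine h3.trans ?_
    rw [Matrix.mul_apply]
    simp only [Matrix.mul_apply, Finset.sum_mul]
    rw [Finset.sum_comm]
    refine Finset.sum_congr rfl fun a _ => Finset.sum_congr rfl fun b _ => ?_
    change u i b * u j a * gramOf (g ((c.extend (𝓡 4)).symm y)) f b a = u i b * _ * u j a
    ring
  rw [h1, h2, Matrix.det_mul, Matrix.det_mul, Matrix.det_transpose, minkowski_det, mul_pow]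
  have h4 : ε ((c.extend (𝓡 4)).symm y) f ^ 2 = 1 := by
    rcases hε.unit _ f hf' with h | h
    · exact (congrArg (· ^ 2) h).trans (one_pow 2)
    · exact (congrArg (· ^ 2) h).trans (by norm_num)
  rw [h4]
  ring

theorem inChart_volume_apply (ε : Form (𝓡 4) M 4) (c : OpenPartialHomeomorph M E4) (y : E4)
    (u : Fin 4 → E4) : Form.inChart (𝓡 4) ε c y u = Form.inChart (𝓡 4) ε c y (stdFrame 4) *
      (Matrix.of fun i j => u i j).det := by
  rw [alternating_eq_mul_det, stdBasis_det_eq, ← Matrix.det_transpose]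
  rfl

/-- The Hodge dual in coordinates. -/
theorem inChart_hodge (g : BilinField M) (ε : Form (𝓡 4) M 4) (F : Form (𝓡 4) M 2)
    (hc : c ∈ atlas E4 M) (hy : y ∈ c.target) (w : Fin 2 → E4) :
    Form.inChart (𝓡 4) (hodge g ε F) c y w = (1 / 2) * ∑ i, ∑ j, ∑ k, ∑ l,
      (gram g c y)⁻¹ i k * (gram g c y)⁻¹ j l * comps F c y k l *
        (Form.inChart (𝓡 4) ε c y (stdFrame 4) *
          (Matrix.of fun m n => (![stdFrame 4 i, stdFrame 4 j, w 0, w 1] m : E4) n).det) := by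
  refine (hodge_eq_frame g ε F _ (det_coordFrame_ne_zero hc hy) _).trans ?_
  unfold hodgeSum
  congr 1
  refine Finset.sum_congr rfl fun i _ => Finset.sum_congr rfl fun j _ =>
    Finset.sum_congr rfl fun k _ => Finset.sum_congr rfl fun l _ => ?_
  have h1 := inChart_volume_apply ε c y ![stdFrame 4 i, stdFrame 4 j, w 0, w 1]
  rw [← h1]
  refine congrArg₂ (· * ·) (congrArg (HMul.hMul ((gram g c y)⁻¹ i k * (gram g c y)⁻¹ j l)) ?_) ?_
  · refine congrArg (F ((c.extend (𝓡 4)).symm y)) (funext fun a => ?_)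
    fin_cases a <;> rfl
  · refine congrArg (ε ((c.extend (𝓡 4)).symm y)) (funext fun a => ?_)
    fin_cases a <;> rfl

theorem contDiffAt_inChart {k : ℕ} {θ : Form (𝓡 4) M k} (hc : c ∈ atlas E4 M)
    (hy : y ∈ c.target) (h : Form.SmoothAt (𝓡 4) θ ((c.extend (𝓡 4)).symm y)) :
    ContDiffAt ℝ ∞ (Form.inChart (𝓡 4) θ c) y := by
  rw [← extend_target_model] at hy
  have := h c hc (extend_symm_mem_source (𝓡 4) hy)
  rw [(c.extend (𝓡 4)).right_inv hy, range_model, contDiffWithinAt_univ] at this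
  exact this

theorem smoothAt_of_inChart {k : ℕ} {θ : Form (𝓡 4) M k}
    (h : ∀ c ∈ atlas E4 M, ∀ y ∈ c.target,
      ContDiffAt ℝ ∞ (Form.inChart (𝓡 4) θ c) y) (x : M) : Form.SmoothAt (𝓡 4) θ x := by
  intro c hc hx
  have hy := extend_mem_target (𝓡 4) hx
  rw [extend_target_model] at hy
  exact (h c hc _ hy).contDiffWithinAt

theorem inChart_d_model {k : ℕ} {θ : Form (𝓡 4) M k} (hc : c ∈ atlas E4 M)
    (hy : y ∈ c.target) (h : Form.SmoothAt (𝓡 4) θ ((c.extend (𝓡 4)).symm y)) :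
    Form.inChart (𝓡 4) (Form.d (𝓡 4) θ) c y = extDeriv (Form.inChart (𝓡 4) θ c) y := by
  rw [inChart_d (𝓡 4) hc (by rwa [extend_target_model]) h, range_model, extDerivWithin_univ]

/-- The components of the dual 1-form. -/
theorem inChart_lowerForm (hg : IsLorentzMetric g) (hc : c ∈ atlas E4 M) (hy : y ∈ c.target)
    (u : E4) : Form.inChart (𝓡 4) (lowerForm g ξ) c y ![u] =
      ∑ l, u l * ∑ m, gram g c y l m * coordField ξ c y m := by
  change g ((c.extend (𝓡 4)).symm y) (ξ _) (chartFrame (𝓡 4) c y u) = _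
  rw [hg.symm, ← chartFrame_coordField (ξ := ξ) hc hy, ← frameMap_coordFrame]
  have h := bilinear_frameMap (bilinOfCLM (g ((c.extend (𝓡 4)).symm y))) (coordFrame c y) u
    (coordField ξ c y)
  rw [frameMap_coordFrame c y (coordField ξ c y)] at h
  refine h.trans ?_
  refine Finset.sum_congr rfl fun i _ => ?_
  rw [Finset.mul_sum]
  refine Finset.sum_congr rfl fun j _ => ?_
  change _ * gram g c y i j = _
  ring

theorem smoothAt_lowerForm (hg : IsLorentzMetric g) (hξ : IsKillingField g ξ) (x : M) :
    Form.SmoothAt (𝓡 4) (lowerForm g ξ) x := by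
  refine smoothAt_of_inChart (fun c hc y hy => ?_) x
  have h := hξ c hc
  rw [← contDiffWithinAt_univ]
  refine contDiffWithinAt_alternating_of_apply fun v => ?_
  rw [contDiffWithinAt_univ]
  have h1 : ContDiffAt ℝ ∞ (fun y => ∑ l, v 0 l * ∑ m, gram g c y l m * coordField ξ c y m) y :=
    ContDiffAt.sum fun l _ => contDiffAt_const.mul (ContDiffAt.sum fun m _ =>
      (h.metric y hy l m).mul (h.field_apply hy m))
  refine h1.congr_of_eventuallyEq ?_
  filter_upwards [h.eventually_mem hy] with z hz
  rw [← inChart_lowerForm hg hc hz]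
  congr 1
  funext i
  fin_cases i
  rfl

theorem comps_d_lowerForm (hg : IsLorentzMetric g) (hξ : IsKillingField g ξ)
    (hc : c ∈ atlas E4 M) (hy : y ∈ c.target) (k l : Fin 4) :
    comps (Form.d (𝓡 4) (lowerForm g ξ)) c y k l =
      pd k (fun z => ∑ m, gram g c z l m * coordField ξ c z m) y -
      pd l (fun z => ∑ m, gram g c z k m * coordField ξ c z m) y := by
  have hs := smoothAt_lowerForm hg hξ ((c.extend (𝓡 4)).symm y)
  have h1 : ∀ a, (fun z => Form.inChart (𝓡 4) (lowerForm g ξ) c z ![stdFrame 4 a]) =ᶠ[𝓝 y]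
      fun z => ∑ m, gram g c z a m * coordField ξ c z m := by
    intro a
    filter_upwards [(hξ c hc).eventually_mem hy] with z hz
    rw [inChart_lowerForm hg hc hz]
    simp [stdFrame]
  rw [comps, inChart_d_model hc hy hs, extDeriv_one_apply
    ((contDiffAt_inChart hc hy hs).differentiableAt (by simp))]
  exact congrArg₂ (· - ·) (pd_congr (h1 l)) (pd_congr (h1 k))

/-- The Komar form in coordinates. -/
theorem inChart_komarForm (hg : IsLorentzMetric g) (ε : Form (𝓡 4) M 4)
    (hξ : IsKillingField g ξ) (hc : c ∈ atlas E4 M) (hy : y ∈ c.target) (w : Fin 2 → E4) :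
    Form.inChart (𝓡 4) (komarForm g ξ ε) c y w = -∑ i, ∑ j,
      (Form.inChart (𝓡 4) ε c y (stdFrame 4) * covBivector (gram g c) (coordField ξ c) i j y) *
        (Matrix.of fun m n => (![stdFrame 4 i, stdFrame 4 j, w 0, w 1] m : E4) n).det := by
  rw [komarForm, inChart_hodge g ε _ hc hy, Finset.mul_sum, ← Finset.sum_neg_distrib]
  refine Finset.sum_congr rfl fun i _ => ?_
  rw [Finset.mul_sum, ← Finset.sum_neg_distrib]
  refine Finset.sum_congr rfl fun j _ => ?_
  have h1 := (hξ c hc).raise_pd_lower hy i j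
  simp only [← Finset.sum_mul, comps_d_lowerForm hg hξ hc hy]
  rw [h1]
  ring

theorem contDiffAt_volume {ε : Form (𝓡 4) M 4} (hε : IsVolumeElement g ε) (hc : c ∈ atlas E4 M)
    (hy : y ∈ c.target) :
    ContDiffAt ℝ ∞ (fun z => Form.inChart (𝓡 4) ε c z (stdFrame 4)) y :=
  (ContinuousAlternatingMap.apply ℝ E4 ℝ (stdFrame 4)).contDiff.contDiffAt.comp y
    (contDiffAt_inChart hc hy (hε.smooth.smoothAt (𝓡 4) _))

theorem smoothAt_komarForm (hg : IsLorentzMetric g) {ε : Form (𝓡 4) M 4}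
    (hε : IsVolumeElement g ε) (hξ : IsKillingField g ξ) (x : M) :
    Form.SmoothAt (𝓡 4) (komarForm g ξ ε) x := by
  refine smoothAt_of_inChart (fun c hc y hy => ?_) x
  have h := hξ c hc
  rw [← contDiffWithinAt_univ]
  refine contDiffWithinAt_alternating_of_apply fun v => ?_
  rw [contDiffWithinAt_univ]
  have h1 : ContDiffAt ℝ ∞ (fun z => -∑ i, ∑ j, (Form.inChart (𝓡 4) ε c z (stdFrame 4) *
      covBivector (gram g c) (coordField ξ c) i j z) *
        (Matrix.of fun m n => (![stdFrame 4 i, stdFrame 4 j, v 0, v 1] m : E4) n).det) y :=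
    (ContDiffAt.sum fun i _ => ContDiffAt.sum fun j _ => ((contDiffAt_volume hε hc hy).mul
      (h.contDiffAt_covBivector hy i j)).mul contDiffAt_const).neg
  refine h1.congr_of_eventuallyEq ?_
  filter_upwards [h.eventually_mem hy] with z hz
  exact inChart_komarForm hg ε hξ hc hz v

/-- The divergence of the Killing bivector, as a vector. -/
def killingDivergence (G : E4 → Matrix (Fin 4) (Fin 4) ℝ) (X : E4 → E4) (y : E4) : E4 :=
  WithLp.toLp 2 fun m => ∑ i, (pd i (covBivector G X i m) y +
    (∑ l, christoffel G l l i y) * covBivector G X i m y)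

/-- The exterior derivative of the Komar form in coordinates. -/
theorem inChart_d_komarForm (hg : IsLorentzMetric g) {ε : Form (𝓡 4) M 4}
    (hε : IsVolumeElement g ε) (hξ : IsKillingField g ξ) (hc : c ∈ atlas E4 M)
    (hy : y ∈ c.target) (u v w : E4) :
    Form.inChart (𝓡 4) (Form.d (𝓡 4) (komarForm g ξ ε)) c y ![u, v, w] =
      2 * Form.inChart (𝓡 4) ε c y
        ![killingDivergence (gram g c) (coordField ξ c) y, u, v, w] := by
  have hk := hξ c hc
  have hs := smoothAt_komarForm hg hε hξ ((c.extend (𝓡 4)).symm y)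
  set e : E4 → ℝ := fun z => Form.inChart (𝓡 4) ε c z (stdFrame 4) with he
  set A := covBivector (gram g c) (coordField ξ c) with hA
  have hed : DifferentiableAt ℝ e y := (contDiffAt_volume hε hc hy).differentiableAt (by simp)
  have hAd : ∀ i j, DifferentiableAt ℝ (A i j) y := fun i j =>
    (hk.contDiffAt_covBivector hy i j).differentiableAt (by simp)
  let p : Fin 4 → Fin 4 → Fin 4 → ℝ := fun k i j => pd k (fun z => e z * A i j z) y
  have hp : ∀ k i j, p k i j = -p k j i := by
    intro k i j
    simp only [p]
    rw [← pd_neg]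
    refine pd_congr ?_
    filter_upwards [hk.eventually_mem hy] with z hz
    rw [hA, hk.covBivector_antisymm hz i j]
    ring
  have hD : ∀ a u v : E4, fderiv ℝ (fun z => Form.inChart (𝓡 4) (komarForm g ξ ε) c z ![u, v]) y a =
      -∑ k, a k * ∑ i, ∑ j, p k i j *
        (Matrix.of fun m n => (![stdFrame 4 i, stdFrame 4 j, u, v] m : E4) n).det := by
    intro a u v
    rw [fderiv_apply_eq_sum_pd, ← Finset.sum_neg_distrib]
    refine Finset.sum_congr rfl fun k _ => ?_
    rw [pd_congr (h := fun z => -∑ i, ∑ j, (e z * A i j z) *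
        (Matrix.of fun m n => (![stdFrame 4 i, stdFrame 4 j, u, v] m : E4) n).det)
      ((hk.eventually_mem hy).mono fun z hz => inChart_komarForm hg ε hξ hc hz ![u, v]), pd_neg,
      mul_neg, pd_sum fun i _ => DifferentiableAt.fun_sum fun j _ =>
        (hed.fun_mul (hAd i j)).mul_const _]
    congr 2
    refine Finset.sum_congr rfl fun i _ => ?_
    rw [pd_sum fun j _ => (hed.fun_mul (hAd i j)).mul_const _]
    refine Finset.sum_congr rfl fun j _ => ?_
    rw [pd_mul (hed.fun_mul (hAd i j)) (differentiableAt_const _)]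
    simp [pd, p]
  have hdet := divergence_det p hp u v w
  have hV : (WithLp.toLp 2 (fun m => ∑ i, p i i m) : E4) =
      e y • killingDivergence (gram g c) (coordField ξ c) y := by
    ext m
    simp only [killingDivergence, PiLp.smul_apply, smul_eq_mul, Finset.mul_sum]
    refine Finset.sum_congr rfl fun i _ => ?_
    simp only [p]
    rw [pd_mul hed (hAd i m), hk.pd_density hy hed
      (Eventually.of_forall fun z => inChart_volume_sq hg hε c z) i]
    ring
  rw [inChart_d_model hc hy hs, extDeriv_two_apply
    ((contDiffAt_inChart hc hy hs).differentiableAt (by simp)), hD, hD, hD,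
    inChart_volume_apply]
  rw [hV] at hdet
  have hsm : (Matrix.of fun m n => (![e y • killingDivergence (gram g c) (coordField ξ c) y,
      u, v, w] m : E4) n).det = e y * (Matrix.of fun m n =>
        (![killingDivergence (gram g c) (coordField ξ c) y, u, v, w] m : E4) n).det := by
    rw [det_laplace, det_laplace]
    simp only [PiLp.smul_apply, smul_eq_mul]
    ring
  rw [hsm] at hdet
  linear_combination -hdet

/-- The contraction `g^{ij} F(a, f_i) F(u, f_j)`. -/
def stressContraction (b : E4 →L[ℝ] E4 →L[ℝ] ℝ) (F : E4 [⋀^Fin 2]→L[ℝ] ℝ) (f : Fin 4 → E4)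
    (a u : E4) : ℝ :=
  ∑ i, ∑ j, (gramOf b f)⁻¹ i j * (bilinOfForm F a (f i) * bilinOfForm F u (f j))

theorem stressContraction_frame (b : E4 →L[ℝ] E4 →L[ℝ] ℝ) (F : E4 [⋀^Fin 2]→L[ℝ] ℝ)
    {f : Fin 4 → E4} (hf : (frameMatrix f).det ≠ 0) (a u : E4) :
    stressContraction b F f a u = stressContraction b F (stdFrame 4) a u := by
  let β : E4 →ₗ[ℝ] E4 →ₗ[ℝ] ℝ := LinearMap.mk₂ ℝ
    (fun p q => bilinOfForm F a p * bilinOfForm F u q)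
    (by intros; simp [add_mul]) (by intros; simp [mul_assoc]) (by intros; simp [mul_add])
    (by intros; simp [mul_left_comm])
  have h : ∀ f : Fin 4 → E4, stressContraction b F f a u =
      ((gramOf b f)⁻¹ * (Matrix.of fun i j => β (f i) (f j))ᵀ).trace := by
    intro f
    simp only [Matrix.trace, Matrix.diag, Matrix.mul_apply, Matrix.transpose_apply]
    rfl
  rw [h, h, bilinear_frame β f, gramOf_frame, trace_congruence' hf]

theorem stressContraction_frameMap (b : E4 →L[ℝ] E4 →L[ℝ] ℝ) (F : E4 [⋀^Fin 2]→L[ℝ] ℝ)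
    (f h : Fin 4 → E4) (a u : E4) : stressContraction b F f a (frameMap h u) =
      ∑ m, u m * stressContraction b F f a (h m) := by
  unfold stressContraction
  rw [frameMap_apply]
  simp only [map_sum, map_smul, LinearMap.sum_apply, LinearMap.smul_apply, smul_eq_mul,
    Finset.mul_sum]
  rw [Finset.sum_comm' (t' := Finset.univ) (s' := fun _ => Finset.univ) (by simp)]
  conv_rhs => rw [Finset.sum_comm]
  rw [Finset.sum_comm]
  refine Finset.sum_congr rfl fun i _ => ?_
  conv_rhs => rw [Finset.sum_comm]
  exact Finset.sum_congr rfl fun j _ => Finset.sum_congr rfl fun m _ => by ring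

theorem stress_of_frame (b : E4 →L[ℝ] E4 →L[ℝ] ℝ) (F : E4 [⋀^Fin 2]→L[ℝ] ℝ) {f : Fin 4 → E4}
    (hf : (frameMatrix f).det ≠ 0) {a V : E4} {Q : ℝ}
    (h : ∀ j, b V (f j) = 4 * stressContraction b F f a (f j) - Q * b a (f j)) (u : E4) :
    b V u = 4 * stressContraction b F (stdFrame 4) a u - Q * b a u := by
  obtain ⟨u, rfl⟩ := frameMap_surjective hf u
  rw [← stressContraction_frame b F hf, stressContraction_frameMap, Finset.mul_sum]
  have h1 : ∀ a : E4, b a (frameMap f u) = ∑ m, u m * b a (f m) := by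
    intro a
    rw [frameMap_apply]
    simp
  rw [h1, h1, Finset.mul_sum, ← Finset.sum_sub_distrib]
  refine Finset.sum_congr rfl fun m _ => ?_
  rw [h]
  ring

/-- The pointwise identity behind the conservation law. -/
theorem poynting (b : E4 →L[ℝ] E4 →L[ℝ] ℝ) (ε : E4 [⋀^Fin 4]→L[ℝ] ℝ) (F : E4 [⋀^Fin 2]→L[ℝ] ℝ)
    {f : Fin 4 → E4} (hf : gramOf b f = minkowski) (hsymm : ∀ u v, b u v = b v u) {Q : ℝ} {a V : E4}
    (hV : ∀ u, b V u = 4 * stressContraction b F (stdFrame 4) a u - Q * b a u) (v w : E4) :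
    ε ![V, a, v, w] = -4 * (F ![a, v] * hodgeSum b ε F (stdFrame 4) ![a, w] -
      F ![a, w] * hodgeSum b ε F (stdFrame 4) ![a, v]) := by
  have hd := det_frameMatrix_ne_zero hf
  obtain ⟨a, rfl⟩ := frameMap_surjective hd a
  obtain ⟨V, rfl⟩ := frameMap_surjective hd V
  obtain ⟨v, rfl⟩ := frameMap_surjective hd v
  obtain ⟨w, rfl⟩ := frameMap_surjective hd w
  let φ : Fin 4 → Fin 4 → ℝ := fun i j => bilinOfForm F (f i) (f j)
  have hvol : ∀ p q r s : E4, ε ![frameMap f p, frameMap f q, frameMap f r, frameMap f s] =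
      ε f * (Matrix.of fun m n => (![p, q, r, s] m : E4) n).det := by
    intro p q r s
    rw [← volume_frame]
    congr 1
    funext i
    fin_cases i <;> rfl
  have hF : ∀ p q : E4, F ![frameMap f p, frameMap f q] = ∑ i, ∑ j, p i * q j * φ i j :=
    fun p q => bilinear_frameMap (bilinOfForm F) f p q
  have hb : ∀ p m, b (frameMap f p) (f m) = minkowski m m * p m := by
    intro p m
    have h1 := bilinear_frameMap (bilinOfCLM b) f p (stdFrame 4 m)
    rw [frameMap_stdFrame] at h1
    refine h1.trans ?_
    have h2 : ∀ i j, bilinOfCLM b (f i) (f j) = minkowski i j := fun i j => by rw [← hf]; rfl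
    simp only [h2]
    simp [stdFrame, minkowski, mul_comm]
  rw [hvol, hF, hF]
  refine poynting_components (ε f) Q φ (fun i j => ?_) a V v w
    (fun u v => hodgeSum b ε F (stdFrame 4) ![frameMap f u, frameMap f v]) (fun u v => ?_)
    (fun m => ?_)
  · have h1 : F (fun k => ![f j, f i] (Equiv.swap 0 1 k)) = -F ![f j, f i] :=
      F.toAlternatingMap.map_swap _ (by decide)
    have h2 : (fun k => ![f j, f i] (Equiv.swap 0 1 k)) = ![f i, f j] := by
      funext k; fin_cases k <;> rfl
    rw [h2] at h1
    exact h1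
  · rw [← hodgeSum_frame b ε F hd, hodgeSum, hf, minkowski_inv]
    congr 1
    refine Finset.sum_congr rfl fun i _ => Finset.sum_congr rfl fun j _ =>
      Finset.sum_congr rfl fun k _ => Finset.sum_congr rfl fun l _ => ?_
    rw [← hvol, frameMap_stdFrame, frameMap_stdFrame]
    rfl
  · rw [← hb, ← hb, hV, ← stressContraction_frame b F hd, stressContraction, hf, minkowski_inv]
    congr 2
    refine Finset.sum_congr rfl fun i _ => Finset.sum_congr rfl fun j _ => ?_
    have h1 := bilinear_frameMap (bilinOfForm F) f a (stdFrame 4 i)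
    rw [frameMap_stdFrame] at h1
    rw [h1]
    simp [stdFrame, φ]
    ring

/-- For a solution of the Einstein-Maxwell equations the exterior derivative of the Komar form of a
Killing field is given by the electromagnetic potentials. -/
theorem d_komarForm_apply (hg : IsLorentzMetric g) {ε : Form (𝓡 4) M 4}
    (hε : IsVolumeElement g ε) {F : Form (𝓡 4) M 2} (hEM : IsEinsteinMaxwell g ε F)
    (hξ : IsKillingField g ξ) (x : M) (v w : TangentSpace (𝓡 4) x) :
    Form.d (𝓡 4) (komarForm g ξ ε) x ![ξ x, v, w] =
      -4 * (F x ![ξ x, v] * hodge g ε F x ![ξ x, w] -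
        F x ![ξ x, w] * hodge g ε F x ![ξ x, v]) := by
  revert v w
  have hc := chart_mem_atlas E4 x
  obtain ⟨y, hy, hx⟩ : ∃ y, y ∈ (chartAt E4 x).target ∧ ((chartAt E4 x).extend (𝓡 4)).symm y = x :=
    ⟨_, by rw [← extend_target_model]; exact extend_mem_target (𝓡 4) (mem_chart_source E4 x),
      extend_left_inv' (𝓡 4) (mem_chart_source E4 x)⟩
  generalize chartAt E4 x = c at hc hy hx
  subst hx
  set x := (c.extend (𝓡 4)).symm y with hx
  intro v w
  have hk := hξ c hc
  set X := coordField ξ c with hX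
  have hdc := det_coordFrame_ne_zero hc hy
  have hframe : ∀ u : E4, frameMap (coordFrame c y) u = chartFrame (𝓡 4) c y u :=
    frameMap_coordFrame c y
  have hξx : frameMap (coordFrame c y) (X y) = ξ x :=
    (hframe _).trans (chartFrame_coordField hc hy)
  obtain ⟨p, hp⟩ := frameMap_surjective hdc v
  obtain ⟨q, hq⟩ := frameMap_surjective hdc w
  set D := killingDivergence (gram g c) X y with hDdef
  set V : E4 := frameMap (coordFrame c y) ((2 : ℝ) • D) with hVdef
  have hleft : Form.d (𝓡 4) (komarForm g ξ ε) x ![ξ x, v, w] = ε x ![V, ξ x, v, w] := by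
    have h1 := inChart_d_komarForm hg hε hξ hc hy (X y) p q
    have h2 : Form.inChart (𝓡 4) (Form.d (𝓡 4) (komarForm g ξ ε)) c y ![X y, p, q] =
        Form.d (𝓡 4) (komarForm g ξ ε) x ![ξ x, v, w] := by
      refine congrArg (Form.d (𝓡 4) (komarForm g ξ ε) x) (funext fun i => ?_)
      fin_cases i
      · exact (hframe _).symm.trans hξx
      · exact (hframe _).symm.trans hp
      · exact (hframe _).symm.trans hq
    have h3 : Form.inChart (𝓡 4) ε c y ![(2 : ℝ) • D, X y, p, q] = ε x ![V, ξ x, v, w] := by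
      refine congrArg (ε x) (funext fun i => ?_)
      fin_cases i
      · exact (hframe _).symm
      · exact (hframe _).symm.trans hξx
      · exact (hframe _).symm.trans hp
      · exact (hframe _).symm.trans hq
    rw [← h2, ← h3, h1]
    rw [inChart_volume_apply, inChart_volume_apply ε c y ![(2 : ℝ) • D, X y, p, q], det_laplace,
      det_laplace]
    simp only [PiLp.smul_apply, smul_eq_mul]
    ring
  obtain ⟨f, hf, -⟩ := exists_minkowski_frame hg x
  let R : ℝ := ∑ a, ∑ b, (gram g c y)⁻¹ a b * ricci (gram g c) a b y
  let Q₀ : ℝ := ∑ a, ∑ b, ∑ e, ∑ d, (gram g c y)⁻¹ a e * (gram g c y)⁻¹ b d * comps F c y a b *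
    comps F c y e d
  have hric : ∀ l j, ricci (gram g c) l j y = 2 * (∑ a, ∑ b, (gram g c y)⁻¹ a b *
      comps F c y l a * comps F c y j b) - (1 / 2) * (Q₀ - R) * gram g c y l j := by
    intro l j
    have h1 := hEM.einstein_eq c hc y hy l j
    simp only [einstein, maxwellStress] at h1
    have hπ := Real.pi_ne_zero
    have h2 : 8 * Real.pi * (1 / (4 * Real.pi) * ((∑ a, ∑ b, (gram g c y)⁻¹ a b *
        comps F c y l a * comps F c y j b) - 1 / 4 * gram g c y l j * Q₀)) =
        2 * ((∑ a, ∑ b, (gram g c y)⁻¹ a b * comps F c y l a * comps F c y j b) -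
          1 / 4 * gram g c y l j * Q₀) := by
      field_simp
      ring
    have h3 := h1.trans h2
    change _ - 1 / 2 * R * _ = _ at h3
    linear_combination h3
  have hcomps : ∀ i j, comps F c y i j =
      bilinOfForm (F x) (coordFrame c y i) (coordFrame c y j) := by
    intro i j
    refine congrArg (F x) (funext fun k => ?_)
    fin_cases k <;> rfl
  have hVj : ∀ j, g x V (coordFrame c y j) =
      4 * stressContraction (g x) (F x) (coordFrame c y) (ξ x) (coordFrame c y j) -
        (Q₀ - R) * g x (ξ x) (coordFrame c y j) := by
    intro j
    have hgj : ∀ u : E4, g x (frameMap (coordFrame c y) u) (coordFrame c y j) =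
        ∑ m, u m * gram g c y m j := by
      intro u
      have h1 := bilinear_frameMap (bilinOfCLM (g x)) (coordFrame c y) u (stdFrame 4 j)
      rw [frameMap_stdFrame] at h1
      refine h1.trans ?_
      refine Finset.sum_congr rfl fun m _ => ?_
      simp only [stdFrame, EuclideanSpace.single_apply, mul_ite, mul_one, mul_zero, ite_mul,
        zero_mul, Finset.sum_ite_eq', Finset.sum_ite_eq, Finset.mem_univ, if_true]
      rfl
    have h1 := hk.divergence_covBivector hy j
    have h2 : g x V (coordFrame c y j) = 2 * ∑ l, ricci (gram g c) l j y * X y l := by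
      rw [← h1]
      refine (hgj _).trans ?_
      rw [Finset.mul_sum]
      refine Finset.sum_congr rfl fun m _ => ?_
      simp only [PiLp.smul_apply, smul_eq_mul, hDdef, killingDivergence]
      ring
    have h3 : stressContraction (g x) (F x) (coordFrame c y) (ξ x) (coordFrame c y j) =
        ∑ l, X y l * ∑ a, ∑ b, (gram g c y)⁻¹ a b * comps F c y l a * comps F c y j b := by
      have h4 : ∀ a, bilinOfForm (F x) (ξ x) (coordFrame c y a) =
          ∑ l, X y l * comps F c y l a := by
        intro a
        have h5 := bilinear_frameMap (bilinOfForm (F x)) (coordFrame c y) (X y) (stdFrame 4 a)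
        rw [frameMap_stdFrame, hξx] at h5
        refine h5.trans ?_
        refine Finset.sum_congr rfl fun m _ => ?_
        simp only [stdFrame, EuclideanSpace.single_apply, mul_ite, mul_one, mul_zero, ite_mul,
          zero_mul, Finset.sum_ite_eq', Finset.sum_ite_eq, Finset.mem_univ, if_true, hcomps]
      have hgr : gramOf (g x) (coordFrame c y) = gram g c y := rfl
      unfold stressContraction
      simp only [h4, hgr, ← hcomps, Finset.mul_sum, Finset.sum_mul]
      have hcomm : ∀ T : Fin 4 → Fin 4 → Fin 4 → ℝ, ∑ i, ∑ j, ∑ l, T i j l =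
          ∑ l, ∑ i, ∑ j, T i j l := fun T => by
        rw [Finset.sum_comm' (s' := fun _ => Finset.univ) (t' := Finset.univ) (by simp)]
        rw [Finset.sum_comm]
        conv_rhs => rw [Finset.sum_comm]
        refine Finset.sum_congr rfl fun i _ => Finset.sum_comm
      rw [hcomm]
      exact Finset.sum_congr rfl fun l _ => Finset.sum_congr rfl fun a _ =>
        Finset.sum_congr rfl fun b _ => by ring
    have h6 : g x (ξ x) (coordFrame c y j) = ∑ m, X y m * gram g c y m j :=
      (congrArg (fun t => g x t (coordFrame c y j)) hξx.symm).trans (hgj _)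
    rw [h2, h3, h6, Finset.mul_sum, Finset.mul_sum, Finset.mul_sum, ← Finset.sum_sub_distrib]
    refine Finset.sum_congr rfl fun l _ => ?_
    rw [hric]
    ring
  have hV : ∀ u : E4, g x V u =
      4 * stressContraction (g x) (F x) (stdFrame 4) (ξ x) u - (Q₀ - R) * g x (ξ x) u := stress_of_frame (g x) (F x) hdc hVj
  have hfin := poynting (g x) (ε x) (F x) hf (hg.symm x) hV v w
  rw [hleft, hodge_eq_hodgeSum, hodge_eq_hodgeSum]
  exact hfin

end Komar

/-! ### The regularised angular momentum form -/

section Regularised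

/-- The dual 1-form of `X` in coordinates. -/
def coordLower (G : E4 → Matrix (Fin 4) (Fin 4) ℝ) (X : E4 → E4) (z u : E4) : ℝ :=
  ∑ l, u l * ∑ m, G z l m * X z m

/-- The 1-form `½ (a db - b da)` in coordinates. -/
def coordGamma (a b : E4 → ℝ) (z u : E4) : ℝ :=
  (1 / 2) * (a z * fderiv ℝ b z u - b z * fderiv ℝ a z u)

theorem fderiv_mul_sub_mul {h p q r s : E4 → ℝ} {y : E4} (hh : DifferentiableAt ℝ h y)
    (hp : DifferentiableAt ℝ p y) (hq : DifferentiableAt ℝ q y) (hr : DifferentiableAt ℝ r y)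
    (hs : DifferentiableAt ℝ s y) (a : E4) :
    fderiv ℝ (fun z => h z * (p z * q z - r z * s z)) y a =
      fderiv ℝ h y a * (p y * q y - r y * s y) + h y * (fderiv ℝ p y a * q y + p y * fderiv ℝ q y a
        - fderiv ℝ r y a * s y - r y * fderiv ℝ s y a) := by
  rw [fderiv_fun_mul hh ((hp.fun_mul hq).fun_sub (hr.fun_mul hs)),
    fderiv_fun_sub (hp.fun_mul hq) (hr.fun_mul hs), fderiv_fun_mul hp hq, fderiv_fun_mul hr hs]
  simp
  ring

section

variable {a b : E4 → ℝ} {y : E4}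

theorem fderiv_coordGamma (ha : ContDiffAt ℝ ∞ a y) (hb : ContDiffAt ℝ ∞ b y) (u v : E4) :
    fderiv ℝ (fun z => coordGamma a b z u) y v = (1 / 2) *
      (fderiv ℝ a y v * fderiv ℝ b y u + a y * fderiv ℝ (fderiv ℝ b) y v u
        - fderiv ℝ b y v * fderiv ℝ a y u - b y * fderiv ℝ (fderiv ℝ a) y v u) := by
  have h1 : ∀ {f : E4 → ℝ}, ContDiffAt ℝ ∞ f y → DifferentiableAt ℝ (fderiv ℝ f) y := fun hf =>
    (hf.fderiv_right (m := 1) (ENat.LEInfty.out : (2 : WithTop ℕ∞) ≤ ∞)).differentiableAt (by simp)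
  have h2 : ∀ {f : E4 → ℝ}, ContDiffAt ℝ ∞ f y →
      HasFDerivAt (fun z => fderiv ℝ f z u) ((fderiv ℝ (fderiv ℝ f) y).flip u) y := fun hf => by
    have := (h1 hf).hasFDerivAt.clm_apply (hasFDerivAt_const u y)
    simpa using this
  have hda := ha.differentiableAt (by simp)
  have hdb := hb.differentiableAt (by simp)
  have h3 := (((hda.hasFDerivAt.mul (h2 hb)).sub (hdb.hasFDerivAt.mul (h2 ha))).const_mul (1 / 2)).fderiv
  have h4 := congrArg (fun L => L v) h3
  refine h4.trans ?_
  simp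
  ring

theorem contDiffAt_coordGamma (ha : ContDiffAt ℝ ∞ a y) (hb : ContDiffAt ℝ ∞ b y) (u : E4) :
    ContDiffAt ℝ ∞ (fun z => coordGamma a b z u) y :=
  contDiffAt_const.mul ((ha.mul ((hb.fderiv_right (m := ∞) (by simp)).clm_apply contDiffAt_const)).sub
    (hb.mul ((ha.fderiv_right (m := ∞) (by simp)).clm_apply contDiffAt_const)))

theorem fderiv_fderiv_symm (ha : ContDiffAt ℝ ∞ a y) (u v : E4) :
    fderiv ℝ (fderiv ℝ a) y u v = fderiv ℝ (fderiv ℝ a) y v u :=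
  ((ha.of_le (ENat.LEInfty.out : (2 : WithTop ℕ∞) ≤ ∞)).isSymmSndFDerivAt (by simp)).eq u v

theorem fderiv_fderiv_field {X : E4 → E4} (ha : ContDiffAt ℝ ∞ a y) (hX : DifferentiableAt ℝ X y)
    (h : ∀ᶠ z in 𝓝 y, fderiv ℝ a z (X z) = 0) (v : E4) :
    fderiv ℝ (fderiv ℝ a) y v (X y) + fderiv ℝ a y (fderiv ℝ X y v) = 0 := by
  have h1 : DifferentiableAt ℝ (fderiv ℝ a) y :=
    (ha.fderiv_right (m := 1) (ENat.LEInfty.out : (2 : WithTop ℕ∞) ≤ ∞)).differentiableAt (by simp)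
  have h2 := (h1.hasFDerivAt.clm_apply hX.hasFDerivAt).fderiv
  have h3 : fderiv ℝ (fun z => fderiv ℝ a z (X z)) y = 0 := by
    rw [Filter.EventuallyEq.fderiv_eq (f₁ := fun z => fderiv ℝ a z (X z)) (f := fun _ => 0) h]
    simp
  rw [h3] at h2
  have h4 := congrArg (fun L => L v) h2
  simp at h4
  linarith

end

variable {W : Set E4} {G : E4 → Matrix (Fin 4) (Fin 4) ℝ} {X : E4 → E4} {y : E4}

namespace IsKillingOn

theorem contDiffAt_coordLower (h : IsKillingOn W G X) (hy : y ∈ W) {u : E4 → E4}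
    (hu : ContDiffAt ℝ ∞ u y) : ContDiffAt ℝ ∞ (fun z => coordLower G X z (u z)) y :=
  ContDiffAt.sum fun l _ => ((EuclideanSpace.proj (𝕜 := ℝ) l : E4 →L[ℝ] ℝ).contDiff.contDiffAt.comp y
    hu).mul (ContDiffAt.sum fun m _ => (h.metric y hy l m).mul (h.field_apply hy m))

theorem fderiv_field_apply (h : IsKillingOn W G X) (hy : y ∈ W) (v : E4) (i : Fin 4) :
    fderiv ℝ X y v i = ∑ k, v k * pd k (fun z => X z i) y := by
  have h1 := ((EuclideanSpace.proj (𝕜 := ℝ) i : E4 →L[ℝ] ℝ).hasFDerivAt.comp y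
    ((h.field y hy).differentiableAt (by simp)).hasFDerivAt).fderiv
  rw [← fderiv_apply_eq_sum_pd]
  exact (congrArg (fun L => L v) h1).symm

/-- The Lie derivative of the dual 1-form along a Killing field vanishes. -/
theorem fderiv_coordLower_field (h : IsKillingOn W G X) (hy : y ∈ W) (u : E4) :
    fderiv ℝ (fun z => coordLower G X z u) y (X y) + coordLower G X y (fderiv ℝ X y u) = 0 := by
  have hX : ∀ i, DifferentiableAt ℝ (fun z => X z i) y := fun i =>
    (h.field_apply hy i).differentiableAt (by simp)
  have hG : ∀ i j, DifferentiableAt ℝ (fun z => G z i j) y := fun i j =>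
    (h.metric y hy i j).differentiableAt (by simp)
  have h1 : ∀ k, pd k (fun z => coordLower G X z u) y = ∑ i, ∑ j,
      u i * (pd k (fun z => G z i j) y * X y j + G y i j * pd k (fun z => X z j) y) := by
    intro k
    unfold coordLower
    rw [pd_sum fun i _ => (DifferentiableAt.fun_sum fun j _ => (hG i j).fun_mul (hX j)).const_mul _]
    refine Finset.sum_congr rfl fun i _ => ?_
    rw [pd_const_mul _ (DifferentiableAt.fun_sum fun j _ => (hG i j).fun_mul (hX j)),
      pd_sum fun j _ => (hG i j).fun_mul (hX j), Finset.mul_sum]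
    exact Finset.sum_congr rfl fun j _ => by rw [pd_mul (hG i j) (hX j)]
  rw [fderiv_apply_eq_sum_pd]
  simp only [h1]
  simp only [coordLower, h.fderiv_field_apply hy]
  have h2 : ∑ i, ∑ j, u i * X y j * (∑ k, X y k * pd k (fun z => G z i j) y +
      ∑ k, G y k j * pd i (fun z => X z k) y + ∑ k, G y i k * pd j (fun z => X z k) y) = 0 := by
    simp only [h.killing y hy, mul_zero, Finset.sum_const_zero]
  rw [← h2]
  have rot : ∀ T : Fin 4 → Fin 4 → Fin 4 → ℝ, ∑ k, ∑ i, ∑ j, T k i j = ∑ i, ∑ j, ∑ k, T k i j := by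
    intro T
    rw [Finset.sum_comm]
    exact Finset.sum_congr rfl fun i _ => Finset.sum_comm
  simp only [mul_add, Finset.sum_add_distrib, Finset.mul_sum, Finset.sum_mul]
  have e1 : ∑ k, ∑ i, ∑ j, X y k * (u i * (pd k (fun z => G z i j) y * X y j)) =
      ∑ i, ∑ j, ∑ k, u i * X y j * (X y k * pd k (fun z => G z i j) y) := by
    rw [rot]
    exact Finset.sum_congr rfl fun i _ => Finset.sum_congr rfl fun j _ =>
      Finset.sum_congr rfl fun k _ => by ring
  have e2 : ∑ k, ∑ i, ∑ j, X y k * (u i * (G y i j * pd k (fun z => X z j) y)) =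
      ∑ i, ∑ j, ∑ k, u i * X y j * (G y i k * pd j (fun z => X z k) y) := by
    rw [Finset.sum_comm]
    exact Finset.sum_congr rfl fun i _ => Finset.sum_congr rfl fun j _ =>
      Finset.sum_congr rfl fun k _ => by ring
  have e3 : ∑ l, ∑ m, ∑ k, u k * pd k (fun z => X z l) y * (G y l m * X y m) =
      ∑ i, ∑ j, ∑ k, u i * X y j * (G y k j * pd i (fun z => X z k) y) := by
    rw [← rot]
    refine Finset.sum_congr rfl fun l _ => ?_
    rw [Finset.sum_comm]
    exact Finset.sum_congr rfl fun j _ => Finset.sum_congr rfl fun k _ => by ring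
  linear_combination e1 + e2 + e3

theorem fderiv_norm (h : IsKillingOn W G X) (hy : y ∈ W) (v : E4) :
    fderiv ℝ (fun z => coordLower G X z (X z)) y v =
      fderiv ℝ (fun z => coordLower G X z (X y)) y v + coordLower G X y (fderiv ℝ X y v) := by
  have hX : ∀ i, DifferentiableAt ℝ (fun z => X z i) y := fun i =>
    (h.field_apply hy i).differentiableAt (by simp)
  have hG : ∀ i j, DifferentiableAt ℝ (fun z => G z i j) y := fun i j =>
    (h.metric y hy i j).differentiableAt (by simp)
  have hl : ∀ i, DifferentiableAt ℝ (fun z => ∑ m, G z i m * X z m) y := fun i =>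
    DifferentiableAt.fun_sum fun j _ => (hG i j).fun_mul (hX j)
  rw [fderiv_apply_eq_sum_pd, fderiv_apply_eq_sum_pd]
  have h1 : ∀ k, pd k (fun z => coordLower G X z (X z)) y = pd k (fun z => coordLower G X z (X y)) y
      + ∑ l, pd k (fun z => X z l) y * ∑ m, G y l m * X y m := by
    intro k
    unfold coordLower
    rw [pd_sum fun i _ => (hX i).fun_mul (hl i), pd_sum fun i _ => (hl i).const_mul _,
      ← Finset.sum_add_distrib]
    refine Finset.sum_congr rfl fun i _ => ?_
    rw [pd_mul (hX i) (hl i), pd_const_mul _ (hl i)]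
    ring
  simp only [h1, mul_add, Finset.sum_add_distrib]
  congr 1
  simp only [coordLower, h.fderiv_field_apply hy, Finset.sum_mul, Finset.mul_sum]
  rw [Finset.sum_comm]
  refine Finset.sum_congr rfl fun i _ => ?_
  rw [Finset.sum_comm]
  refine Finset.sum_congr rfl fun j _ => Finset.sum_congr rfl fun k _ => by ring

theorem coordLower_neg_fderiv (h : IsKillingOn W G X) (hy : y ∈ W) (v : E4) :
    fderiv ℝ (fun z => coordLower G X z (X z)) y v =
      fderiv ℝ (fun z => coordLower G X z (X y)) y v - fderiv ℝ (fun z => coordLower G X z v) y (X y) := by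
  rw [h.fderiv_norm hy]
  linarith [h.fderiv_coordLower_field hy v]

/-- The exterior derivative of `γ ∧ η / (|η|² + δ)`, contracted with the Killing field. -/
theorem d_regularised (h : IsKillingOn W G X) (hy : y ∈ W) {a b : E4 → ℝ}
    (ha : ContDiffAt ℝ ∞ a y) (hb : ContDiffAt ℝ ∞ b y)
    (ha0 : ∀ᶠ z in 𝓝 y, fderiv ℝ a z (X z) = 0) (hb0 : ∀ᶠ z in 𝓝 y, fderiv ℝ b z (X z) = 0)
    {δ : ℝ} (hδ : coordLower G X y (X y) + δ ≠ 0) (θ : E4 → E4 → E4 → ℝ)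
    (hθ : ∀ z u v, θ z u v = (coordLower G X z (X z) + δ)⁻¹ *
      (coordGamma a b z u * coordLower G X z v - coordGamma a b z v * coordLower G X z u))
    (v w : E4) :
    fderiv ℝ (fun z => θ z v w) y (X y) - fderiv ℝ (fun z => θ z (X y) w) y v +
      fderiv ℝ (fun z => θ z (X y) v) y w =
    coordLower G X y (X y) / (coordLower G X y (X y) + δ) *
      (fderiv ℝ a y v * fderiv ℝ b y w - fderiv ℝ a y w * fderiv ℝ b y v) +
    δ / (coordLower G X y (X y) + δ) ^ 2 *
      (fderiv ℝ (fun z => coordLower G X z (X z)) y v * coordGamma a b y w -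
        fderiv ℝ (fun z => coordLower G X z (X z)) y w * coordGamma a b y v) := by
  have hXd := (h.field y hy).differentiableAt (n := ∞) (by simp)
  have hγd : ∀ u, DifferentiableAt ℝ (fun z => coordGamma a b z u) y := fun u =>
    (contDiffAt_coordGamma ha hb u).differentiableAt (by simp)
  have hld : ∀ u, DifferentiableAt ℝ (fun z => coordLower G X z u) y := fun u =>
    (h.contDiffAt_coordLower hy (u := fun _ => u) contDiffAt_const).differentiableAt (by simp)
  have hfd : DifferentiableAt ℝ (fun z => coordLower G X z (X z)) y :=
    (h.contDiffAt_coordLower hy (h.field y hy)).differentiableAt (by simp)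
  have hhd : DifferentiableAt ℝ (fun z => (coordLower G X z (X z) + δ)⁻¹) y :=
    (hfd.add_const δ).inv hδ
  have hh : ∀ u, fderiv ℝ (fun z => (coordLower G X z (X z) + δ)⁻¹) y u =
      -((coordLower G X y (X y) + δ) ^ 2)⁻¹ * fderiv ℝ (fun z => coordLower G X z (X z)) y u := by
    intro u
    have := ((hasDerivAt_inv hδ).comp_hasFDerivAt y (hfd.hasFDerivAt.add_const δ)).fderiv
    have h5 : fderiv ℝ (fun z => (coordLower G X z (X z) + δ)⁻¹) y u =
        (-((coordLower G X y (X y) + δ) ^ 2)⁻¹ • fderiv ℝ (fun z => coordLower G X z (X z)) y) u :=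
      congrArg (fun L => L u) this
    rw [h5, ContinuousLinearMap.smul_apply, smul_eq_mul]
  have hD : ∀ p q u, fderiv ℝ (fun z => θ z p q) y u = _ := fun p q u =>
    (congrArg (fun f => fderiv ℝ f y u) (funext fun z => hθ z p q)).trans
      (fderiv_mul_sub_mul hhd (hγd p) (hld q) (hγd q) (hld p) u)
  have a0 := ha0.self_of_nhds
  have b0 := hb0.self_of_nhds
  have av := fderiv_fderiv_field ha hXd ha0 v
  have aw := fderiv_fderiv_field ha hXd ha0 w
  have bv := fderiv_fderiv_field hb hXd hb0 v
  have bw := fderiv_fderiv_field hb hXd hb0 w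
  have hγX : coordGamma a b y (X y) = 0 := by simp [coordGamma, a0, b0]
  have hfX : fderiv ℝ (fun z => coordLower G X z (X z)) y (X y) = 0 := by
    rw [h.coordLower_neg_fderiv hy]; ring
  have hfv := h.coordLower_neg_fderiv hy v
  have hfw := h.coordLower_neg_fderiv hy w
  rw [hD, hD, hD, hh, hh, hh, hγX, hfX, fderiv_coordGamma ha hb, fderiv_coordGamma ha hb,
    fderiv_coordGamma ha hb, fderiv_coordGamma ha hb, fderiv_coordGamma ha hb,
    fderiv_coordGamma ha hb, a0, b0, fderiv_fderiv_symm ha (X y) v, fderiv_fderiv_symm ha (X y) w,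
    fderiv_fderiv_symm hb (X y) v, fderiv_fderiv_symm hb (X y) w, fderiv_fderiv_symm ha w v,
    fderiv_fderiv_symm hb w v, hfv, hfw]
  generalize coordLower G X y (X y) = f at *
  field_simp
  ring

/-- The derivative of `γ ∧ η / (|η|² + δ)` vanishes where `γ` and `η` vanish. -/
theorem d_regularised_of_zero (h : IsKillingOn W G X) (hy : y ∈ W) {a b : E4 → ℝ}
    (ha : ContDiffAt ℝ ∞ a y) (hb : ContDiffAt ℝ ∞ b y) (hX0 : X y = 0)
    (ha0 : fderiv ℝ a y = 0) (hb0 : fderiv ℝ b y = 0)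
    {δ : ℝ} (hδ : coordLower G X y (X y) + δ ≠ 0) (θ : E4 → E4 → E4 → ℝ)
    (hθ : ∀ z u v, θ z u v = (coordLower G X z (X z) + δ)⁻¹ *
      (coordGamma a b z u * coordLower G X z v - coordGamma a b z v * coordLower G X z u))
    (u v w : E4) : fderiv ℝ (fun z => θ z v w) y u = 0 := by
  have hγd : ∀ u, DifferentiableAt ℝ (fun z => coordGamma a b z u) y := fun u =>
    (contDiffAt_coordGamma ha hb u).differentiableAt (by simp)
  have hld : ∀ u, DifferentiableAt ℝ (fun z => coordLower G X z u) y := fun u =>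
    (h.contDiffAt_coordLower hy (u := fun _ => u) contDiffAt_const).differentiableAt (by simp)
  have hfd : DifferentiableAt ℝ (fun z => coordLower G X z (X z)) y :=
    (h.contDiffAt_coordLower hy (h.field y hy)).differentiableAt (by simp)
  have hhd : DifferentiableAt ℝ (fun z => (coordLower G X z (X z) + δ)⁻¹) y :=
    (hfd.add_const δ).inv hδ
  rw [show (fun z => θ z v w) = _ from funext fun z => hθ z v w,
    fderiv_mul_sub_mul hhd (hγd v) (hld w) (hγd w) (hld v) u]
  have hl : ∀ u, coordLower G X y u = 0 := fun u => by simp [coordLower, hX0]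
  have hγ : ∀ u, coordGamma a b y u = 0 := fun u => by simp [coordGamma, ha0, hb0]
  simp [hl, hγ]

end IsKillingOn

end Regularised

section RegularForm

variable {M : Type*} [TopologicalSpace M] [ChartedSpace E4 M] [IsManifold (𝓡 4) ∞ M]
  {g : BilinField M} {ξ : VField (𝓡 4) M} {c : OpenPartialHomeomorph M E4} {y : E4}

theorem smoothAt_hodge {ε : Form (𝓡 4) M 4} (hε : IsVolumeElement g ε) (hξ : IsKillingField g ξ)
    {F : Form (𝓡 4) M 2} (hF : Form.IsSmooth (𝓡 4) F) (x : M) :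
    Form.SmoothAt (𝓡 4) (hodge g ε F) x := by
  refine smoothAt_of_inChart (fun c hc y hy => ?_) x
  have h := hξ c hc
  have hFc := contDiffAt_inChart hc hy (hF.smoothAt (𝓡 4) _)
  rw [← contDiffWithinAt_univ]
  refine contDiffWithinAt_alternating_of_apply fun v => ?_
  rw [contDiffWithinAt_univ]
  have hcomp : ∀ k l, ContDiffAt ℝ ∞ (fun z => comps F c z k l) y := fun k l =>
    (ContinuousAlternatingMap.apply ℝ E4 ℝ ![stdFrame 4 k, stdFrame 4 l]).contDiff.contDiffAt.comp y
      hFc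
  have h1 : ContDiffAt ℝ ∞ (fun y => (1 / 2) * ∑ i, ∑ j, ∑ k, ∑ l,
      (gram g c y)⁻¹ i k * (gram g c y)⁻¹ j l * comps F c y k l *
        (Form.inChart (𝓡 4) ε c y (stdFrame 4) *
          (Matrix.of fun m n => (![stdFrame 4 i, stdFrame 4 j, v 0, v 1] m : E4) n).det)) y :=
    contDiffAt_const.mul (ContDiffAt.sum fun i _ => ContDiffAt.sum fun j _ =>
      ContDiffAt.sum fun k _ => ContDiffAt.sum fun l _ =>
        (((h.contDiffAt_inv hy i k).mul (h.contDiffAt_inv hy j l)).mul (hcomp k l)).mul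
          ((contDiffAt_volume hε hc hy).mul contDiffAt_const))
  refine h1.congr_of_eventuallyEq ?_
  filter_upwards [h.eventually_mem hy] with z hz
  exact inChart_hodge g ε F hc hz v

/-- `γ ∧ η / (|η|² + δ)`. -/
def regularWedge (g : BilinField M) (ξ : VField (𝓡 4) M) (χ ψ : M → ℝ) (δ : ℝ) :
    Form (𝓡 4) M 2 := fun x =>
  (g x (ξ x) (ξ x) + δ)⁻¹ • wedge (V := E4) (gammaForm χ ψ x) (lower g ξ x)

/-- The regularised angular momentum form `*dη + 4 γ ∧ η / (|η|² + δ)`. -/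
def regularForm (g : BilinField M) (ξ : VField (𝓡 4) M) (ε : Form (𝓡 4) M 4) (χ ψ : M → ℝ) (δ : ℝ) :
    Form (𝓡 4) M 2 := fun x => komarForm g ξ ε x + (4 : ℝ) • regularWedge g ξ χ ψ δ x

theorem hasFDerivAt_comp_symm {χ : M → ℝ} (hc : c ∈ atlas E4 M) (hy : y ∈ c.target)
    (hχ : ContMDiffAt (𝓡 4) 𝓘(ℝ, ℝ) ∞ χ ((c.extend (𝓡 4)).symm y)) :
    HasFDerivAt (fun z => χ ((c.extend (𝓡 4)).symm z))
      ((differential (𝓡 4) χ ((c.extend (𝓡 4)).symm y)).comp (chartFrame (𝓡 4) c y)) y := by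
  have h1 := (hχ.mdifferentiableAt (by simp)).hasMFDerivAt.comp_hasMFDerivWithinAt y
    (hasMFDerivWithinAt_extend_symm (𝓡 4) hc (by rwa [extend_target_model]))
  rw [range_model, hasMFDerivWithinAt_univ] at h1
  exact h1.hasFDerivAt

theorem contDiffAt_comp_symm {χ : M → ℝ} (hc : c ∈ atlas E4 M) (hy : y ∈ c.target)
    (hχ : ContMDiffAt (𝓡 4) 𝓘(ℝ, ℝ) ∞ χ ((c.extend (𝓡 4)).symm y)) :
    ContDiffAt ℝ ∞ (fun z => χ ((c.extend (𝓡 4)).symm z)) y := by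
  rw [← extend_target_model] at hy
  have := contDiffWithinAt_comp_extend_symm (𝓡 4) hχ hc (extend_symm_mem_source (𝓡 4) hy)
  rwa [(c.extend (𝓡 4)).right_inv hy, range_model, contDiffWithinAt_univ] at this

theorem gammaForm_chartFrame {χ ψ : M → ℝ} (hc : c ∈ atlas E4 M) (hy : y ∈ c.target)
    (hχ : ContMDiffAt (𝓡 4) 𝓘(ℝ, ℝ) ∞ χ ((c.extend (𝓡 4)).symm y))
    (hψ : ContMDiffAt (𝓡 4) 𝓘(ℝ, ℝ) ∞ ψ ((c.extend (𝓡 4)).symm y)) (u : E4) :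
    gammaForm χ ψ ((c.extend (𝓡 4)).symm y) (chartFrame (𝓡 4) c y u) =
      coordGamma (fun z => χ ((c.extend (𝓡 4)).symm z)) (fun z => ψ ((c.extend (𝓡 4)).symm z)) y u := by
  rw [coordGamma, (hasFDerivAt_comp_symm hc hy hχ).fderiv, (hasFDerivAt_comp_symm hc hy hψ).fderiv]
  rfl

theorem lower_chartFrame (hg : IsLorentzMetric g) (hc : c ∈ atlas E4 M) (hy : y ∈ c.target)
    (u : E4) : lower g ξ ((c.extend (𝓡 4)).symm y) (chartFrame (𝓡 4) c y u) =
      coordLower (gram g c) (coordField ξ c) y u :=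
  inChart_lowerForm hg hc hy u

theorem norm_eq_coordLower (hg : IsLorentzMetric g) (hc : c ∈ atlas E4 M) (hy : y ∈ c.target) :
    g ((c.extend (𝓡 4)).symm y) (ξ ((c.extend (𝓡 4)).symm y)) (ξ ((c.extend (𝓡 4)).symm y)) =
      coordLower (gram g c) (coordField ξ c) y (coordField ξ c y) := by
  rw [← lower_chartFrame hg hc hy, chartFrame_coordField hc hy]
  rfl

theorem inChart_regularWedge (hg : IsLorentzMetric g) (hc : c ∈ atlas E4 M) (hy : y ∈ c.target)
    {χ ψ : M → ℝ} (hχ : ContMDiffAt (𝓡 4) 𝓘(ℝ, ℝ) ∞ χ ((c.extend (𝓡 4)).symm y))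
    (hψ : ContMDiffAt (𝓡 4) 𝓘(ℝ, ℝ) ∞ ψ ((c.extend (𝓡 4)).symm y)) (δ : ℝ) (u v : E4) :
    Form.inChart (𝓡 4) (regularWedge g ξ χ ψ δ) c y ![u, v] =
      (coordLower (gram g c) (coordField ξ c) y (coordField ξ c y) + δ)⁻¹ *
        (coordGamma (fun z => χ ((c.extend (𝓡 4)).symm z)) (fun z => ψ ((c.extend (𝓡 4)).symm z)) y u
            * coordLower (gram g c) (coordField ξ c) y v -
          coordGamma (fun z => χ ((c.extend (𝓡 4)).symm z)) (fun z => ψ ((c.extend (𝓡 4)).symm z)) y v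
            * coordLower (gram g c) (coordField ξ c) y u) := by
  rw [← norm_eq_coordLower hg hc hy, ← gammaForm_chartFrame hc hy hχ hψ u,
    ← gammaForm_chartFrame hc hy hχ hψ v, ← lower_chartFrame hg hc hy u,
    ← lower_chartFrame hg hc hy v]
  have h := wedge_apply (V := E4) (gammaForm χ ψ ((c.extend (𝓡 4)).symm y))
    (lower g ξ ((c.extend (𝓡 4)).symm y)) (chartFrame (𝓡 4) c y u) (chartFrame (𝓡 4) c y v)
  refine Eq.trans ?_ (congrArg (HMul.hMul _) h)
  refine congrArg (HMul.hMul _) (congrArg (wedge (V := E4) _ _) (funext fun i => ?_))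
  fin_cases i <;> rfl

variable {ε : Form (𝓡 4) M 4} {F : Form (𝓡 4) M 2} {U : Set M} {χ ψ : M → ℝ}

/-- The data of the conservation law: a solution of the Einstein-Maxwell equations with a Killing
field and electromagnetic potentials on an open set `U`. -/
structure IsConserved (g : BilinField M) (ξ : VField (𝓡 4) M) (ε : Form (𝓡 4) M 4)
    (F : Form (𝓡 4) M 2) (U : Set M) (χ ψ : M → ℝ) : Prop where
  lorentz : IsLorentzMetric g
  volume : IsVolumeElement g ε
  einsteinMaxwell : IsEinsteinMaxwell g ε F
  killing : IsKillingField g ξ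
  isOpen : IsOpen U
  electric : IsPotential ξ F χ U
  magnetic : IsPotential ξ (hodge g ε F) ψ U
  nonneg : ∀ x, 0 ≤ g x (ξ x) (ξ x)

namespace IsConserved

theorem contMDiffAt_electric (h : IsConserved g ξ ε F U χ ψ) {x : M} (hx : x ∈ U) :
    ContMDiffAt (𝓡 4) 𝓘(ℝ, ℝ) ∞ χ x :=
  h.electric.1.contMDiffAt (h.isOpen.mem_nhds hx)

theorem contMDiffAt_magnetic (h : IsConserved g ξ ε F U χ ψ) {x : M} (hx : x ∈ U) :
    ContMDiffAt (𝓡 4) 𝓘(ℝ, ℝ) ∞ ψ x :=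
  h.magnetic.1.contMDiffAt (h.isOpen.mem_nhds hx)

theorem eventually_mem (h : IsConserved g ξ ε F U χ ψ) (hc : c ∈ atlas E4 M) (hy : y ∈ c.target)
    (hU : (c.extend (𝓡 4)).symm y ∈ U) :
    ∀ᶠ z in 𝓝 y, z ∈ c.target ∧ (c.extend (𝓡 4)).symm z ∈ U := by
  have h1 : y ∈ (c.extend (𝓡 4)).target := by rwa [extend_target_model]
  have h2 : ContinuousWithinAt (c.extend (𝓡 4)).symm (range (𝓡 4)) y :=
    ((c.continuousOn_extend_symm (I := 𝓡 4)) _ h1).mono_of_mem_nhdsWithin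
      (extend_target_mem_nhdsWithin' (𝓡 4) h1)
  rw [range_model, continuousWithinAt_univ] at h2
  exact ((h.killing c hc).eventually_mem hy).and (h2 (h.isOpen.mem_nhds hU))

theorem fderiv_electric (h : IsConserved g ξ ε F U χ ψ) (hc : c ∈ atlas E4 M) (hy : y ∈ c.target)
    (hU : (c.extend (𝓡 4)).symm y ∈ U) (u : E4) :
    fderiv ℝ (fun z => χ ((c.extend (𝓡 4)).symm z)) y u =
      Form.inChart (𝓡 4) F c y ![coordField ξ c y, u] := by
  rw [(hasFDerivAt_comp_symm hc hy (h.contMDiffAt_electric hU)).fderiv]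
  refine (h.electric.2 _ hU _).trans ?_
  refine congrArg (F ((c.extend (𝓡 4)).symm y)) (funext fun i => ?_)
  fin_cases i
  · exact (chartFrame_coordField hc hy).symm
  · rfl

theorem fderiv_magnetic (h : IsConserved g ξ ε F U χ ψ) (hc : c ∈ atlas E4 M) (hy : y ∈ c.target)
    (hU : (c.extend (𝓡 4)).symm y ∈ U) (u : E4) :
    fderiv ℝ (fun z => ψ ((c.extend (𝓡 4)).symm z)) y u =
      Form.inChart (𝓡 4) (hodge g ε F) c y ![coordField ξ c y, u] := by
  rw [(hasFDerivAt_comp_symm hc hy (h.contMDiffAt_magnetic hU)).fderiv]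
  refine (h.magnetic.2 _ hU _).trans ?_
  refine congrArg (hodge g ε F ((c.extend (𝓡 4)).symm y)) (funext fun i => ?_)
  fin_cases i
  · exact (chartFrame_coordField hc hy).symm
  · rfl

theorem coordLower_nonneg (h : IsConserved g ξ ε F U χ ψ) (hc : c ∈ atlas E4 M) (hy : y ∈ c.target) :
    0 ≤ coordLower (gram g c) (coordField ξ c) y (coordField ξ c y) := by
  rw [← norm_eq_coordLower h.lorentz hc hy]
  exact h.nonneg _

theorem contDiffAt_regularWedge (h : IsConserved g ξ ε F U χ ψ) (hc : c ∈ atlas E4 M)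
    (hy : y ∈ c.target) (hU : (c.extend (𝓡 4)).symm y ∈ U) {δ : ℝ} (hδ : 0 < δ) :
    ContDiffAt ℝ ∞ (Form.inChart (𝓡 4) (regularWedge g ξ χ ψ δ) c) y := by
  have hk := h.killing c hc
  rw [← contDiffWithinAt_univ]
  refine contDiffWithinAt_alternating_of_apply fun v => ?_
  rw [contDiffWithinAt_univ]
  have hγ : ∀ u, ContDiffAt ℝ ∞ (fun z => coordGamma (fun z => χ ((c.extend (𝓡 4)).symm z))
      (fun z => ψ ((c.extend (𝓡 4)).symm z)) z u) y := fun u =>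
    contDiffAt_coordGamma (contDiffAt_comp_symm hc hy (h.contMDiffAt_electric hU))
      (contDiffAt_comp_symm hc hy (h.contMDiffAt_magnetic hU)) u
  have hl : ∀ u, ContDiffAt ℝ ∞ (fun z => coordLower (gram g c) (coordField ξ c) z u) y := fun u =>
    hk.contDiffAt_coordLower hy (u := fun _ => u) contDiffAt_const
  have hf := hk.contDiffAt_coordLower hy (hk.field y hy)
  have hpos : coordLower (gram g c) (coordField ξ c) y (coordField ξ c y) + δ ≠ 0 :=
    (add_pos_of_nonneg_of_pos (h.coordLower_nonneg hc hy) hδ).ne'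
  refine (((hf.add contDiffAt_const).inv hpos).mul (((hγ (v 0)).mul (hl (v 1))).sub
    ((hγ (v 1)).mul (hl (v 0))))).congr_of_eventuallyEq ?_
  filter_upwards [h.eventually_mem hc hy hU] with z hz
  have hv : v = ![v 0, v 1] := by funext i; fin_cases i <;> rfl
  conv_lhs => rw [hv]
  exact inChart_regularWedge h.lorentz hc hz.1 (h.contMDiffAt_electric hz.2)
    (h.contMDiffAt_magnetic hz.2) δ _ _

theorem smoothAt_regularWedge (h : IsConserved g ξ ε F U χ ψ) {x : M} (hx : x ∈ U) {δ : ℝ}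
    (hδ : 0 < δ) : Form.SmoothAt (𝓡 4) (regularWedge g ξ χ ψ δ) x := by
  intro c hc hxc
  have hy := extend_mem_target (𝓡 4) hxc
  rw [extend_target_model] at hy
  refine (h.contDiffAt_regularWedge hc hy ?_ hδ).contDiffWithinAt
  rw [extend_left_inv' (𝓡 4) hxc]
  exact hx

theorem smoothAt_regularForm (h : IsConserved g ξ ε F U χ ψ) {x : M} (hx : x ∈ U) {δ : ℝ}
    (hδ : 0 < δ) : Form.SmoothAt (𝓡 4) (regularForm g ξ ε χ ψ δ) x :=
  (smoothAt_komarForm h.lorentz h.volume h.killing x).add (𝓡 4)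
    ((h.smoothAt_regularWedge hx hδ).const_smul (𝓡 4) 4)

/-- The exterior derivative of the regularised form is the sum of two derivatives. -/
theorem inChart_d_regularForm (h : IsConserved g ξ ε F U χ ψ) (hc : c ∈ atlas E4 M)
    (hy : y ∈ c.target) (hU : (c.extend (𝓡 4)).symm y ∈ U) {δ : ℝ} (hδ : 0 < δ) (u v w : E4) :
    Form.inChart (𝓡 4) (Form.d (𝓡 4) (regularForm g ξ ε χ ψ δ)) c y ![u, v, w] =
      Form.inChart (𝓡 4) (Form.d (𝓡 4) (komarForm g ξ ε)) c y ![u, v, w] + 4 *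
      (fderiv ℝ (fun z => Form.inChart (𝓡 4) (regularWedge g ξ χ ψ δ) c z ![v, w]) y u -
        fderiv ℝ (fun z => Form.inChart (𝓡 4) (regularWedge g ξ χ ψ δ) c z ![u, w]) y v +
        fderiv ℝ (fun z => Form.inChart (𝓡 4) (regularWedge g ξ χ ψ δ) c z ![u, v]) y w) := by
  have h1 := contDiffAt_inChart hc hy (smoothAt_komarForm h.lorentz h.volume h.killing _)
  have h2 := h.contDiffAt_regularWedge hc hy hU hδ
  have hd1 := h1.differentiableAt (n := ∞) (by simp)
  have hd2 := h2.differentiableAt (n := ∞) (by simp)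
  rw [inChart_d_model hc hy (h.smoothAt_regularForm hU hδ), inChart_d_model hc hy
    (smoothAt_komarForm h.lorentz h.volume h.killing _), ← extDeriv_two_apply hd2]
  change extDeriv (Form.inChart (𝓡 4) (komarForm g ξ ε) c + (4 : ℝ) •
    Form.inChart (𝓡 4) (regularWedge g ξ χ ψ δ) c) y ![u, v, w] = _
  rw [extDeriv_add hd1 (hd2.const_smul _), extDeriv_smul]
  rfl

theorem inChart_d_regularForm_field (h : IsConserved g ξ ε F U χ ψ) (hc : c ∈ atlas E4 M)
    (hy : y ∈ c.target) (hU : (c.extend (𝓡 4)).symm y ∈ U) {δ : ℝ} (hδ : 0 < δ) (v w : E4) :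
    Form.inChart (𝓡 4) (Form.d (𝓡 4) (regularForm g ξ ε χ ψ δ)) c y ![coordField ξ c y, v, w] =
      4 * (δ / (coordLower (gram g c) (coordField ξ c) y (coordField ξ c y) + δ) ^ 2 *
        (Form.inChart (𝓡 4) (Form.d (𝓡 4) (lowerForm g ξ)) c y ![v, coordField ξ c y] *
          coordGamma (fun z => χ ((c.extend (𝓡 4)).symm z)) (fun z => ψ ((c.extend (𝓡 4)).symm z)) y w
        - Form.inChart (𝓡 4) (Form.d (𝓡 4) (lowerForm g ξ)) c y ![w, coordField ξ c y] *
          coordGamma (fun z => χ ((c.extend (𝓡 4)).symm z)) (fun z => ψ ((c.extend (𝓡 4)).symm z)) y v)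
        - δ / (coordLower (gram g c) (coordField ξ c) y (coordField ξ c y) + δ) *
        (Form.inChart (𝓡 4) F c y ![coordField ξ c y, v] *
          Form.inChart (𝓡 4) (hodge g ε F) c y ![coordField ξ c y, w] -
        Form.inChart (𝓡 4) F c y ![coordField ξ c y, w] *
          Form.inChart (𝓡 4) (hodge g ε F) c y ![coordField ξ c y, v])) := by
  have hk := h.killing c hc
  set X := coordField ξ c with hX
  set G := gram g c with hG
  set a : E4 → ℝ := fun z => χ ((c.extend (𝓡 4)).symm z) with ha
  set b : E4 → ℝ := fun z => ψ ((c.extend (𝓡 4)).symm z) with hb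
  have hpos : coordLower G X y (X y) + δ ≠ 0 :=
    (add_pos_of_nonneg_of_pos (h.coordLower_nonneg hc hy) hδ).ne'
  have halt : ∀ (θ : E4 [⋀^Fin 2]→L[ℝ] ℝ) (u : E4), θ ![u, u] = 0 := fun θ u =>
    θ.map_eq_zero_of_eq _ (i := 0) (j := 1) rfl (by decide)
  have hev := h.eventually_mem hc hy hU
  have ha0 : ∀ᶠ z in 𝓝 y, fderiv ℝ a z (X z) = 0 := by
    filter_upwards [hev] with z hz
    rw [ha, h.fderiv_electric hc hz.1 hz.2, halt]
  have hb0 : ∀ᶠ z in 𝓝 y, fderiv ℝ b z (X z) = 0 := by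
    filter_upwards [hev] with z hz
    rw [hb, h.fderiv_magnetic hc hz.1 hz.2, halt]
  have hreg : ∀ v w u, fderiv ℝ (fun z => Form.inChart (𝓡 4) (regularWedge g ξ χ ψ δ) c z ![v, w]) y u =
      fderiv ℝ (fun z => (coordLower G X z (X z) + δ)⁻¹ * (coordGamma a b z v * coordLower G X z w -
        coordGamma a b z w * coordLower G X z v)) y u := by
    intro v w u
    have : (fun z => Form.inChart (𝓡 4) (regularWedge g ξ χ ψ δ) c z ![v, w]) =ᶠ[𝓝 y]
        (fun z => (coordLower G X z (X z) + δ)⁻¹ * (coordGamma a b z v * coordLower G X z w -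
        coordGamma a b z w * coordLower G X z v)) := by
      filter_upwards [hev] with z hz
      exact inChart_regularWedge h.lorentz hc hz.1 (h.contMDiffAt_electric hz.2)
        (h.contMDiffAt_magnetic hz.2) δ _ _
    rw [this.fderiv_eq]
  have hf' : ∀ v, fderiv ℝ (fun z => coordLower G X z (X z)) y v =
      Form.inChart (𝓡 4) (Form.d (𝓡 4) (lowerForm g ξ)) c y ![v, X y] := by
    intro v
    have hs := smoothAt_lowerForm h.lorentz h.killing ((c.extend (𝓡 4)).symm y)
    rw [hk.coordLower_neg_fderiv hy, inChart_d_model hc hy hs,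
      extDeriv_one_apply ((contDiffAt_inChart hc hy hs).differentiableAt (by simp))]
    have h1 : ∀ u : E4, (fun z => Form.inChart (𝓡 4) (lowerForm g ξ) c z ![u]) =ᶠ[𝓝 y]
        fun z => coordLower G X z u := fun u => by
      filter_upwards [hev] with z hz
      exact inChart_lowerForm h.lorentz hc hz.1 u
    rw [(h1 _).fderiv_eq, (h1 _).fderiv_eq]
  have hmain := hk.d_regularised hy (contDiffAt_comp_symm hc hy (h.contMDiffAt_electric hU))
    (contDiffAt_comp_symm hc hy (h.contMDiffAt_magnetic hU)) ha0 hb0 hpos _ (fun _ _ _ => rfl) v w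
  have hK : Form.inChart (𝓡 4) (Form.d (𝓡 4) (komarForm g ξ ε)) c y ![X y, v, w] =
      -4 * (fderiv ℝ a y v * fderiv ℝ b y w - fderiv ℝ a y w * fderiv ℝ b y v) := by
    have h1 := d_komarForm_apply h.lorentz h.volume h.einsteinMaxwell h.killing
      ((c.extend (𝓡 4)).symm y) (chartFrame (𝓡 4) c y v) (chartFrame (𝓡 4) c y w)
    rw [← h.electric.2 _ hU, ← h.electric.2 _ hU, ← h.magnetic.2 _ hU, ← h.magnetic.2 _ hU] at h1
    rw [ha, hb, (hasFDerivAt_comp_symm hc hy (h.contMDiffAt_electric hU)).fderiv,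
      (hasFDerivAt_comp_symm hc hy (h.contMDiffAt_magnetic hU)).fderiv]
    refine Eq.trans ?_ h1
    refine congrArg (Form.d (𝓡 4) (komarForm g ξ ε) ((c.extend (𝓡 4)).symm y)) (funext fun i => ?_)
    fin_cases i
    · exact chartFrame_coordField hc hy
    · rfl
    · rfl
  rw [h.inChart_d_regularForm hc hy hU hδ, hreg, hreg, hreg, hmain, hK, ← h.fderiv_electric hc hy hU,
    ← h.fderiv_electric hc hy hU, ← h.fderiv_magnetic hc hy hU, ← h.fderiv_magnetic hc hy hU,
    hf', hf']
  field_simp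
  ring

theorem inChart_d_regularForm_of_zero (h : IsConserved g ξ ε F U χ ψ) (hc : c ∈ atlas E4 M)
    (hy : y ∈ c.target) (hU : (c.extend (𝓡 4)).symm y ∈ U) {δ : ℝ} (hδ : 0 < δ)
    (hX : coordField ξ c y = 0) (u v w : E4) :
    Form.inChart (𝓡 4) (Form.d (𝓡 4) (regularForm g ξ ε χ ψ δ)) c y ![u, v, w] = 0 := by
  have hk := h.killing c hc
  set a : E4 → ℝ := fun z => χ ((c.extend (𝓡 4)).symm z) with ha
  set b : E4 → ℝ := fun z => ψ ((c.extend (𝓡 4)).symm z) with hb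
  have hpos : coordLower (gram g c) (coordField ξ c) y (coordField ξ c y) + δ ≠ 0 :=
    (add_pos_of_nonneg_of_pos (h.coordLower_nonneg hc hy) hδ).ne'
  have hzero : ∀ (θ : E4 [⋀^Fin 2]→L[ℝ] ℝ) (u : E4), θ ![coordField ξ c y, u] = 0 := fun θ u =>
    θ.map_coord_zero 0 hX
  have hev := h.eventually_mem hc hy hU
  have ha0 : fderiv ℝ a y = 0 := by
    ext u
    exact (h.fderiv_electric hc hy hU u).trans (hzero _ u)
  have hb0 : fderiv ℝ b y = 0 := by
    ext u
    exact (h.fderiv_magnetic hc hy hU u).trans (hzero _ u)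
  have hreg : ∀ v w u, fderiv ℝ (fun z => Form.inChart (𝓡 4) (regularWedge g ξ χ ψ δ) c z ![v, w]) y u =
      0 := by
    intro v w u
    have : (fun z => Form.inChart (𝓡 4) (regularWedge g ξ χ ψ δ) c z ![v, w]) =ᶠ[𝓝 y]
        (fun z => (coordLower (gram g c) (coordField ξ c) z (coordField ξ c z) + δ)⁻¹ *
          (coordGamma a b z v * coordLower (gram g c) (coordField ξ c) z w -
        coordGamma a b z w * coordLower (gram g c) (coordField ξ c) z v)) := by
      filter_upwards [hev] with z hz
      exact inChart_regularWedge h.lorentz hc hz.1 (h.contMDiffAt_electric hz.2)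
        (h.contMDiffAt_magnetic hz.2) δ _ _
    rw [this.fderiv_eq]
    exact hk.d_regularised_of_zero hy (contDiffAt_comp_symm hc hy (h.contMDiffAt_electric hU))
      (contDiffAt_comp_symm hc hy (h.contMDiffAt_magnetic hU)) hX ha0 hb0 hpos _
      (fun _ _ _ => rfl) u v w
  have hD : killingDivergence (gram g c) (coordField ξ c) y = 0 := by
    have h1 : ∀ j, ∑ m, killingDivergence (gram g c) (coordField ξ c) y m * gram g c y m j = 0 :=
      fun j => (hk.divergence_covBivector hy j).trans (by simp [hX])
    have h2 : (killingDivergence (gram g c) (coordField ξ c) y).ofLp ᵥ* gram g c y = 0 :=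
      funext h1
    have h3 := Matrix.eq_zero_of_vecMul_eq_zero (hk.det_ne_zero y hy) h2
    ext m
    exact congrFun h3 m
  rw [h.inChart_d_regularForm hc hy hU hδ, hreg, hreg, hreg,
    inChart_d_komarForm h.lorentz h.volume h.killing hc hy,
    ContinuousAlternatingMap.map_coord_zero _ 0 hD]
  simp

end IsConserved

end RegularForm

/-! ### Uniform bounds for the regularised form -/

section Bounds

theorem abs_apply_two_le {V : Type*} [NormedAddCommGroup V] [NormedSpace ℝ V]
    (θ : V [⋀^Fin 2]→L[ℝ] ℝ) (u v : V) : |θ ![u, v]| ≤ ‖θ‖ * ‖u‖ * ‖v‖ := by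
  have := θ.le_opNorm ![u, v]
  rw [Fin.prod_univ_two, ← mul_assoc] at this
  simpa using this

theorem abs_coordLower_le {G : E4 → Matrix (Fin 4) (Fin 4) ℝ} {X : E4 → E4} {z : E4} {C : ℝ}
    (hC : ∀ i j, |G z i j| ≤ C) (u : E4) : |coordLower G X z u| ≤ 16 * C * ‖X z‖ * ‖u‖ := by
  unfold coordLower
  have hc : 0 ≤ C := (abs_nonneg _).trans (hC 0 0)
  have h1 : ∀ l m, |u l * (G z l m * X z m)| ≤ C * ‖X z‖ * ‖u‖ := fun l m => by
    rw [abs_mul, abs_mul]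
    have hu : |u l| ≤ ‖u‖ := PiLp.norm_apply_le u l
    have hX : |X z m| ≤ ‖X z‖ := PiLp.norm_apply_le (X z) m
    calc |u l| * (|G z l m| * |X z m|) ≤ ‖u‖ * (C * ‖X z‖) := by
          gcongr; exact hC l m
      _ = _ := by ring
  simp_rw [Finset.mul_sum]
  calc |∑ l, ∑ m, u l * (G z l m * X z m)| ≤ ∑ l, ∑ m, |u l * (G z l m * X z m)| :=
        (Finset.abs_sum_le_sum_abs _ _).trans
          (Finset.sum_le_sum fun l _ => Finset.abs_sum_le_sum_abs _ _)
    _ ≤ ∑ _l : Fin 4, ∑ _m : Fin 4, C * ‖X z‖ * ‖u‖ :=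
        Finset.sum_le_sum fun l _ => Finset.sum_le_sum fun m _ => h1 l m
    _ = _ := by simp; ring

variable {M : Type*} [TopologicalSpace M] [ChartedSpace E4 M] [IsManifold (𝓡 4) ∞ M]
  {g : BilinField M} {ξ : VField (𝓡 4) M} {c : OpenPartialHomeomorph M E4} {y : E4}
  {ε : Form (𝓡 4) M 4} {F : Form (𝓡 4) M 2} {U : Set M} {χ ψ : M → ℝ}

/-- The field is spacelike away from its zeros, uniformly near them: in coordinates, its square is
locally bounded below by a multiple of the Euclidean square. -/
def IsUniformlySpacelike (g : BilinField M) (ξ : VField (𝓡 4) M) : Prop :=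
  ∀ c ∈ atlas E4 M, ∀ y ∈ c.target, ∃ κ : ℝ, 0 < κ ∧ ∀ᶠ z in 𝓝 y, κ * ‖coordField ξ c z‖ ^ 2 ≤
    coordLower (gram g c) (coordField ξ c) z (coordField ξ c z)

theorem IsUniformlySpacelike.pos (hs : IsUniformlySpacelike g ξ) (hc : c ∈ atlas E4 M)
    (hy : y ∈ c.target) (hX : coordField ξ c y ≠ 0) :
    0 < coordLower (gram g c) (coordField ξ c) y (coordField ξ c y) := by
  obtain ⟨κ, hκ, h⟩ := hs c hc y hy
  refine lt_of_lt_of_le ?_ h.self_of_nhds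
  have := norm_pos_iff.2 hX
  positivity

namespace IsConserved

/-- Simultaneous local bounds for all coefficients. -/
theorem exists_bound (h : IsConserved g ξ ε F U χ ψ) (hs : IsUniformlySpacelike g ξ)
    (hc : c ∈ atlas E4 M) (hy : y ∈ c.target) (hU : (c.extend (𝓡 4)).symm y ∈ U) :
    ∃ C κ : ℝ, 0 ≤ C ∧ 0 < κ ∧ ∀ᶠ z in 𝓝 y, (z ∈ c.target ∧ (c.extend (𝓡 4)).symm z ∈ U) ∧
      κ * ‖coordField ξ c z‖ ^ 2 ≤ coordLower (gram g c) (coordField ξ c) z (coordField ξ c z) ∧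
      ‖coordField ξ c z‖ ≤ C ∧
      (∀ u, |coordLower (gram g c) (coordField ξ c) z u| ≤ C * ‖coordField ξ c z‖ * ‖u‖) ∧
      (∀ u, |Form.inChart (𝓡 4) F c z ![coordField ξ c z, u]| ≤ C * ‖coordField ξ c z‖ * ‖u‖) ∧
      (∀ u, |Form.inChart (𝓡 4) (hodge g ε F) c z ![coordField ξ c z, u]| ≤
        C * ‖coordField ξ c z‖ * ‖u‖) ∧
      (∀ u, |Form.inChart (𝓡 4) (Form.d (𝓡 4) (lowerForm g ξ)) c z ![u, coordField ξ c z]| ≤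
        C * ‖u‖ * ‖coordField ξ c z‖) ∧
      ∀ u, |coordGamma (fun z => χ ((c.extend (𝓡 4)).symm z))
        (fun z => ψ ((c.extend (𝓡 4)).symm z)) z u| ≤ C * ‖coordField ξ c z‖ * ‖u‖ := by
  have hk := h.killing c hc
  obtain ⟨κ, hκ, hev⟩ := hs c hc y hy
  set a : E4 → ℝ := fun z => χ ((c.extend (𝓡 4)).symm z) with ha
  set b : E4 → ℝ := fun z => ψ ((c.extend (𝓡 4)).symm z) with hb
  have c1 : ContinuousAt a y :=
    (contDiffAt_comp_symm hc hy (h.contMDiffAt_electric hU)).continuousAt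
  have c2 : ContinuousAt b y :=
    (contDiffAt_comp_symm hc hy (h.contMDiffAt_magnetic hU)).continuousAt
  have c3 : ContinuousAt (Form.inChart (𝓡 4) F c) y :=
    (contDiffAt_inChart hc hy (h.einsteinMaxwell.smooth.smoothAt (𝓡 4) _)).continuousAt
  have c4 : ContinuousAt (Form.inChart (𝓡 4) (hodge g ε F) c) y :=
    (contDiffAt_inChart hc hy
      (smoothAt_hodge h.volume h.killing h.einsteinMaxwell.smooth _)).continuousAt
  have c5 : ContinuousAt (Form.inChart (𝓡 4) (Form.d (𝓡 4) (lowerForm g ξ)) c) y :=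
    (contDiffAt_inChart hc hy (Form.SmoothAt.d (𝓡 4) (Eventually.of_forall
      fun x => smoothAt_lowerForm h.lorentz h.killing x))).continuousAt
  have c6 : ContinuousAt (fun z => fun i j => gram g c z i j : E4 → Fin 4 → Fin 4 → ℝ) y :=
    continuousAt_pi.2 fun i => continuousAt_pi.2 fun j => (hk.metric y hy i j).continuousAt
  have c7 : ContinuousAt (coordField ξ c) y := (hk.field y hy).continuousAt
  have hcont := (c1.prodMk (c2.prodMk (c3.prodMk (c4.prodMk (c5.prodMk (c6.prodMk c7)))))).norm
  obtain ⟨C, hC⟩ : ∃ C : ℝ, ∀ᶠ z in 𝓝 y, ‖(a z, b z, Form.inChart (𝓡 4) F c z,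
      Form.inChart (𝓡 4) (hodge g ε F) c z,
      Form.inChart (𝓡 4) (Form.d (𝓡 4) (lowerForm g ξ)) c z,
      (fun i j => gram g c z i j : Fin 4 → Fin 4 → ℝ), coordField ξ c z)‖ ≤ C :=
    ⟨_, (hcont.eventually (eventually_lt_nhds (lt_add_one _))).mono fun z hz => hz.le⟩
  have hC0 : 0 ≤ C := (norm_nonneg _).trans hC.self_of_nhds
  refine ⟨16 * C + C * C, κ, by positivity, hκ, ?_⟩
  filter_upwards [hC, h.eventually_mem hc hy hU, hev] with z hz hmem hsp
  simp only [Prod.norm_mk, max_le_iff] at hz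
  obtain ⟨n1, n2, n3, n4, n5, n6, n7⟩ := hz
  have key : ∀ {p q r s : ℝ}, p ≤ q * r * s → q ≤ C → 0 ≤ r → 0 ≤ s →
      p ≤ (16 * C + C * C) * r * s := fun {p q r s} hp hq hr hs => by
    refine hp.trans ?_
    gcongr
    nlinarith
  have hF : ∀ u, |Form.inChart (𝓡 4) F c z ![coordField ξ c z, u]| ≤
      C * ‖coordField ξ c z‖ * ‖u‖ := fun u => (abs_apply_two_le _ _ _).trans (by gcongr)
  have hH : ∀ u, |Form.inChart (𝓡 4) (hodge g ε F) c z ![coordField ξ c z, u]| ≤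
      C * ‖coordField ξ c z‖ * ‖u‖ := fun u => (abs_apply_two_le _ _ _).trans (by gcongr)
  refine ⟨hmem, hsp, by nlinarith, fun u => ?_, fun u => key (hF u) le_rfl (norm_nonneg _)
    (norm_nonneg _), fun u => key (hH u) le_rfl (norm_nonneg _) (norm_nonneg _),
    fun u => key (abs_apply_two_le _ _ _) n5 (norm_nonneg _) (norm_nonneg _), fun u => ?_⟩
  · refine (abs_coordLower_le (fun i j => ?_) u).trans (?_ : 16 * C * ‖coordField ξ c z‖ * ‖u‖ ≤ _)
    · exact (norm_le_pi_norm (fun j => gram g c z i j) j).trans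
        ((norm_le_pi_norm (fun i j => gram g c z i j) i).trans n6)
    · gcongr
      nlinarith
  · rw [coordGamma, ha, hb, h.fderiv_electric hc hmem.1 hmem.2, h.fderiv_magnetic hc hmem.1 hmem.2]
    change |1 / 2 * (a z * _ - b z * _)| ≤ _
    have e1 := abs_sub (a z * Form.inChart (𝓡 4) (hodge g ε F) c z ![coordField ξ c z, u])
      (b z * Form.inChart (𝓡 4) F c z ![coordField ξ c z, u])
    rw [abs_mul, abs_mul] at e1
    have e2 : |a z| * |Form.inChart (𝓡 4) (hodge g ε F) c z ![coordField ξ c z, u]| ≤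
        C * (C * ‖coordField ξ c z‖ * ‖u‖) := by
      gcongr
      exacts [n1, hH u]
    have e3 : |b z| * |Form.inChart (𝓡 4) F c z ![coordField ξ c z, u]| ≤
        C * (C * ‖coordField ξ c z‖ * ‖u‖) := by
      gcongr
      exacts [n2, hF u]
    rw [abs_mul, abs_of_pos (by norm_num : (0 : ℝ) < 1 / 2)]
    have e4 : 0 ≤ 16 * C * ‖coordField ξ c z‖ * ‖u‖ := by positivity
    nlinarith

theorem exists_bound_regularWedge (h : IsConserved g ξ ε F U χ ψ) (hs : IsUniformlySpacelike g ξ)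
    (hc : c ∈ atlas E4 M) (hy : y ∈ c.target) (hU : (c.extend (𝓡 4)).symm y ∈ U) :
    ∃ C : ℝ, ∀ᶠ z in 𝓝 y, ∀ δ : ℝ, 0 ≤ δ → ∀ u v : E4,
      |Form.inChart (𝓡 4) (regularWedge g ξ χ ψ δ) c z ![u, v]| ≤ C * ‖u‖ * ‖v‖ := by
  obtain ⟨C, κ, hC, hκ, hev⟩ := h.exists_bound hs hc hy hU
  refine ⟨2 * (C * C) / κ, ?_⟩
  filter_upwards [hev] with z hz δ hδ u v
  obtain ⟨hmem, hsp, -, hl, -, -, -, hγ⟩ := hz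
  rw [inChart_regularWedge h.lorentz hc hmem.1 (h.contMDiffAt_electric hmem.2)
    (h.contMDiffAt_magnetic hmem.2)]
  set f := coordLower (gram g c) (coordField ξ c) z (coordField ξ c z)
  set x := ‖coordField ξ c z‖ with hx
  have hx0 : 0 ≤ x := norm_nonneg _
  have hf : 0 ≤ f := le_trans (by positivity) hsp
  have e : ∀ u v, |coordGamma (fun z => χ ((c.extend (𝓡 4)).symm z))
      (fun z => ψ ((c.extend (𝓡 4)).symm z)) z u * coordLower (gram g c) (coordField ξ c) z v| ≤
      (C * x * ‖u‖) * (C * x * ‖v‖) := fun u v => by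
    rw [abs_mul]
    have := hγ u
    have := hl v
    gcongr
  have e1 := (abs_sub _ _).trans (add_le_add (e u v) (e v u))
  rw [abs_mul, abs_inv, abs_of_nonneg (by positivity : 0 ≤ f + δ)]
  have e2 : x ^ 2 * (f + δ)⁻¹ ≤ κ⁻¹ := by
    rcases eq_or_lt_of_le (by positivity : 0 ≤ f + δ) with h0 | h0
    · rw [← h0]; simp; positivity
    · rw [← div_eq_mul_inv, div_le_iff₀ h0, inv_mul_eq_div, le_div_iff₀ hκ]
      nlinarith
  refine (mul_le_mul_of_nonneg_left e1 (by positivity)).trans ?_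
  have : (f + δ)⁻¹ * (C * x * ‖u‖ * (C * x * ‖v‖) + C * x * ‖v‖ * (C * x * ‖u‖)) =
      (2 * (C * C) * ‖u‖ * ‖v‖) * (x ^ 2 * (f + δ)⁻¹) := by ring
  rw [this]
  refine (mul_le_mul_of_nonneg_left e2 (by positivity)).trans (le_of_eq ?_)
  field_simp

theorem exists_bound_d_regularForm (h : IsConserved g ξ ε F U χ ψ) (hs : IsUniformlySpacelike g ξ)
    (hc : c ∈ atlas E4 M) (hy : y ∈ c.target) (hU : (c.extend (𝓡 4)).symm y ∈ U) :
    ∃ C : ℝ, 0 ≤ C ∧ ∀ᶠ z in 𝓝 y, ∀ δ : ℝ, 0 < δ → ∀ v w : E4,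
      |Form.inChart (𝓡 4) (Form.d (𝓡 4) (regularForm g ξ ε χ ψ δ)) c z ![coordField ξ c z, v, w]| ≤
        C * ‖v‖ * ‖w‖ := by
  obtain ⟨C, κ, hC, hκ, hev⟩ := h.exists_bound hs hc hy hU
  refine ⟨4 * (2 * (C * C) / κ + 2 * (C * C * (C * C))), by positivity, ?_⟩
  filter_upwards [hev] with z hz δ hδ v w
  obtain ⟨hmem, hsp, hX, -, hF, hH, hd, hγ⟩ := hz
  rw [h.inChart_d_regularForm_field hc hmem.1 hmem.2 hδ]
  set f := coordLower (gram g c) (coordField ξ c) z (coordField ξ c z)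
  set x := ‖coordField ξ c z‖ with hx
  have hx0 : 0 ≤ x := norm_nonneg _
  have hf : 0 ≤ f := le_trans (by positivity) hsp
  have e1 : ∀ v w, |Form.inChart (𝓡 4) (Form.d (𝓡 4) (lowerForm g ξ)) c z ![v, coordField ξ c z] *
      coordGamma (fun z => χ ((c.extend (𝓡 4)).symm z)) (fun z => ψ ((c.extend (𝓡 4)).symm z)) z w| ≤
      (C * ‖v‖ * x) * (C * x * ‖w‖) := fun v w => by
    rw [abs_mul]
    have := hd v
    have := hγ w
    gcongr
  have e2 : ∀ v w, |Form.inChart (𝓡 4) F c z ![coordField ξ c z, v] *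
      Form.inChart (𝓡 4) (hodge g ε F) c z ![coordField ξ c z, w]| ≤
      (C * x * ‖v‖) * (C * x * ‖w‖) := fun v w => by
    rw [abs_mul]
    have := hF v
    have := hH w
    gcongr
  have hp1 : 0 ≤ δ / (f + δ) ^ 2 := by positivity
  have hp2 : 0 ≤ δ / (f + δ) := by positivity
  have e3 : δ / (f + δ) ^ 2 * x ^ 2 ≤ κ⁻¹ := by
    rw [div_mul_eq_mul_div, div_le_iff₀ (by positivity), inv_mul_eq_div, le_div_iff₀ hκ]
    nlinarith [mul_le_mul_of_nonneg_left hsp hδ.le]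
  have e4 : δ / (f + δ) * x ^ 2 ≤ C * C := by
    have : δ / (f + δ) ≤ 1 := (div_le_one (by positivity)).2 (by linarith)
    calc δ / (f + δ) * x ^ 2 ≤ 1 * C ^ 2 := by gcongr
      _ = _ := by ring
  rw [abs_mul, abs_of_pos (by norm_num : (0 : ℝ) < 4), mul_assoc, mul_assoc]
  refine mul_le_mul_of_nonneg_left ?_ (by norm_num)
  refine (abs_sub _ _).trans ?_
  rw [abs_mul, abs_mul, abs_of_nonneg hp1, abs_of_nonneg hp2]
  have t1 := mul_le_mul_of_nonneg_left ((abs_sub _ _).trans (add_le_add (e1 v w) (e1 w v))) hp1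
  have t2 := mul_le_mul_of_nonneg_left ((abs_sub _ _).trans (add_le_add (e2 v w) (e2 w v))) hp2
  refine (add_le_add t1 t2).trans ?_
  have r1 : δ / (f + δ) ^ 2 * (C * ‖v‖ * x * (C * x * ‖w‖) + C * ‖w‖ * x * (C * x * ‖v‖)) =
      (2 * (C * C) * (‖v‖ * ‖w‖)) * (δ / (f + δ) ^ 2 * x ^ 2) := by ring
  have r2 : δ / (f + δ) * (C * x * ‖v‖ * (C * x * ‖w‖) + C * x * ‖w‖ * (C * x * ‖v‖)) =
      (2 * (C * C) * (‖v‖ * ‖w‖)) * (δ / (f + δ) * x ^ 2) := by ring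
  rw [r1, r2]
  refine (add_le_add (mul_le_mul_of_nonneg_left e3 (by positivity))
    (mul_le_mul_of_nonneg_left e4 (by positivity))).trans (le_of_eq ?_)
  field_simp

theorem tendsto_d_regularForm (h : IsConserved g ξ ε F U χ ψ)
    (hc : c ∈ atlas E4 M) (hy : y ∈ c.target) (hU : (c.extend (𝓡 4)).symm y ∈ U)
    (hpos : 0 < coordLower (gram g c) (coordField ξ c) y (coordField ξ c y)) (v w : E4) :
    Tendsto (fun δ => Form.inChart (𝓡 4) (Form.d (𝓡 4) (regularForm g ξ ε χ ψ δ)) c y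
      ![coordField ξ c y, v, w]) (𝓝[>] 0) (𝓝 0) := by
  set f := coordLower (gram g c) (coordField ξ c) y (coordField ξ c y)
  have h1 : Tendsto (fun δ : ℝ => δ / (f + δ) ^ 2) (𝓝[>] 0) (𝓝 0) := by
    have : ContinuousAt (fun δ : ℝ => δ / (f + δ) ^ 2) 0 := by
      refine continuousAt_id.div (by fun_prop) ?_
      simpa using hpos.ne'
    simpa using this.tendsto.mono_left nhdsWithin_le_nhds
  have h2 : Tendsto (fun δ : ℝ => δ / (f + δ)) (𝓝[>] 0) (𝓝 0) := by
    have : ContinuousAt (fun δ : ℝ => δ / (f + δ)) 0 := by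
      refine continuousAt_id.div (by fun_prop) ?_
      simpa using hpos.ne'
    simpa using this.tendsto.mono_left nhdsWithin_le_nhds
  have h3 : ∀ p q : ℝ, Tendsto (fun δ : ℝ => 4 * (δ / (f + δ) ^ 2 * p - δ / (f + δ) * q)) (𝓝[>] 0)
      (𝓝 0) := fun p q => by
    simpa using ((h1.mul_const p).sub (h2.mul_const q)).const_mul (4 : ℝ)
  exact Tendsto.congr' (eventually_nhdsWithin_of_forall fun δ hδ =>
    (h.inChart_d_regularForm_field hc hy hU hδ v w).symm) (h3 _ _)

theorem tendsto_regularWedge (h : IsConserved g ξ ε F U χ ψ) (hs : IsUniformlySpacelike g ξ)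
    (hc : c ∈ atlas E4 M) (hy : y ∈ c.target) (hU : (c.extend (𝓡 4)).symm y ∈ U) (u v : E4) :
    Tendsto (fun δ => Form.inChart (𝓡 4) (regularWedge g ξ χ ψ δ) c y ![u, v]) (𝓝[>] 0)
      (𝓝 (Form.inChart (𝓡 4) (regularWedge g ξ χ ψ 0) c y ![u, v])) := by
  simp only [inChart_regularWedge h.lorentz hc hy (h.contMDiffAt_electric hU)
    (h.contMDiffAt_magnetic hU)]
  by_cases hX : coordField ξ c y = 0
  · simp [coordLower, hX]
  · have hpos := hs.pos hc hy hX
    have : ContinuousAt (fun δ : ℝ => (coordLower (gram g c) (coordField ξ c) y (coordField ξ c y)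
        + δ)⁻¹) 0 := (continuousAt_const.add continuousAt_id).inv₀ (by simpa using hpos.ne')
    exact (this.tendsto.mono_left nhdsWithin_le_nhds).mul_const _

end IsConserved

theorem regularWedge_zero (g : BilinField M) (ξ : VField (𝓡 4) M) (χ ψ : M → ℝ) :
    regularWedge g ξ χ ψ 0 = gammaWedgeHat g ξ χ ψ := by
  funext x
  ext v
  have hv : v = ![v 0, v 1] := by funext i; fin_cases i <;> rfl
  rw [hv]
  refine Eq.trans (congrArg (HMul.hMul _) (wedge_apply (V := E4) (gammaForm χ ψ x) (lower g ξ x) _ _))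
    (Eq.trans ?_ (wedge_apply (V := E4) (gammaForm χ ψ x) (hatForm g ξ x) _ _).symm)
  have key : ∀ r a b p q : ℝ, (r + 0)⁻¹ * (a * q - b * p) = a * (r⁻¹ * q) - b * (r⁻¹ * p) :=
    fun r a b p q => by rw [add_zero]; ring
  exact key _ _ _ _ _

end Bounds

/-! ### Flows with periodic orbits near a fixed point -/

section PeriodicFlow

variable {E : Type*} [NormedAddCommGroup E] [NormedSpace ℝ E]

/-- Near a zero of a vector field with periodic orbits, the field is almost contained in the image
of its linearisation. -/
theorem eventually_abs_apply_le {X : E → E} {y₀ : E} {T : ℝ} (hT : 0 < T)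
    (hX : ContDiffAt ℝ 1 X y₀)
    (horb : ∀ r > 0, ∀ᶠ y in 𝓝 y₀, ∃ u : ℝ → E, u 0 = y ∧ u T = y ∧
      ∀ t, HasDerivAt u (X (u t)) t ∧ u t ∈ Metric.ball y₀ r)
    (l : E →L[ℝ] ℝ) (hl : l.comp (fderiv ℝ X y₀) = 0) {ε : ℝ} (hε : 0 < ε) :
    ∀ᶠ y in 𝓝 y₀, |l (X y)| ≤ ε * ‖X y‖ := by
  set C : ℝ := ‖fderiv ℝ X y₀‖ + 1 with hC
  set ε' : ℝ := ε / (T * Real.exp (C * T)) with hε'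
  have hε'0 : 0 < ε' := by positivity
  have hcont : ContinuousAt (fderiv ℝ X) y₀ :=
    (hX.fderiv_right (m := 0) (by norm_num)).continuousAt
  have h1 : ∀ᶠ z in 𝓝 y₀, ‖fderiv ℝ X z‖ < C :=
    hcont.norm.eventually (eventually_lt_nhds (by linarith))
  have h2 : ∀ᶠ z in 𝓝 y₀, ‖l.comp (fderiv ℝ X z)‖ < ε' := by
    have h : ContinuousAt (fun z => l.comp (fderiv ℝ X z)) y₀ := continuousAt_const.clm_comp hcont
    refine h.norm.eventually (eventually_lt_nhds ?_)
    simpa [hl] using hε'0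
  have h3 : ∀ᶠ z in 𝓝 y₀, DifferentiableAt ℝ X z :=
    (hX.eventually (by simp)).mono fun z hz => hz.differentiableAt (by simp)
  obtain ⟨r, hr, hball⟩ := Metric.eventually_nhds_iff_ball.1 (h1.and (h2.and h3))
  filter_upwards [horb r hr] with y hy
  obtain ⟨u, hu0, huT, hu⟩ := hy
  have hn : ∀ t, HasDerivAt (fun t => X (u t)) (fderiv ℝ X (u t) (X (u t))) t := fun t =>
    (hball _ (hu t).2).2.2.hasFDerivAt.comp_hasDerivAt t (hu t).1
  have hgr : ∀ t ∈ Icc 0 T, ‖X (u t)‖ ≤ ‖X y‖ * Real.exp (C * T) := fun t ht => by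
    have h := norm_le_gronwallBound_of_norm_deriv_right_le (f := fun t => X (u t)) (δ := ‖X y‖)
      (K := C) (ε := 0) (a := 0) (b := T)
      (fun t _ => (hn t).continuousAt.continuousWithinAt) (fun t _ => (hn t).hasDerivWithinAt)
      (by simp [hu0]) (fun t _ => by
        rw [add_zero]
        exact ((fderiv ℝ X (u t)).le_opNorm _).trans (mul_le_mul_of_nonneg_right
          (hball _ (hu t).2).1.le (norm_nonneg _))) t ht
    rw [gronwallBound_ε0, sub_zero] at h
    refine h.trans ?_
    have : 0 ≤ C := by positivity
    gcongr
    exact ht.2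
  obtain ⟨s, hs, hs0⟩ := exists_hasDerivAt_eq_zero (f := fun t => l (u t))
    (f' := fun t => l (X (u t))) hT
    (fun t _ => (l.hasFDerivAt.comp_hasDerivAt t (hu t).1).continuousAt.continuousWithinAt)
    (by rw [hu0, huT]) (fun t _ => l.hasFDerivAt.comp_hasDerivAt t (hu t).1)
  have hmv := norm_image_sub_le_of_norm_deriv_le_segment' (f := fun t => l (X (u t)))
    (f' := fun t => l (fderiv ℝ X (u t) (X (u t)))) (a := 0) (b := T)
    (C := ε' * (‖X y‖ * Real.exp (C * T)))
    (fun t _ => (l.hasFDerivAt.comp_hasDerivAt t (hn t)).hasDerivWithinAt)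
    (fun t ht => ((l.comp (fderiv ℝ X (u t))).le_opNorm _).trans
      (mul_le_mul (hball _ (hu t).2).2.1.le (hgr t (Ico_subset_Icc_self ht)) (norm_nonneg _)
        hε'0.le)) s (Ioo_subset_Icc_self hs)
  simp only [hs0, hu0, zero_sub, norm_neg, Real.norm_eq_abs, sub_zero] at hmv
  refine hmv.trans ?_
  calc ε' * (‖X y‖ * Real.exp (C * T)) * s ≤ ε' * (‖X y‖ * Real.exp (C * T)) * T := by
        gcongr; exact hs.2.le
    _ = ε * ‖X y‖ := by rw [hε']; field_simp

/-- The linearised flow equation. -/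
theorem hasDerivAt_fderiv_flow {Ψ : ℝ × E → E} {X : E → E} {t : ℝ} {y : E} (v : E)
    (hΨ : ContDiffAt ℝ ∞ Ψ (t, y)) (hX : DifferentiableAt ℝ X (Ψ (t, y)))
    (hflow : ∀ᶠ q in 𝓝 (t, y), fderiv ℝ Ψ q (1, 0) = X (Ψ q)) :
    HasDerivAt (fun s => fderiv ℝ Ψ (s, y) (0, v))
      (fderiv ℝ X (Ψ (t, y)) (fderiv ℝ Ψ (t, y) (0, v))) t := by
  have h1 : HasFDerivAt (fderiv ℝ Ψ) (fderiv ℝ (fderiv ℝ Ψ) (t, y)) (t, y) :=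
    ((hΨ.fderiv_right (m := ∞) (by simp)).differentiableAt (by simp)).hasFDerivAt
  have h2 : HasDerivAt (fun s : ℝ => (s, y)) (1, 0) t := (hasDerivAt_id t).prodMk (hasDerivAt_const t y)
  have h3 : HasDerivAt (fun s => fderiv ℝ Ψ (s, y) (0, v))
      (fderiv ℝ (fderiv ℝ Ψ) (t, y) (1, 0) (0, v)) t :=
    (ContinuousLinearMap.apply ℝ E ((0 : ℝ), v)).hasFDerivAt.comp_hasDerivAt t
      (HasFDerivAt.comp_hasDerivAt (f := fun s : ℝ => (s, y)) t h1 h2)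
  have hsymm : IsSymmSndFDerivAt ℝ Ψ (t, y) :=
    hΨ.isSymmSndFDerivAt (by simpa using (ENat.LEInfty.out : (2 : WithTop ℕ∞) ≤ ∞))
  rw [hsymm] at h3
  convert h3 using 1
  have h4 : HasFDerivAt (fun q => fderiv ℝ Ψ q (1, 0))
      ((ContinuousLinearMap.apply ℝ E ((1 : ℝ), (0 : E))).comp (fderiv ℝ (fderiv ℝ Ψ) (t, y)))
      (t, y) :=
    (ContinuousLinearMap.apply ℝ E ((1 : ℝ), (0 : E))).hasFDerivAt.comp (t, y) h1
  have h5 : HasFDerivAt (fun q => X (Ψ q)) ((fderiv ℝ X (Ψ (t, y))).comp (fderiv ℝ Ψ (t, y))) (t, y) :=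
    hX.hasFDerivAt.comp _ (hΨ.differentiableAt (by simp)).hasFDerivAt
  have h6 := (h5.congr_of_eventuallyEq hflow).unique h4
  exact DFunLike.congr_fun h6 (0, v)

/-- A linear flow with a periodic orbit has no nilpotent part on it. -/
theorem apply_eq_zero_of_periodic {A : E →L[ℝ] E} {R : ℝ → E} {T : ℝ} (hT : 0 < T)
    (hR : ∀ t, HasDerivAt R (A (R t)) t) (hper : R T = R 0) (h : A (A (R 0)) = 0) :
    A (R 0) = 0 := by
  have hQ : ∀ t ∈ Icc 0 T, A (A (R t)) = 0 := fun t ht => by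
    have hd : ∀ t, HasDerivAt (fun t => A (A (R t))) (A (A (A (R t)))) t := fun t =>
      A.hasFDerivAt.comp_hasDerivAt t (A.hasFDerivAt.comp_hasDerivAt t (hR t))
    have h1 := norm_le_gronwallBound_of_norm_deriv_right_le (f := fun t => A (A (R t))) (δ := 0)
      (K := ‖A‖) (ε := 0) (a := 0) (b := T)
      (fun t _ => (hd t).continuousAt.continuousWithinAt) (fun t _ => (hd t).hasDerivWithinAt)
      (by simp [h]) (fun t _ => by rw [add_zero]; exact A.le_opNorm _) t ht
    rw [gronwallBound_ε0, zero_mul] at h1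
    simpa using h1
  have hS : ∀ t ∈ Icc 0 T, A (R t) = A (R 0) := fun t ht => by
    have h1 := norm_image_sub_le_of_norm_deriv_le_segment' (f := fun t => A (R t))
      (f' := fun t => A (A (R t))) (a := 0) (b := T) (C := 0)
      (fun t _ => (A.hasFDerivAt.comp_hasDerivAt t (hR t)).hasDerivWithinAt)
      (fun t ht => by simp [hQ t (Ico_subset_Icc_self ht)]) t ht
    simpa [sub_eq_zero] using h1
  have h1 := norm_image_sub_le_of_norm_deriv_le_segment' (f := fun t => R t - t • A (R 0))
    (f' := fun t => A (R t) - (1 : ℝ) • A (R 0)) (a := 0) (b := T) (C := 0)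
    (fun t _ => ((hR t).sub ((hasDerivAt_id t).smul_const (A (R 0)))).hasDerivWithinAt)
    (fun t ht => by simp [hS t (Ico_subset_Icc_self ht)]) T ⟨hT.le, le_rfl⟩
  simpa [hper, hT.ne'] using h1

end PeriodicFlow

/-! ### Coercivity of quadratic forms near a subspace -/

section Coercive

theorem exists_coercive_on {E : Type*} [NormedAddCommGroup E] [InnerProductSpace ℝ E]
    [FiniteDimensional ℝ E] {b : E →L[ℝ] E →L[ℝ] ℝ} {S : Submodule ℝ E}
    (hpos : ∀ w ∈ S, w ≠ 0 → 0 < b w w) : ∃ m : ℝ, 0 < m ∧ ∀ w ∈ S, m * ‖w‖ ^ 2 ≤ b w w := by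
  have hcpt : IsCompact (Metric.sphere (0 : E) 1 ∩ S) :=
    (isCompact_sphere 0 1).inter_right S.closed_of_finiteDimensional
  have hcont : Continuous fun w => b w w := by fun_prop
  rcases (Metric.sphere (0 : E) 1 ∩ S).eq_empty_or_nonempty with h0 | hne
  · refine ⟨1, one_pos, fun w hw => ?_⟩
    by_cases hw0 : w = 0
    · simp [hw0]
    · exfalso
      have : ‖w‖⁻¹ • w ∈ Metric.sphere (0 : E) 1 ∩ S :=
        ⟨by simp [norm_smul, hw0], S.smul_mem _ hw⟩
      rw [h0] at this
      exact this
  · obtain ⟨w₀, hw₀, hmin⟩ := hcpt.exists_isMinOn hne hcont.continuousOn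
    have hw1 : ‖w₀‖ = 1 := by simpa using hw₀.1
    refine ⟨b w₀ w₀, hpos _ hw₀.2 (by rintro rfl; simp at hw1), fun w hw => ?_⟩
    by_cases hw0 : w = 0
    · simp [hw0]
    · have h1 : b w₀ w₀ ≤ b (‖w‖⁻¹ • w) (‖w‖⁻¹ • w) :=
        hmin ⟨by simp [norm_smul, hw0], S.smul_mem _ hw⟩
      simp only [map_smul, smul_apply, smul_eq_mul] at h1
      have hn : 0 < ‖w‖ := norm_pos_iff.2 hw0
      calc b w₀ w₀ * ‖w‖ ^ 2 ≤ (‖w‖⁻¹ * (‖w‖⁻¹ * b w w)) * ‖w‖ ^ 2 := by gcongr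
        _ = b w w := by field_simp

/-- A continuous family of bilinear forms, positive definite on a subspace, is uniformly coercive
on vectors close to that subspace. -/
theorem eventually_coercive {Z E : Type*} [TopologicalSpace Z] [NormedAddCommGroup E]
    [InnerProductSpace ℝ E] [FiniteDimensional ℝ E] {b : Z → E →L[ℝ] E →L[ℝ] ℝ} {z₀ : Z}
    (hb : Tendsto (fun z => ‖b z - b z₀‖) (𝓝 z₀) (𝓝 0)) {S : Submodule ℝ E} (hpos : ∀ w ∈ S, w ≠ 0 → 0 < b z₀ w w) :
    ∃ κ : ℝ, 0 < κ ∧ ∃ ε : ℝ, 0 < ε ∧ ∀ᶠ z in 𝓝 z₀, ∀ w p, p ∈ S → ‖p‖ ≤ ‖w‖ →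
      ‖w - p‖ ≤ ε * ‖w‖ → κ * ‖w‖ ^ 2 ≤ b z w w := by
  obtain ⟨m, hm, hS⟩ := exists_coercive_on hpos
  set K := ‖b z₀‖ with hK
  have hK0 : 0 ≤ K := norm_nonneg (b z₀)
  set ε : ℝ := min (1 / 2) (m / (24 * (K + 1))) with hε
  have hε0 : 0 < ε := by positivity
  have hε1 : ε ≤ 1 / 2 := min_le_left _ _
  have hε2 : K * ε ≤ m / 24 := by
    have : ε * (24 * (K + 1)) ≤ m := (le_div_iff₀ (by positivity)).1 (min_le_right _ _)
    nlinarith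
  have hev : ∀ᶠ z in 𝓝 z₀, ‖b z - b z₀‖ < m / 16 :=
    hb.eventually (eventually_lt_nhds (by positivity))
  refine ⟨m / 16, by positivity, ε, hε0, ?_⟩
  filter_upwards [hev] with z hz w p hp hpw hwp
  set q := w - p with hq
  have hw : w = p + q := by rw [hq]; abel
  have hp1 : ‖w‖ / 2 ≤ ‖p‖ := by
    have : ‖w‖ ≤ ‖p‖ + ‖q‖ := by rw [hw]; exact norm_add_le _ _
    nlinarith [norm_nonneg w]
  have e1 : m * ‖p‖ ^ 2 ≤ b z₀ p p := hS p hp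
  have e2 : ∀ u v : E, -(K * ‖u‖ * ‖v‖) ≤ b z₀ u v := fun u v =>
    (abs_le.1 ((b z₀).le_opNorm₂ u v)).1
  have e3 : -(m / 16 * ‖w‖ * ‖w‖) ≤ (b z - b z₀) w w := by
    refine le_trans ?_ (abs_le.1 ((b z - b z₀).le_opNorm₂ w w)).1
    simp only [neg_le_neg_iff]
    gcongr
  have e4 : b z w w = b z₀ p p + b z₀ p q + b z₀ q p + b z₀ q q + (b z - b z₀) w w := by
    have h1 : b z w w = b z₀ w w + (b z - b z₀) w w := by simp
    have h2 : b z₀ w w = b z₀ p p + b z₀ p q + b z₀ q p + b z₀ q q := by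
      conv_lhs => rw [hw]
      simp only [map_add, add_apply]
      ring
    rw [h1, h2]
  have e5 := e2 p q
  have e6 := e2 q p
  have e7 := e2 q q
  have hn : 0 ≤ ‖w‖ := norm_nonneg w
  have f1 : K * ‖p‖ * ‖q‖ ≤ m / 24 * ‖w‖ ^ 2 := by
    calc K * ‖p‖ * ‖q‖ ≤ K * ‖w‖ * (ε * ‖w‖) := by gcongr
      _ = (K * ε) * ‖w‖ ^ 2 := by ring
      _ ≤ _ := by gcongr
  have f2 : K * ‖q‖ * ‖q‖ ≤ m / 24 * ‖w‖ ^ 2 := by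
    calc K * ‖q‖ * ‖q‖ ≤ K * (ε * ‖w‖) * (ε * ‖w‖) := by gcongr
      _ = (K * ε) * ε * ‖w‖ ^ 2 := by ring
      _ ≤ (m / 24) * 1 * ‖w‖ ^ 2 := by gcongr; linarith
      _ = _ := by ring
  have f3 : m * (‖w‖ / 2) ^ 2 ≤ m * ‖p‖ ^ 2 := by gcongr
  have f4 : K * ‖q‖ * ‖p‖ = K * ‖p‖ * ‖q‖ := by ring
  rw [e4]
  nlinarith

end Coercive

/-! ### The axial Killing field -/

section AxialFlow

variable {M : Type*} [TopologicalSpace M] [ChartedSpace E4 M] [IsManifold (𝓡 4) ∞ M]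
  {g : BilinField M} {c : OpenPartialHomeomorph M E4} {y : E4}

theorem metric_eq_coordLower (hg : IsLorentzMetric g) (hc : c ∈ atlas E4 M) {x : M}
    (hx : x ∈ c.source) (u v : TangentSpace (𝓡 4) x) :
    g x u v = coordLower (gram g c) (fun _ => coframe (𝓡 4) c x v) (c.extend (𝓡 4) x)
      (coframe (𝓡 4) c x u) := by
  obtain ⟨y, hy, rfl⟩ : ∃ y, y ∈ (c.extend (𝓡 4)).target ∧ (c.extend (𝓡 4)).symm y = x :=
    ⟨_, extend_mem_target (𝓡 4) hx, extend_left_inv' (𝓡 4) hx⟩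
  rw [(c.extend (𝓡 4)).right_inv hy]
  have h1 := fun w => DFunLike.congr_fun (frame_comp_coframe (𝓡 4) hc hy) w
  have h := bilinear_frameMap (bilinOfCLM (g ((c.extend (𝓡 4)).symm y))) (coordFrame c y)
    (coframe (𝓡 4) c ((c.extend (𝓡 4)).symm y) u) (coframe (𝓡 4) c ((c.extend (𝓡 4)).symm y) v)
  rw [frameMap_coordFrame, frameMap_coordFrame] at h
  refine Eq.trans ?_ (h.trans ?_)
  · exact congrArg₂ (fun a b : E4 => (g ((c.extend (𝓡 4)).symm y) : E4 →L[ℝ] E4 →L[ℝ] ℝ) a b)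
      (h1 u).symm (h1 v).symm
  · unfold coordLower
    refine Finset.sum_congr rfl fun i _ => ?_
    rw [Finset.mul_sum]
    refine Finset.sum_congr rfl fun j _ => ?_
    change _ * _ * gramOf _ _ i j = _
    rw [gramOf_coordFrame]
    ring

theorem det_gram_ne_zero (hg : IsLorentzMetric g) (hc : c ∈ atlas E4 M) (hy : y ∈ c.target) :
    (gram g c y).det ≠ 0 := by
  obtain ⟨f, hf, -⟩ := exists_minkowski_frame hg ((c.extend (𝓡 4)).symm y)
  have h1 := det_frameMatrix_sq hf
  have h2 : (gramOf (g ((c.extend (𝓡 4)).symm y)) (stdFrame 4)).det ≠ 0 := by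
    intro h0
    rw [h0] at h1
    norm_num at h1
  have key : ∀ (b : E4 →L[ℝ] E4 →L[ℝ] ℝ) (f : Fin 4 → E4), (gramOf b (stdFrame 4)).det ≠ 0 →
      (frameMatrix f).det ≠ 0 → (gramOf b f).det ≠ 0 := fun b f hb hf => by
    rw [gramOf_frame, Matrix.det_mul, Matrix.det_mul, Matrix.det_transpose]
    positivity
  exact key (g ((c.extend (𝓡 4)).symm y)) (coordFrame c y) h2 (det_coordFrame_ne_zero hc hy)

theorem coordField_extend (ξ : VField (𝓡 4) M) {x : M} (hx : x ∈ c.source) :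
    coordField ξ c (c.extend (𝓡 4) x) = coframe (𝓡 4) c x (ξ x) := by
  unfold coordField
  rw [extend_left_inv' (𝓡 4) hx]

variable [MulAction Circle M]

/-- The flow of the axial Killing field in the chart `c`. -/
def axialFlow (c : OpenPartialHomeomorph M E4) (q : ℝ × E4) : E4 :=
  c.extend (𝓡 4) (Circle.exp q.1 • (c.extend (𝓡 4)).symm q.2)

theorem axialFlow_zero (hy : y ∈ c.target) : axialFlow c (0, y) = y := by
  rw [axialFlow, Circle.exp_zero, one_smul]
  exact (c.extend (𝓡 4)).right_inv (by rwa [extend_target_model])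

namespace IsAxialSymmetry

theorem contMDiff_flow (h : IsAxialSymmetry g) :
    ContMDiff (𝓘(ℝ, ℝ).prod (𝓡 4)) (𝓡 4) ∞ (fun q : ℝ × M => Circle.exp q.1 • q.2) :=
  h.smooth.comp ((contMDiff_circleExp.comp contMDiff_fst).prodMk contMDiff_snd)

theorem contMDiff_smul (h : IsAxialSymmetry g) (t : ℝ) :
    ContMDiff (𝓡 4) (𝓡 4) ∞ (fun x : M => Circle.exp t • x) :=
  h.contMDiff_flow.comp (contMDiff_const.prodMk contMDiff_id)

theorem contMDiffAt_flow_symm (h : IsAxialSymmetry g) (hc : c ∈ atlas E4 M) {q : ℝ × E4}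
    (hq : q.2 ∈ c.target) : ContMDiffAt 𝓘(ℝ, ℝ × E4) (𝓡 4) ∞
      (fun q : ℝ × E4 => Circle.exp q.1 • (c.extend (𝓡 4)).symm q.2) q := by
  have h1 : ContMDiffAt 𝓘(ℝ, E4) (𝓡 4) ∞ (c.extend (𝓡 4)).symm q.2 := by
    have := contMDiffWithinAt_extend_symm (𝓡 4) hc (y := q.2) (by rwa [extend_target_model])
    rwa [range_model, contMDiffWithinAt_univ] at this
  have h2 : ContMDiffAt 𝓘(ℝ, ℝ × E4) 𝓘(ℝ, E4) ∞ (Prod.snd : ℝ × E4 → E4) q :=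
    contDiffAt_snd.contMDiffAt
  have h3 : ContMDiffAt 𝓘(ℝ, ℝ × E4) 𝓘(ℝ, ℝ) ∞ (Prod.fst : ℝ × E4 → ℝ) q :=
    contDiffAt_fst.contMDiffAt
  exact h.contMDiff_flow.contMDiffAt.comp q (h3.prodMk (h1.comp q h2))

theorem contDiffAt_axialFlow (h : IsAxialSymmetry g) (hc : c ∈ atlas E4 M) {q : ℝ × E4}
    (hq : q.2 ∈ c.target) (hq' : Circle.exp q.1 • (c.extend (𝓡 4)).symm q.2 ∈ c.source) :
    ContDiffAt ℝ ∞ (axialFlow c) q :=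
  ((contMDiffAt_extend_of_mem_atlas (𝓡 4) hc hq').comp q
    (h.contMDiffAt_flow_symm hc hq)).contDiffAt

theorem eventually_mem (h : IsAxialSymmetry g) (hc : c ∈ atlas E4 M) {q : ℝ × E4}
    (hq : q.2 ∈ c.target) (hq' : Circle.exp q.1 • (c.extend (𝓡 4)).symm q.2 ∈ c.source) :
    ∀ᶠ q' in 𝓝 q, q'.2 ∈ c.target ∧ Circle.exp q'.1 • (c.extend (𝓡 4)).symm q'.2 ∈ c.source :=
  (continuousAt_snd.eventually (c.open_target.mem_nhds hq)).and
    ((h.contMDiffAt_flow_symm hc hq).continuousAt.eventually (c.open_source.mem_nhds hq'))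

theorem hasDerivAt_orbit_zero (h : IsAxialSymmetry g) (hc : c ∈ atlas E4 M) {x : M}
    (hx : x ∈ c.source) : HasDerivAt (fun t : ℝ => c.extend (𝓡 4) (Circle.exp t • x))
      (coframe (𝓡 4) c x (axialField M x)) 0 := by
  have key : ∀ {γ : ℝ → M} {x : M}, γ 0 = x → x ∈ c.source →
      MDifferentiableAt 𝓘(ℝ, ℝ) (𝓡 4) γ 0 → HasDerivAt (fun t => c.extend (𝓡 4) (γ t))
        (coframe (𝓡 4) c x ((show TangentSpace (𝓡 4) (γ 0) →L[ℝ] TangentSpace (𝓡 4) x from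
          ContinuousLinearMap.id ℝ E4) (mfderiv 𝓘(ℝ, ℝ) (𝓡 4) γ 0 (1 : ℝ)))) 0 := by
    rintro γ x rfl hx hγ
    have h1 := (hasMFDerivAt_extend (𝓡 4) hc hx).comp (0 : ℝ) hγ.hasMFDerivAt
    have h2 : HasFDerivAt (fun t => c.extend (𝓡 4) (γ t)) (show ℝ →L[ℝ] E4 from
      (coframe (𝓡 4) c (γ 0)).comp (mfderiv 𝓘(ℝ, ℝ) (𝓡 4) γ 0)) 0 := h1.hasFDerivAt
    exact h2.hasDerivAt
  refine key (by simp) hx ?_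
  have : ContMDiff 𝓘(ℝ, ℝ) (𝓡 4) ∞ (fun t : ℝ => Circle.exp t • x) :=
    h.contMDiff_flow.comp (contMDiff_id.prodMk contMDiff_const)
  exact this.contMDiffAt.mdifferentiableAt (by simp)

theorem hasDerivAt_axialFlow (h : IsAxialSymmetry g) (hc : c ∈ atlas E4 M) {t : ℝ}
    (hx : Circle.exp t • (c.extend (𝓡 4)).symm y ∈ c.source) :
    HasDerivAt (fun s => axialFlow c (s, y)) (coordField (axialField M) c (axialFlow c (t, y))) t := by
  have h1 := h.hasDerivAt_orbit_zero hc hx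
  have h2 : HasDerivAt (fun s : ℝ => s - t) 1 t := (hasDerivAt_id t).sub_const t
  have h3 := HasDerivAt.scomp (h := fun s : ℝ => s - t) t (by simpa using h1) h2
  rw [one_smul] at h3
  have e1 : (fun s => axialFlow c (s, y)) = (fun t_1 => c.extend (𝓡 4) (Circle.exp t_1 •
      Circle.exp t • (c.extend (𝓡 4)).symm y)) ∘ fun s => s - t := by
    funext s
    simp only [axialFlow, Function.comp_apply, smul_smul]
    rw [← Circle.exp_add, sub_add_cancel]
  rw [e1]
  exact h3.congr_deriv (coordField_extend _ hx).symm

theorem fderiv_axialFlow (h : IsAxialSymmetry g) (hc : c ∈ atlas E4 M) {q : ℝ × E4}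
    (hq : q.2 ∈ c.target) (hq' : Circle.exp q.1 • (c.extend (𝓡 4)).symm q.2 ∈ c.source) :
    fderiv ℝ (axialFlow c) q (1, 0) = coordField (axialField M) c (axialFlow c q) := by
  have h1 := ((h.contDiffAt_axialFlow hc hq hq').differentiableAt (by simp)).hasFDerivAt
  have h2 : HasDerivAt (fun s : ℝ => (s, q.2)) (1, 0) q.1 :=
    (hasDerivAt_id q.1).prodMk (hasDerivAt_const q.1 q.2)
  have h3 := HasFDerivAt.comp_hasDerivAt (f := fun s : ℝ => (s, q.2)) q.1 h1 h2
  exact h3.unique (h.hasDerivAt_axialFlow hc hq')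

theorem symm_mem_source (hy : y ∈ c.target) :
    Circle.exp 0 • (c.extend (𝓡 4)).symm y ∈ c.source := by
  rw [Circle.exp_zero, one_smul]
  exact extend_symm_mem_source (𝓡 4) (by rwa [extend_target_model])

theorem contDiffAt_coordField (h : IsAxialSymmetry g) (hc : c ∈ atlas E4 M) (hy : y ∈ c.target) :
    ContDiffAt ℝ ∞ (coordField (axialField M) c) y := by
  have h1 : ContDiffAt ℝ ∞ (fderiv ℝ (axialFlow c)) (0, y) :=
    (h.contDiffAt_axialFlow hc (q := (0, y)) hy (symm_mem_source hy)).fderiv_right (by simp)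
  have h2 : ContDiffAt ℝ ∞ (fun z : E4 => fderiv ℝ (axialFlow c) (0, z)) y :=
    h1.comp y (contDiffAt_const.prodMk contDiffAt_id)
  refine (h2.clm_apply (contDiffAt_const (c := ((1 : ℝ), (0 : E4))))).congr_of_eventuallyEq ?_
  filter_upwards [c.open_target.mem_nhds hy] with z hz
  rw [h.fderiv_axialFlow hc (q := (0, z)) hz (symm_mem_source hz), axialFlow_zero hz]

/-- The derivative of the flow in space. -/
theorem fderiv_axialFlow_space (h : IsAxialSymmetry g) (hc : c ∈ atlas E4 M) {t : ℝ}
    (hy : y ∈ c.target) (hx : Circle.exp t • (c.extend (𝓡 4)).symm y ∈ c.source) (u : E4) :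
    fderiv ℝ (axialFlow c) (t, y) (0, u) = coframe (𝓡 4) c (Circle.exp t • (c.extend (𝓡 4)).symm y)
      (mfderiv (𝓡 4) (𝓡 4) (fun p : M => Circle.exp t • p) ((c.extend (𝓡 4)).symm y)
        (chartFrame (𝓡 4) c y u)) := by
  have h1 := ((h.contDiffAt_axialFlow hc (q := (t, y)) hy hx).differentiableAt (by simp)).hasFDerivAt
  have h2 : HasFDerivAt (fun z : E4 => (t, z)) (ContinuousLinearMap.inr ℝ ℝ E4) y :=
    hasFDerivAt_prodMk_right t y
  have h3 := HasFDerivAt.comp (f := fun z : E4 => (t, z)) y h1 h2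
  have h4 := hasFDerivWithinAt_coord (𝓡 4) (𝓡 4) hc hc (y := y) (by rwa [extend_target_model])
    ((h.contMDiff_smul t).contMDiffAt.mdifferentiableAt (by simp)) hx
  rw [range_model, hasFDerivWithinAt_univ] at h4
  have h5 := h3.unique h4
  exact DFunLike.congr_fun h5 u

/-- The flow is isometric, in coordinates. -/
theorem isometry_coord (h : IsAxialSymmetry g) (hg : IsLorentzMetric g) (hc : c ∈ atlas E4 M) {t : ℝ}
    (hy : y ∈ c.target) (hx : Circle.exp t • (c.extend (𝓡 4)).symm y ∈ c.source) (u v : E4) :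
    coordLower (gram g c) (fun _ => fderiv ℝ (axialFlow c) (t, y) (0, v)) (axialFlow c (t, y))
      (fderiv ℝ (axialFlow c) (t, y) (0, u)) = coordLower (gram g c) (fun _ => v) y u := by
  have hy' : y ∈ (c.extend (𝓡 4)).target := by rwa [extend_target_model]
  rw [h.fderiv_axialFlow_space hc hy hx, h.fderiv_axialFlow_space hc hy hx]
  refine (metric_eq_coordLower hg hc hx _ _).symm.trans ((h.isometry _ _ _ _).trans ?_)
  refine (metric_eq_coordLower hg hc (extend_symm_mem_source (𝓡 4) hy') _ _).trans ?_
  have h1 := fun w => DFunLike.congr_fun (coframe_comp_frame (𝓡 4) hc hy') w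
  rw [(c.extend (𝓡 4)).right_inv hy']
  exact congrArg₂ (fun a b : E4 => coordLower (gram g c) (fun _ => b) y a) (h1 u) (h1 v)

theorem hasDerivAt_fderiv_axialFlow (h : IsAxialSymmetry g) (hc : c ∈ atlas E4 M) {t : ℝ}
    (hy : y ∈ c.target) (hx : Circle.exp t • (c.extend (𝓡 4)).symm y ∈ c.source) (v : E4) :
    HasDerivAt (fun s => fderiv ℝ (axialFlow c) (s, y) (0, v))
      (fderiv ℝ (coordField (axialField M) c) (axialFlow c (t, y))
        (fderiv ℝ (axialFlow c) (t, y) (0, v))) t := by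
  refine hasDerivAt_fderiv_flow v (h.contDiffAt_axialFlow hc (q := (t, y)) hy hx) ?_ ?_
  · refine (h.contDiffAt_coordField hc ?_).differentiableAt (by simp)
    have := extend_mem_target (𝓡 4) hx
    rwa [extend_target_model] at this
  · filter_upwards [h.eventually_mem hc (q := (t, y)) hy hx] with q hq
    exact h.fderiv_axialFlow hc hq.1 hq.2

theorem fderiv_axialFlow_zero (h : IsAxialSymmetry g) (hc : c ∈ atlas E4 M) (hy : y ∈ c.target)
    (v : E4) : fderiv ℝ (axialFlow c) (0, y) (0, v) = v := by
  have h1 := ((h.contDiffAt_axialFlow hc (q := (0, y)) hy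
    (symm_mem_source hy)).differentiableAt (by simp)).hasFDerivAt
  have h2 : HasFDerivAt (fun z : E4 => ((0 : ℝ), z)) (ContinuousLinearMap.inr ℝ ℝ E4) y :=
    hasFDerivAt_prodMk_right 0 y
  have h3 := HasFDerivAt.comp (f := fun z : E4 => ((0 : ℝ), z)) y h1 h2
  have h4 : HasFDerivAt (axialFlow c ∘ fun z : E4 => ((0 : ℝ), z)) (ContinuousLinearMap.id ℝ E4) y :=
    (hasFDerivAt_id y).congr_of_eventuallyEq (by
      filter_upwards [c.open_target.mem_nhds hy] with z hz
      exact axialFlow_zero hz)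
  exact DFunLike.congr_fun (h3.unique h4) v

/-- The axial field satisfies Killing's equation. -/
theorem isKillingField (h : IsAxialSymmetry g) (hg : IsLorentzMetric g) :
    IsKillingField g (axialField M) := by
  intro c hc
  have hG : ∀ y ∈ c.target, ∀ i j, ContDiffAt ℝ ∞ (fun z => gram g c z i j) y := fun y hy i j =>
    (hg.smooth c hc i j).contDiffAt (c.open_target.mem_nhds hy)
  refine ⟨c.open_target, hG, fun y _ i j => hg.symm _ _ _, fun y hy => det_gram_ne_zero hg hc hy,
    fun y hy => h.contDiffAt_coordField hc hy, fun y hy i j => ?_⟩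
  have hx := symm_mem_source hy
  have hmem : ∀ᶠ t : ℝ in 𝓝 0, Circle.exp t • (c.extend (𝓡 4)).symm y ∈ c.source := by
    have h1 := h.eventually_mem hc (q := (0, y)) hy hx
    have h2 : Tendsto (fun t : ℝ => (t, y)) (𝓝 0) (𝓝 (0, y)) :=
      (Continuous.tendsto (by fun_prop) 0)
    exact (h2.eventually h1).mono fun t ht => ht.2
  have hΨ : HasDerivAt (fun s => axialFlow c (s, y)) (coordField (axialField M) c y) 0 := by
    have := h.hasDerivAt_axialFlow hc hx
    rwa [axialFlow_zero hy] at this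
  have hD : ∀ v k, HasDerivAt (fun s => fderiv ℝ (axialFlow c) (s, y) (0, v) k)
      (fderiv ℝ (fun z => coordField (axialField M) c z k) y v) 0 := by
    intro v k
    have h1 := h.hasDerivAt_fderiv_axialFlow hc hy hx v
    rw [axialFlow_zero hy, h.fderiv_axialFlow_zero hc hy] at h1
    have h2 := (EuclideanSpace.proj (𝕜 := ℝ) k : E4 →L[ℝ] ℝ).hasFDerivAt.comp_hasDerivAt 0 h1
    have h3 := ((EuclideanSpace.proj (𝕜 := ℝ) k : E4 →L[ℝ] ℝ).hasFDerivAt.comp y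
      ((h.contDiffAt_coordField hc hy).differentiableAt (by simp)).hasFDerivAt).fderiv
    refine h2.congr_deriv ?_
    exact (DFunLike.congr_fun h3 v).symm
  have hGt : ∀ k l, HasDerivAt (fun s => gram g c (axialFlow c (s, y)) k l)
      (fderiv ℝ (fun z => gram g c z k l) y (coordField (axialField M) c y)) 0 := by
    intro k l
    have h1 : HasFDerivAt (fun z => gram g c z k l) (fderiv ℝ (fun z => gram g c z k l) y)
        (axialFlow c (0, y)) := by
      rw [axialFlow_zero hy]
      exact ((hG y hy k l).differentiableAt (by simp)).hasFDerivAt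
    exact HasFDerivAt.comp_hasDerivAt (f := fun s => axialFlow c (s, y)) 0 h1 hΨ
  have hsum : HasDerivAt (fun s => coordLower (gram g c)
      (fun _ => fderiv ℝ (axialFlow c) (s, y) (0, stdFrame 4 j)) (axialFlow c (s, y))
      (fderiv ℝ (axialFlow c) (s, y) (0, stdFrame 4 i))) _ 0 :=
    HasDerivAt.fun_sum fun l _ => (hD (stdFrame 4 i) l).fun_mul
      (HasDerivAt.fun_sum fun m _ => (hGt l m).fun_mul (hD (stdFrame 4 j) m))
  have hconst : HasDerivAt (fun s => coordLower (gram g c)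
      (fun _ => fderiv ℝ (axialFlow c) (s, y) (0, stdFrame 4 j)) (axialFlow c (s, y))
      (fderiv ℝ (axialFlow c) (s, y) (0, stdFrame 4 i))) 0 0 := by
    refine (hasDerivAt_const (0 : ℝ) (coordLower (gram g c) (fun _ => stdFrame 4 j) y
      (stdFrame 4 i))).congr_of_eventuallyEq ?_
    filter_upwards [hmem] with s hs
    exact h.isometry_coord hg hc hy hs _ _
  have hfin := hsum.unique hconst
  simp only [h.fderiv_axialFlow_zero hc hy, axialFlow_zero hy, fderiv_apply_eq_sum_pd _ y
    (coordField (axialField M) c y)] at hfin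
  rw [← hfin]
  have e : ∀ a b : Fin 4, (stdFrame 4 a : E4) b = if b = a then 1 else 0 := fun a b => by
    simp [stdFrame]
  simp only [e]
  simp only [mul_ite, mul_one, mul_zero, ite_mul, one_mul, zero_mul, Finset.sum_add_distrib,
    Finset.sum_ite_eq', Finset.mem_univ, if_true, pd]
  simp only [mul_comm]
  ring

end IsAxialSymmetry

end AxialFlow

/-! ### The axis of a Killing field with periodic orbits -/

section Axis

/-- The matrix `G` as a bilinear form. -/
def metricForm (G : E4 → Matrix (Fin 4) (Fin 4) ℝ) (z : E4) : E4 →L[ℝ] E4 →L[ℝ] ℝ :=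
  ∑ l, ∑ m, G z l m • (EuclideanSpace.proj (𝕜 := ℝ) l : E4 →L[ℝ] ℝ).smulRight
    (EuclideanSpace.proj (𝕜 := ℝ) m : E4 →L[ℝ] ℝ)

theorem metricForm_apply (G : E4 → Matrix (Fin 4) (Fin 4) ℝ) (z u v : E4) :
    metricForm G z u v = coordLower G (fun _ => v) z u := by
  simp only [metricForm, coordLower, sum_apply, smul_apply, ContinuousLinearMap.smulRight_apply,
    Finset.mul_sum, smul_eq_mul]
  refine Finset.sum_congr rfl fun l _ => Finset.sum_congr rfl fun m _ => ?_
  change G z l m * (u l * v m) = _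
  ring

theorem metricForm_field (G : E4 → Matrix (Fin 4) (Fin 4) ℝ) (X : E4 → E4) (z : E4) :
    metricForm G z (X z) (X z) = coordLower G X z (X z) :=
  metricForm_apply G z (X z) (X z)

theorem tendsto_norm_sum_smul_sub {V : Type*} [NormedAddCommGroup V] [NormedSpace ℝ V]
    (e : Fin 4 → Fin 4 → V) {G : E4 → Matrix (Fin 4) (Fin 4) ℝ} {y : E4}
    (hG : ∀ i j, ContinuousAt (fun z => G z i j) y) :
    Tendsto (fun z => ‖∑ l, ∑ m, G z l m • e l m - ∑ l, ∑ m, G y l m • e l m‖) (𝓝 y) (𝓝 0) := by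
  have h : ContinuousAt (fun z => ‖∑ l, ∑ m, G z l m • e l m - ∑ l, ∑ m, G y l m • e l m‖) y :=
    (ContinuousAt.sub (tendsto_finsetSum _ fun l _ => tendsto_finsetSum _ fun m _ =>
      (hG l m).tendsto.smul_const (e l m)) continuousAt_const).norm
  simpa [ContinuousAt] using h

theorem tendsto_metricForm {G : E4 → Matrix (Fin 4) (Fin 4) ℝ} {y : E4}
    (hG : ∀ i j, ContinuousAt (fun z => G z i j) y) :
    Tendsto (fun z => ‖metricForm G z - metricForm G y‖) (𝓝 y) (𝓝 0) :=
  tendsto_norm_sum_smul_sub (V := E4 →L[ℝ] E4 →L[ℝ] ℝ) _ hG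

theorem norm_le_sum_abs (q : E4) : ‖q‖ ≤ ∑ i, |q i| := by
  conv_lhs => rw [← (stdBasis 4).sum_repr q]
  refine (norm_sum_le _ _).trans (Finset.sum_le_sum fun i _ => ?_)
  rw [norm_smul, stdBasis_repr, stdBasis_eq]
  simp [stdFrame]

namespace IsKillingOn

variable {W : Set E4} {G : E4 → Matrix (Fin 4) (Fin 4) ℝ} {X : E4 → E4} {y : E4}

theorem metricForm_symm (h : IsKillingOn W G X) (hy : y ∈ W) (u v : E4) :
    metricForm G y u v = metricForm G y v u := by
  rw [metricForm_apply, metricForm_apply]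
  simp only [coordLower, Finset.mul_sum]
  rw [Finset.sum_comm]
  refine Finset.sum_congr rfl fun l _ => Finset.sum_congr rfl fun m _ => ?_
  rw [h.symm y hy m l]
  ring

theorem metricForm_nondegenerate (h : IsKillingOn W G X) (hy : y ∈ W) {u : E4}
    (hu : ∀ v, metricForm G y u v = 0) : u = 0 := by
  have h2 : u.ofLp ᵥ* G y = 0 := by
    funext j
    have := hu (stdFrame 4 j)
    rw [metricForm_apply] at this
    simpa [coordLower, stdFrame, Matrix.vecMul, dotProduct] using this
  have h3 := Matrix.eq_zero_of_vecMul_eq_zero (h.det_ne_zero y hy) h2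
  ext m
  exact congrFun h3 m

/-- At a zero of a Killing field, its linearisation is skew. -/
theorem metricForm_skew (h : IsKillingOn W G X) (hy : y ∈ W) (hX : X y = 0) (u v : E4) :
    metricForm G y (fderiv ℝ X y u) v = -metricForm G y u (fderiv ℝ X y v) := by
  have hA : ∀ v k, fderiv ℝ X y v k = ∑ i, v i * pd i (fun z => X z k) y := fun v k =>
    (h.fderiv_field_apply hy v k)
  have hK : ∀ i j, ∑ k, G y k j * pd i (fun z => X z k) y +
      ∑ k, G y i k * pd j (fun z => X z k) y = 0 := fun i j => by
    have := h.killing y hy i j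
    simpa [hX] using this
  have h1 : ∑ i, ∑ j, u i * v j * (∑ k, G y k j * pd i (fun z => X z k) y +
      ∑ k, G y i k * pd j (fun z => X z k) y) = 0 := by simp [hK]
  rw [metricForm_apply, metricForm_apply, eq_neg_iff_add_eq_zero, ← h1]
  simp only [coordLower, hA, Fin.sum_univ_four]
  ring

theorem metricForm_image_nonneg (h : IsKillingOn W G X) (hy : y ∈ W) (hX : X y = 0)
    (hf : ∀ᶠ z in 𝓝 y, 0 ≤ coordLower G X z (X z)) (v : E4) :
    0 ≤ metricForm G y (fderiv ℝ X y v) (fderiv ℝ X y v) := by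
  have hd : HasDerivAt (fun s : ℝ => X (y + s • v)) (fderiv ℝ X y v) 0 := by
    have h1 : HasFDerivAt X (fderiv ℝ X y) (y + (0 : ℝ) • v) := by
      simpa using ((h.field y hy).differentiableAt (by simp)).hasFDerivAt
    have h2 : HasDerivAt (fun s : ℝ => y + s • v) v 0 := by
      simpa using ((hasDerivAt_id (0 : ℝ)).smul_const v).const_add y
    exact HasFDerivAt.comp_hasDerivAt (f := fun s : ℝ => y + s • v) 0 h1 h2
  have hline : Tendsto (fun s : ℝ => y + s • v) (𝓝[≠] 0) (𝓝 y) := by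
    have : Continuous fun s : ℝ => y + s • v := by fun_prop
    simpa using (this.tendsto 0).mono_left nhdsWithin_le_nhds
  have hsl := hasDerivAt_iff_tendsto_slope.1 hd
  have hlim : Tendsto (fun s : ℝ => coordLower G (fun _ => slope (fun s : ℝ => X (y + s • v)) 0 s)
      (y + s • v) (slope (fun s : ℝ => X (y + s • v)) 0 s)) (𝓝[≠] 0)
      (𝓝 (coordLower G (fun _ => fderiv ℝ X y v) y (fderiv ℝ X y v))) := by
    have hc : ∀ k : Fin 4, Tendsto (fun s => slope (fun s : ℝ => X (y + s • v)) 0 s k) (𝓝[≠] 0)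
        (𝓝 (fderiv ℝ X y v k)) := fun k =>
      ((EuclideanSpace.proj (𝕜 := ℝ) k : E4 →L[ℝ] ℝ).continuous.tendsto _).comp hsl
    refine tendsto_finsetSum _ fun l _ => (hc l).mul (tendsto_finsetSum _ fun m _ => Tendsto.mul ?_ (hc m))
    exact ((h.metric y hy l m).continuousAt.tendsto).comp hline
  rw [metricForm_apply]
  refine ge_of_tendsto hlim ?_
  filter_upwards [hline.eventually hf] with s hs
  have e1 : slope (fun s : ℝ => X (y + s • v)) 0 s = s⁻¹ • X (y + s • v) := by
    simp [slope, hX]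
  rw [e1, ← metricForm_apply]
  simp only [map_smul, smul_apply, smul_eq_mul]
  rw [metricForm_field, ← mul_assoc]
  exact mul_nonneg (mul_self_nonneg _) hs

/-- At a zero of a Killing field with nonnegative square and without nilpotent part, the metric is
positive definite on the image of the linearisation. -/
theorem metricForm_image_pos (h : IsKillingOn W G X) (hy : y ∈ W) (hX : X y = 0)
    (hf : ∀ᶠ z in 𝓝 y, 0 ≤ coordLower G X z (X z))
    (hnil : ∀ v, fderiv ℝ X y (fderiv ℝ X y v) = 0 → fderiv ℝ X y v = 0) {v : E4}
    (hv : fderiv ℝ X y v ≠ 0) : 0 < metricForm G y (fderiv ℝ X y v) (fderiv ℝ X y v) := by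
  set A := fderiv ℝ X y
  set b := metricForm G y with hb
  have hnn : ∀ w, 0 ≤ b (A w) (A w) := h.metricForm_image_nonneg hy hX hf
  refine lt_of_le_of_ne (hnn v) fun h0 => hv (hnil v ?_)
  refine h.metricForm_nondegenerate hy fun w => ?_
  rw [h.metricForm_skew hy hX]
  have h1 : ∀ t : ℝ, 0 ≤ b (A w) (A w) * (t * t) + 2 * b (A v) (A w) * t + 0 := fun t => by
    have h2 := hnn (v + t • w)
    simp only [map_add, map_smul, add_apply, smul_apply, smul_eq_mul] at h2
    rw [← h0, h.metricForm_symm hy (A w) (A v)] at h2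
    linarith
  have h2 := discrim_le_zero h1
  rw [discrim] at h2
  have h3 : b (A v) (A w) = 0 := by nlinarith [sq_nonneg (b (A v) (A w))]
  change -b (A v) (A w) = 0
  rw [h3, neg_zero]

/-- Uniform spacelikeness near a zero of a Killing field with periodic orbits. -/
theorem eventually_norm_sq_le (h : IsKillingOn W G X) (hy : y ∈ W) (hX : X y = 0)
    (hf : ∀ᶠ z in 𝓝 y, 0 ≤ coordLower G X z (X z))
    (hnil : ∀ v, fderiv ℝ X y (fderiv ℝ X y v) = 0 → fderiv ℝ X y v = 0)
    (hA : ∀ l : E4 →L[ℝ] ℝ, l.comp (fderiv ℝ X y) = 0 → ∀ ε : ℝ, 0 < ε →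
      ∀ᶠ z in 𝓝 y, |l (X z)| ≤ ε * ‖X z‖) :
    ∃ κ : ℝ, 0 < κ ∧ ∀ᶠ z in 𝓝 y, κ * ‖X z‖ ^ 2 ≤ coordLower G X z (X z) := by
  set S : Submodule ℝ E4 := LinearMap.range (fderiv ℝ X y).toLinearMap with hS
  obtain ⟨κ, hκ, ε, hε, hev⟩ := eventually_coercive (z₀ := y) (S := S)
    (tendsto_metricForm fun i j => (h.metric y hy i j).continuousAt) (by
      rintro _ ⟨v, rfl⟩ hv
      exact h.metricForm_image_pos hy hX hf hnil hv)
  refine ⟨κ, hκ, ?_⟩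
  have hl : ∀ i, ∀ᶠ z in 𝓝 y, |(X z - S.starProjection (X z)) i| ≤ ε / 4 * ‖X z‖ := fun i => by
    refine hA ((EuclideanSpace.proj (𝕜 := ℝ) i : E4 →L[ℝ] ℝ).comp
      (ContinuousLinearMap.id ℝ E4 - S.starProjection)) ?_ (ε / 4) (by positivity)
    ext v
    have : S.starProjection (fderiv ℝ X y v) = fderiv ℝ X y v :=
      Submodule.starProjection_eq_self_iff.2 ⟨v, rfl⟩
    simp [this]
  filter_upwards [hev, eventually_all.2 hl] with z hz hlz
  rw [← metricForm_field]
  refine hz _ (S.starProjection (X z)) (Submodule.starProjection_apply_mem _ _)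
    (Submodule.norm_starProjection_apply_le _ _) ?_
  refine (norm_le_sum_abs _).trans ((Finset.sum_le_sum fun i _ => hlz i).trans (le_of_eq ?_))
  simp
  ring

end IsKillingOn

variable {M : Type*} [TopologicalSpace M] [ChartedSpace E4 M] [IsManifold (𝓡 4) ∞ M]
  {g : BilinField M} {c : OpenPartialHomeomorph M E4} {y : E4}

theorem coordField_eq_zero_iff {ξ : VField (𝓡 4) M} (hc : c ∈ atlas E4 M) (hy : y ∈ c.target) :
    coordField ξ c y = 0 ↔ ξ ((c.extend (𝓡 4)).symm y) = 0 := by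
  constructor
  · intro h
    exact (chartFrame_coordField hc hy).symm.trans ((congrArg (chartFrame (𝓡 4) c y) h).trans
      (map_zero (chartFrame (𝓡 4) c y)))
  · intro h
    exact (congrArg (coframe (𝓡 4) c ((c.extend (𝓡 4)).symm y)) h).trans
      (map_zero (coframe (𝓡 4) c ((c.extend (𝓡 4)).symm y)))

variable [MulAction Circle M]

namespace IsAxialSymmetry

/-- The axial field is invariant under its flow. -/
theorem fderiv_axialFlow_field (h : IsAxialSymmetry g) (hc : c ∈ atlas E4 M) {t : ℝ}
    (hy : y ∈ c.target) (hx : Circle.exp t • (c.extend (𝓡 4)).symm y ∈ c.source) :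
    fderiv ℝ (axialFlow c) (t, y) (0, coordField (axialField M) c y) =
      coordField (axialField M) c (axialFlow c (t, y)) := by
  have hx0 := symm_mem_source hy
  have h1 : HasFDerivAt (axialFlow c) (fderiv ℝ (axialFlow c) (t, y)) (t, axialFlow c (0, y)) := by
    rw [axialFlow_zero hy]
    exact ((h.contDiffAt_axialFlow hc (q := (t, y)) hy hx).differentiableAt (by simp)).hasFDerivAt
  have h2 : HasDerivAt (fun s : ℝ => (t, axialFlow c (s, y)))
      (0, coordField (axialField M) c (axialFlow c (0, y))) 0 :=
    (hasDerivAt_const 0 t).prodMk (h.hasDerivAt_axialFlow hc hx0)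
  have h3 := HasFDerivAt.comp_hasDerivAt (f := fun s : ℝ => (t, axialFlow c (s, y))) 0 h1 h2
  rw [axialFlow_zero hy] at h3
  have h4 : HasDerivAt (fun s => axialFlow c (t + s, y))
      (coordField (axialField M) c (axialFlow c (t, y))) 0 := by
    have h5 : HasDerivAt (fun s => axialFlow c (s, y))
        (coordField (axialField M) c (axialFlow c (t, y))) (t + 0) := by
      rw [add_zero]
      exact h.hasDerivAt_axialFlow hc hx
    exact h5.comp_const_add t 0
  refine h3.unique (h4.congr_of_eventuallyEq ?_)
  have h6 := h.eventually_mem hc (q := (0, y)) hy hx0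
  have h7 : Tendsto (fun s : ℝ => (s, y)) (𝓝 0) (𝓝 (0, y)) := Continuous.tendsto (by fun_prop) 0
  filter_upwards [h7.eventually h6] with s hs
  simp only [Function.comp_apply, axialFlow]
  rw [extend_left_inv' (𝓡 4) hs.2, smul_smul, ← Circle.exp_add]

/-- Zeros of the axial field are fixed points of the action. -/
theorem smul_eq_of_axialField_eq_zero (h : IsAxialSymmetry g) {x : M} (hx : axialField M x = 0)
    (t : ℝ) : Circle.exp t • x = x := by
  set c := chartAt E4 x
  have hc : c ∈ atlas E4 M := chart_mem_atlas E4 x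
  have hxs : x ∈ c.source := mem_chart_source E4 x
  set y := c.extend (𝓡 4) x with hy_def
  have hy : y ∈ c.target := by
    have := extend_mem_target (𝓡 4) hxs
    rwa [extend_target_model] at this
  have hl : (c.extend (𝓡 4)).symm y = x := extend_left_inv' (𝓡 4) hxs
  have hX : coordField (axialField M) c y = 0 := by
    rw [coordField_eq_zero_iff hc hy, hl]; exact hx
  have hev : ∀ᶠ s : ℝ in 𝓝 0, Circle.exp s • x ∈ c.source := by
    have h6 := h.eventually_mem hc (q := (0, y)) hy (symm_mem_source hy)
    have h7 : Tendsto (fun s : ℝ => (s, y)) (𝓝 0) (𝓝 (0, y)) := Continuous.tendsto (by fun_prop) 0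
    filter_upwards [h7.eventually h6] with s hs
    rw [← hl]
    exact hs.2
  obtain ⟨δ, hδ, hball⟩ := Metric.eventually_nhds_iff_ball.1 hev
  have hmem : ∀ s ∈ Ico 0 δ, Circle.exp s • x ∈ c.source := fun s hs => hball s (by
    rw [Metric.mem_ball, Real.dist_eq, sub_zero, abs_of_nonneg hs.1]; exact hs.2)
  have hsmall : ∀ s ∈ Ico 0 δ, Circle.exp s • x = x := fun s hs => by
    have hd : ∀ r ∈ Icc 0 s, HasDerivAt (fun r => axialFlow c (r, y)) 0 r := fun r hr => by
      have hr' : Circle.exp r • (c.extend (𝓡 4)).symm y ∈ c.source := by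
        rw [hl]; exact hmem r ⟨hr.1, hr.2.trans_lt hs.2⟩
      have h1 := h.hasDerivAt_axialFlow hc hr'
      rwa [← h.fderiv_axialFlow_field hc hy hr', hX, Prod.mk_zero_zero, map_zero] at h1
    have h1 := norm_image_sub_le_of_norm_deriv_le_segment' (f := fun r => axialFlow c (r, y))
      (f' := fun _ => 0) (C := 0) (fun r hr => (hd r hr).hasDerivWithinAt) (by simp) s ⟨hs.1, le_rfl⟩
    rw [zero_mul, norm_le_zero_iff, sub_eq_zero, axialFlow_zero hy, axialFlow, hl] at h1
    have := congrArg (c.extend (𝓡 4)).symm h1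
    rwa [extend_left_inv' (𝓡 4) (hmem s hs), hl] at this
  have hpos : ∀ t : ℝ, 0 ≤ t → Circle.exp t • x = x := fun t ht => by
    obtain ⟨n, hn⟩ := exists_nat_gt (t / δ)
    have hn0 : (0 : ℝ) < n := (div_nonneg ht hδ.le).trans_lt hn
    have hs : t / n ∈ Ico 0 δ := ⟨by positivity, by
      rw [div_lt_iff₀ hδ] at hn
      rw [div_lt_iff₀ hn0]; linarith⟩
    have hiter : ∀ k : ℕ, Circle.exp (k * (t / n)) • x = x := fun k => by
      induction k with
      | zero => simp
      | succ k ih =>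
        rw [Nat.cast_succ, add_mul, one_mul, Circle.exp_add, ← smul_smul, hsmall _ hs, ih]
    have := hiter n
    rwa [mul_div_cancel₀ _ hn0.ne'] at this
  rcases le_total 0 t with ht | ht
  · exact hpos t ht
  · have h1 := hpos (-t) (by linarith)
    rw [Circle.exp_neg, inv_smul_eq_iff] at h1
    exact h1.symm

/-- Points near a fixed point have their whole orbit near it. -/
theorem eventually_forall_smul (h : IsAxialSymmetry g) {x : M} (hx : ∀ t : ℝ, Circle.exp t • x = x)
    {P : M → Prop} (hP : ∀ᶠ x' in 𝓝 x, P x') : ∀ᶠ x' in 𝓝 x, ∀ t : ℝ, P (Circle.exp t • x') := by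
  have h1 : ∀ᶠ x' in 𝓝 x, ∀ z ∈ (univ : Set Circle), P (z • x') := by
    refine isCompact_univ.eventually_forall_of_forall_eventually fun z _ => ?_
    have hz : z • x = x := by rw [← Circle.exp_arg z]; exact hx _
    have hc : ContinuousAt (fun q : M × Circle => q.2 • q.1) (x, z) :=
      (h.smooth.continuous.comp continuous_swap).continuousAt
    refine hc.eventually ?_
    change ∀ᶠ x' in 𝓝 (z • x), P x'
    rwa [hz]
  exact h1.mono fun x' hx' t => hx' _ (mem_univ _)

theorem exists_orbit (h : IsAxialSymmetry g) (hc : c ∈ atlas E4 M) (hy : y ∈ c.target)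
    (hX : coordField (axialField M) c y = 0) {r : ℝ} (hr : 0 < r) :
    ∀ᶠ z in 𝓝 y, ∃ u : ℝ → E4, u 0 = z ∧ u (2 * Real.pi) = z ∧
      ∀ t, HasDerivAt u (coordField (axialField M) c (u t)) t ∧ u t ∈ Metric.ball y r := by
  have hy' : y ∈ (c.extend (𝓡 4)).target := by rwa [extend_target_model]
  set x := (c.extend (𝓡 4)).symm y with hx
  have hxs : x ∈ c.source := extend_symm_mem_source (𝓡 4) hy'
  have hfix := h.smul_eq_of_axialField_eq_zero ((coordField_eq_zero_iff hc hy).1 hX)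
  have hP : ∀ᶠ x' in 𝓝 x, x' ∈ c.source ∧ c.extend (𝓡 4) x' ∈ Metric.ball y r := by
    refine Filter.Eventually.and (c.open_source.mem_nhds hxs) ?_
    refine (c.continuousAt_extend (I := 𝓡 4) hxs).eventually ?_
    rw [hx, (c.extend (𝓡 4)).right_inv hy']
    exact Metric.ball_mem_nhds _ hr
  have hsymm : ContinuousAt (c.extend (𝓡 4)).symm y := by
    have := (contMDiffWithinAt_extend_symm (𝓡 4) hc hy').continuousWithinAt
    rwa [range_model, continuousWithinAt_univ] at this
  filter_upwards [hsymm.eventually (h.eventually_forall_smul hfix hP), c.open_target.mem_nhds hy]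
    with z hz hzt
  refine ⟨fun t => axialFlow c (t, z), axialFlow_zero hzt, ?_, fun t =>
    ⟨h.hasDerivAt_axialFlow hc (hz t).1, (hz t).2⟩⟩
  have := axialFlow_zero hzt
  simp only [axialFlow, Circle.exp_zero, Circle.exp_two_pi] at this ⊢
  exact this

theorem nilpotent_eq_zero (h : IsAxialSymmetry g) (hc : c ∈ atlas E4 M) (hy : y ∈ c.target)
    (hX : coordField (axialField M) c y = 0) {v : E4}
    (hv : fderiv ℝ (coordField (axialField M) c) y (fderiv ℝ (coordField (axialField M) c) y v) = 0) :
    fderiv ℝ (coordField (axialField M) c) y v = 0 := by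
  have hy' : y ∈ (c.extend (𝓡 4)).target := by rwa [extend_target_model]
  have hfix := h.smul_eq_of_axialField_eq_zero ((coordField_eq_zero_iff hc hy).1 hX)
  have hΨ : ∀ t, axialFlow c (t, y) = y := fun t => by
    simp only [axialFlow]
    rw [hfix, (c.extend (𝓡 4)).right_inv hy']
  have hR : ∀ t, HasDerivAt (fun s => fderiv ℝ (axialFlow c) (s, y) (0, v))
      (fderiv ℝ (coordField (axialField M) c) y (fderiv ℝ (axialFlow c) (t, y) (0, v))) t := fun t => by
    have h1 := h.hasDerivAt_fderiv_axialFlow hc (t := t) hy (by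
      rw [hfix]; exact extend_symm_mem_source (𝓡 4) hy') v
    rwa [hΨ] at h1
  have hper : fderiv ℝ (axialFlow c) (2 * Real.pi, y) = fderiv ℝ (axialFlow c) (0, y) := by
    have e : axialFlow c = fun q => axialFlow c (q + (2 * Real.pi, 0)) := by
      funext q
      simp [axialFlow]
    conv_rhs => rw [e]
    rw [fderiv_comp_add_right]
    simp
  have h0 := h.fderiv_axialFlow_zero hc hy v
  have := apply_eq_zero_of_periodic (T := 2 * Real.pi) (by positivity) hR (by simp only [hper])
    (by simpa only [h0] using hv)
  simpa only [h0] using this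

theorem eventually_coordField_eq_zero (h : IsAxialSymmetry g) (hc : c ∈ atlas E4 M)
    (hy : y ∈ c.target) (hX : coordField (axialField M) c y = 0)
    (hA : fderiv ℝ (coordField (axialField M) c) y = 0) :
    ∀ᶠ z in 𝓝 y, coordField (axialField M) c z = 0 := by
  have h1 : ∀ i : Fin 4, ∀ᶠ z in 𝓝 y, |coordField (axialField M) c z i| ≤
      1 / 8 * ‖coordField (axialField M) c z‖ := fun i =>
    eventually_abs_apply_le (T := 2 * Real.pi) (by positivity)
      ((h.contDiffAt_coordField hc hy).of_le (by simp))
      (fun r hr => h.exists_orbit hc hy hX hr) (EuclideanSpace.proj (𝕜 := ℝ) i : E4 →L[ℝ] ℝ)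
      (by simp [hA]) (by norm_num)
  filter_upwards [eventually_all.2 h1] with z hz
  have h2 := (norm_le_sum_abs (coordField (axialField M) c z)).trans
    (Finset.sum_le_sum fun i _ => hz i)
  simp only [Finset.sum_const, Finset.card_univ, Fintype.card_fin, nsmul_eq_mul] at h2
  have h3 := norm_nonneg (coordField (axialField M) c z)
  have h4 : ‖coordField (axialField M) c z‖ = 0 := by
    push_cast at h2
    linarith
  exact norm_eq_zero.1 h4

/-- The linearisation of the axial field does not vanish on the axis. -/
theorem fderiv_coordField_ne_zero [ConnectedSpace M] (h : IsAxialSymmetry g) (hc : c ∈ atlas E4 M)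
    (hy : y ∈ c.target) (hX : coordField (axialField M) c y = 0) :
    fderiv ℝ (coordField (axialField M) c) y ≠ 0 := by
  intro hA
  set Z : Set M := {x | ∀ᶠ x' in 𝓝 x, axialField M x' = 0} with hZ
  have hsymm : ∀ {c : OpenPartialHomeomorph M E4}, c ∈ atlas E4 M → ∀ {y}, y ∈ c.target →
      ContinuousAt (c.extend (𝓡 4)).symm y := fun {c} hc {y} hy => by
    have := (contMDiffWithinAt_extend_symm (𝓡 4) hc (y := y)
      (by rwa [extend_target_model])).continuousWithinAt
    rwa [range_model, continuousWithinAt_univ] at this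
  have key : ∀ {c : OpenPartialHomeomorph M E4}, c ∈ atlas E4 M → ∀ {x}, x ∈ c.source →
      coordField (axialField M) c (c.extend (𝓡 4) x) = 0 →
      fderiv ℝ (coordField (axialField M) c) (c.extend (𝓡 4) x) = 0 → x ∈ Z := by
    intro c hc x hx h0 h1
    have ht : c.extend (𝓡 4) x ∈ c.target := by
      have := extend_mem_target (𝓡 4) hx
      rwa [extend_target_model] at this
    have h2 := h.eventually_coordField_eq_zero hc ht h0 h1
    filter_upwards [(c.continuousAt_extend (I := 𝓡 4) hx).eventually h2,
      c.open_source.mem_nhds hx] with x' hx' hs'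
    have ht' : c.extend (𝓡 4) x' ∈ c.target := by
      have := extend_mem_target (𝓡 4) hs'
      rwa [extend_target_model] at this
    have := (coordField_eq_zero_iff hc ht').1 hx'
    rwa [extend_left_inv' (𝓡 4) hs'] at this
  have hopen : IsOpen Z := isOpen_iff_mem_nhds.2 fun x hx => eventually_eventually_nhds.2 hx
  have hclosed : IsClosed Z := by
    refine isClosed_of_closure_subset fun x hx => ?_
    set c := chartAt E4 x
    have hc : c ∈ atlas E4 M := chart_mem_atlas E4 x
    have hxs : x ∈ c.source := mem_chart_source E4 x
    have ht : c.extend (𝓡 4) x ∈ c.target := by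
      have := extend_mem_target (𝓡 4) hxs
      rwa [extend_target_model] at this
    have hfr := mem_closure_iff_frequently.1 hx
    have hce := c.continuousAt_extend (I := 𝓡 4) hxs
    have hval : ∀ᶠ x' in 𝓝 x, x' ∈ Z → coordField (axialField M) c (c.extend (𝓡 4) x') = 0 ∧
        fderiv ℝ (coordField (axialField M) c) (c.extend (𝓡 4) x') = 0 := by
      filter_upwards [c.open_source.mem_nhds hxs] with x' hs' hx'
      have ht' : c.extend (𝓡 4) x' ∈ c.target := by
        have := extend_mem_target (𝓡 4) hs'
        rwa [extend_target_model] at this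
      have h3 : ∀ᶠ z in 𝓝 (c.extend (𝓡 4) x'), coordField (axialField M) c z = 0 := by
        have h4 := hsymm hc ht'
        rw [ContinuousAt, extend_left_inv' (𝓡 4) hs'] at h4
        filter_upwards [h4.eventually hx', c.open_target.mem_nhds ht'] with z hz hzt
        exact (coordField_eq_zero_iff hc hzt).2 hz
      refine ⟨h3.self_of_nhds, ?_⟩
      have h5 : coordField (axialField M) c =ᶠ[𝓝 (c.extend (𝓡 4) x')] fun _ => 0 := h3
      rw [h5.fderiv_eq]
      simp
    have hsm := h.contDiffAt_coordField hc ht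
    refine key hc hxs ?_ ?_
    · by_contra hne
      have := (hsm.continuousAt.comp hce).eventually_ne hne
      exact hfr ((this.and hval).mono fun x' hx' hz => hx'.1 (hx'.2 hz).1)
    · by_contra hne
      have := ((hsm.fderiv_right (m := 0) (by simp)).continuousAt.comp hce).eventually_ne hne
      exact hfr ((this.and hval).mono fun x' hx' hz => hx'.1 (hx'.2 hz).2)
  have hne : ((c.extend (𝓡 4)).symm y) ∈ Z := by
    have hy' : y ∈ (c.extend (𝓡 4)).target := by rwa [extend_target_model]
    refine key hc (extend_symm_mem_source (𝓡 4) hy') ?_ ?_ <;>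
    · rw [(c.extend (𝓡 4)).right_inv hy']
      assumption
  have huniv : Z = univ := IsClopen.eq_univ ⟨hclosed, hopen⟩ ⟨_, hne⟩
  have hfix : ∀ x : M, Circle.exp Real.pi • x = x := fun x =>
    h.smul_eq_of_axialField_eq_zero (show axialField M x = 0 from by
      have hx : x ∈ Z := huniv ▸ mem_univ x
      exact Eventually.self_of_nhds (p := fun x' => axialField M x' = 0) hx) _
  have := h.effective
  have h1 : Circle.exp Real.pi = 1 := eq_of_smul_eq_smul fun x : M => by rw [hfix x, one_smul]
  have h2 := congrArg (fun z : Circle => (z : ℂ)) h1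
  simp only [Circle.coe_exp, Complex.exp_pi_mul_I, Circle.coe_one] at h2
  norm_num at h2

theorem coordLower_nonneg (hg : IsLorentzMetric g)
    (hsp : ∀ x : M, axialField M x ≠ 0 → 0 < g x (axialField M x) (axialField M x))
    (hc : c ∈ atlas E4 M) (hy : y ∈ c.target) :
    0 ≤ coordLower (gram g c) (coordField (axialField M) c) y (coordField (axialField M) c y) := by
  by_cases hX : coordField (axialField M) c y = 0
  · simp [coordLower, hX]
  · rw [← norm_eq_coordLower hg hc hy]
    exact (hsp _ fun h0 => hX ((coordField_eq_zero_iff hc hy).2 h0)).le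

theorem eventually_coordLower_nonneg (hg : IsLorentzMetric g)
    (hsp : ∀ x : M, axialField M x ≠ 0 → 0 < g x (axialField M x) (axialField M x))
    (hc : c ∈ atlas E4 M) (hy : y ∈ c.target) : ∀ᶠ z in 𝓝 y,
    0 ≤ coordLower (gram g c) (coordField (axialField M) c) z (coordField (axialField M) c z) := by
  filter_upwards [c.open_target.mem_nhds hy] with z hz
  exact coordLower_nonneg hg hsp hc hz

theorem isUniformlySpacelike (h : IsAxialSymmetry g) (hg : IsLorentzMetric g)
    (hsp : ∀ x : M, axialField M x ≠ 0 → 0 < g x (axialField M x) (axialField M x)) :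
    IsUniformlySpacelike g (axialField M) := by
  intro c hc y hy
  have hk := h.isKillingField hg c hc
  by_cases hX : coordField (axialField M) c y = 0
  · exact hk.eventually_norm_sq_le hy hX (eventually_coordLower_nonneg hg hsp hc hy)
      (fun v hv => h.nilpotent_eq_zero hc hy hX hv)
      fun l hl ε hε => eventually_abs_apply_le (T := 2 * Real.pi) (by positivity)
        ((h.contDiffAt_coordField hc hy).of_le (by simp))
        (fun r hr => h.exists_orbit hc hy hX hr) l hl hε
  · have hpos : 0 < coordLower (gram g c) (coordField (axialField M) c) y
        (coordField (axialField M) c y) := by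
      rw [← norm_eq_coordLower hg hc hy]
      exact hsp _ fun h0 => hX ((coordField_eq_zero_iff hc hy).2 h0)
    set f := fun z => coordLower (gram g c) (coordField (axialField M) c) z
      (coordField (axialField M) c z) with hf
    have hfc : ContinuousAt f y := (hk.contDiffAt_coordLower hy (hk.field y hy)).continuousAt
    have hXc : ContinuousAt (fun z => ‖coordField (axialField M) c z‖ ^ 2) y :=
      ((hk.field y hy).continuousAt.norm).pow 2
    refine ⟨f y / 2 / (‖coordField (axialField M) c y‖ ^ 2 + 1), by positivity, ?_⟩
    filter_upwards [hfc.eventually (eventually_gt_nhds (half_lt_self hpos)),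
      hXc.eventually (eventually_lt_nhds (lt_add_one _))] with z h1 h2
    refine le_trans ?_ (le_of_lt h1)
    rw [div_mul_eq_mul_div, div_le_iff₀ (by positivity)]
    have : 0 < f y := hpos
    gcongr

end IsAxialSymmetry

end Axis

/-! ### Integrability of the inverse norm of a map with two transversal directions -/

section InverseNorm

/-- The plane. -/
abbrev E2 : Type := EuclideanSpace ℝ (Fin 2)

theorem lintegral_inv_norm_ball_lt_top (r : ℝ) :
    ∫⁻ τ in Metric.ball (0 : E2) r, ‖τ‖ₑ⁻¹ < ⊤ := by
  have h1 : IntegrableOn (fun τ : E2 => ‖τ‖⁻¹) (Metric.ball 0 r) := by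
    rw [integrableOn_fun_norm_addHaar volume (f := fun s : ℝ => s⁻¹)]
    refine (integrableOn_const (C := (1 : ℝ)) (by simp)).congr_fun (fun s hs => ?_) measurableSet_Ioo
    have : s ≠ 0 := hs.1.ne'
    simp [this]
  refine lt_of_le_of_lt (le_of_eq ?_) h1.2
  refine lintegral_congr_ae ?_
  filter_upwards [ae_restrict_of_ae (Measure.ae_ne (volume : Measure E2) 0)] with τ hτ
  rw [enorm_inv (norm_ne_zero_iff.2 hτ), enorm_norm]

theorem lintegral_inv_norm_lt_top {E F : Type*} [NormedAddCommGroup E] [NormedSpace ℝ E]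
    [FiniteDimensional ℝ E] [MeasurableSpace E] [BorelSpace E] (μ : Measure E) [μ.IsAddHaarMeasure]
    [NormedAddCommGroup F] [MeasurableSpace F] [BorelSpace F]
    {h : E → F} {K : Set E} (hK : IsCompact K) (hcont : ContinuousOn h K)
    (T : E2 →L[ℝ] E) {c : ℝ} (hc : 0 < c)
    (hlow : ∀ u ∈ K, ∀ τ : E2, u + T τ ∈ K → c * ‖τ‖ ≤ ‖h (u + T τ) - h u‖) :
    ∫⁻ y in K, ‖h y‖ₑ⁻¹ ∂μ < ⊤ := by
  classical
  set D : Set E2 := Metric.closedBall 0 1 with hD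
  have hDc : IsCompact D := isCompact_closedBall 0 1
  set H : E → F := K.piecewise h 0 with hH
  have hHm : Measurable H :=
    hcont.measurable_piecewise continuousOn_const hK.measurableSet
  set f : E → ENNReal := K.indicator fun y => ‖H y‖ₑ⁻¹ with hf
  have hfm : Measurable f := hHm.enorm.inv.indicator hK.measurableSet
  have hint : ∫⁻ y in K, ‖h y‖ₑ⁻¹ ∂μ = ∫⁻ y, f y ∂μ := by
    rw [hf, lintegral_indicator hK.measurableSet]
    refine setLIntegral_congr_fun hK.measurableSet fun y hy => ?_
    simp [hH, hy]
  set C : ENNReal := ENNReal.ofReal (2 / c) * ∫⁻ τ in Metric.ball (0 : E2) 3, ‖τ‖ₑ⁻¹ with hC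
  have hCtop : C < ⊤ := ENNReal.mul_lt_top ENNReal.ofReal_lt_top (lintegral_inv_norm_ball_lt_top 3)
  have hslice : ∀ y, ∫⁻ τ in D, f (y + T τ) ≤ C := by
    intro y
    set Dy : Set E2 := D ∩ (fun τ => y + T τ) ⁻¹' K with hDy
    have hDyc : IsCompact Dy := hDc.inter_right (hK.isClosed.preimage (by fun_prop))
    have hzero : ∀ τ ∈ D, τ ∉ Dy → f (y + T τ) = 0 := fun τ hτ hn =>
      indicator_of_notMem (s := K) (fun hk => hn ⟨hτ, hk⟩) _
    rcases Dy.eq_empty_or_nonempty with he | hne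
    · have : ∫⁻ τ in D, f (y + T τ) = 0 := by
        rw [← lintegral_zero (μ := volume.restrict D)]
        refine setLIntegral_congr_fun hDc.measurableSet fun τ hτ => hzero τ hτ (by simp [he])
      rw [this]
      exact bot_le
    · have hcy : ContinuousOn (fun τ => ‖h (y + T τ)‖) Dy :=
        (hcont.comp (by fun_prop) fun τ hτ => hτ.2).norm
      obtain ⟨τ₀, hτ₀, hmin⟩ := hDyc.exists_isMinOn hne hcy
      have hbound : ∀ τ ∈ D, f (y + T τ) ≤ ENNReal.ofReal (2 / c) * ‖τ - τ₀‖ₑ⁻¹ := by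
        intro τ hτ
        by_cases hτD : τ ∈ Dy
        · have e1 : f (y + T τ) = ‖h (y + T τ)‖ₑ⁻¹ := by
            have : y + T τ ∈ K := hτD.2
            simp [hf, hH, this]
          have e2 : c * ‖τ - τ₀‖ ≤ 2 * ‖h (y + T τ)‖ := by
            have := hlow (y + T τ₀) hτ₀.2 (τ - τ₀) (by
              rw [map_sub, add_add_sub_cancel]; exact hτD.2)
            rw [map_sub, add_add_sub_cancel] at this
            have h3 := norm_sub_le (h (y + T τ)) (h (y + T τ₀))
            have h4 : ‖h (y + T τ₀)‖ ≤ ‖h (y + T τ)‖ := hmin hτD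
            linarith
          rw [e1]
          have e3 : ENNReal.ofReal (c / 2) * ‖τ - τ₀‖ₑ ≤ ‖h (y + T τ)‖ₑ := by
            rw [← ofReal_norm, ← ofReal_norm, ← ENNReal.ofReal_mul (by positivity)]
            exact ENNReal.ofReal_le_ofReal (by linarith)
          refine (ENNReal.inv_le_inv.2 e3).trans (le_of_eq ?_)
          rw [ENNReal.mul_inv (Or.inl (by simp [hc])) (Or.inl ENNReal.ofReal_ne_top),
            ← ENNReal.ofReal_inv_of_pos (by positivity), inv_div]
        · rw [hzero τ hτ hτD]
          exact bot_le
      calc ∫⁻ τ in D, f (y + T τ) ≤ ∫⁻ τ in D, ENNReal.ofReal (2 / c) * ‖τ - τ₀‖ₑ⁻¹ :=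
            setLIntegral_mono' hDc.measurableSet hbound
        _ = ENNReal.ofReal (2 / c) * ∫⁻ τ in D, ‖τ - τ₀‖ₑ⁻¹ := by
            rw [lintegral_const_mul _ (by fun_prop)]
        _ ≤ C := by
            refine mul_le_mul_right ?_ _
            rw [← lintegral_indicator hDc.measurableSet, ← lintegral_indicator measurableSet_ball,
              ← lintegral_sub_right_eq_self ((Metric.ball (0 : E2) 3).indicator fun τ => ‖τ‖ₑ⁻¹) τ₀]
            refine lintegral_mono fun τ => ?_
            by_cases hτ : τ ∈ D
            · have : τ - τ₀ ∈ Metric.ball (0 : E2) 3 := by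
                have h1 : ‖τ‖ ≤ 1 := by simpa [hD] using hτ
                have h2 : ‖τ₀‖ ≤ 1 := by simpa [hD] using hτ₀.1
                rw [mem_ball_zero_iff]
                linarith [norm_sub_le τ τ₀]
              rw [indicator_of_mem hτ, indicator_of_mem this]
            · rw [indicator_of_notMem hτ]
              exact bot_le
  set K' : Set E := (fun q : E × E2 => q.1 - T q.2) '' (K ×ˢ D) with hK'
  have hK'c : IsCompact K' := (hK.prod hDc).image (by fun_prop)
  have hmeas : Measurable fun q : E × E2 => f (q.1 + T q.2) :=
    hfm.comp (by fun_prop)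
  have hswap : volume D * ∫⁻ y, f y ∂μ = ∫⁻ y, (∫⁻ τ in D, f (y + T τ)) ∂μ := by
    rw [lintegral_lintegral_swap hmeas.aemeasurable]
    simp only [lintegral_add_right_eq_self (μ := μ) f]
    rw [setLIntegral_const, mul_comm]
  have hle : ∫⁻ y, (∫⁻ τ in D, f (y + T τ)) ∂μ ≤ C * μ K' := by
    calc ∫⁻ y, (∫⁻ τ in D, f (y + T τ)) ∂μ ≤ ∫⁻ y, K'.indicator (fun _ => C) y ∂μ := by
          refine lintegral_mono fun y => ?_
          by_cases hy : y ∈ K'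
          · rw [indicator_of_mem hy]
            exact hslice y
          · rw [indicator_of_notMem hy, nonpos_iff_eq_zero, ← lintegral_zero (μ := volume.restrict D)]
            refine setLIntegral_congr_fun hDc.measurableSet fun τ hτ => ?_
            refine indicator_of_notMem (fun hk => hy ⟨(y + T τ, τ), ⟨hk, hτ⟩, by simp⟩) _
      _ = C * μ K' := by rw [lintegral_indicator_const hK'c.measurableSet]
  rw [hint]
  have hDpos : volume D ≠ 0 := (Metric.measure_closedBall_pos volume 0 one_pos).ne'
  have hfin : volume D * ∫⁻ y, f y ∂μ < ⊤ := by
    rw [hswap]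
    exact hle.trans_lt (ENNReal.mul_lt_top hCtop hK'c.measure_lt_top)
  exact ENNReal.lt_top_of_mul_ne_top_right hfin.ne hDpos

/-- Local integrability of the inverse norm of a map whose derivative is injective on a plane. -/
theorem exists_lintegral_inv_norm_lt_top {E F : Type*} [NormedAddCommGroup E] [NormedSpace ℝ E]
    [FiniteDimensional ℝ E] [MeasurableSpace E] [BorelSpace E] (μ : Measure E) [μ.IsAddHaarMeasure]
    [NormedAddCommGroup F] [NormedSpace ℝ F] [MeasurableSpace F] [BorelSpace F]
    {h : E → F} {R : Set E} {y₀ : E} (hR : Convex ℝ R) (hRc : IsClosed R) (hRu : UniqueDiffOn ℝ R)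
    (hy₀ : y₀ ∈ R) (hh : ContDiffWithinAt ℝ 1 h R y₀) (T : E2 →L[ℝ] E)
    (hT : Function.Injective ((fderivWithin ℝ h R y₀).comp T)) {s : Set E} (hs : s ∈ 𝓝[R] y₀) :
    ∃ r > 0, Metric.closedBall y₀ r ∩ R ⊆ s ∧ ContinuousOn h (Metric.closedBall y₀ r ∩ R) ∧
      ∫⁻ y in Metric.closedBall y₀ r ∩ R, ‖h y‖ₑ⁻¹ ∂μ < ⊤ := by
  set L := fderivWithin ℝ h R y₀ with hL
  obtain ⟨k, hk, hanti⟩ := LinearMap.exists_antilipschitzWith (L.comp T).toLinearMap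
    (LinearMap.ker_eq_bot.2 hT)
  have hanti' : ∀ τ, ‖τ‖ ≤ k * ‖L (T τ)‖ := fun τ => by
    have := hanti.le_mul_dist τ 0
    simpa using this
  have hk' : (0 : ℝ) < k := hk
  set η : ℝ := 1 / (2 * k * (‖T‖ + 1)) with hη
  have hη0 : 0 < η := by positivity
  have h1 : ∀ᶠ y in 𝓝[R] y₀, ContDiffWithinAt ℝ 1 h R y := by
    have := hh.eventually (by simp)
    rwa [insert_eq_of_mem hy₀] at this
  have h2 : ∀ᶠ y in 𝓝[R] y₀, ‖fderivWithin ℝ h R y - L‖ < η := by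
    have hc : ContinuousWithinAt (fun y => ‖fderivWithin ℝ h R y - L‖) R y₀ :=
      ((hh.fderivWithin_right (m := 0) hRu (by norm_num) hy₀).continuousWithinAt.sub
        continuousWithinAt_const).norm
    refine hc.eventually (eventually_lt_nhds ?_)
    simpa [hL] using hη0
  obtain ⟨r, hr, hsub⟩ := Metric.mem_nhdsWithin_iff.1 ((h1.and h2).and hs)
  have hsub' : ∀ y ∈ Metric.closedBall y₀ (r / 2) ∩ R, (ContDiffWithinAt ℝ 1 h R y ∧
      ‖fderivWithin ℝ h R y - L‖ < η) ∧ y ∈ s := fun y hy =>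
    hsub ⟨Metric.closedBall_subset_ball (half_lt_self hr) hy.1, hy.2⟩
  have hcont : ContinuousOn h (Metric.closedBall y₀ (r / 2) ∩ R) := fun y hy =>
    (hsub' y hy).1.1.continuousWithinAt.mono inter_subset_right
  refine ⟨r / 2, half_pos hr, fun y hy => (hsub' y hy).2, hcont, ?_⟩
  refine lintegral_inv_norm_lt_top μ ((isCompact_closedBall y₀ (r / 2)).inter_right hRc) hcont T
    (c := 1 / (2 * k)) (by positivity) fun u hu τ hτ => ?_
  have h3 := Convex.norm_image_sub_le_of_norm_hasFDerivWithin_le'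
    (f' := fderivWithin ℝ h R) (φ := L) (C := η)
    (fun y hy => ((hsub' y hy).1.1.differentiableWithinAt (by simp)).hasFDerivWithinAt.mono
      inter_subset_right) (fun y hy => (hsub' y hy).1.2.le)
    ((convex_closedBall y₀ (r / 2)).inter hR) hu hτ
  rw [add_sub_cancel_left] at h3
  have h4 : ‖T τ‖ ≤ ‖T‖ * ‖τ‖ := T.le_opNorm τ
  have h5 : η * ‖T τ‖ ≤ 1 / (2 * k) * ‖τ‖ := by
    calc η * ‖T τ‖ ≤ η * ((‖T‖ + 1) * ‖τ‖) := by
          gcongr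
          nlinarith [norm_nonneg τ]
      _ = 1 / (2 * k) * ‖τ‖ := by rw [hη]; field_simp
  have h6 : 1 / k * ‖τ‖ ≤ ‖L (T τ)‖ := by
    rw [one_div, inv_mul_le_iff₀ hk']
    exact hanti' τ
  have h7 := norm_sub_norm_le (L (T τ)) (L (T τ) - (h (u + T τ) - h u))
  rw [sub_sub_cancel, norm_sub_rev (L (T τ)) _] at h7
  have h8 : 1 / k * ‖τ‖ = 1 / (2 * k) * ‖τ‖ + 1 / (2 * k) * ‖τ‖ := by field_simp; ring
  linarith

end InverseNorm

section Transversal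

/-- The image of the tangent space under the linearisation of a tangent vector field at a zero. -/
theorem exists_fderiv_apply_eq {E F : Type*} [NormedAddCommGroup E] [NormedSpace ℝ E]
    [FiniteDimensional ℝ E] [NormedAddCommGroup F] [NormedSpace ℝ F] [FiniteDimensional ℝ F]
    {Φ : E → F} {X : F → F} {R : Set E} {y₀ : E}
    (hRu : UniqueDiffOn ℝ R) (hy₀ : y₀ ∈ R) (hΦ : ContDiffWithinAt ℝ 1 Φ R y₀)
    (hinj : Function.Injective (fderivWithin ℝ Φ R y₀)) (hX : DifferentiableAt ℝ X (Φ y₀))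
    (hX0 : X (Φ y₀) = 0) (htan : ∀ᶠ y in 𝓝[R] y₀, ∃ v, fderivWithin ℝ Φ R y v = X (Φ y)) (w : E) :
    ∃ w', fderiv ℝ X (Φ y₀) (fderivWithin ℝ Φ R y₀ w) = fderivWithin ℝ Φ R y₀ w' := by
  set D := fderivWithin ℝ Φ R y₀ with hD
  set A := fderiv ℝ X (Φ y₀)
  by_contra! hcon
  have hnot : A (D w) ∉ LinearMap.range D.toLinearMap := fun ⟨w', hw'⟩ => hcon w' hw'.symm
  obtain ⟨n, hn, hnD⟩ := Submodule.exists_dual_map_eq_bot_of_notMem hnot inferInstance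
  set n' : F →L[ℝ] ℝ := LinearMap.toContinuousLinearMap n
  have hn'D : ∀ v, n' (D v) = 0 := fun v => by
    have : n (D v) ∈ (LinearMap.range D.toLinearMap).map n := ⟨D v, ⟨v, rfl⟩, rfl⟩
    rw [hnD] at this
    exact this
  obtain ⟨k, hk, hanti⟩ := LinearMap.exists_antilipschitzWith D.toLinearMap
    (LinearMap.ker_eq_bot.2 hinj)
  have hk' : (0 : ℝ) < k := hk
  have hanti' : ∀ v, ‖v‖ ≤ k * ‖D v‖ := fun v => by
    have := hanti.le_mul_dist v 0
    simpa using this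
  have hfd : HasFDerivWithinAt Φ D R y₀ := (hΦ.differentiableWithinAt (by simp)).hasFDerivWithinAt
  have hh : HasFDerivWithinAt (fun y => X (Φ y)) (A.comp D) R y₀ :=
    hX.hasFDerivAt.comp_hasFDerivWithinAt y₀ hfd
  have hc : ContinuousWithinAt (fderivWithin ℝ Φ R) R y₀ :=
    (hΦ.fderivWithin_right (m := 0) hRu (by norm_num) hy₀).continuousWithinAt
  have hO : (fun y => X (Φ y)) =O[𝓝[R] y₀] fun y => y - y₀ := by
    have := hh.isBigO_sub
    simpa [hX0] using this
  have hlo : (fun y => n' (X (Φ y))) =o[𝓝[R] y₀] fun y => y - y₀ := by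
    refine Asymptotics.IsLittleO.trans_isBigO ?_ hO
    rw [Asymptotics.isLittleO_iff]
    intro ε hε
    have e1 : ∀ᶠ y in 𝓝[R] y₀, ‖fderivWithin ℝ Φ R y - D‖ < 1 / (2 * k) := by
      have : ContinuousWithinAt (fun y => ‖fderivWithin ℝ Φ R y - D‖) R y₀ :=
        (hc.sub continuousWithinAt_const).norm
      exact this.eventually (eventually_lt_nhds (by simpa [hD] using hk'))
    have e2 : ∀ᶠ y in 𝓝[R] y₀, ‖n'.comp (fderivWithin ℝ Φ R y)‖ < ε / (2 * k) := by
      have : ContinuousWithinAt (fun y => ‖n'.comp (fderivWithin ℝ Φ R y)‖) R y₀ :=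
        (continuousWithinAt_const.clm_comp hc).norm
      refine this.eventually (eventually_lt_nhds ?_)
      have h0 : n'.comp (fderivWithin ℝ Φ R y₀) = 0 := by ext v; exact hn'D v
      change ‖n'.comp (fderivWithin ℝ Φ R y₀)‖ < _
      rw [h0, norm_zero]
      positivity
    filter_upwards [e1, e2, htan] with y h1 h2 ⟨v, hv⟩
    rw [← hv]
    have h3 : ‖v‖ ≤ 2 * k * ‖fderivWithin ℝ Φ R y v‖ := by
      have a1 : ‖D v‖ ≤ ‖fderivWithin ℝ Φ R y v‖ + 1 / (2 * k) * ‖v‖ := by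
        have a2 : D v = fderivWithin ℝ Φ R y v - (fderivWithin ℝ Φ R y - D) v := by simp
        rw [a2]
        refine (norm_sub_le _ _).trans (add_le_add le_rfl ?_)
        exact ((fderivWithin ℝ Φ R y - D).le_opNorm v).trans (by gcongr)
      have a3 : ‖v‖ ≤ k * (‖fderivWithin ℝ Φ R y v‖ + 1 / (2 * k) * ‖v‖) :=
        (hanti' v).trans (by gcongr)
      have a4 : (k : ℝ) * (1 / (2 * k) * ‖v‖) = ‖v‖ / 2 := by field_simp
      rw [mul_add, a4] at a3
      linarith
    calc ‖n' (fderivWithin ℝ Φ R y v)‖ ≤ ‖n'.comp (fderivWithin ℝ Φ R y)‖ * ‖v‖ :=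
          (n'.comp (fderivWithin ℝ Φ R y)).le_opNorm v
      _ ≤ ε / (2 * k) * (2 * k * ‖fderivWithin ℝ Φ R y v‖) := by gcongr
      _ = ε * ‖fderivWithin ℝ Φ R y v‖ := by field_simp
  have hz : HasFDerivWithinAt (fun y => n' (X (Φ y))) (0 : E →L[ℝ] ℝ) R y₀ := by
    refine HasFDerivWithinAt.of_isLittleO ?_
    simpa [hX0] using hlo
  have hu := (hRu y₀ hy₀).eq hz (n'.hasFDerivAt.comp_hasFDerivWithinAt y₀ hh)
  exact hn (DFunLike.congr_fun hu w).symm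

/-- The linearisation of the field is injective on a plane tangent to the hypersurface. -/
theorem exists_plane {E : Type*} [NormedAddCommGroup E] [NormedSpace ℝ E] [FiniteDimensional ℝ E]
    {A : E4 →L[ℝ] E4} {b : E4 →L[ℝ] E4 →L[ℝ] ℝ} (hskew : ∀ u v, b (A u) v = -b u (A v))
    (hsymm : ∀ u v, b u v = b v u)
    (hnil : ∀ v, A (A v) = 0 → A v = 0) (hpos : ∀ v, A v ≠ 0 → 0 < b (A v) (A v)) (hA : A ≠ 0)
    (hE : Module.finrank ℝ E = 3) {D : E →L[ℝ] E4} (hD : Function.Injective D)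
    (hinv : ∀ w, ∃ w', A (D w) = D w') :
    ∃ T : E2 →L[ℝ] E, Function.Injective ((A.comp D).comp T) := by
  have hex : ∃ s, A (D s) ≠ 0 := by
    by_contra! h0
    have hle : LinearMap.range D.toLinearMap ≤ LinearMap.ker A.toLinearMap := by
      rintro _ ⟨w, rfl⟩
      exact h0 w
    have h3 : Module.finrank ℝ (LinearMap.range D.toLinearMap) = 3 := by
      rw [LinearMap.finrank_range_of_inj hD, hE]
    have hk := Submodule.finrank_mono hle
    have hrn := A.toLinearMap.finrank_range_add_finrank_ker
    have h4 : Module.finrank ℝ E4 = 4 := by simp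
    have h1 : Module.finrank ℝ (LinearMap.range A.toLinearMap) ≤ 1 := by omega
    obtain ⟨⟨w, hw⟩, hspan⟩ := finrank_le_one_iff.1 h1
    obtain ⟨u, hu⟩ : ∃ u, A u ≠ 0 := by
      by_contra! h
      exact hA (ContinuousLinearMap.ext h)
    obtain ⟨a, ha⟩ := hspan ⟨A u, ⟨u, rfl⟩⟩
    obtain ⟨a', ha'⟩ := hspan ⟨A (A u), ⟨A u, rfl⟩⟩
    have ha1 : a • w = A u := congrArg Subtype.val ha
    have ha2 : a' • w = A (A u) := congrArg Subtype.val ha'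
    have ha0 : a ≠ 0 := by rintro rfl; simp at ha1; exact hu ha1.symm
    have hw' : w = a⁻¹ • A u := by rw [← ha1, smul_smul, inv_mul_cancel₀ ha0, one_smul]
    have hAA : A (A u) = (a' * a⁻¹) • A u := by rw [← ha2, hw', smul_smul]
    have h5 : b (A (A u)) (A u) = 0 := by
      have := hskew (A u) (A u)
      rw [hsymm (A u) (A (A u))] at this
      linarith
    rw [hAA, map_smul, smul_apply, smul_eq_mul, mul_eq_zero] at h5
    rcases h5 with h5 | h5
    · exact hu (hnil u (by rw [hAA, h5, zero_smul]))
    · exact (hpos u hu).ne' h5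
  obtain ⟨s, hs⟩ := hex
  obtain ⟨s', hs'⟩ := hinv s
  have hAA : A (A (D s)) ≠ 0 := fun h => hs (hnil _ h)
  refine ⟨(EuclideanSpace.proj (𝕜 := ℝ) 0 : E2 →L[ℝ] ℝ).smulRight s +
    (EuclideanSpace.proj (𝕜 := ℝ) 1 : E2 →L[ℝ] ℝ).smulRight s', ?_⟩
  rw [injective_iff_map_eq_zero]
  intro τ hτ
  have h1 : τ 0 • A (D s) + τ 1 • A (A (D s)) = 0 := by
    have : A (D (τ 0 • s + τ 1 • s')) = 0 := hτ
    rwa [map_add, map_smul, map_smul, map_add, map_smul, map_smul, ← hs'] at this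
  have h5 : b (A (A (D s))) (A (D s)) = 0 := by
    have := hskew (A (D s)) (A (D s))
    rw [hsymm (A (D s)) (A (A (D s)))] at this
    linarith
  have h2 : b (τ 0 • A (D s) + τ 1 • A (A (D s))) (A (D s)) = 0 := by rw [h1]; simp
  simp only [map_add, map_smul, add_apply, smul_apply, smul_eq_mul, h5, mul_zero, add_zero] at h2
  have h3 : τ 0 = 0 := (mul_eq_zero.1 h2).resolve_right (hpos _ hs).ne'
  rw [h3, zero_smul, zero_add] at h1
  have h4 : τ 1 = 0 := (smul_eq_zero.1 h1).resolve_right hAA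
  ext i
  fin_cases i
  · exact h3
  · exact h4

end Transversal

section Domination

theorem alternating_three_le {V : Type*} [NormedAddCommGroup V] [NormedSpace ℝ V]
    (θ : V [⋀^Fin 3]→L[ℝ] ℝ) (L : EuclideanSpace ℝ (Fin 3) →L[ℝ] V)
    (v : EuclideanSpace ℝ (Fin 3)) :
    |θ fun i => L (stdFrame 3 i)| * ‖L v‖ ≤ ‖L‖ *
      (|θ ![L v, L (stdFrame 3 1), L (stdFrame 3 2)]| +
        |θ ![L v, L (stdFrame 3 0), L (stdFrame 3 2)]| +
        |θ ![L v, L (stdFrame 3 0), L (stdFrame 3 1)]|) := by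
  have hs : ∀ i, ‖stdFrame 3 i‖ = 1 := fun i => by simp [stdFrame]
  set a := L (stdFrame 3 0)
  set b := L (stdFrame 3 1)
  set d := L (stdFrame 3 2)
  have hfun : (fun i => L (stdFrame 3 i)) = ![a, b, d] := by
    funext i; fin_cases i <;> rfl
  have hv : L v = v 0 • a + v 1 • b + v 2 • d := by
    have h1 : v = ∑ i, v i • stdFrame 3 i := by
      have := (stdBasis 3).sum_repr v
      simp only [stdBasis_repr, stdBasis_eq] at this
      exact this.symm
    conv_lhs => rw [h1]
    simp [Fin.sum_univ_three, a, b, d]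
  have hexp : ∀ p q : V, θ ![L v, p, q] =
      v 0 * θ ![a, p, q] + v 1 * θ ![b, p, q] + v 2 * θ ![d, p, q] := fun p q => by
    have hl : ∀ x : V, θ ![x, p, q] = θ.toMultilinearMap.toLinearMap ![0, p, q] 0 x := fun x => by
      simp only [MultilinearMap.toLinearMap_apply]
      refine congrArg θ (funext fun i => ?_)
      fin_cases i <;> simp
    simp only [hl, hv, map_add, map_smul, smul_eq_mul]
  have hz : ∀ (f : Fin 3 → V) (i j : Fin 3), i ≠ j → f i = f j → θ f = 0 := fun f i j hij h =>
    θ.map_eq_zero_of_eq f h hij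
  have e1 : θ ![L v, b, d] = v 0 * θ ![a, b, d] := by
    rw [hexp, hz ![b, b, d] 0 1 (by decide) rfl, hz ![d, b, d] 0 2 (by decide) rfl]; ring
  have e2 : θ ![L v, a, d] = -(v 1 * θ ![a, b, d]) := by
    have h : θ (![a, b, d] ∘ Equiv.swap (0 : Fin 3) 1) = -θ ![a, b, d] :=
      θ.toAlternatingMap.map_swap ![a, b, d] (show (0 : Fin 3) ≠ 1 by decide)
    have h' : ![a, b, d] ∘ Equiv.swap (0 : Fin 3) 1 = ![b, a, d] := by
      funext i; fin_cases i <;> rfl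
    rw [h'] at h
    rw [hexp, hz ![a, a, d] 0 1 (by decide) rfl, hz ![d, a, d] 0 2 (by decide) rfl, h]; ring
  have e3 : θ ![L v, a, b] = v 2 * θ ![a, b, d] := by
    have h : θ (![a, b, d] ∘ Equiv.swap (0 : Fin 3) 1) = -θ ![a, b, d] :=
      θ.toAlternatingMap.map_swap ![a, b, d] (show (0 : Fin 3) ≠ 1 by decide)
    have h' : ![a, b, d] ∘ Equiv.swap (0 : Fin 3) 1 = ![b, a, d] := by
      funext i; fin_cases i <;> rfl
    have k : θ (![b, a, d] ∘ Equiv.swap (0 : Fin 3) 2) = -θ ![b, a, d] :=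
      θ.toAlternatingMap.map_swap ![b, a, d] (show (0 : Fin 3) ≠ 2 by decide)
    have k' : ![b, a, d] ∘ Equiv.swap (0 : Fin 3) 2 = ![d, a, b] := by
      funext i; fin_cases i <;> rfl
    rw [h'] at h
    rw [k', h, neg_neg] at k
    rw [hexp, hz ![a, a, b] 0 1 (by decide) rfl, hz ![b, a, b] 0 2 (by decide) rfl, k]; ring
  have hn : ‖L v‖ ≤ ‖L‖ * (|v 0| + |v 1| + |v 2|) := by
    have hle : ∀ i, ‖L (stdFrame 3 i)‖ ≤ ‖L‖ := fun i => by
      have := L.le_opNorm (stdFrame 3 i)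
      rwa [hs, mul_one] at this
    rw [hv]
    refine (norm_add₃_le).trans ?_
    rw [norm_smul, norm_smul, norm_smul, Real.norm_eq_abs, Real.norm_eq_abs, Real.norm_eq_abs]
    have h0 := mul_le_mul_of_nonneg_left (hle 0) (abs_nonneg (v 0))
    have h1 := mul_le_mul_of_nonneg_left (hle 1) (abs_nonneg (v 1))
    have h2 := mul_le_mul_of_nonneg_left (hle 2) (abs_nonneg (v 2))
    linarith
  rw [hfun, e1, e2, e3, abs_neg, abs_mul, abs_mul, abs_mul]
  refine (mul_le_mul_of_nonneg_left hn (abs_nonneg _)).trans (le_of_eq ?_)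
  ring

theorem exists_integrable_inv_norm {E F : Type*} [NormedAddCommGroup E] [NormedSpace ℝ E]
    [FiniteDimensional ℝ E] [MeasurableSpace E] [BorelSpace E] (μ : Measure E) [μ.IsAddHaarMeasure]
    [NormedAddCommGroup F] [NormedSpace ℝ F] [MeasurableSpace F] [BorelSpace F]
    {h : E → F} {R : Set E} {y₀ : E} (hR : Convex ℝ R) (hRc : IsClosed R) (hRu : UniqueDiffOn ℝ R)
    (hy₀ : y₀ ∈ R) (hh : ContDiffWithinAt ℝ 1 h R y₀)
    (hT : h y₀ = 0 → ∃ T : E2 →L[ℝ] E, Function.Injective ((fderivWithin ℝ h R y₀).comp T)) :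
    ∃ t ∈ 𝓝 y₀, ∃ b : E → ℝ, Integrable b μ ∧ ∀ y ∈ t, y ∈ R → ‖h y‖⁻¹ ≤ b y := by
  by_cases h0 : h y₀ = 0
  · obtain ⟨T, hT⟩ := hT h0
    obtain ⟨r, hr, -, hcont, hint⟩ := exists_lintegral_inv_norm_lt_top μ hR hRc hRu hy₀ hh T hT
      (univ_mem : univ ∈ 𝓝[R] y₀)
    have hK : IsCompact (Metric.closedBall y₀ r ∩ R) := (isCompact_closedBall y₀ r).inter_right hRc
    refine ⟨Metric.closedBall y₀ r, Metric.closedBall_mem_nhds y₀ hr,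
      (Metric.closedBall y₀ r ∩ R).indicator fun y => ‖h y‖⁻¹, ?_, fun y hy hyR => ?_⟩
    · refine IntegrableOn.integrable_indicator ⟨?_, ?_⟩ hK.measurableSet
      · exact (hcont.norm.aemeasurable hK.measurableSet).inv.aestronglyMeasurable
      · refine lt_of_le_of_lt (lintegral_mono fun y => ?_) hint
        by_cases hy : h y = 0
        · simp [hy]
        · rw [enorm_inv (norm_ne_zero_iff.2 hy), enorm_norm]
    · rw [indicator_of_mem (show y ∈ Metric.closedBall y₀ r ∩ R from ⟨hy, hyR⟩)]
  · have hc : ContinuousWithinAt (fun y => ‖h y‖⁻¹) R y₀ :=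
      hh.continuousWithinAt.norm.inv₀ (norm_ne_zero_iff.2 h0)
    have he : ∀ᶠ y in 𝓝[R] y₀, ‖h y‖⁻¹ < ‖h y₀‖⁻¹ + 1 :=
      hc.eventually (eventually_lt_nhds (lt_add_one _))
    rw [eventually_nhdsWithin_iff] at he
    refine ⟨_, inter_mem he (Metric.ball_mem_nhds y₀ one_pos),
      (Metric.ball y₀ 1).indicator fun _ => ‖h y₀‖⁻¹ + 1, ?_, fun y hy hyR => ?_⟩
    · refine IntegrableOn.integrable_indicator ?_ Metric.isOpen_ball.measurableSet
      exact integrableOn_const (Metric.isBounded_ball.measure_lt_top.ne) (by simp)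
    · rw [indicator_of_mem hy.2]
      exact (hy.1 hyR).le

variable {M : Type*} [TopologicalSpace M] [ChartedSpace E4 M] [IsManifold (𝓡 4) ∞ M]
  {g : BilinField M} {ξ : VField (𝓡 4) M} {c : OpenPartialHomeomorph M E4}
  {N : Type*} [TopologicalSpace N] [ChartedSpace (EuclideanHalfSpace 3) N] [IsManifold (𝓡∂ 3) ∞ N]
  {ι : N → M} {cN : OpenPartialHomeomorph N (EuclideanHalfSpace 3)} {y : EuclideanSpace ℝ (Fin 3)}

/-- The expression of the map `ι` in charts. -/
def surfaceCoord (ι : N → M) (cN : OpenPartialHomeomorph N (EuclideanHalfSpace 3))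
    (c : OpenPartialHomeomorph M E4) (y : EuclideanSpace ℝ (Fin 3)) : E4 :=
  c.extend (𝓡 4) (ι ((cN.extend (𝓡∂ 3)).symm y))

namespace IsTangentHypersurface

theorem hasFDerivWithinAt_surfaceCoord (hι : IsTangentHypersurface ξ ι)
    (hcN : cN ∈ atlas (EuclideanHalfSpace 3) N) (hc : c ∈ atlas E4 M)
    (hy : y ∈ (cN.extend (𝓡∂ 3)).target) (hιy : ι ((cN.extend (𝓡∂ 3)).symm y) ∈ c.source) :
    HasFDerivWithinAt (surfaceCoord ι cN c)
      ((coframe (𝓡 4) c (ι ((cN.extend (𝓡∂ 3)).symm y))).comp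
        ((mfderiv (𝓡∂ 3) (𝓡 4) ι ((cN.extend (𝓡∂ 3)).symm y)).comp
          (chartFrame (𝓡∂ 3) cN y))) (range (𝓡∂ 3)) y :=
  hasFDerivWithinAt_coord (𝓡∂ 3) (𝓡 4) hcN hc hy ((hι.smooth _).mdifferentiableAt (by simp)) hιy

theorem contDiffWithinAt_surfaceCoord (hι : IsTangentHypersurface ξ ι)
    (hcN : cN ∈ atlas (EuclideanHalfSpace 3) N) (hc : c ∈ atlas E4 M)
    (hy : y ∈ (cN.extend (𝓡∂ 3)).target) (hιy : ι ((cN.extend (𝓡∂ 3)).symm y) ∈ c.source) :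
    ContDiffWithinAt ℝ ∞ (surfaceCoord ι cN c) (range (𝓡∂ 3)) y :=
  contDiffWithinAt_coord (𝓡∂ 3) (𝓡 4) hcN hc hy (hι.smooth _) hιy

theorem fderivWithin_surfaceCoord_apply (hι : IsTangentHypersurface ξ ι)
    (hcN : cN ∈ atlas (EuclideanHalfSpace 3) N) (hc : c ∈ atlas E4 M)
    (hy : y ∈ (cN.extend (𝓡∂ 3)).target) (hιy : ι ((cN.extend (𝓡∂ 3)).symm y) ∈ c.source)
    (v : EuclideanSpace ℝ (Fin 3)) : fderivWithin ℝ (surfaceCoord ι cN c) (range (𝓡∂ 3)) y v =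
      coframe (𝓡 4) c (ι ((cN.extend (𝓡∂ 3)).symm y))
        (mfderiv (𝓡∂ 3) (𝓡 4) ι ((cN.extend (𝓡∂ 3)).symm y) (chartFrame (𝓡∂ 3) cN y v)) :=
  DFunLike.congr_fun ((hι.hasFDerivWithinAt_surfaceCoord hcN hc hy hιy).fderivWithin
    ((𝓡∂ 3).uniqueDiffOn _ (extend_target_subset_range _ _ hy))) v

theorem injective_fderivWithin_surfaceCoord (hι : IsTangentHypersurface ξ ι)
    (hcN : cN ∈ atlas (EuclideanHalfSpace 3) N) (hc : c ∈ atlas E4 M)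
    (hy : y ∈ (cN.extend (𝓡∂ 3)).target) (hιy : ι ((cN.extend (𝓡∂ 3)).symm y) ∈ c.source) :
    Function.Injective (fderivWithin ℝ (surfaceCoord ι cN c) (range (𝓡∂ 3)) y) := by
  intro u v huv
  rw [hι.fderivWithin_surfaceCoord_apply hcN hc hy hιy,
    hι.fderivWithin_surfaceCoord_apply hcN hc hy hιy] at huv
  have h1 := hι.immersion _ (coframe_injective (𝓡 4) hc hιy huv)
  have h2 := congrArg (coframe (𝓡∂ 3) cN ((cN.extend (𝓡∂ 3)).symm y)) h1
  have h3 : ∀ w, coframe (𝓡∂ 3) cN ((cN.extend (𝓡∂ 3)).symm y) (chartFrame (𝓡∂ 3) cN y w) = w :=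
    fun w => DFunLike.congr_fun (coframe_comp_frame (𝓡∂ 3) hcN hy) w
  exact (h3 u).symm.trans (h2.trans (h3 v))

theorem exists_fderivWithin_surfaceCoord (hι : IsTangentHypersurface ξ ι)
    (hcN : cN ∈ atlas (EuclideanHalfSpace 3) N) (hc : c ∈ atlas E4 M)
    (hy : y ∈ (cN.extend (𝓡∂ 3)).target) (hιy : ι ((cN.extend (𝓡∂ 3)).symm y) ∈ c.source) :
    ∃ v, fderivWithin ℝ (surfaceCoord ι cN c) (range (𝓡∂ 3)) y v =
      coordField ξ c (surfaceCoord ι cN c y) := by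
  obtain ⟨v, hv⟩ := hι.tangent ((cN.extend (𝓡∂ 3)).symm y)
  refine ⟨coframe (𝓡∂ 3) cN ((cN.extend (𝓡∂ 3)).symm y) v, ?_⟩
  rw [hι.fderivWithin_surfaceCoord_apply hcN hc hy hιy]
  have h1 : chartFrame (𝓡∂ 3) cN y (coframe (𝓡∂ 3) cN ((cN.extend (𝓡∂ 3)).symm y) v) = v :=
    DFunLike.congr_fun (frame_comp_coframe (𝓡∂ 3) hcN hy) v
  refine Eq.trans ?_ (coordField_extend ξ hιy).symm
  exact congrArg _ ((congrArg _ h1).trans hv)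

theorem eventually_surfaceCoord (hι : IsTangentHypersurface ξ ι)
    (hy : y ∈ (cN.extend (𝓡∂ 3)).target) (hιy : ι ((cN.extend (𝓡∂ 3)).symm y) ∈ c.source) :
    ∀ᶠ z in 𝓝[range (𝓡∂ 3)] y, z ∈ (cN.extend (𝓡∂ 3)).target ∧
      ι ((cN.extend (𝓡∂ 3)).symm z) ∈ c.source :=
  eventually_coord (𝓡∂ 3) hy (hι.smooth _).continuousAt hιy

end IsTangentHypersurface

theorem surfaceCoord_mem_target (hιy : ι ((cN.extend (𝓡∂ 3)).symm y) ∈ c.source) :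
    surfaceCoord ι cN c y ∈ c.target := by
  have := extend_mem_target (𝓡 4) hιy
  rwa [extend_target_model] at this

theorem extend_symm_surfaceCoord (hιy : ι ((cN.extend (𝓡∂ 3)).symm y) ∈ c.source) :
    (c.extend (𝓡 4)).symm (surfaceCoord ι cN c y) = ι ((cN.extend (𝓡∂ 3)).symm y) :=
  extend_left_inv' (𝓡 4) hιy

/-- The reciprocal of the length of the axial field is integrable on tangent three-surfaces. -/
theorem IsAxialSymmetry.exists_integrable_inv_norm [ConnectedSpace M] [MulAction Circle M]
    (h : IsAxialSymmetry g) (hg : IsLorentzMetric g)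
    (hsp : ∀ x : M, axialField M x ≠ 0 → 0 < g x (axialField M x) (axialField M x))
    (hι : IsTangentHypersurface (axialField M) ι)
    (hcN : cN ∈ atlas (EuclideanHalfSpace 3) N) (hc : c ∈ atlas E4 M)
    (hy : y ∈ (cN.extend (𝓡∂ 3)).target) (hιy : ι ((cN.extend (𝓡∂ 3)).symm y) ∈ c.source) :
    ∃ t ∈ 𝓝 y, ∃ b : EuclideanSpace ℝ (Fin 3) → ℝ, Integrable b ∧ ∀ z ∈ t, z ∈ range (𝓡∂ 3) →
      ‖coordField (axialField M) c (surfaceCoord ι cN c z)‖⁻¹ ≤ b z := by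
  have hyR := extend_target_subset_range (𝓡∂ 3) cN hy
  have hΦy := surfaceCoord_mem_target hιy
  have hΦ := (hι.contDiffWithinAt_surfaceCoord hcN hc hy hιy).of_le (m := 1) (by simp)
  have hX := (h.contDiffAt_coordField hc hΦy).of_le (m := 1) (by simp)
  have hXd := hX.differentiableAt (by simp)
  refine AngMom.exists_integrable_inv_norm volume (h := fun z => coordField (axialField M) c (surfaceCoord ι cN c z))
    (𝓡∂ 3).convex_range (𝓡∂ 3).isClosed_range (𝓡∂ 3).uniqueDiffOn hyR
    (hX.comp_contDiffWithinAt y hΦ) fun h0 => ?_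
  have hD : fderivWithin ℝ (fun z => coordField (axialField M) c (surfaceCoord ι cN c z))
      (range (𝓡∂ 3)) y = (fderiv ℝ (coordField (axialField M) c) (surfaceCoord ι cN c y)).comp
        (fderivWithin ℝ (surfaceCoord ι cN c) (range (𝓡∂ 3)) y) :=
    (hXd.hasFDerivAt.comp_hasFDerivWithinAt y
      (hΦ.differentiableWithinAt (by simp)).hasFDerivWithinAt).fderivWithin
      ((𝓡∂ 3).uniqueDiffOn _ hyR)
  rw [hD]
  have hk := h.isKillingField hg c hc
  have hinj := hι.injective_fderivWithin_surfaceCoord hcN hc hy hιy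
  have hnil : ∀ v, _ → _ := fun v => h.nilpotent_eq_zero hc hΦy h0 (v := v)
  refine exists_plane (hk.metricForm_skew hΦy h0) (hk.metricForm_symm hΦy) hnil
    (fun v hv => hk.metricForm_image_pos hΦy h0
      (IsAxialSymmetry.eventually_coordLower_nonneg hg hsp hc hΦy) hnil hv)
    (h.fderiv_coordField_ne_zero hc hΦy h0) (by simp) hinj
    (exists_fderiv_apply_eq (𝓡∂ 3).uniqueDiffOn hyR hΦ hinj hXd h0 ?_)
  filter_upwards [hι.eventually_surfaceCoord hy hιy] with z hz
  exact hι.exists_fderivWithin_surfaceCoord hcN hc hz.1 hz.2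

variable {ε : Form (𝓡 4) M 4} {F : Form (𝓡 4) M 2} {U : Set M} {χ ψ : M → ℝ}

namespace IsConserved

theorem inChart_pullback_d_regularForm (hι : IsTangentHypersurface ξ ι)
    (hcN : cN ∈ atlas (EuclideanHalfSpace 3) N) (hc : c ∈ atlas E4 M)
    (hy : y ∈ (cN.extend (𝓡∂ 3)).target) (hιy : ι ((cN.extend (𝓡∂ 3)).symm y) ∈ c.source) (δ : ℝ) :
    Form.inChart (𝓡∂ 3) (Form.pullback (𝓡 4) (𝓡∂ 3) (Form.d (𝓡 4) (regularForm g ξ ε χ ψ δ)) ι)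
      cN y (stdFrame 3) =
    Form.inChart (𝓡 4) (Form.d (𝓡 4) (regularForm g ξ ε χ ψ δ)) c (surfaceCoord ι cN c y)
      fun i => fderivWithin ℝ (surfaceCoord ι cN c) (range (𝓡∂ 3)) y (stdFrame 3 i) :=
  DFunLike.congr_fun (inChart_pullback (𝓡∂ 3) (𝓡 4) hcN hc hy
    ((hι.smooth _).mdifferentiableAt (by simp)) hιy _) (stdFrame 3)

theorem pullback_d_regularForm_of_zero (h : IsConserved g ξ ε F U χ ψ)
    (hι : IsTangentHypersurface ξ ι)
    (hcN : cN ∈ atlas (EuclideanHalfSpace 3) N) (hc : c ∈ atlas E4 M)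
    (hy : y ∈ (cN.extend (𝓡∂ 3)).target) (hιy : ι ((cN.extend (𝓡∂ 3)).symm y) ∈ c.source)
    (hU : range ι ⊆ U) {δ : ℝ} (hδ : 0 < δ) (hX : coordField ξ c (surfaceCoord ι cN c y) = 0) :
    Form.inChart (𝓡∂ 3) (Form.pullback (𝓡 4) (𝓡∂ 3) (Form.d (𝓡 4) (regularForm g ξ ε χ ψ δ)) ι)
      cN y (stdFrame 3) = 0 := by
  rw [inChart_pullback_d_regularForm hι hcN hc hy hιy]
  have hz := h.inChart_d_regularForm_of_zero hc (surfaceCoord_mem_target hιy)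
    (by rw [extend_symm_surfaceCoord hιy]; exact hU ⟨_, rfl⟩) hδ hX
  refine Eq.trans (congrArg _ (funext fun i => ?_)) (hz
    (fderivWithin ℝ (surfaceCoord ι cN c) (range (𝓡∂ 3)) y (stdFrame 3 0))
    (fderivWithin ℝ (surfaceCoord ι cN c) (range (𝓡∂ 3)) y (stdFrame 3 1))
    (fderivWithin ℝ (surfaceCoord ι cN c) (range (𝓡∂ 3)) y (stdFrame 3 2)))
  fin_cases i <;> rfl

theorem exists_bound_pullback_d_regularForm (h : IsConserved g ξ ε F U χ ψ)
    (hs : IsUniformlySpacelike g ξ) (hι : IsTangentHypersurface ξ ι)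
    (hcN : cN ∈ atlas (EuclideanHalfSpace 3) N) (hc : c ∈ atlas E4 M)
    (hy : y ∈ (cN.extend (𝓡∂ 3)).target) (hιy : ι ((cN.extend (𝓡∂ 3)).symm y) ∈ c.source)
    (hU : range ι ⊆ U) : ∃ C : ℝ, 0 ≤ C ∧ ∀ᶠ z in 𝓝[range (𝓡∂ 3)] y, ∀ δ : ℝ, 0 < δ →
      |Form.inChart (𝓡∂ 3) (Form.pullback (𝓡 4) (𝓡∂ 3)
        (Form.d (𝓡 4) (regularForm g ξ ε χ ψ δ)) ι) cN z (stdFrame 3)| ≤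
        C * ‖coordField ξ c (surfaceCoord ι cN c z)‖⁻¹ := by
  have hΦ := hι.contDiffWithinAt_surfaceCoord hcN hc hy hιy
  obtain ⟨C, hC, hb⟩ := h.exists_bound_d_regularForm hs hc (surfaceCoord_mem_target hιy)
    (by rw [extend_symm_surfaceCoord hιy]; exact hU ⟨_, rfl⟩)
  have hD : ContinuousWithinAt (fun z => ‖fderivWithin ℝ (surfaceCoord ι cN c) (range (𝓡∂ 3)) z‖)
      (range (𝓡∂ 3)) y :=
    (hΦ.fderivWithin_right (m := 0) (𝓡∂ 3).uniqueDiffOn (by simp)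
      (extend_target_subset_range _ _ hy)).continuousWithinAt.norm
  set l := ‖fderivWithin ℝ (surfaceCoord ι cN c) (range (𝓡∂ 3)) y‖ + 1 with hl
  have hl0 : 0 ≤ l := by positivity
  refine ⟨3 * C * l ^ 3, by positivity, ?_⟩
  filter_upwards [hι.eventually_surfaceCoord hy hιy, hΦ.continuousWithinAt.eventually hb,
    hD.eventually (eventually_lt_nhds (lt_add_one _))] with z hz hbz hLz δ hδ
  obtain ⟨v, hv⟩ := hι.exists_fderivWithin_surfaceCoord hcN hc hz.1 hz.2
  by_cases hX : coordField ξ c (surfaceCoord ι cN c z) = 0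
  · rw [h.pullback_d_regularForm_of_zero hι hcN hc hz.1 hz.2 hU hδ hX, abs_zero]
    positivity
  rw [inChart_pullback_d_regularForm hι hcN hc hz.1 hz.2, ← div_eq_mul_inv,
    le_div_iff₀ (norm_pos_iff.2 hX)]
  set L := fderivWithin ℝ (surfaceCoord ι cN c) (range (𝓡∂ 3)) z
  have key := alternating_three_le (Form.inChart (𝓡 4) (Form.d (𝓡 4)
    (regularForm g ξ ε χ ψ δ)) c (surfaceCoord ι cN c z)) L v
  rw [hv] at key
  have hLs : ∀ i, ‖L (stdFrame 3 i)‖ ≤ l := fun i => by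
    refine (L.le_opNorm _).trans ?_
    have : ‖stdFrame 3 i‖ = 1 := by simp [stdFrame]
    rw [this, mul_one]
    exact hLz.le
  have hle : ∀ i k, |Form.inChart (𝓡 4) (Form.d (𝓡 4) (regularForm g ξ ε χ ψ δ)) c
      (surfaceCoord ι cN c z) ![coordField ξ c (surfaceCoord ι cN c z), L (stdFrame 3 i),
        L (stdFrame 3 k)]| ≤ C * l * l := fun i k =>
    (hbz δ hδ _ _).trans (mul_le_mul (mul_le_mul_of_nonneg_left (hLs i) hC) (hLs k)
      (norm_nonneg _) (by positivity))
  refine key.trans ?_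
  calc _ ≤ l * (C * l * l + C * l * l + C * l * l) :=
        mul_le_mul hLz.le (add_le_add (add_le_add (hle _ _) (hle _ _)) (hle _ _))
          (by positivity) hl0
    _ = 3 * C * l ^ 3 := by ring

theorem tendsto_pullback_d_regularForm (h : IsConserved g ξ ε F U χ ψ)
    (hs : IsUniformlySpacelike g ξ) (hι : IsTangentHypersurface ξ ι)
    (hcN : cN ∈ atlas (EuclideanHalfSpace 3) N)
    (hy : y ∈ (cN.extend (𝓡∂ 3)).target) (hU : range ι ⊆ U) :
    Tendsto (fun δ => Form.inChart (𝓡∂ 3) (Form.pullback (𝓡 4) (𝓡∂ 3)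
      (Form.d (𝓡 4) (regularForm g ξ ε χ ψ δ)) ι) cN y (stdFrame 3)) (𝓝[>] 0) (𝓝 0) := by
  set c := chartAt E4 (ι ((cN.extend (𝓡∂ 3)).symm y))
  have hc : c ∈ atlas E4 M := chart_mem_atlas _ _
  have hιy : ι ((cN.extend (𝓡∂ 3)).symm y) ∈ c.source := mem_chart_source _ _
  have hΦy := surfaceCoord_mem_target hιy
  by_cases hX : coordField ξ c (surfaceCoord ι cN c y) = 0
  · refine tendsto_const_nhds.congr' (eventually_nhdsWithin_of_forall fun δ hδ => ?_)
    exact (h.pullback_d_regularForm_of_zero hι hcN hc hy hιy hU hδ hX).symm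
  obtain ⟨v, hv⟩ := hι.exists_fderivWithin_surfaceCoord hcN hc hy hιy
  set L := fderivWithin ℝ (surfaceCoord ι cN c) (range (𝓡∂ 3)) y
  have ht : ∀ p q : E4, _ := fun p q => (h.tendsto_d_regularForm hc hΦy
    (by rw [extend_symm_surfaceCoord hιy]; exact hU ⟨_, rfl⟩) (hs.pos hc hΦy hX) p q).abs
  have hlim := ((((ht (L (stdFrame 3 1)) (L (stdFrame 3 2))).add
    (ht (L (stdFrame 3 0)) (L (stdFrame 3 2)))).add
    (ht (L (stdFrame 3 0)) (L (stdFrame 3 1)))).const_mul ‖L‖).mul_const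
      ‖coordField ξ c (surfaceCoord ι cN c y)‖⁻¹
  simp only [abs_zero, add_zero, mul_zero, zero_mul] at hlim
  refine squeeze_zero_norm (fun δ => ?_) hlim
  rw [inChart_pullback_d_regularForm hι hcN hc hy hιy, ← div_eq_mul_inv,
    le_div_iff₀ (norm_pos_iff.2 hX), Real.norm_eq_abs]
  have key := alternating_three_le (Form.inChart (𝓡 4) (Form.d (𝓡 4)
    (regularForm g ξ ε χ ψ δ)) c (surfaceCoord ι cN c y)) L v
  rwa [hv] at key

end IsConserved

end Domination

section SurfaceIntegral

variable {n : ℕ} {X : Type*} [TopologicalSpace X] [ChartedSpace (EuclideanSpace ℝ (Fin n)) X]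

theorem extend_target_eq (c : OpenPartialHomeomorph X (EuclideanSpace ℝ (Fin n))) :
    (c.extend (𝓡 n)).target = c.target := by
  rw [c.extend_target]
  simp

theorem FormIntegrable.isLocallyIntegrableForm {θ : Form (𝓡 n) X n} (h : FormIntegrable θ) :
    IsLocallyIntegrableForm (𝓡 n) θ := fun p => by
  rw [extend_target_eq]
  exact h _ (chart_mem_atlas _ p)

variable [IsManifold (𝓡 n) ∞ X] [T2Space X] [CompactSpace X] {ν θ : Form (𝓡 n) X n}

theorem formIntegral_neg (ν θ : Form (𝓡 n) X n) (A : Set X) :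
    formIntegral (fun x => -ν x) θ A = -formIntegral ν θ A := by
  unfold formIntegral
  rw [← finsum_neg_distrib]
  refine finsum_congr fun p => ?_
  rw [← integral_neg]
  refine integral_congr_ae (ae_of_all _ fun y => ?_)
  have h : Form.inChart (𝓡 n) (fun x => -ν x)
      (chartAt (EuclideanSpace ℝ (Fin n)) p) y (stdFrame n) =
      -Form.inChart (𝓡 n) ν (chartAt (EuclideanSpace ℝ (Fin n)) p) y (stdFrame n) := rfl
  change _ * (Real.sign _ * _) = -(_ * (Real.sign _ * _))
  rw [h, Real.sign_neg]
  ring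

theorem formIntegral_add_compl (hν : IsOrientationForm (𝓡 n) ν)
    (hθ : IsLocallyIntegrableForm (𝓡 n) θ) {A : Set X} (hA : IsClopen A) :
    formIntegral ν θ A + formIntegral ν θ Aᶜ = formIntegral ν θ univ := by
  have hfin : ∀ A : Set X, (Function.support fun p : X =>
      ∫ y in (chartAt (EuclideanSpace ℝ (Fin n)) p).target ∩
        (chartAt (EuclideanSpace ℝ (Fin n)) p).symm ⁻¹' A,
      chartPartition n X p ((chartAt (EuclideanSpace ℝ (Fin n)) p).symm y) *
        chartDensity ν θ (chartAt (EuclideanSpace ℝ (Fin n)) p) y).Finite := fun A => by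
    refine (finite_support_partition (𝓡 n) (chartPartition n X)).subset fun p hp => ?_
    by_contra hcon
    have h0 : ∀ x, chartPartition n X p x = 0 := by simpa using hcon
    refine hp ?_
    simp [h0]
  unfold formIntegral
  rw [← finsum_add_distrib (hfin A) (hfin Aᶜ)]
  refine finsum_congr fun p => ?_
  have hint : IntegrableOn (fun y =>
      chartPartition n X p ((chartAt (EuclideanSpace ℝ (Fin n)) p).symm y) *
        chartDensity ν θ (chartAt (EuclideanSpace ℝ (Fin n)) p) y)
      (chartAt (EuclideanSpace ℝ (Fin n)) p).target := by
    have := integrableOn_partition_orientedCoef (𝓡 n) (chartPartition_isSubordinate (n := n) (X := X))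
      hν hθ p
    rwa [extend_target_eq] at this
  have hm := measurableSet_extend_target_inter (𝓡 n) (chartAt (EuclideanSpace ℝ (Fin n)) p)
    hA.compl.isOpen
  rw [extend_target_eq] at hm
  replace hm : MeasurableSet ((chartAt (EuclideanSpace ℝ (Fin n)) p).target ∩
    (chartAt (EuclideanSpace ℝ (Fin n)) p).symm ⁻¹' Aᶜ) := hm
  rw [← setIntegral_union (Disjoint.mono inter_subset_right inter_subset_right
      (disjoint_compl_right.preimage _)) hm (hint.mono_set inter_subset_left)
      (hint.mono_set inter_subset_left), ← inter_union_distrib_left, ← preimage_union,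
    union_compl_self]

end SurfaceIntegral

section Surface

variable {M : Type*} [TopologicalSpace M] [ChartedSpace E4 M] [IsManifold (𝓡 4) ∞ M]
  {g : BilinField M} {ξ : VField (𝓡 4) M} {ε : Form (𝓡 4) M 4} {F : Form (𝓡 4) M 2} {U : Set M}
  {χ ψ : M → ℝ}
  {B : Type*} [TopologicalSpace B] [T2Space B] [CompactSpace B]
  [ChartedSpace (EuclideanSpace ℝ (Fin 2)) B] [IsManifold (𝓡 2) ∞ B] {f : B → M} {cB : OpenPartialHomeomorph B (EuclideanSpace ℝ (Fin 2))}
  {y : EuclideanSpace ℝ (Fin 2)}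

theorem inChart_pullback_two (hf : ContMDiff (𝓡 2) (𝓡 4) ∞ f)
    (hcB : cB ∈ atlas (EuclideanSpace ℝ (Fin 2)) B) {c : OpenPartialHomeomorph M E4}
    (hc : c ∈ atlas E4 M) (hy : y ∈ (cB.extend (𝓡 2)).target)
    (hfy : f ((cB.extend (𝓡 2)).symm y) ∈ c.source) (θ : Form (𝓡 4) M 2) :
    Form.inChart (𝓡 2) (Form.pullback (𝓡 4) (𝓡 2) θ f) cB y (stdFrame 2) =
      Form.inChart (𝓡 4) θ c (c.extend (𝓡 4) (f ((cB.extend (𝓡 2)).symm y)))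
        ![fderivWithin ℝ (fun z => c.extend (𝓡 4) (f ((cB.extend (𝓡 2)).symm z))) (range (𝓡 2)) y
            (stdFrame 2 0),
          fderivWithin ℝ (fun z => c.extend (𝓡 4) (f ((cB.extend (𝓡 2)).symm z))) (range (𝓡 2)) y
            (stdFrame 2 1)] := by
  refine (DFunLike.congr_fun (inChart_pullback (𝓡 2) (𝓡 4) hcB hc hy
    ((hf _).mdifferentiableAt (by simp)) hfy θ) (stdFrame 2)).trans ?_
  refine congrArg (Form.inChart (𝓡 4) θ c (c.extend (𝓡 4) (f ((cB.extend (𝓡 2)).symm y))))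
    (funext fun i => ?_)
  fin_cases i <;> rfl

namespace IsConserved

theorem exists_bound_pullback_regularWedge (h : IsConserved g ξ ε F U χ ψ)
    (hs : IsUniformlySpacelike g ξ) (hf : ContMDiff (𝓡 2) (𝓡 4) ∞ f) (hU : range f ⊆ U)
    (hcB : cB ∈ atlas (EuclideanSpace ℝ (Fin 2)) B) (hy : y ∈ (cB.extend (𝓡 2)).target) :
    ∃ C : ℝ, ∀ᶠ z in 𝓝 y, ∀ δ : ℝ, 0 ≤ δ → |Form.inChart (𝓡 2) (Form.pullback (𝓡 4) (𝓡 2)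
      (regularWedge g ξ χ ψ δ) f) cB z (stdFrame 2)| ≤ C := by
  set c := chartAt E4 (f ((cB.extend (𝓡 2)).symm y))
  have hc : c ∈ atlas E4 M := chart_mem_atlas _ _
  have hfy : f ((cB.extend (𝓡 2)).symm y) ∈ c.source := mem_chart_source _ _
  set Φ : EuclideanSpace ℝ (Fin 2) → E4 := fun z => c.extend (𝓡 4) (f ((cB.extend (𝓡 2)).symm z))
  have hΦ : ContDiffWithinAt ℝ ∞ Φ (range (𝓡 2)) y :=
    contDiffWithinAt_coord (𝓡 2) (𝓡 4) hcB hc hy (hf _) hfy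
  have hΦy : Φ y ∈ c.target := by
    have := extend_mem_target (𝓡 4) hfy
    rwa [extend_target_model] at this
  have hΦU : (c.extend (𝓡 4)).symm (Φ y) ∈ U := by
    rw [show (c.extend (𝓡 4)).symm (Φ y) = _ from extend_left_inv' (𝓡 4) hfy]
    exact hU ⟨_, rfl⟩
  obtain ⟨C, hC⟩ := h.exists_bound_regularWedge hs hc hΦy hΦU
  have hD : ContinuousWithinAt (fun z => ‖fderivWithin ℝ Φ (range (𝓡 2)) z‖) (range (𝓡 2)) y :=
    (hΦ.fderivWithin_right (m := 0) (𝓡 2).uniqueDiffOn (by simp)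
      (extend_target_subset_range _ _ hy)).continuousWithinAt.norm
  set l := ‖fderivWithin ℝ Φ (range (𝓡 2)) y‖ + 1 with hl
  have hr : 𝓝[range (𝓡 2)] y = 𝓝 y := by rw [(𝓡 2).range_eq_univ, nhdsWithin_univ]
  refine ⟨|C| * l * l, ?_⟩
  rw [← hr]
  filter_upwards [eventually_coord (𝓡 2) hy (hf _).continuousAt hfy,
    hΦ.continuousWithinAt.eventually hC, hD.eventually (eventually_lt_nhds (lt_add_one _))]
    with z hz hCz hLz δ hδ
  rw [inChart_pullback_two hf hcB hc hz.1 hz.2]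
  have hLs : ∀ i, ‖fderivWithin ℝ Φ (range (𝓡 2)) z (stdFrame 2 i)‖ ≤ l := fun i => by
    refine (ContinuousLinearMap.le_opNorm _ _).trans ?_
    have : ‖stdFrame 2 i‖ = 1 := by simp [stdFrame]
    rw [this, mul_one]
    exact hLz.le
  refine (hCz δ hδ _ _).trans ?_
  refine mul_le_mul (mul_le_mul (le_abs_self C) (hLs 0) (norm_nonneg _) (abs_nonneg _)) (hLs 1)
    (norm_nonneg _) (by positivity)

theorem tendsto_pullback_regularWedge (h : IsConserved g ξ ε F U χ ψ)
    (hs : IsUniformlySpacelike g ξ) (hf : ContMDiff (𝓡 2) (𝓡 4) ∞ f) (hU : range f ⊆ U)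
    (hcB : cB ∈ atlas (EuclideanSpace ℝ (Fin 2)) B) (hy : y ∈ (cB.extend (𝓡 2)).target) :
    Tendsto (fun δ => Form.inChart (𝓡 2) (Form.pullback (𝓡 4) (𝓡 2)
      (regularWedge g ξ χ ψ δ) f) cB y (stdFrame 2)) (𝓝[>] 0)
      (𝓝 (Form.inChart (𝓡 2) (Form.pullback (𝓡 4) (𝓡 2)
        (gammaWedgeHat g ξ χ ψ) f) cB y (stdFrame 2))) := by
  have hc := chart_mem_atlas E4 (f ((cB.extend (𝓡 2)).symm y))
  have hfy := mem_chart_source E4 (f ((cB.extend (𝓡 2)).symm y))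
  have hΦy := extend_mem_target (𝓡 4) hfy
  rw [extend_target_model] at hΦy
  rw [← regularWedge_zero]
  simp only [inChart_pullback_two hf hcB hc hy hfy]
  refine h.tendsto_regularWedge hs hc hΦy ?_ _ _
  rw [extend_left_inv' (𝓡 4) hfy]
  exact hU ⟨_, rfl⟩

theorem smoothAt_pullback_regularWedge (h : IsConserved g ξ ε F U χ ψ)
    (hf : ContMDiff (𝓡 2) (𝓡 4) ∞ f) (hU : range f ⊆ U) {δ : ℝ} (hδ : 0 < δ) (x : B) :
    Form.SmoothAt (𝓡 2) (Form.pullback (𝓡 4) (𝓡 2) (regularWedge g ξ χ ψ δ) f) x :=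
  Form.SmoothAt.pullback (𝓡 2) (𝓡 4) (Eventually.of_forall fun x => hf x)
    (h.smoothAt_regularWedge (hU ⟨x, rfl⟩) hδ)

/-- `γ ∧ η̂` is locally bounded, hence integrable, on surfaces. -/
theorem formIntegrable_gammaWedgeHat (h : IsConserved g ξ ε F U χ ψ)
    (hs : IsUniformlySpacelike g ξ) (hf : ContMDiff (𝓡 2) (𝓡 4) ∞ f) (hU : range f ⊆ U) :
    FormIntegrable (Form.pullback (𝓡 4) (𝓡 2) (gammaWedgeHat g ξ χ ψ) f) := by
  intro cB hcB y hy
  rw [← extend_target_eq] at hy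
  obtain ⟨C, hC⟩ := h.exists_bound_pullback_regularWedge hs hf hU hcB hy
  obtain ⟨t, ht, hto, hyt⟩ := mem_nhds_iff.1 (inter_mem hC (Metric.ball_mem_nhds y one_pos))
  have hm : MeasurableSet (t ∩ cB.target) := hto.measurableSet.inter cB.open_target.measurableSet
  refine ⟨t ∩ cB.target, inter_mem (mem_nhdsWithin_of_mem_nhds (hto.mem_nhds hyt))
    self_mem_nhdsWithin, ?_⟩
  have hδ : Tendsto (fun k : ℕ => (1 : ℝ) / (k + 1)) atTop (𝓝[>] 0) :=
    tendsto_nhdsWithin_iff.2 ⟨tendsto_one_div_add_atTop_nhds_zero_nat,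
      Eventually.of_forall fun k => by simp only [mem_Ioi]; positivity⟩
  refine ⟨?_, HasFiniteIntegral.restrict_of_bounded C ?_ ?_⟩
  · refine aestronglyMeasurable_of_tendsto_ae (u := atTop) (f := fun (k : ℕ) z =>
      Form.inChart (𝓡 2) (Form.pullback (𝓡 4) (𝓡 2) (regularWedge g ξ χ ψ (1 / (k + 1))) f) cB z
        (stdFrame 2)) (fun k => ?_) ?_
    · have hsm := continuousOn_inChart (𝓡 2)
        (h.smoothAt_pullback_regularWedge hf hU (δ := 1 / ((k : ℝ) + 1)) (by positivity)) hcB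
        (stdFrame 2)
      rw [extend_target_eq] at hsm
      exact (hsm.mono inter_subset_right).aestronglyMeasurable hm
    · refine (ae_restrict_iff' hm).2 (ae_of_all _ fun z hz => ?_)
      exact (h.tendsto_pullback_regularWedge hs hf hU hcB (by rw [extend_target_eq]; exact hz.2)).comp hδ
  · refine (measure_mono ?_).trans_lt (measure_ball_lt_top (x := y) (r := 1))
    exact fun z hz => (ht hz.1).2
  · refine (ae_restrict_iff' hm).2 (ae_of_all _ fun z hz => ?_)
    have := (ht hz.1).1 0 le_rfl
    rwa [regularWedge_zero] at this

theorem isLocallyIntegrableForm_komarForm (h : IsConserved g ξ ε F U χ ψ)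
    (hf : ContMDiff (𝓡 2) (𝓡 4) ∞ f) : IsLocallyIntegrableForm (𝓡 2)
      (Form.pullback (𝓡 4) (𝓡 2) (komarForm g ξ ε) f) :=
  isLocallyIntegrableForm_of_smoothAt (𝓡 2) fun x =>
    Form.SmoothAt.pullback (𝓡 2) (𝓡 4) (Eventually.of_forall fun x => hf x)
      (smoothAt_komarForm h.lorentz h.volume h.killing (f x))

end IsConserved

theorem Form.pullback_pullback {N : Type*} [TopologicalSpace N]
    [ChartedSpace (EuclideanHalfSpace 3) N] {k : ℕ} {ι : N → M} {j : B → N}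
    (hι : ContMDiff (𝓡∂ 3) (𝓡 4) ∞ ι) (hj : ContMDiff (𝓡 2) (𝓡∂ 3) ∞ j) (θ : Form (𝓡 4) M k) :
    Form.pullback (𝓡∂ 3) (𝓡 2) (Form.pullback (𝓡 4) (𝓡∂ 3) θ ι) j =
      Form.pullback (𝓡 4) (𝓡 2) θ (ι ∘ j) := by
  funext b
  have h := mfderiv_comp b ((hι (j b)).mdifferentiableAt (by simp))
    ((hj b).mdifferentiableAt (by simp))
  ext v
  refine congrArg (θ (ι (j b))) (funext fun i => ?_)
  exact (DFunLike.congr_fun h (v i)).symm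

end Surface

section Conservation

variable {M : Type*} [TopologicalSpace M] [ChartedSpace E4 M] [IsManifold (𝓡 4) ∞ M]
  {g : BilinField M} {ξ : VField (𝓡 4) M} {ε : Form (𝓡 4) M 4} {F : Form (𝓡 4) M 2} {U : Set M}
  {χ ψ : M → ℝ}
  {B : Type*} [TopologicalSpace B] [T2Space B] [CompactSpace B]
  [ChartedSpace (EuclideanSpace ℝ (Fin 2)) B] [IsManifold (𝓡 2) ∞ B]

namespace IsConserved

theorem formIntegral_komarForm_add (h : IsConserved g ξ ε F U χ ψ) {f : B → M}
    (hf : ContMDiff (𝓡 2) (𝓡 4) ∞ f) {ν : Form (𝓡 2) B 2} (hν : IsOrientationForm (𝓡 2) ν)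
    {θ : Form (𝓡 4) M 2}
    (hθ : IsLocallyIntegrableForm (𝓡 2) (Form.pullback (𝓡 4) (𝓡 2) θ f)) :
    formIntegral ν (Form.pullback (𝓡 4) (𝓡 2) (fun x => komarForm g ξ ε x + (4 : ℝ) • θ x) f) univ =
      formIntegral ν (Form.pullback (𝓡 4) (𝓡 2) (komarForm g ξ ε) f) univ +
        4 * formIntegral ν (Form.pullback (𝓡 4) (𝓡 2) θ f) univ := by
  simp only [formIntegral_eq_partitionIntegral]
  have h4 : IsLocallyIntegrableForm (𝓡 2) (fun b => (4 : ℝ) • Form.pullback (𝓡 4) (𝓡 2) θ f b) :=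
    fun p => (hθ p).smul (4 : ℝ)
  rw [← partitionIntegral_const_smul, ← partitionIntegral_add (𝓡 2) chartPartition_isSubordinate hν
    (h.isLocallyIntegrableForm_komarForm hf) h4]
  rfl

theorem tendsto_formIntegral_regularWedge (h : IsConserved g ξ ε F U χ ψ)
    (hs : IsUniformlySpacelike g ξ) {f : B → M} (hf : ContMDiff (𝓡 2) (𝓡 4) ∞ f)
    (hU : range f ⊆ U) {ν : Form (𝓡 2) B 2} (hν : IsOrientationForm (𝓡 2) ν) {δ : ℕ → ℝ}
    (hδ0 : ∀ k, 0 < δ k) (hδ : Tendsto δ atTop (𝓝[>] 0)) :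
    Tendsto (fun k => formIntegral ν (Form.pullback (𝓡 4) (𝓡 2)
      (regularWedge g ξ χ ψ (δ k)) f) univ) atTop
      (𝓝 (formIntegral ν (Form.pullback (𝓡 4) (𝓡 2) (gammaWedgeHat g ξ χ ψ) f) univ)) := by
  simp only [formIntegral_eq_partitionIntegral]
  refine tendsto_partitionIntegral (𝓡 2) chartPartition_isSubordinate hν
    (fun k => isLocallyIntegrableForm_of_smoothAt (𝓡 2)
      (h.smoothAt_pullback_regularWedge hf hU (hδ0 k))) (fun p y hy => ?_) fun p y hy =>
        (h.tendsto_pullback_regularWedge hs hf hU (chart_mem_atlas _ p) hy).comp hδ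
  obtain ⟨C, hC⟩ := h.exists_bound_pullback_regularWedge hs hf hU (chart_mem_atlas _ p) hy
  refine ⟨_, inter_mem hC (Metric.ball_mem_nhds y one_pos),
    (Metric.ball y 1).indicator fun _ => C, ?_, fun k z hz _ => ?_⟩
  · refine IntegrableOn.integrable_indicator ?_ Metric.isOpen_ball.measurableSet
    exact integrableOn_const measure_ball_lt_top.ne (by simp)
  · rw [indicator_of_mem hz.2]
    exact hz.1 (δ k) (hδ0 k).le

variable {N : Type*} [TopologicalSpace N] [T2Space N] [CompactSpace N]
  [ChartedSpace (EuclideanHalfSpace 3) N] [IsManifold (𝓡∂ 3) ∞ N] {ι : N → M} {j : B → N}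

theorem smoothAt_pullback_regularForm (h : IsConserved g ξ ε F U χ ψ)
    (hι : ContMDiff (𝓡∂ 3) (𝓡 4) ∞ ι) (hU : range ι ⊆ U) {δ : ℝ} (hδ : 0 < δ) (x : N) :
    Form.SmoothAt (𝓡∂ 3) (Form.pullback (𝓡 4) (𝓡∂ 3) (regularForm g ξ ε χ ψ δ) ι) x :=
  Form.SmoothAt.pullback (𝓡∂ 3) (𝓡 4) (Eventually.of_forall fun x => hι x)
    (h.smoothAt_regularForm (hU ⟨x, rfl⟩) hδ)

theorem d_pullback_regularForm (h : IsConserved g ξ ε F U χ ψ)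
    (hι : ContMDiff (𝓡∂ 3) (𝓡 4) ∞ ι) (hU : range ι ⊆ U) {δ : ℝ} (hδ : 0 < δ) :
    Form.d (𝓡∂ 3) (Form.pullback (𝓡 4) (𝓡∂ 3) (regularForm g ξ ε χ ψ δ) ι) =
      Form.pullback (𝓡 4) (𝓡∂ 3) (Form.d (𝓡 4) (regularForm g ξ ε χ ψ δ)) ι :=
  funext fun x => d_pullback (𝓡∂ 3) (𝓡 4) (Eventually.of_forall fun x => hι x)
    (h.smoothAt_regularForm (hU ⟨x, rfl⟩) hδ)

/-- The boundary integral of `*dη + 4 γ ∧ η̂` vanishes. -/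
theorem formIntegral_komarForm_eq (h : IsConserved g ξ ε F U χ ψ) (hs : IsUniformlySpacelike g ξ)
    {νN : Form (𝓡∂ 3) N 3} (hνN : IsOrientationForm (𝓡∂ 3) νN) (hι : IsTangentHypersurface ξ ι)
    {νB : Form (𝓡 2) B 2} (hνB : IsOrientationForm (𝓡 2) νB) (hj : IsOrientedBoundary νN νB j)
    (hU : range ι ⊆ U)
    (hint : ∀ cN ∈ atlas (EuclideanHalfSpace 3) N, ∀ y ∈ (cN.extend (𝓡∂ 3)).target,
      ∃ t ∈ 𝓝 y, ∃ b : EuclideanSpace ℝ (Fin 3) → ℝ, Integrable b ∧ ∀ z ∈ t, z ∈ range (𝓡∂ 3) →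
        ‖coordField ξ (chartAt E4 (ι ((cN.extend (𝓡∂ 3)).symm y)))
          (surfaceCoord ι cN (chartAt E4 (ι ((cN.extend (𝓡∂ 3)).symm y))) z)‖⁻¹ ≤ b z) :
    formIntegral νB (Form.pullback (𝓡 4) (𝓡 2) (komarForm g ξ ε) (ι ∘ j)) univ +
      4 * formIntegral νB (Form.pullback (𝓡 4) (𝓡 2) (gammaWedgeHat g ξ χ ψ) (ι ∘ j)) univ = 0 := by
  have hf : ContMDiff (𝓡 2) (𝓡 4) ∞ (ι ∘ j) := hι.smooth.comp hj.smooth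
  have hfU : range (ι ∘ j) ⊆ U := (range_comp_subset_range j ι).trans hU
  obtain ⟨P, hP⟩ := SmoothPartitionOfUnity.exists_isSubordinate_chartAt_source (𝓡∂ 3) N
  set δ : ℕ → ℝ := fun k => 1 / (k + 1)
  have hδ0 : ∀ k, 0 < δ k := fun k => by positivity
  have hδ : Tendsto δ atTop (𝓝[>] 0) :=
    tendsto_nhdsWithin_iff.2 ⟨tendsto_one_div_add_atTop_nhds_zero_nat, Eventually.of_forall hδ0⟩
  have hst : ∀ k, formIntegral νB (Form.pullback (𝓡 4) (𝓡 2) (komarForm g ξ ε) (ι ∘ j)) univ +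
      4 * formIntegral νB (Form.pullback (𝓡 4) (𝓡 2) (regularWedge g ξ χ ψ (δ k)) (ι ∘ j)) univ =
      partitionIntegral (𝓡∂ 3) P νN (Form.pullback (𝓡 4) (𝓡∂ 3)
        (Form.d (𝓡 4) (regularForm g ξ ε χ ψ (δ k))) ι) := fun k => by
    rw [← h.d_pullback_regularForm hι.smooth hU (hδ0 k), ← stokes hP hνN hνB hj
      (h.smoothAt_pullback_regularForm hι.smooth hU (hδ0 k)),
      Form.pullback_pullback hι.smooth hj.smooth]
    exact (h.formIntegral_komarForm_add hf hνB (isLocallyIntegrableForm_of_smoothAt (𝓡 2)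
      (h.smoothAt_pullback_regularWedge hf hfU (hδ0 k)))).symm
  have hlim := (h.tendsto_formIntegral_regularWedge hs hf hfU hνB hδ0 hδ).const_mul 4 |>.const_add
    (formIntegral νB (Form.pullback (𝓡 4) (𝓡 2) (komarForm g ξ ε) (ι ∘ j)) univ)
  simp only [hst] at hlim
  have hzero : partitionIntegral (𝓡∂ 3) P νN (fun _ => 0) = 0 := by
    have := partitionIntegral_const_smul (𝓡∂ 3) (P := P) (ν := νN) (θ := fun _ => 0) 0
    simpa using this
  refine tendsto_nhds_unique hlim (hzero ▸ ?_)
  refine tendsto_partitionIntegral (𝓡∂ 3) hP hνN (fun k => ?_) (fun p y hy => ?_) fun p y hy => ?_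
  · rw [← h.d_pullback_regularForm hι.smooth hU (hδ0 k)]
    exact isLocallyIntegrableForm_of_smoothAt (𝓡∂ 3) fun x => Form.SmoothAt.d (𝓡∂ 3)
      (Eventually.of_forall (h.smoothAt_pullback_regularForm hι.smooth hU (hδ0 k)))
  · have hc := chart_mem_atlas (EuclideanHalfSpace 3) p
    obtain ⟨t, ht, b, hb, hle⟩ := hint _ hc y hy
    obtain ⟨C, hC, hbd⟩ := h.exists_bound_pullback_d_regularForm hs hι hc (chart_mem_atlas E4 _) hy
      (mem_chart_source E4 _) hU
    rw [eventually_nhdsWithin_iff] at hbd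
    refine ⟨_, inter_mem ht hbd, fun z => C * b z, hb.const_mul C, fun k z hz hzt => ?_⟩
    have hzR := extend_target_subset_range _ _ hzt
    exact (hz.2 hzR (δ k) (hδ0 k)).trans (mul_le_mul_of_nonneg_left (hle z hz.1 hzR) hC)
  · exact (h.tendsto_pullback_d_regularForm hs hι (chart_mem_atlas _ p) hy hU).comp hδ

end IsConserved

end Conservation

end AngMom

end

theorem lemmal
    -- the spacetime: a connected oriented four-manifold with a Lorentzian metric
    {M : Type*} [TopologicalSpace M] [T2Space M] [SecondCountableTopology M] [ConnectedSpace M]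
    [ChartedSpace AngMom.E4 M] [IsManifold (𝓡 4) ∞ M]
    (g : AngMom.BilinField M) (hg : AngMom.IsLorentzMetric g)
    (ε : AngMom.Form (𝓡 4) M 4) (hε : AngMom.IsVolumeElement g ε)
    -- axial symmetry; the Killing field is spacelike away from the axis
    [MulAction Circle M] (haxial : AngMom.IsAxialSymmetry g)
    (hspacelike : ∀ x : M, AngMom.axialField M x ≠ 0 →
      0 < g x (AngMom.axialField M x) (AngMom.axialField M x))
    -- the electromagnetic field
    (F : AngMom.Form (𝓡 4) M 2) (hEM : AngMom.IsEinsteinMaxwell g ε F)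
    (hLie : AngMom.LieDerivVanishes F)
    -- the compact oriented three-surface, tangent to the Killing field
    {N : Type*} [TopologicalSpace N] [T2Space N] [CompactSpace N]
    [ChartedSpace (EuclideanHalfSpace 3) N] [IsManifold (𝓡∂ 3) ∞ N]
    (νN : AngMom.Form (𝓡∂ 3) N 3) (hνN : AngMom.IsOrientationForm (𝓡∂ 3) νN)
    (ι : N → M) (hι : AngMom.IsTangentHypersurface (AngMom.axialField M) ι)
    -- its boundary
    {B : Type*} [TopologicalSpace B] [T2Space B] [CompactSpace B]
    [ChartedSpace (EuclideanSpace ℝ (Fin 2)) B] [IsManifold (𝓡 2) ∞ B]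
    (νB : AngMom.Form (𝓡 2) B 2) (hνB : AngMom.IsOrientationForm (𝓡 2) νB)
    (j : B → N) (hj : AngMom.IsOrientedBoundary νN νB j)
    -- the electromagnetic potentials, on a neighbourhood of the three-surface
    (U : Set M) (hU : IsOpen U) (hιU : Set.range ι ⊆ U) (χ ψ : M → ℝ)
    (hχ : AngMom.IsPotential (AngMom.axialField M) F χ U)
    (hψ : AngMom.IsPotential (AngMom.axialField M) (AngMom.hodge g ε F) ψ U) :
    -- `γ ∧ η̂` is integrable over the boundary
    AngMom.FormIntegrable (AngMom.Form.pullback (𝓡 4) (𝓡 2)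
      (AngMom.gammaWedgeHat g (AngMom.axialField M) χ ψ) (ι ∘ j)) ∧
    -- the Komar integral of the boundary
    AngMom.komar g (AngMom.axialField M) ε νB (ι ∘ j) Set.univ =
      -(1 / (4 * Real.pi)) * AngMom.formIntegral νB (AngMom.Form.pullback (𝓡 4) (𝓡 2)
        (AngMom.gammaWedgeHat g (AngMom.axialField M) χ ψ) (ι ∘ j)) Set.univ ∧
    -- conservation: the total angular momentum of the whole boundary vanishes
    AngMom.totalAngularMomentum g (AngMom.axialField M) ε χ ψ νB (ι ∘ j) Set.univ = 0 ∧
    -- conservation: if the boundary consists of two closed surfaces, the second one taken with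
    -- the opposite orientation, then these have the same total angular momentum
    ∀ A : Set B, IsClopen A →
      AngMom.totalAngularMomentum g (AngMom.axialField M) ε χ ψ νB (ι ∘ j) A =
        AngMom.totalAngularMomentum g (AngMom.axialField M) ε χ ψ (fun b => -νB b) (ι ∘ j) Aᶜ := by
  have hs := haxial.isUniformlySpacelike hg hspacelike
  have h : AngMom.IsConserved g (AngMom.axialField M) ε F U χ ψ :=
    { lorentz := hg
      volume := hε
      einsteinMaxwell := hEM
      killing := haxial.isKillingField hg
      isOpen := hU
      electric := hχ
      magnetic := hψ
      nonneg := fun x => by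
        by_cases hx : AngMom.axialField M x = 0
        · rw [hx, map_zero]
        · exact (hspacelike x hx).le }
  have hf : ContMDiff (𝓡 2) (𝓡 4) ∞ (ι ∘ j) := hι.smooth.comp hj.smooth
  have hfU : Set.range (ι ∘ j) ⊆ U := (Set.range_comp_subset_range j ι).trans hιU
  have hint := h.formIntegrable_gammaWedgeHat hs hf hfU
  have hkey := h.formIntegral_komarForm_eq hs hνN hι hνB hj hιU fun cN hcN y hy =>
    haxial.exists_integrable_inv_norm hg hspacelike hι hcN (chart_mem_atlas AngMom.E4 _) hy
      (mem_chart_source AngMom.E4 _)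
  have hadd := h.formIntegral_komarForm_add hf hνB hint.isLocallyIntegrableForm
  have hloc : AngMom.IsLocallyIntegrableForm (𝓡 2) (AngMom.Form.pullback (𝓡 4) (𝓡 2)
      (fun x => AngMom.komarForm g (AngMom.axialField M) ε x +
        (4 : ℝ) • AngMom.gammaWedgeHat g (AngMom.axialField M) χ ψ x) (ι ∘ j)) := fun p =>
    (h.isLocallyIntegrableForm_komarForm hf p).add ((hint.isLocallyIntegrableForm p).smul (4 : ℝ))
  have htot : AngMom.totalAngularMomentum g (AngMom.axialField M) ε χ ψ νB (ι ∘ j) Set.univ = 0 := by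
    rw [AngMom.totalAngularMomentum, hadd, hkey, mul_zero]
  refine ⟨hint, ?_, htot, fun A hA => ?_⟩
  · rw [AngMom.komar, eq_neg_of_add_eq_zero_left hkey]
    field_simp
    ring
  · have hsum := AngMom.formIntegral_add_compl hνB hloc hA
    rw [hadd, hkey] at hsum
    rw [AngMom.totalAngularMomentum, AngMom.totalAngularMomentum, AngMom.formIntegral_neg,
      eq_neg_of_add_eq_zero_left hsum]
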